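/- Let $\ell\ge 2$ be an integer. **Setting.** Let $k$ be a field in which $6\ell\neq 0$ and which contains a primitive $\ell$-th root of unity. Let $a,b$ be independent transcendentals, $K=k(a,b)$, $\overline K$ an algebraic closure, $E: y^2=x^3+ax+b$, with identity $O$ at infinity, $E[\ell]\subset E(\overline K)$ the $\ell$-torsion, and $K_\ell$ the field generated over $K$ by the coordinates $x_P,y_P$ of the points $P\in E[\ell]\setminus\{O\}$. Give $a,b,x_P,y_P$ the weights $4,6,2,3$, and let $\mathcal R_1=k[a,b]$. An algebraic modular form of level $\Gamma(\ell)$ and weight $j\ge 0$ is an element $f\in K_\ell$ that is a quotient of two isobaric polynomials in the $x_P,y_P$ with coefficients in the graded ring $\mathcal R_1$, the quotient having weight $j$, and that satisfies an equation $f^n+c_1f^{n-1}+\dots+c_n=0$ with $n\ge1$ and $c_i\in\mathcal R_1$ of weight $ij$. Let $\mathcal R_\ell$ be the graded $k$-algebra generated by $a$, $b$, all $x_P,y_P$, and, in weight $1$, the slopes $\lambda$ of the lines $y=\lambda x+\nu$ through $P,Q,R\in E[\ell]\setminus\{O\}$ with $P\oplus Q\oplus R=O$ (the tangent line if $P=Q$).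 Let $t=-x/y$, a uniformizer at $O$. If $D$ is a principal divisor and $m_0$ is the multiplicity of $O$ in $D$, then $f_D$ is the function with divisor $D$ and Laurent expansion $t^{m_0}(1+O(t))$ at $O$. For any divisor $D$ supported on $E[\ell]$, put $m=m_0-\deg D$, where again $m_0$ is the multiplicity of $O$ in $D$; the divisor $D'=\ell\,(D-(\deg D)(O))$ is principal, and $f_D=(f_{D'})^{1/\ell}$ denotes the $\ell$-th root of the Laurent series $f_{D'}$ that has the form $t^{m}(1+O(t))$. It exists and is unique, and agrees with the previous $f_D$ when $D$ is principal. Write $f_D=t^m\bigl(1+\sum_{j\ge1}\lambda_D^{(j)}t^j\bigr)$. If $\operatorname{char} k=0$, let $z=\int dx/(2y)=t+\tfrac25at^5+\cdots$. **Theorem.** (0) Every weight-$j$ element of $\mathcal R_\ell$ ($j\ge0$) is a modular form of weight $j$ on $\Gamma(\ell)$. (1) For every divisor $D$ supported on $E[\ell]$, the series $f_D(t)$ is $\mathcal R_\ell$-balanced: for all $j\ge1$, $\lambda_D^{(j)}$ is an element of $\mathcal R_\ell$ of weight $j$. In particular $\lambda_D^{(j)}\in\mathcal R_\ell$ is a modular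 form of weight $j$ on $\Gamma(\ell)$. (2) Moreover $df_D/f_D=t^{-1}\bigl(m+\sum_{j\ge1}d_jt^j\bigr)dt$ with $d_j\in\mathcal R_\ell$ of weight $j$. If $\operatorname{char}k=0$, then $f_D$ has a unique expansion in $z$, of the form $f_D=z^m\bigl(1+\sum_{j\ge1}c_jz^j\bigr)$ with $c_j\in\mathcal R_\ell$ of weight $j$, and $df_D/f_D=z^{-1}\bigl(m+\sum_{j\ge1}e_jz^j\bigr)dz$ with $e_j\in\mathcal R_\ell$ of weight $j$. (3) Let $k=\mathbb C$. For $\tau$ in the upper half-plane $\mathfrak H$ let $L_\tau=\mathbb Z+\mathbb Z\tau$. Then there are a homomorphism $\varphi:\mathbb Z^2\to E(\overline K)$ with image $E[\ell]$ and kernel $\ell\mathbb Z^2$, and an injective homomorphism of $\mathbb C$-algebras from $\mathcal R_\ell$ to the functions on $\mathfrak H$, which sends $a$ and $b$ to $-15\sum_{0\ne\omega\in L_\tau}\omega^{-4}$ and $-35\sum_{0\neq\omega\in L_\tau}\omega^{-6}$, and, for $P=\varphi(r,s)\ne O$ and $\alpha=(r\tau+s)/\ell$, sends $x_P$ and $y_P$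 to $\wp(\alpha;L_\tau)$ and $\tfrac12\wp'(\alpha;L_\tau)$, such that, if $\mathcal R_\ell$ is viewed in this way as a ring of functions of $\tau$, it contains all holomorphic Eisenstein series on $\Gamma(\ell)$. More precisely, for $j\ge1$ and $\alpha=(r\tau+s)/\ell$ let $E_j(\tau,\alpha)$ be the value at $s'=0$ of the analytic continuation of $\sum_{\omega\in L_\tau,\ \omega\ne-\alpha}(\alpha+\omega)^{-j}|\alpha+\omega|^{-2s'}$, which converges for $\operatorname{Re}s'>1-j/2$. Then every holomorphic function of $\tau\in\mathfrak H$ that is a $\mathbb C$-linear combination of the $E_j(\tau,(r\tau+s)/\ell)$, $0\le r,s<\ell$, is an element of $\mathcal R_\ell$ of weight $j$. -/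

import Mathlib

open scoped Classical

noncomputable section

namespace ModuliEisenstein

open Polynomial

/-! ## The curve `y ^ 2 = x ^ 3 + a x + b` over a field and its expansions at the point at infinity -/

section Curve

variable {F : Type*} [Field F]

/-- The short Weierstrass curve `y ^ 2 = x ^ 3 + a x + b`. -/
abbrev curve (a b : F) : WeierstrassCurve.Affine F := ⟨0, 0, 0, a, b⟩

/-- The `x`-coordinate of a point, with the convention that it is `0` at infinity. -/
def xCoord {a b : F} : (curve a b).Point → F
  | .zero => 0
  | .some x _ _ => x

/-- The `y`-coordinate of a point, with the convention that it is `0` at infinity. -/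
def yCoord {a b : F} : (curve a b).Point → F
  | .zero => 0
  | .some _ y _ => y

/-- Successive approximations to the solution of `s = 1 + a t ^ 4 s ^ 2 + b t ^ 6 s ^ 3`. -/
def sIter (a b : F) : ℕ → PowerSeries F
  | 0 => 1
  | n + 1 => 1 + PowerSeries.C a * PowerSeries.X ^ 4 * sIter a b n ^ 2
      + PowerSeries.C b * PowerSeries.X ^ 6 * sIter a b n ^ 3

/-- The power series `s = 1 + a t ^ 4 + ...` with `s = 1 + a t ^ 4 s ^ 2 + b t ^ 6 s ^ 3`. In terms
of the uniformizer `t = -x / y` at infinity, `-1 / y = t ^ 3 s`. -/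
def sSeries (a b : F) : PowerSeries F :=
  PowerSeries.mk fun n => PowerSeries.coeff n (sIter a b n)

theorem sIter_step (a b : F) (u v : PowerSeries F) (n : ℕ)
    (h : (PowerSeries.X : PowerSeries F) ^ n ∣ u - v) :
    (PowerSeries.X : PowerSeries F) ^ (n + 1) ∣
      (1 + PowerSeries.C a * PowerSeries.X ^ 4 * u ^ 2
        + PowerSeries.C b * PowerSeries.X ^ 6 * u ^ 3) -
      (1 + PowerSeries.C a * PowerSeries.X ^ 4 * v ^ 2
        + PowerSeries.C b * PowerSeries.X ^ 6 * v ^ 3) := by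
  obtain ⟨w, hw⟩ := h
  refine ⟨w * (PowerSeries.C a * PowerSeries.X ^ 3 * (u + v)
    + PowerSeries.C b * PowerSeries.X ^ 5 * (u ^ 2 + u * v + v ^ 2)), ?_⟩
  have : u = v + PowerSeries.X ^ n * w := by rw [← hw]; ring
  subst this
  ring

theorem sIter_dvd (a b : F) (n : ℕ) :
    (PowerSeries.X : PowerSeries F) ^ (n + 1) ∣ sIter a b (n + 1) - sIter a b n := by
  induction n with
  | zero =>
    refine ⟨PowerSeries.C a * PowerSeries.X ^ 3 + PowerSeries.C b * PowerSeries.X ^ 5, ?_⟩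
    simp only [sIter]
    ring
  | succ n ih => exact sIter_step a b _ _ _ ih

theorem sIter_dvd' (a b : F) (n m : ℕ) :
    (PowerSeries.X : PowerSeries F) ^ (n + 1) ∣ sIter a b (n + m) - sIter a b n := by
  induction m with
  | zero => simp
  | succ m ih =>
    have h1 : (PowerSeries.X : PowerSeries F) ^ (n + 1) ∣
        sIter a b (n + m + 1) - sIter a b (n + m) :=
      (pow_dvd_pow _ (by omega)).trans (sIter_dvd a b (n + m))
    have := dvd_add h1 ih
    simpa [add_assoc] using this

theorem coeff_sIter (a b : F) (n m : ℕ) (h : n ≤ m) :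
    PowerSeries.coeff n (sIter a b m) = PowerSeries.coeff n (sIter a b n) := by
  obtain ⟨d, rfl⟩ := Nat.exists_eq_add_of_le h
  have := (PowerSeries.X_pow_dvd_iff.mp (sIter_dvd' a b n d)) n (by omega)
  rw [map_sub, sub_eq_zero] at this
  exact this

theorem sSeries_sub_dvd (a b : F) (n : ℕ) :
    (PowerSeries.X : PowerSeries F) ^ (n + 1) ∣ sSeries a b - sIter a b n := by
  rw [PowerSeries.X_pow_dvd_iff]
  intro m hm
  rw [map_sub, sub_eq_zero, sSeries, PowerSeries.coeff_mk, coeff_sIter a b m n (by omega)]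

theorem sSeries_eq (a b : F) :
    sSeries a b = 1 + PowerSeries.C a * PowerSeries.X ^ 4 * sSeries a b ^ 2
      + PowerSeries.C b * PowerSeries.X ^ 6 * sSeries a b ^ 3 := by
  ext n
  have h := PowerSeries.X_pow_dvd_iff.mp
    (sIter_step a b _ _ _ (sSeries_sub_dvd a b n)) n (by omega)
  rw [map_sub, sub_eq_zero] at h
  rw [h]
  change _ = PowerSeries.coeff n (sIter a b (n + 1))
  rw [coeff_sIter a b n (n + 1) (by omega), sSeries, PowerSeries.coeff_mk]

theorem constantCoeff_sSeries (a b : F) : PowerSeries.constantCoeff (sSeries a b) = 1 := by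
  rw [sSeries_eq]
  simp

/-- The Laurent expansion `x = t ^ (-2) / s = t ^ (-2) (1 - a t ^ 4 + ...)`. -/
def xSeries (a b : F) : LaurentSeries F :=
  (HahnSeries.single (-2 : ℤ) 1 : LaurentSeries F) * (HahnSeries.ofPowerSeries ℤ F (sSeries a b))⁻¹

/-- The Laurent expansion `y = - t ^ (-3) / s = t ^ (-3) (-1 + a t ^ 4 + ...)`. -/
def ySeries (a b : F) : LaurentSeries F :=
  -(HahnSeries.single (-3 : ℤ) 1 * (HahnSeries.ofPowerSeries ℤ F (sSeries a b))⁻¹)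

theorem sLaurent_ne_zero (a b : F) : HahnSeries.ofPowerSeries ℤ F (sSeries a b) ≠ 0 := by
  rw [Ne, ← map_zero (HahnSeries.ofPowerSeries ℤ F), HahnSeries.ofPowerSeries_injective.eq_iff]
  intro h
  have := constantCoeff_sSeries a b
  rw [h] at this
  simp at this

theorem single_ne_zero' : (HahnSeries.single (1 : ℤ) (1 : F) : LaurentSeries F) ≠ 0 :=
  HahnSeries.single_ne_zero one_ne_zero

theorem single_neg_eq (n : ℕ) : (HahnSeries.single (-(n : ℤ)) (1 : F) : LaurentSeries F) =
    ((HahnSeries.single (1 : ℤ) (1 : F) : LaurentSeries F) ^ n)⁻¹ := by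
  apply eq_inv_of_mul_eq_one_left
  rw [HahnSeries.single_pow, HahnSeries.single_mul_single]
  simp

theorem sLaurent_eq (a b : F) :
    HahnSeries.ofPowerSeries ℤ F (sSeries a b) =
      1 + algebraMap F (LaurentSeries F) a * HahnSeries.single (1 : ℤ) 1 ^ 4 *
          HahnSeries.ofPowerSeries ℤ F (sSeries a b) ^ 2
        + algebraMap F (LaurentSeries F) b * HahnSeries.single (1 : ℤ) 1 ^ 6 *
          HahnSeries.ofPowerSeries ℤ F (sSeries a b) ^ 3 := by
  conv_lhs => rw [sSeries_eq]
  simp [HahnSeries.ofPowerSeries_C, HahnSeries.ofPowerSeries_X, HahnSeries.algebraMap_apply']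

theorem series_equation (a b : F) :
    ySeries a b ^ 2 = xSeries a b ^ 3 + algebraMap F (LaurentSeries F) a * xSeries a b
      + algebraMap F (LaurentSeries F) b := by
  have hs := sLaurent_ne_zero a b
  have hT := single_ne_zero' (F := F)
  have h2 : (HahnSeries.single (-2 : ℤ) (1 : F) : LaurentSeries F) = _ := single_neg_eq 2
  have h3 : (HahnSeries.single (-3 : ℤ) (1 : F) : LaurentSeries F) = _ := single_neg_eq 3
  have he := sLaurent_eq a b
  rw [xSeries, ySeries, h2, h3]
  generalize HahnSeries.ofPowerSeries ℤ F (sSeries a b) = s at *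
  generalize (HahnSeries.single (1 : ℤ) (1 : F) : LaurentSeries F) = T at *
  field_simp
  linear_combination he

/-- The function `t = -x / y` expands to `t`. -/
theorem neg_xSeries_div_ySeries (a b : F) :
    -(xSeries a b / ySeries a b) = HahnSeries.single (1 : ℤ) 1 := by
  have hs := sLaurent_ne_zero a b
  have hT := single_ne_zero' (F := F)
  have h2 : (HahnSeries.single (-2 : ℤ) (1 : F) : LaurentSeries F) = _ := single_neg_eq 2
  have h3 : (HahnSeries.single (-3 : ℤ) (1 : F) : LaurentSeries F) = _ := single_neg_eq 3
  rw [xSeries, ySeries, h2, h3]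
  generalize HahnSeries.ofPowerSeries ℤ F (sSeries a b) = s at *
  generalize (HahnSeries.single (1 : ℤ) (1 : F) : LaurentSeries F) = T at *
  field_simp

theorem xSeries_transcendental (a b : F) (N : F[X]) (hN : aeval (xSeries a b) N = 0) : N = 0 := by
  by_contra h0
  set u : PowerSeries F := PowerSeries.X ^ 2 * sSeries a b with hu
  have hxu : HahnSeries.ofPowerSeries ℤ F u = (xSeries a b)⁻¹ := by
    have h2 : (HahnSeries.single (-2 : ℤ) (1 : F) : LaurentSeries F) = _ := single_neg_eq 2
    rw [xSeries, h2, hu]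
    simp [HahnSeries.ofPowerSeries_X, mul_comm]
  have hx0 : xSeries a b ≠ 0 := by
    rw [xSeries]
    exact mul_ne_zero (HahnSeries.single_ne_zero one_ne_zero) (inv_ne_zero (sLaurent_ne_zero a b))
  have h1 : aeval (xSeries a b)⁻¹ N.reverse = 0 := by
    have : Invertible (xSeries a b) := invertibleOfNonzero hx0
    have := eval₂_reverse_mul_pow (algebraMap F (LaurentSeries F)) (xSeries a b) N
    rw [← aeval_def, ← aeval_def, hN, invOf_eq_inv] at this
    exact (mul_eq_zero.mp this).resolve_right (pow_ne_zero _ hx0)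
  have h2 : aeval u N.reverse = 0 := by
    apply HahnSeries.ofPowerSeries_injective (Γ := ℤ)
    rw [map_zero, ← h1, ← hxu, aeval_def, aeval_def, hom_eval₂]
    congr 1
  have h3 := congrArg PowerSeries.constantCoeff h2
  rw [map_zero, aeval_def, hom_eval₂] at h3
  have h4 : PowerSeries.constantCoeff u = 0 := by simp [hu]
  rw [h4, eval₂_at_zero, coeff_zero_reverse] at h3
  simp at h3
  exact h0 h3

theorem polynomial_eval₂ (a b : F) :
    (curve a b).polynomial.eval₂ (aeval (xSeries a b) : F[X] →ₐ[F] LaurentSeries F).toRingHom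
      (ySeries a b) = 0 := by
  have h := series_equation a b
  rw [WeierstrassCurve.Affine.polynomial]
  simp only [eval₂_add, eval₂_sub, eval₂_zero, eval₂_mul, eval₂_pow, eval₂_X, eval₂_C, map_zero, map_add,
    map_mul, map_pow, zero_mul, AlgHom.toRingHom_eq_coe, RingHom.coe_coe, aeval_X, aeval_C]
  linear_combination h

/-- Expansion at infinity, in terms of `t = -x / y`, of the regular functions on the affine curve:
the ring homomorphism sending `x` and `y` to their expansions. -/
def expandCoord (a b : F) : (curve a b).CoordinateRing →+* LaurentSeries F :=
  AdjoinRoot.lift (aeval (xSeries a b) : F[X] →ₐ[F] LaurentSeries F).toRingHom (ySeries a b)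
    (polynomial_eval₂ a b)

theorem expandCoord_injective (a b : F) : Function.Injective (expandCoord a b) := by
  rw [injective_iff_map_eq_zero]
  intro f hf
  obtain ⟨p, q, rfl⟩ := WeierstrassCurve.Affine.CoordinateRing.exists_smul_basis_eq f
  have h1 : aeval (xSeries a b) p + aeval (xSeries a b) q * ySeries a b = 0 := by
    have : expandCoord a b (p • 1 + q • WeierstrassCurve.Affine.CoordinateRing.mk _ X)
        = aeval (xSeries a b) p + aeval (xSeries a b) q * ySeries a b := by
      rw [WeierstrassCurve.Affine.CoordinateRing.smul, WeierstrassCurve.Affine.CoordinateRing.smul]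
      simp only [map_add, map_mul, mul_one]
      simp [expandCoord, WeierstrassCurve.Affine.CoordinateRing.mk]
    rw [← this, hf]
  have h2 : p ^ 2 - q ^ 2 * (X ^ 3 + C a * X + C b) = 0 := by
    apply xSeries_transcendental a b
    have := series_equation a b
    simp only [map_sub, map_mul, map_pow, map_add, aeval_X, aeval_C]
    have h5 : aeval (xSeries a b) p = - (aeval (xSeries a b) q * ySeries a b) := by
      linear_combination h1
    rw [h5]
    linear_combination (aeval (xSeries a b) q) ^ 2 * this
  have hd : (X ^ 3 + C a * X + C b : F[X]).natDegree = 3 := by compute_degree!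
  have hd0 : (X ^ 3 + C a * X + C b : F[X]) ≠ 0 := by
    intro h; rw [h] at hd; simp at hd
  have hq : q = 0 := by
    by_contra hq
    have h6 : (p ^ 2).natDegree = (q ^ 2 * (X ^ 3 + C a * X + C b)).natDegree := by
      rw [sub_eq_zero.mp h2]
    rw [natDegree_mul (pow_ne_zero _ hq) hd0, natDegree_pow, natDegree_pow, hd] at h6
    omega
  subst hq
  have hp : p = 0 := by simpa using h2
  simp [hp]

/-- Laurent expansion at infinity, in terms of `t = -x / y`, of elements of the function field. -/
def expandAtInfty (a b : F) : (curve a b).FunctionField →+* LaurentSeries F :=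
  IsFractionRing.lift (expandCoord_injective a b)

/-- The function `f` has order `n` at the point `P`. At infinity this is the order of the Laurent
expansion. At an affine point `(x₀, y₀)` write `f = g / h` with `g`, `h` in the coordinate ring; the
order of a regular function is the exact power of the maximal ideal `(x - x₀, y - y₀)` in which it
lies. -/
def HasOrderAt {a b : F} (f : (curve a b).FunctionField) : (curve a b).Point → ℤ → Prop
  | .zero, n => f ≠ 0 ∧ (expandAtInfty a b f).order = n
  | .some x₀ y₀ _, n => ∃ (g h : (curve a b).CoordinateRing) (i j : ℕ),
      f * algebraMap _ _ h = algebraMap _ _ g ∧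
      g ∈ WeierstrassCurve.Affine.CoordinateRing.XYIdeal (curve a b) x₀ (C y₀) ^ i ∧
      g ∉ WeierstrassCurve.Affine.CoordinateRing.XYIdeal (curve a b) x₀ (C y₀) ^ (i + 1) ∧
      h ∈ WeierstrassCurve.Affine.CoordinateRing.XYIdeal (curve a b) x₀ (C y₀) ^ j ∧
      h ∉ WeierstrassCurve.Affine.CoordinateRing.XYIdeal (curve a b) x₀ (C y₀) ^ (j + 1) ∧
      n = i - j

/-- `div f = D`. -/
def HasDivisor {a b : F} (f : (curve a b).FunctionField) (D : (curve a b).Point →₀ ℤ) : Prop :=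
  ∀ P, HasOrderAt f P (D P)

/-- The degree of a divisor. -/
def divDegree {a b : F} (D : (curve a b).Point →₀ ℤ) : ℤ := D.sum fun _ n => n

/-- For a principal divisor `D`, the function `f_D`: its divisor is `D` and its expansion at infinity
is `t ^ m₀ (1 + O(t))`. -/
def IsPrincipalFunction {a b : F} (D : (curve a b).Point →₀ ℤ) (f : (curve a b).FunctionField) :
    Prop :=
  HasDivisor f D ∧ (expandAtInfty a b f).leadingCoeff = 1

/-- For any divisor `D` supported on the `l`-torsion, the Laurent series
`f_D = (f_{D'}) ^ (1 / l)` where `D' = l (D - (deg D) (O))`; the `l`-th root of the series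
is the one of the form `t ^ (m₀ - deg D) (1 + O(t))`. -/
def IsNormalizedSeries {a b : F} (l : ℕ) (D : (curve a b).Point →₀ ℤ) (G : LaurentSeries F) :
    Prop :=
  G.leadingCoeff = 1 ∧ ∃ f : (curve a b).FunctionField,
    IsPrincipalFunction ((l : ℤ) • (D - Finsupp.single 0 (divDegree D))) f ∧ G ^ l = expandAtInfty a b f

/-- The series `dx / (2 y dt)`: the invariant differential is `ω = dx / (2 y)`. -/
def omegaSeries (a b : F) : LaurentSeries F :=
  LaurentSeries.derivative F (xSeries a b) / (2 * ySeries a b)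

/-- The analytic uniformizer `z = ∫ ω = t + 2 a t ^ 5 / 5 + ...` as a power series in `t`
(used in characteristic zero only). -/
def zSeries (a b : F) : PowerSeries F :=
  PowerSeries.mk fun n => (omegaSeries a b).coeff ((n : ℤ) - 1) / n

/-- Composition `G(u(t))` of a Laurent series `G` with a power series `u` without constant term:
if `G = X ^ m G₀` with a power series `G₀`, this is `u ^ m G₀(u)`. -/
def laurentComp (G : LaurentSeries F) (u : PowerSeries F) : LaurentSeries F :=
  HahnSeries.ofPowerSeries ℤ F u ^ G.order *
    HahnSeries.ofPowerSeries ℤ F (PowerSeries.subst u G.powerSeriesPart)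

/-- `G = X ^ m (e + ∑_{j ≥ 1} c_j X ^ j)` with each `c_j` in the weight `j` part `R j`. -/
def IsWeightedExpansion (R : ℕ → Set F) (m : ℤ) (e : F) (G : LaurentSeries F) : Prop :=
  ∃ c : ℕ → F, c 0 = e ∧ (∀ j, 1 ≤ j → c j ∈ R j) ∧
    G = HahnSeries.single m 1 * HahnSeries.ofPowerSeries ℤ F (PowerSeries.mk c)

/-- `G` is an `R`-balanced Laurent series with leading exponent `m`. -/
def IsBalanced (R : ℕ → Set F) (m : ℤ) (G : LaurentSeries F) : Prop :=
  IsWeightedExpansion R m 1 G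

end Curve

/-! ## The generic curve, modular forms and the ring `R_l` -/

section Generic

variable (k : Type*) [Field k]

/-- The rational function field `K = k(a, b)`. -/
abbrev BaseField := FractionRing (MvPolynomial (Fin 2) k)

/-- An algebraic closure of `k(a, b)`. -/
abbrev GenField := AlgebraicClosure (BaseField k)

/-- The first transcendental `a`. -/
def genA : GenField k :=
  algebraMap (BaseField k) (GenField k)
    (algebraMap (MvPolynomial (Fin 2) k) (BaseField k) (MvPolynomial.X 0))

/-- The second transcendental `b`. -/
def genB : GenField k :=
  algebraMap (BaseField k) (GenField k)
    (algebraMap (MvPolynomial (Fin 2) k) (BaseField k) (MvPolynomial.X 1))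

/-- The points, over the algebraic closure, of the generic curve `y ^ 2 = x ^ 3 + a x + b`. -/
abbrev GenPoint := (curve (genA k) (genB k)).Point

/-- The nonzero `l`-torsion points `E[l] - {O}`. -/
abbrev Torsion (l : ℕ) := {P : GenPoint k // l • P = 0 ∧ P ≠ 0}

/-- The field `K_l`, generated over `K` by the coordinates of the `l`-torsion points. -/
def torsionField (l : ℕ) : IntermediateField (BaseField k) (GenField k) :=
  IntermediateField.adjoin (BaseField k)
    {c | ∃ P : Torsion k l, c = xCoord P.1 ∨ c = yCoord P.1}

/-- Variables for polynomials in `a`, `b` and the coordinates of the `l`-torsion points. -/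
inductive CoordVar (l : ℕ) : Type _
  | a : CoordVar l
  | b : CoordVar l
  | x (P : Torsion k l) : CoordVar l
  | y (P : Torsion k l) : CoordVar l

variable {k}

/-- The weights: `a`, `b`, `x_P`, `y_P` have weights `4`, `6`, `2`, `3`. -/
def CoordVar.weight {l : ℕ} : CoordVar k l → ℕ
  | .a => 4
  | .b => 6
  | .x _ => 2
  | .y _ => 3

/-- The element that a variable stands for. -/
def CoordVar.val {l : ℕ} : CoordVar k l → GenField k
  | .a => genA k
  | .b => genB k
  | .x P => xCoord P.1
  | .y P => yCoord P.1

variable (k)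

/-- The weight `j` part of `R_1 = k[a, b]`. -/
def levelOne (j : ℕ) : Submodule k (GenField k) :=
  (MvPolynomial.weightedHomogeneousSubmodule k ![4, 6] j).map
    (MvPolynomial.aeval ![genA k, genB k]).toLinearMap

/-- Algebraic modular forms of level `Γ(l)` and weight `j`: elements of `K_l` that are quotients of
isobaric polynomials in the `x_P`, `y_P` with coefficients in the graded ring `R_1`, of total
weight `j`, and that satisfy an equation of graded integral dependence over `R_1`. -/
def IsModularForm (l j : ℕ) (f : GenField k) : Prop :=
  f ∈ torsionField k l ∧
  (∃ (d : ℕ) (g h : MvPolynomial (CoordVar k l) k),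
    g.IsWeightedHomogeneous CoordVar.weight (d + j) ∧
    h.IsWeightedHomogeneous CoordVar.weight d ∧
    MvPolynomial.aeval CoordVar.val h ≠ 0 ∧
    f = MvPolynomial.aeval CoordVar.val g / MvPolynomial.aeval CoordVar.val h) ∧
  ∃ (n : ℕ) (c : ℕ → GenField k), 1 ≤ n ∧ (∀ i, c i ∈ levelOne k (i * j)) ∧
    f ^ n + ∑ i ∈ Finset.Icc 1 n, c i * f ^ (n - i) = 0

/-- Names for the generators of `R_l`: `a`, `b`, `x_P`, `y_P`, and the slopes `λ_D` for
`D = (P) + (Q) + (R)` with `P`, `Q`, `R` in `E[l] - {O}` and `P + Q + R = O`. -/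
inductive GenVar (l : ℕ) : Type _
  | coord (v : CoordVar k l) : GenVar l
  | slope (P Q R : Torsion k l) (h : P.1 + Q.1 + R.1 = 0) : GenVar l

variable {k}

/-- The weights of the generators of `R_l`; the slopes have weight `1`. -/
def GenVar.weight {l : ℕ} : GenVar k l → ℕ
  | .coord v => v.weight
  | .slope _ _ _ _ => 1

/-- The values of the generators of `R_l`. The line through the three points (tangent if `P = Q`)
is `y = λ x + ν`. -/
def GenVar.val {l : ℕ} : GenVar k l → GenField k
  | .coord v => v.val
  | .slope P Q _ _ => (curve (genA k) (genB k)).slope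
      (xCoord P.1) (xCoord Q.1) (yCoord P.1) (yCoord Q.1)

variable (k)

/-- The ring `R_l`, the `k`-algebra generated by `a`, `b`, the `x_P`, `y_P` and the slopes. -/
def ringR (l : ℕ) : Subalgebra k (GenField k) :=
  (MvPolynomial.aeval (GenVar.val (k := k) (l := l))).range

/-- The weight `j` part of `R_l`. -/
def weightPart (l j : ℕ) : Submodule k (GenField k) :=
  (MvPolynomial.weightedHomogeneousSubmodule k (GenVar.weight (k := k) (l := l)) j).map
    (MvPolynomial.aeval GenVar.val).toLinearMap

variable {k} in
/-- A generator, as an element of `R_l`. -/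
def ringR.gen {l : ℕ} (v : CoordVar k l) : ringR k l :=
  ⟨v.val, MvPolynomial.X (GenVar.coord v), by simp [GenVar.val]⟩

end Generic

/-! ## The complex case -/

section Complex

/-- The pair of periods `1, τ` of the lattice `L_τ = ℤ + ℤ τ`. -/
def periods (τ : UpperHalfPlane) : PeriodPair where
  ω₁ := 1
  ω₂ := τ
  indep := by
    rw [LinearIndependent.pair_iff]
    intro s t h
    have him := congrArg Complex.im h
    have hre := congrArg Complex.re h
    have hτ : (τ : ℂ).im ≠ 0 := τ.im_ne_zero
    simp at him
    have ht : t = 0 := him.resolve_right hτ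
    subst ht
    simpa using hre

/-- The point `α = (r τ + s) / l`. -/
def torsionArg (l : ℕ) (r s : ℤ) (τ : UpperHalfPlane) : ℂ := (r * (τ : ℂ) + s) / l

/-- Hecke's series `∑' (α + ω) ^ (-j) |α + ω| ^ (-2 s)`, the sum being over `ω = m τ + n` in `L_τ`
with `ω ≠ -α`. -/
def heckeSeries (j : ℕ) (τ : UpperHalfPlane) (α s : ℂ) : ℂ :=
  ∑' p : ℤ × ℤ, if α + (p.1 * (τ : ℂ) + p.2) = 0 then 0 else
    1 / ((α + (p.1 * (τ : ℂ) + p.2)) ^ j *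
      ((‖α + (p.1 * (τ : ℂ) + p.2)‖ : ℝ) : ℂ) ^ (2 * s))

/-- `e = E_j(τ, α)`: the value at `s = 0` of the analytic continuation of Hecke's series, which
converges absolutely for `Re s > 1 - j / 2`. -/
def IsEisensteinValue (j : ℕ) (τ : UpperHalfPlane) (α e : ℂ) : Prop :=
  ∃ (ε : ℝ) (Φ : ℂ → ℂ), 0 < ε ∧ AnalyticOnNhd ℂ Φ {s | -ε < s.re} ∧
    (∀ s : ℂ, 1 - (j : ℝ) / 2 < s.re → -ε < s.re → Φ s = heckeSeries j τ α s) ∧ Φ 0 = e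

/-- The holomorphic Eisenstein series of weight `j` on `Γ(l)`: the holomorphic functions on the upper
half-plane that are linear combinations of the `E_j(τ, α)`, `α = (r τ + s) / l`. -/
def IsHolomorphicEisenstein (l j : ℕ) (g : UpperHalfPlane → ℂ) : Prop :=
  DifferentiableOn ℂ (g ∘ UpperHalfPlane.ofComplex) {w : ℂ | 0 < w.im} ∧
  ∃ (E : Fin l × Fin l → UpperHalfPlane → ℂ) (c : Fin l × Fin l → ℂ),
    (∀ p τ, IsEisensteinValue j τ (torsionArg l (p.1 : ℕ) (p.2 : ℕ) τ) (E p τ)) ∧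
    ∀ τ, g τ = ∑ p, c p * E p τ

/-- The identification of the algebraic and analytic pictures for `k = ℂ`. The torsion points are
labelled by `P_α`, `α = (r τ + s) / l`, through `φ : ℤ × ℤ → E[l]`, and the elements of `R_l` are
viewed as functions of `τ` through the injective homomorphism `Ψ`, so that the curve is
`y ^ 2 = x ^ 3 + a(τ) x + b(τ)` with `a = -15 ∑ ω ^ (-4)`, `b = -35 ∑ ω ^ (-6)`, parametrized by
`(℘, ℘' / 2)`. -/
structure IsAnalyticRealization (l : ℕ) (φ : ℤ × ℤ →+ GenPoint ℂ)
    (Ψ : ringR ℂ l →ₐ[ℂ] (UpperHalfPlane → ℂ)) : Prop where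
  ker : ∀ r s : ℤ, φ (r, s) = 0 ↔ (l : ℤ) ∣ r ∧ (l : ℤ) ∣ s
  range : ∀ P : GenPoint ℂ, l • P = 0 ↔ ∃ p, φ p = P
  injective : Function.Injective Ψ
  map_a : Ψ (ringR.gen .a) = fun τ => -15 * (periods τ).G 4
  map_b : Ψ (ringR.gen .b) = fun τ => -35 * (periods τ).G 6
  map_x : ∀ (P : Torsion ℂ l) (r s : ℤ), φ (r, s) = P.1 →
    Ψ (ringR.gen (.x P)) = fun τ => (periods τ).weierstrassP (torsionArg l r s τ)
  map_y : ∀ (P : Torsion ℂ l) (r s : ℤ), φ (r, s) = P.1 →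
    Ψ (ringR.gen (.y P)) = fun τ => (periods τ).derivWeierstrassP (torsionArg l r s τ) / 2

end Complex

end ModuliEisenstein

end

/-! The expansions rest on Miller's construction, read at infinity. In `t = -x/y` the series `t^2 x`
and `-t^3 y` are both `1/s`, whose coefficient of `t^j` is isobaric of weight `j` in `a`, `b`. Hence
a vertical line `x - x_P` (a constant of weight 2) and a normalized chord (slope of weight 1,
intercept of weight 3) have balanced expansions over `R_l`. The chord through `P`, `Q` divided by
the vertical line through `P + Q` has divisor `(P) + (Q) - (P+Q) - (O)`; products of such functions
give `l(P) - l(O)` for a torsion point `P`, and then every `l(D - deg D (O))`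
(`TorsionGraded.exists_balanced_divisor`). Balanced series are closed under products, inverses,
`l`-th roots (since `l` is invertible) and change of uniformizer to `z`, and their logarithmic
derivatives have coefficients of the right weight. Uniqueness of `f_D` holds because two functions
with the same affine divisor differ by a constant.

Elements of `R_l` are modular forms because the generators are integral over `k[a,b]`
(`torsion_xCoord_integral`). For a valuation ring containing `a`, `b`, `1/l`, the points with `|x| >
1` together with `O` form a group on which `x/y` is additive up to strictly smaller terms, so
multiplication by the unit `l` kills none of them but `O`. Slopes follow from `lam^2 = x_P + x_Q +
x_R`. Weights are tracked by an auxiliary variable `T`, through the curve with coefficients `a T^4`,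
`b T^6`.

Over the complex numbers the slope through the points with parameters `u`, `v` is `ζ(u+v) - ζ(u) -
ζ(v)`, the additive defect of the Weierstrass zeta function (`zetaSlope_sq`,
`lattice_isLineSection`). The functions `a(τ)`, `b(τ)` are algebraically independent
(`aeval_holA_holB_injective`), so the algebraic closure of `ℂ(a,b)` embeds in an algebraic closure
of the fraction field of the holomorphic functions on the half-plane. The points `(℘, ℘'/2)` at the
arguments `(rτ+s)/l` are torsion, so they come from the generic curve, and specialization to one
lattice curve shows that they exhaust `E[l]` (`labelling_range`).

For the Eisenstein series, subtracting from Hecke's summand its terms of order at most one in `α`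
gives a series convergent to the left of `s = 0`. In weight 1 its value there is `ζ(α)`, so the
Eisenstein values are additive up to slopes, and telescoping along the multiples of `α` recovers
each of them. In weight 2 the values differ by `℘(α)` from `E_2(τ,0)`, whose coefficient must vanish
in a holomorphic combination. In weight at least 3 they are derivatives of `℘` up to a constant,
hence polynomials in `℘`, `℘'`, `a`; the level one series comes from the distribution relation. -/

noncomputable section

namespace ModuliEisenstein

open Polynomial

/-! ### Collinear triples and the group law -/

section Points

/-- The line `y = lam x + nu` meets the cubic `y ^ 2 = x ^ 3 + a x + b` in the three given points,
counted with multiplicity. -/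
def IsLineSection {R : Type*} [CommRing R] (a b lam nu x₁ y₁ x₂ y₂ x₃ y₃ : R) : Prop :=
  (y₁ = lam * x₁ + nu ∧ y₂ = lam * x₂ + nu ∧ y₃ = lam * x₃ + nu) ∧
    x₁ + x₂ + x₃ = lam ^ 2 ∧ x₁ * x₂ + x₁ * x₃ + x₂ * x₃ = a - 2 * lam * nu ∧
    x₁ * x₂ * x₃ = nu ^ 2 - b

theorem IsLineSection.map {R S : Type*} [CommRing R] [CommRing S] (f : R →+* S)
    {a b lam nu x₁ y₁ x₂ y₂ x₃ y₃ : R} (h : IsLineSection a b lam nu x₁ y₁ x₂ y₂ x₃ y₃) :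
    IsLineSection (f a) (f b) (f lam) (f nu) (f x₁) (f y₁) (f x₂) (f y₂) (f x₃) (f y₃) := by
  obtain ⟨⟨h1, h2, h3⟩, h4, h5, h6⟩ := h
  refine ⟨⟨?_, ?_, ?_⟩, ?_, ?_, ?_⟩
  · rw [h1]; simp
  · rw [h2]; simp
  · rw [h3]; simp
  · simpa using congrArg f h4
  · simpa [map_ofNat f 2] using congrArg f h5
  · simpa using congrArg f h6

theorem IsLineSection.of_map {R S : Type*} [CommRing R] [CommRing S] {f : R →+* S}
    (hf : Function.Injective f)
    {a b lam nu x₁ y₁ x₂ y₂ x₃ y₃ : R}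
    (h : IsLineSection (f a) (f b) (f lam) (f nu) (f x₁) (f y₁) (f x₂) (f y₂) (f x₃) (f y₃)) :
    IsLineSection a b lam nu x₁ y₁ x₂ y₂ x₃ y₃ := by
  obtain ⟨⟨h1, h2, h3⟩, h4, h5, h6⟩ := h
  refine ⟨⟨hf ?_, hf ?_, hf ?_⟩, hf ?_, hf ?_, hf ?_⟩ <;> simpa [map_ofNat f 2]

variable {F : Type*} [Field F] {a b : F}

theorem curve_equation_iff {x y : F} : (curve a b).Equation x y ↔ y ^ 2 = x ^ 3 + a * x + b := by
  rw [WeierstrassCurve.Affine.equation_iff]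
  simp

theorem curve_negY (x y : F) : (curve a b).negY x y = -y := by
  simp [WeierstrassCurve.Affine.negY]

theorem curve_nonsingular_iff {x y : F} : (curve a b).Nonsingular x y ↔
    y ^ 2 = x ^ 3 + a * x + b ∧ (3 * x ^ 2 + a ≠ 0 ∨ 2 * y ≠ 0) := by
  rw [WeierstrassCurve.Affine.nonsingular_iff', curve_equation_iff]
  refine and_congr_right fun _ => or_congr ?_ (by simp)
  rw [← neg_ne_zero]
  simp [add_comm]

theorem IsLineSection.eq₁ {R : Type*} [CommRing R] {a b lam nu x₁ y₁ x₂ y₂ x₃ y₃ : R}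
    (h : IsLineSection a b lam nu x₁ y₁ x₂ y₂ x₃ y₃) : y₁ ^ 2 = x₁ ^ 3 + a * x₁ + b := by
  obtain ⟨⟨h1, h2, h3⟩, h4, h5, h6⟩ := h
  rw [h1]
  linear_combination -x₁ ^ 2 * h4 + x₁ * h5 - h6

/-- The line is not vertical, so two points that are negatives of each other would coincide and have
`2y = 0`; the double root would then force `3x^2 + a = 0`, against nonsingularity. Away from this
case the slope in the addition formula must be `lam`. -/
theorem IsLineSection.add_eq_zero {lam nu x₁ y₁ x₂ y₂ x₃ y₃ : F}
    (h : IsLineSection a b lam nu x₁ y₁ x₂ y₂ x₃ y₃) (h₁ : (curve a b).Nonsingular x₁ y₁)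
    (h₂ : (curve a b).Nonsingular x₂ y₂) (h₃ : (curve a b).Nonsingular x₃ y₃) :
    (WeierstrassCurve.Affine.Point.some x₁ y₁ h₁ : (curve a b).Point) + .some x₂ y₂ h₂
      + .some x₃ y₃ h₃ = 0 := by
  obtain ⟨⟨e1, e2, e3⟩, e4, e5, e6⟩ := h
  have hxy : ¬(x₁ = x₂ ∧ y₁ = (curve a b).negY x₂ y₂) := by
    rintro ⟨hx, hy⟩
    rw [curve_negY] at hy
    subst hx
    have hy' : y₁ = y₂ := by rw [e1, e2]
    have hs := (curve_nonsingular_iff.mp h₁).2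
    have h2 : 2 * y₁ = 0 := by linear_combination hy + hy'
    have h3 : 3 * x₁ ^ 2 + a = 0 := by
      linear_combination -e5 + 2 * x₁ * e4 - 2 * lam * e1 + lam * h2
    tauto
  have hsl : (curve a b).slope x₁ x₂ y₁ y₂ = lam := by
    by_cases hx : x₁ = x₂
    · have hy : y₁ ≠ (curve a b).negY x₂ y₂ := fun h => hxy ⟨hx, h⟩
      rw [WeierstrassCurve.Affine.slope_of_Y_ne hx hy, curve_negY]
      subst hx
      have hy' : y₁ = y₂ := by rw [e1, e2]
      rw [curve_negY, ← hy'] at hy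
      have : y₁ - -y₁ ≠ 0 := sub_ne_zero.mpr hy
      rw [div_eq_iff this]
      simp
      linear_combination -e5 + 2 * x₁ * e4 - 2 * lam * e1
    · rw [WeierstrassCurve.Affine.slope_of_X_ne hx, div_eq_iff (sub_ne_zero.mpr hx)]
      linear_combination e1 - e2
  rw [WeierstrassCurve.Affine.Point.add_some hxy, ← eq_neg_iff_add_eq_zero,
    WeierstrassCurve.Affine.Point.neg_some, WeierstrassCurve.Affine.Point.some.injEq, hsl]
  have hX : (curve a b).addX x₁ x₂ lam = x₃ := by
    simp [WeierstrassCurve.Affine.addX]; linear_combination -e4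
  refine ⟨hX, ?_⟩
  rw [WeierstrassCurve.Affine.addY, WeierstrassCurve.Affine.negAddY, hX, curve_negY, curve_negY, e3, e1]
  ring

/-- The equation of the third point is the addition formula. The two remaining symmetric functions
come from the tangent slope if `x₁ = x₂`, and otherwise from the curve equations after cancelling
`x₁ - x₂`. -/
theorem isLineSection_of_add_eq_zero {x₁ y₁ x₂ y₂ x₃ y₃ : F} (h₁ : (curve a b).Nonsingular x₁ y₁)
    (h₂ : (curve a b).Nonsingular x₂ y₂) (h₃ : (curve a b).Nonsingular x₃ y₃)
    (h : (WeierstrassCurve.Affine.Point.some x₁ y₁ h₁ : (curve a b).Point) + .some x₂ y₂ h₂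
      + .some x₃ y₃ h₃ = 0) :
    IsLineSection a b ((curve a b).slope x₁ x₂ y₁ y₂)
      (y₁ - (curve a b).slope x₁ x₂ y₁ y₂ * x₁) x₁ y₁ x₂ y₂ x₃ y₃ := by
  have hxy : ¬(x₁ = x₂ ∧ y₁ = (curve a b).negY x₂ y₂) := by
    rintro ⟨hx, hy⟩
    rw [WeierstrassCurve.Affine.Point.add_of_Y_eq hx hy, zero_add] at h
    exact WeierstrassCurve.Affine.Point.some_ne_zero _ h
  rw [WeierstrassCurve.Affine.Point.add_some hxy, ← eq_neg_iff_add_eq_zero,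
    WeierstrassCurve.Affine.Point.neg_some, WeierstrassCurve.Affine.Point.some.injEq] at h
  obtain ⟨hX, hY⟩ := h
  have e₁ := curve_equation_iff.mp h₁.1
  have e₂ := curve_equation_iff.mp h₂.1
  rw [WeierstrassCurve.Affine.addY, WeierstrassCurve.Affine.negAddY, hX, curve_negY, curve_negY,
    neg_inj] at hY
  have hX' : x₃ = (curve a b).slope x₁ x₂ y₁ y₂ ^ 2 - x₁ - x₂ := by
    rw [← hX]; simp [WeierstrassCurve.Affine.addX]
  by_cases hx : x₁ = x₂
  · have hy : y₁ ≠ (curve a b).negY x₂ y₂ := fun h => hxy ⟨hx, h⟩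
    have hy' := WeierstrassCurve.Affine.Y_eq_of_Y_ne h₁.1 h₂.1 hx hy
    subst hx hy'
    have hs := WeierstrassCurve.Affine.slope_of_Y_ne (W := curve a b) rfl hy
    generalize (curve a b).slope x₁ x₁ y₁ y₁ = s at *
    rw [curve_negY] at hy hs
    have hy0 : y₁ - -y₁ ≠ 0 := sub_ne_zero.mpr hy
    rw [eq_div_iff hy0] at hs
    simp at hs
    refine ⟨⟨by ring, by ring, by linear_combination -hY⟩, by rw [hX']; ring, ?_, ?_⟩
    · rw [hX']; linear_combination hs
    · rw [hX']; linear_combination x₁ * hs - e₁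
  · have hs := WeierstrassCurve.Affine.slope_of_X_ne (W := curve a b) (y₁ := y₁) (y₂ := y₂) hx
    generalize (curve a b).slope x₁ x₂ y₁ y₂ = s at *
    have hx' := sub_ne_zero.mpr hx
    rw [eq_div_iff hx'] at hs
    refine ⟨⟨by ring, by linear_combination hs, by linear_combination -hY⟩, by rw [hX']; ring, ?_, ?_⟩
    · rw [hX']
      apply mul_left_cancel₀ hx'
      grind
    · rw [hX']
      apply mul_left_cancel₀ hx'
      grind

/-- Collinearity only speaks of triples of affine points. The triples containing `O` are covered by
oddness and by invariance under translation by the elements sent to zero. -/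
theorem map_add_of_triples {A B : Type*} [AddCommGroup A] [AddCommGroup B] (f : A → B)
    (hneg : ∀ u, f (-u) = -f u) (hz : ∀ u v, f u = 0 → f (u + v) = f v)
    (h3 : ∀ u v w, u + v + w = 0 → f u ≠ 0 → f v ≠ 0 → f w ≠ 0 → f u + f v + f w = 0) (u v : A) :
    f (u + v) = f u + f v := by
  by_cases hu : f u = 0
  · rw [hz u v hu, hu, zero_add]
  by_cases hv : f v = 0
  · rw [add_comm u, hz v u hv, hv, add_zero]
  by_cases huv : f (u + v) = 0
  · have := hz (u + v) (-u) huv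
    rw [hneg, add_neg_cancel_comm] at this
    rw [huv, this, add_neg_cancel]
  have := h3 u v (-(u + v)) (add_neg_cancel _) hu hv (by rw [hneg]; exact neg_ne_zero.mpr huv)
  rw [hneg, add_neg_eq_zero] at this
  exact this.symm

@[simp] theorem xCoord_some {x y : F} (h : (curve a b).Nonsingular x y) :
    xCoord (.some x y h : (curve a b).Point) = x := rfl

@[simp] theorem yCoord_some {x y : F} (h : (curve a b).Nonsingular x y) :
    yCoord (.some x y h : (curve a b).Point) = y := rfl

theorem point_nonsingular {P : (curve a b).Point} (hP : P ≠ 0) :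
    (curve a b).Nonsingular (xCoord P) (yCoord P) := by
  rcases P with _ | ⟨x, y, h⟩
  · exact absurd rfl hP
  · exact h

theorem point_eq_some {P : (curve a b).Point} (hP : P ≠ 0) :
    P = .some (xCoord P) (yCoord P) (point_nonsingular hP) := by
  rcases P with _ | ⟨x, y, h⟩
  · exact absurd rfl hP
  · rfl

theorem point_equation {P : (curve a b).Point} (hP : P ≠ 0) :
    yCoord P ^ 2 = xCoord P ^ 3 + a * xCoord P + b :=
  curve_equation_iff.mp (point_nonsingular hP).1

theorem xCoord_neg (P : (curve a b).Point) : xCoord (-P) = xCoord P := by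
  rcases P with _ | ⟨x, y, h⟩
  · rfl
  · rw [WeierstrassCurve.Affine.Point.neg_some]; rfl

theorem yCoord_neg (P : (curve a b).Point) : yCoord (-P) = -yCoord P := by
  rcases P with _ | ⟨x, y, h⟩
  · exact neg_zero.symm
  · rw [WeierstrassCurve.Affine.Point.neg_some, yCoord_some, yCoord_some, curve_negY]

theorem point_ext {P Q : (curve a b).Point} (hP : P ≠ 0) (hQ : Q ≠ 0) (hx : xCoord P = xCoord Q)
    (hy : yCoord P = yCoord Q) : P = Q := by
  rw [point_eq_some hP, point_eq_some hQ, WeierstrassCurve.Affine.Point.some.injEq]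
  exact ⟨hx, hy⟩

theorem isLineSection_of_points {P Q R : (curve a b).Point} (hP : P ≠ 0) (hQ : Q ≠ 0) (hR : R ≠ 0)
    (h : P + Q + R = 0) :
    IsLineSection a b ((curve a b).slope (xCoord P) (xCoord Q) (yCoord P) (yCoord Q))
      (yCoord P - (curve a b).slope (xCoord P) (xCoord Q) (yCoord P) (yCoord Q) * xCoord P)
      (xCoord P) (yCoord P) (xCoord Q) (yCoord Q) (xCoord R) (yCoord R) := by
  apply isLineSection_of_add_eq_zero (point_nonsingular hP) (point_nonsingular hQ)
    (point_nonsingular hR)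
  rwa [← point_eq_some hP, ← point_eq_some hQ, ← point_eq_some hR]

theorem IsLineSection.points_add_eq_zero {lam nu : F} {P Q R : (curve a b).Point} (hP : P ≠ 0)
    (hQ : Q ≠ 0) (hR : R ≠ 0) (h : IsLineSection a b lam nu (xCoord P) (yCoord P) (xCoord Q)
      (yCoord Q) (xCoord R) (yCoord R)) : P + Q + R = 0 := by
  have := h.add_eq_zero (point_nonsingular hP) (point_nonsingular hQ) (point_nonsingular hR)
  rwa [← point_eq_some hP, ← point_eq_some hQ, ← point_eq_some hR] at this

/-- The relations of a line section determine the slope. Since these relations pass through ring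
homomorphisms, slopes can be compared after a change of ring without going through the case
distinction that defines them. -/
theorem IsLineSection.slope_eq {lam nu : F} {P Q R : (curve a b).Point} (hP : P ≠ 0)
    (hQ : Q ≠ 0) (hR : R ≠ 0) (h : IsLineSection a b lam nu (xCoord P) (yCoord P) (xCoord Q)
      (yCoord Q) (xCoord R) (yCoord R)) :
    (curve a b).slope (xCoord P) (xCoord Q) (yCoord P) (yCoord Q) = lam := by
  have h' := isLineSection_of_points hP hQ hR (h.points_add_eq_zero hP hQ hR)
  have hn := point_nonsingular hP
  generalize (curve a b).slope (xCoord P) (xCoord Q) (yCoord P) (yCoord Q) = s at *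
  generalize xCoord P = x₁ at *
  generalize yCoord P = y₁ at *
  generalize xCoord Q = x₂ at *
  obtain ⟨⟨e1, e2, e3⟩, e4, e5, e6⟩ := h
  obtain ⟨⟨f1, f2, f3⟩, f4, f5, f6⟩ := h'
  by_cases hx : x₁ = x₂
  · subst hx
    have hs := (curve_nonsingular_iff.mp hn).2
    by_cases h2 : 2 * y₁ = 0
    · exfalso
      have h3 : 3 * x₁ ^ 2 + a = 0 := by
        linear_combination -e5 + 2 * x₁ * e4 - 2 * lam * e1 + lam * h2
      tauto
    · apply mul_left_cancel₀ h2
      linear_combination -e5 + 2 * x₁ * e4 - 2 * lam * e1 + (f5 - 2 * x₁ * f4)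
  · apply mul_left_cancel₀ (sub_ne_zero.mpr hx)
    linear_combination e1 - e2 - f1 + f2

/-- These are the explicit quotients that exhibit a slope as a ratio of isobaric polynomials; that
`P + Q` is not `O` is what makes the tangent denominator nonzero. -/
theorem slope_formula {P Q R : (curve a b).Point} (hP : P ≠ 0) (hQ : Q ≠ 0) (hR : R ≠ 0)
    (h : P + Q + R = 0) :
    (xCoord P = xCoord Q → 2 * yCoord P ≠ 0 ∧
      (curve a b).slope (xCoord P) (xCoord Q) (yCoord P) (yCoord Q) =
        (3 * xCoord P ^ 2 + a) / (2 * yCoord P)) ∧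
    (xCoord P ≠ xCoord Q →
      (curve a b).slope (xCoord P) (xCoord Q) (yCoord P) (yCoord Q) =
        (yCoord P - yCoord Q) / (xCoord P - xCoord Q)) := by
  have hs := isLineSection_of_points hP hQ hR h
  have hn := (curve_nonsingular_iff.mp (point_nonsingular hP)).2
  generalize (curve a b).slope (xCoord P) (xCoord Q) (yCoord P) (yCoord Q) = s at *
  obtain ⟨⟨e1, e2, e3⟩, e4, e5, e6⟩ := hs
  refine ⟨fun hx => ?_, fun hx => ?_⟩
  · rw [← hx] at e4 e5
    have hy : 2 * yCoord P ≠ 0 := by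
      intro hy
      have : 3 * xCoord P ^ 2 + a = 0 := by
        linear_combination -e5 + 2 * xCoord P * e4 - 2 * s * e1 + s * hy
      tauto
    refine ⟨hy, ?_⟩
    rw [eq_div_iff hy]
    linear_combination e5 - 2 * xCoord P * e4 + 2 * s * e1
  · rw [eq_div_iff (sub_ne_zero.mpr hx)]
    linear_combination e2

end Points

/-! ### Integrality of the coordinates of torsion points -/

section Integrality

/-- The relation between slope and intercept in the coordinates `x / y`, `1 / y` near infinity. -/
theorem IsLineSection.slope_relation {R : Type*} [CommRing R]
    {a b lam nu x₁ y₁ x₂ y₂ x₃ y₃ : R} (h : IsLineSection a b lam nu x₁ y₁ x₂ y₂ x₃ y₃) :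
    lam * (y₁ ^ 2 * y₂ ^ 2 - a * x₂ * y₁ * (y₁ + y₂) - b * (y₁ ^ 2 + y₁ * y₂ + y₂ ^ 2)) =
      -nu * (x₁ ^ 2 * y₂ ^ 2 + x₁ * x₂ * y₁ * y₂ + x₂ ^ 2 * y₁ ^ 2 + a * y₂ ^ 2) := by
  obtain ⟨⟨h1, h2, h3⟩, h4, h5, h6⟩ := h
  -- A line section is freely parametrized by `lam`, `nu`, `x₁`, `x₂`: every other quantity is a
  -- polynomial in these, and the claim becomes a polynomial identity.
  have ha : a = x₁ * x₂ + x₁ * x₃ + x₂ * x₃ + 2 * lam * nu := by linear_combination -h5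
  have hb : b = nu ^ 2 - x₁ * x₂ * x₃ := by linear_combination h6
  have h7 : x₃ = lam ^ 2 - x₁ - x₂ := by linear_combination h4
  subst h1 h2 h3 ha hb h7
  ring

/-- The quotient of the second quantity by the first is `x₁/y₁ + x₂/y₂ + x₃/y₃`, so the sum of the
parameters at infinity is expressed by the line alone. -/
theorem IsLineSection.prod_y {R : Type*} [CommRing R]
    {a b lam nu x₁ y₁ x₂ y₂ x₃ y₃ : R} (h : IsLineSection a b lam nu x₁ y₁ x₂ y₂ x₃ y₃) :
    y₁ * y₂ * y₃ = nu ^ 3 + a * lam ^ 2 * nu - b * lam ^ 3 ∧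
      x₁ * y₂ * y₃ + x₂ * y₁ * y₃ + x₃ * y₁ * y₂ = 2 * a * lam * nu - 3 * b * lam ^ 2 := by
  obtain ⟨⟨h1, h2, h3⟩, h4, h5, h6⟩ := h
  have ha : a = x₁ * x₂ + x₁ * x₃ + x₂ * x₃ + 2 * lam * nu := by linear_combination -h5
  have hb : b = nu ^ 2 - x₁ * x₂ * x₃ := by linear_combination h6
  have h7 : x₃ = lam ^ 2 - x₁ - x₂ := by linear_combination h4
  subst h1 h2 h3 ha hb h7
  constructor <;> ring

variable {F : Type*} [Field F] {Γ : Type*} [LinearOrderedCommGroupWithZero Γ] (v : Valuation F Γ)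
  {a b : F}

theorem valuation_y_le_one (ha : v a ≤ 1) (hb : v b ≤ 1) {x y : F}
    (h : y ^ 2 = x ^ 3 + a * x + b) (hx : v x ≤ 1) : v y ≤ 1 := by
  have : v y ^ 2 ≤ 1 := by
    rw [← map_pow, h]
    refine v.map_add_le (v.map_add_le ?_ ?_) hb
    · rw [map_pow]; exact pow_le_one' hx 3
    · rw [map_mul]; exact mul_le_one' ha hx
  exact (pow_le_one_iff (by norm_num)).mp this

theorem valuation_sq_y (ha : v a ≤ 1) (hb : v b ≤ 1) {x y : F}
    (h : y ^ 2 = x ^ 3 + a * x + b) (hx : 1 < v x) : v y ^ 2 = v x ^ 3 := by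
  rw [← map_pow, h, add_assoc, ← map_pow]
  apply Valuation.map_add_eq_of_lt_left
  rw [map_pow]
  have h1 : v x < v x ^ 3 := by
    simpa using pow_lt_pow_right₀ hx (show 1 < 3 by norm_num)
  refine v.map_add_lt ?_ (lt_of_le_of_lt hb (hx.trans h1))
  rw [map_mul]
  exact lt_of_le_of_lt (mul_le_of_le_one_left' ha) h1

/-- Since `|y|^2 = |x|^3` and `|x| > 1`, one has `|x| < |y| ≤ |x|^2`: near infinity `x/y` is small
and `1/y` is at most its square. -/
theorem valuation_small (ha : v a ≤ 1) (hb : v b ≤ 1) {x y : F}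
    (h : y ^ 2 = x ^ 3 + a * x + b) (hx : 1 < v x) :
    y ≠ 0 ∧ 0 < v (x / y) ∧ v (x / y) < 1 ∧ v (1 / y) ≤ v (x / y) ^ 2 := by
  have h1 := valuation_sq_y v ha hb h hx
  have hx0 : 0 < v x := zero_lt_one.trans hx
  have hy0 : v y ≠ 0 := by
    intro h0; rw [h0] at h1
    exact (pow_ne_zero 3 hx0.ne') (by simpa using h1.symm)
  have hy1 : v x < v y := by
    by_contra hc
    have := pow_le_pow_left' (not_lt.mp hc) 2
    rw [h1] at this
    exact absurd this (not_le.mpr (pow_lt_pow_right₀ hx (by norm_num)))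
  have hy2 : v y ≤ v x ^ 2 := by
    by_contra hc
    have := pow_le_pow_left' (not_le.mp hc).le 2
    rw [h1, ← pow_mul] at this
    exact absurd this (not_le.mpr (pow_lt_pow_right₀ hx (by norm_num)))
  have hy0' := zero_lt_iff.mpr hy0
  refine ⟨v.ne_zero_iff.mp hy0, ?_, ?_, ?_⟩
  · rw [map_div₀]; exact div_pos hx0 hy0'
  · rw [map_div₀]; exact (div_lt_one₀ hy0').mpr hy1
  · rw [map_div₀, map_div₀, map_one, div_pow, div_le_div_iff₀ hy0' (pow_pos hy0' 2), one_mul, sq,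
      mul_comm]
    exact mul_le_mul_left hy2 _

/-- First order additivity of the formal group. Put `t = x/y`, `w = 1/y`, and let `m < 1` be the
larger of `|t₁|`, `|t₂|`. The slope relation gives `|lam| ≤ |nu| m^2`, and `1 = lam t₁ + nu w₁` then
forces `|nu| m^2 ≥ 1`, so `nu` dominates. In `prod_y` the product of ordinates has size `|nu|^3` and
the numerator at most `|nu|^2 m^2`, so the sum of the parameters is at most `m^2/|nu| < m`. -/
theorem IsLineSection.valuation_third (ha : v a ≤ 1) (hb : v b ≤ 1) (h2 : v 2 ≤ 1) (h3 : v 3 ≤ 1)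
    {lam nu x₁ y₁ x₂ y₂ x₃ y₃ : F} (h : IsLineSection a b lam nu x₁ y₁ x₂ y₂ x₃ y₃)
    (e₂ : y₂ ^ 2 = x₂ ^ 3 + a * x₂ + b) (e₃ : y₃ ^ 2 = x₃ ^ 3 + a * x₃ + b)
    (hx₁ : 1 < v x₁) (hx₂ : 1 < v x₂) :
    1 < v x₃ ∧ v (x₁ / y₁ + x₂ / y₂ + x₃ / y₃) < max (v (x₁ / y₁)) (v (x₂ / y₂)) := by
  obtain ⟨hy₁, ht₁, ht₁', hw₁⟩ := valuation_small v ha hb h.eq₁ hx₁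
  obtain ⟨hy₂, ht₂, ht₂', hw₂⟩ := valuation_small v ha hb e₂ hx₂
  obtain ⟨hp, hs⟩ := h.prod_y
  have hr := h.slope_relation
  obtain ⟨⟨l1, l2, l3⟩, -, -, -⟩ := h
  have hUS : lam * (1 - (a * (x₂ / y₂) * (1 / y₁ + 1 / y₂) + b * ((1 / y₁) ^ 2 + (1 / y₁) * (1 / y₂)
        + (1 / y₂) ^ 2))) =
      -nu * ((x₁ / y₁) ^ 2 + (x₁ / y₁) * (x₂ / y₂) + (x₂ / y₂) ^ 2 + a * (1 / y₁) ^ 2) := by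
    field_simp
    linear_combination hr
  have h1 : 1 = lam * (x₁ / y₁) + nu * (1 / y₁) := by
    field_simp; linear_combination l1
  -- The case distinction is provisional: `y₃ ≠ 0` only becomes available once the product of
  -- ordinates is known to have size `|nu|^3`.
  have hsum : x₁ / y₁ + x₂ / y₂ + x₃ / y₃ =
      if y₃ = 0 then x₁ / y₁ + x₂ / y₂ + x₃ / y₃ else
      (2 * a * lam * nu - 3 * b * lam ^ 2) / (y₁ * y₂ * y₃) := by
    split_ifs with h0
    · rfl
    · rw [← hs]; field_simp
  rw [hsum]
  generalize x₁ / y₁ = t₁ at *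
  generalize x₂ / y₂ = t₂ at *
  generalize 1 / y₁ = w₁ at *
  generalize 1 / y₂ = w₂ at *
  set m := max (v t₁) (v t₂) with hm
  have hm0 : 0 < m := lt_max_of_lt_left ht₁
  have hm1 : m < 1 := max_lt ht₁' ht₂'
  have t₁m : v t₁ ≤ m := le_max_left _ _
  have t₂m : v t₂ ≤ m := le_max_right _ _
  have hmm : m ^ 2 < 1 := pow_lt_one₀ zero_le hm1 (by norm_num)
  have w₁m : v w₁ ≤ m ^ 2 := hw₁.trans (pow_le_pow_left' t₁m 2)
  have w₂m : v w₂ ≤ m ^ 2 := hw₂.trans (pow_le_pow_left' t₂m 2)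
  have w₁1 : v w₁ < 1 := w₁m.trans_lt hmm
  have w₂1 : v w₂ < 1 := w₂m.trans_lt hmm
  have hU : v (1 - (a * t₂ * (w₁ + w₂) + b * (w₁ ^ 2 + w₁ * w₂ + w₂ ^ 2))) = 1 := by
    apply Valuation.map_one_sub_of_lt
    refine v.map_add_lt ?_ ?_
    · rw [map_mul, map_mul]
      exact (mul_le_of_le_one_left' (mul_le_one' ha ht₂'.le)).trans_lt (v.map_add_lt w₁1 w₂1)
    · rw [map_mul]
      refine (mul_le_of_le_one_left' hb).trans_lt ?_
      refine v.map_add_lt (v.map_add_lt ?_ ?_) ?_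
      · rw [map_pow]; exact pow_lt_one₀ zero_le w₁1 (by norm_num)
      · rw [map_mul]; exact (mul_le_of_le_one_left' w₁1.le).trans_lt w₂1
      · rw [map_pow]; exact pow_lt_one₀ zero_le w₂1 (by norm_num)
  have hS : v (t₁ ^ 2 + t₁ * t₂ + t₂ ^ 2 + a * w₁ ^ 2) ≤ m ^ 2 := by
    refine v.map_add_le (v.map_add_le (v.map_add_le ?_ ?_) ?_) ?_
    · rw [map_pow]; exact pow_le_pow_left' t₁m 2
    · rw [map_mul, sq]; exact mul_le_mul' t₁m t₂m
    · rw [map_pow]; exact pow_le_pow_left' t₂m 2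
    · rw [map_mul, map_pow]
      refine (mul_le_of_le_one_left' ha).trans ?_
      rw [sq]
      exact (mul_le_of_le_one_left' w₁1.le).trans w₁m
  have hlam : v lam ≤ v nu * m ^ 2 := by
    have := congrArg v hUS
    rw [map_mul, hU, mul_one, map_mul, Valuation.map_neg] at this
    rw [this]
    exact mul_le_mul_right hS _
  have hnu : 1 ≤ v nu * m ^ 2 := by
    have h4 : v (lam * t₁ + nu * w₁) ≤ v nu * m ^ 2 := by
      refine v.map_add_le ?_ ?_
      · rw [map_mul]; exact (mul_le_of_le_one_right' ht₁'.le).trans hlam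
      · rw [map_mul]; exact mul_le_mul_right w₁m _
    rwa [← h1, map_one] at h4
  have hnu0 : 0 < v nu := by
    rw [zero_lt_iff]; intro h0; rw [h0, zero_mul] at hnu; exact absurd hnu (by simp)
  have hnu1 : 1 < v nu := by
    refine lt_of_le_of_lt hnu ?_
    exact mul_lt_of_lt_one_right hnu0 hmm
  have hln : v lam < v nu := hlam.trans_lt (mul_lt_of_lt_one_right hnu0 hmm)
  have hprod : v (y₁ * y₂ * y₃) = v nu ^ 3 := by
    rw [hp, add_sub_assoc, ← map_pow]
    apply Valuation.map_add_eq_of_lt_left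
    have hl2 : v lam ^ 2 < v nu ^ 2 := pow_lt_pow_left₀ hln zero_le (by norm_num)
    have hl3 : v lam ^ 3 < v nu ^ 3 := pow_lt_pow_left₀ hln zero_le (by norm_num)
    refine v.map_sub_lt ?_ ?_
    · simp only [map_mul, map_pow]
      rw [pow_succ (v nu) 2]
      refine mul_lt_mul_of_pos_right ?_ hnu0
      exact (mul_le_of_le_one_left' ha).trans_lt hl2
    · simp only [map_mul, map_pow]
      exact (mul_le_of_le_one_left' hb).trans_lt hl3
  have hy₃ : y₃ ≠ 0 := by
    rintro rfl
    rw [mul_zero, map_zero] at hprod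
    exact pow_ne_zero 3 hnu0.ne' hprod.symm
  constructor
  -- If `x₃` were integral then so would be `y₃`, but `y₃ = lam x₃ + nu` has size `|nu| > 1`.
  · by_contra hc
    have hx := not_lt.mp hc
    have hy := valuation_y_le_one v ha hb e₃ hx
    have : v y₃ = v nu := by
      rw [l3]
      apply Valuation.map_add_eq_of_lt_right
      rw [map_mul]
      exact (mul_le_of_le_one_right' hx).trans_lt hln
    rw [this] at hy
    exact absurd hnu1 (not_lt.mpr hy)
  · rw [if_neg hy₃, map_div₀, hprod, div_lt_iff₀ (pow_pos hnu0 3)]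
    have key : v (2 * a * lam * nu - 3 * b * lam ^ 2) ≤ v nu ^ 2 * m ^ 2 := by
      refine v.map_sub_le ?_ ?_
      · simp only [map_mul]
        calc v 2 * v a * v lam * v nu ≤ 1 * (v nu * m ^ 2) * v nu := by
              gcongr; exact mul_le_one' h2 ha
          _ = v nu ^ 2 * m ^ 2 := by rw [one_mul, sq (v nu), mul_right_comm]
      · simp only [map_mul, map_pow]
        calc v 3 * v b * v lam ^ 2 ≤ 1 * (v lam * v lam) := by
              rw [sq]; gcongr; exact mul_le_one' h3 hb
          _ ≤ v nu * (v nu * m ^ 2) := by rw [one_mul]; gcongr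
          _ = v nu ^ 2 * m ^ 2 := by rw [sq (v nu), mul_assoc]
    refine key.trans_lt ?_
    have h5 : v nu ^ 2 * m ^ 2 < v nu ^ 2 * m := by
      refine mul_lt_mul_of_pos_left ?_ (pow_pos hnu0 2)
      rw [sq]; exact mul_lt_of_lt_one_right hm0 hm1
    refine h5.trans ?_
    rw [mul_comm]
    exact mul_lt_mul_of_pos_left (pow_lt_pow_right₀ hnu1 (by norm_num)) hm0

/-- The parameter `x / y` at infinity. -/
def infParam (P : (curve a b).Point) : F := xCoord P / yCoord P

theorem infParam_zero : infParam (0 : (curve a b).Point) = 0 := by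
  change (0 : F) / 0 = 0
  simp

theorem infParam_neg (P : (curve a b).Point) : infParam (-P) = -infParam P := by
  rw [infParam, infParam, xCoord_neg, yCoord_neg, div_neg]

/-- The points of the kernel of reduction. -/
def IsNearInf (P : (curve a b).Point) : Prop := P = 0 ∨ 1 < v (xCoord P)

/-- The bound `r` is a common scale rather than the size of either parameter, so that a multiple of
a point and the point itself can be added at the scale of the point. -/
theorem IsNearInf.add (ha : v a ≤ 1) (hb : v b ≤ 1) (h2 : v 2 ≤ 1) (h3 : v 3 ≤ 1)
    {P Q : (curve a b).Point} (hP : IsNearInf v P) (hQ : IsNearInf v Q) {r : Γ} (hr : 0 < r)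
    (hP' : v (infParam P) ≤ r) (hQ' : v (infParam Q) ≤ r) :
    IsNearInf v (P + Q) ∧ v (infParam (P + Q) - infParam P - infParam Q) < r := by
  by_cases hP0 : P = 0
  · subst hP0
    rw [zero_add, infParam_zero]
    exact ⟨hQ, by simpa⟩
  by_cases hQ0 : Q = 0
  · subst hQ0
    rw [add_zero, infParam_zero]
    exact ⟨hP, by simpa⟩
  by_cases hR : P + Q = 0
  · refine ⟨Or.inl hR, ?_⟩
    rw [hR, infParam_zero, eq_neg_of_add_eq_zero_left hR, infParam_neg]
    simpa
  have hs := isLineSection_of_points hP0 hQ0 (neg_ne_zero.mpr hR) (add_neg_cancel (P + Q))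
  have h1 := hs.valuation_third v ha hb h2 h3 (point_equation hQ0) (point_equation (neg_ne_zero.mpr hR))
    (hP.resolve_left hP0) (hQ.resolve_left hQ0)
  rw [xCoord_neg, yCoord_neg] at h1
  refine ⟨Or.inr h1.1, ?_⟩
  have h4 := h1.2.trans_le (max_le hP' hQ')
  rw [← Valuation.map_neg] at h4
  convert h4 using 2
  rw [infParam, infParam, infParam, div_neg]
  ring

/-- Each addition makes an error strictly smaller than the parameter of `P`, and by the ultrametric
inequality the errors do not accumulate. -/
theorem IsNearInf.nsmul (ha : v a ≤ 1) (hb : v b ≤ 1) (h2 : v 2 ≤ 1) (h3 : v 3 ≤ 1)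
    (hn : ∀ n : ℕ, v (n : F) ≤ 1)
    {P : (curve a b).Point} (hP : IsNearInf v P) (h0 : 0 < v (infParam P)) (n : ℕ) :
    IsNearInf v (n • P) ∧ v (infParam (n • P) - n * infParam P) < v (infParam P) := by
  induction n with
  | zero =>
    refine ⟨Or.inl (zero_smul _ _), ?_⟩
    rw [zero_smul, infParam_zero]
    simpa
  | succ n ih =>
    have h5 : v (infParam (n • P)) ≤ v (infParam P) := by
      have : infParam (n • P) = (infParam (n • P) - n * infParam P) + n * infParam P := by ring
      rw [this]
      refine v.map_add_le ih.2.le ?_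
      rw [map_mul]
      exact mul_le_of_le_one_left' (hn n)
    obtain ⟨h6, h7⟩ := ih.1.add v ha hb h2 h3 hP h0 h5 le_rfl
    rw [succ_nsmul]
    refine ⟨h6, ?_⟩
    have : infParam (n • P + P) - (n + 1 : ℕ) * infParam P =
      (infParam (n • P + P) - infParam (n • P) - infParam P)
        + (infParam (n • P) - n * infParam P) := by push_cast; ring
    rw [this]
    exact v.map_add_lt h7 ih.2

/-- If `|x| > 1` then `P` lies near infinity with nonzero parameter `t`. As `l P = O` has parameter
0, this gives `|l t| < |t|`, impossible because `l` is a unit. -/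
theorem torsion_xCoord_mem (V : ValuationSubring F) (ha : a ∈ V) (hb : b ∈ V) {l : ℕ}
    (hl : (l : F)⁻¹ ∈ V) (hl0 : (l : F) ≠ 0) {P : (curve a b).Point} (hP : l • P = 0) :
    xCoord P ∈ V := by
  by_cases hP0 : P = 0
  · subst hP0; exact V.zero_mem
  by_contra hc
  rw [← V.valuation_le_one_iff, not_le] at hc
  have ha' := (V.valuation_le_one_iff a).mpr ha
  have hb' := (V.valuation_le_one_iff b).mpr hb
  have hn : ∀ n : ℕ, V.valuation (n : F) ≤ 1 := fun n =>
    (V.valuation_le_one_iff _).mpr (natCast_mem V n)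
  obtain ⟨-, h0, -, -⟩ := valuation_small V.valuation ha' hb' (point_equation hP0) hc
  obtain ⟨-, h1⟩ := IsNearInf.nsmul V.valuation ha' hb' (by simp) (by simp) hn
    (P := P) (Or.inr hc) h0 l
  rw [hP, infParam_zero, zero_sub, Valuation.map_neg, map_mul] at h1
  have h2 : V.valuation (l : F) = 1 := by
    refine le_antisymm (hn l) ?_
    have h3 := (V.valuation_le_one_iff _).mpr hl
    rw [map_inv₀] at h3
    exact (inv_le_one₀ (zero_lt_iff.mpr (V.valuation.ne_zero_iff.mpr hl0))).mp h3
  rw [h2, one_mul] at h1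
  exact lt_irrefl _ h1

/-- The `x`-coordinates of `l`-torsion points are integral over any ring that contains `a`, `b` and
`1 / l`. -/
theorem torsion_xCoord_integral (A : Subring F) (ha : a ∈ A) (hb : b ∈ A) {l : ℕ}
    (hl : (l : F)⁻¹ ∈ A) (hl0 : (l : F) ≠ 0) {P : (curve a b).Point} (hP : l • P = 0) :
    IsIntegral A (xCoord P) := by
  -- The integral closure of `A` in the field is the intersection of the valuation rings containing
  -- `A`.
  have h := iInf_valuationSubring_superset (s := (A : Set F))
  rw [Subring.closure_eq] at h
  have h1 : xCoord P ∈ (integralClosure A F).toSubring := by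
    rw [← h, Subring.mem_iInf]
    rintro ⟨V, hV⟩
    exact torsion_xCoord_mem V (hV ha) (hV hb) (hV hl) hl0 hP
  exact h1

theorem torsion_yCoord_integral (A : Subring F) (ha : a ∈ A) (hb : b ∈ A) {l : ℕ}
    (hl : (l : F)⁻¹ ∈ A) (hl0 : (l : F) ≠ 0) {P : (curve a b).Point} (hP : l • P = 0) :
    IsIntegral A (yCoord P) := by
  by_cases hP0 : P = 0
  · subst hP0; exact isIntegral_zero
  have hx := torsion_xCoord_integral A ha hb hl hl0 hP
  refine IsIntegral.of_pow (n := 2) (by norm_num) ?_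
  rw [point_equation hP0]
  exact ((hx.pow 3).add ((isIntegral_algebraMap (x := (⟨a, ha⟩ : A))).mul hx)).add
    (isIntegral_algebraMap (x := (⟨b, hb⟩ : A)))

theorem IsLineSection.slope_integral (A : Subring F) {lam nu x₁ y₁ x₂ y₂ x₃ y₃ : F}
    (h : IsLineSection a b lam nu x₁ y₁ x₂ y₂ x₃ y₃) (h₁ : IsIntegral A x₁) (h₂ : IsIntegral A x₂)
    (h₃ : IsIntegral A x₃) : IsIntegral A lam := by
  refine IsIntegral.of_pow (n := 2) (by norm_num) ?_
  rw [← h.2.1]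
  exact (h₁.add h₂).add h₃

end Integrality

/-! ### Homomorphisms into groups of points, and rescaling of the curve -/

section PointHom

variable {F : Type*} [Field F] {a b : F}

/-- A parametrization of points by an abelian group, trivial exactly on `N`, that carries triples
with sum zero to line sections, is a homomorphism. -/
theorem exists_pointHom {A : Type*} [AddCommGroup A] (N : AddSubgroup A) (X Y : A → F)
    (hns : ∀ u, u ∉ N → (curve a b).Nonsingular (X u) (Y u))
    (hneg : ∀ u, u ∉ N → X (-u) = X u ∧ Y (-u) = -Y u)
    (hper : ∀ u v, u ∈ N → v ∉ N → X (u + v) = X v ∧ Y (u + v) = Y v)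
    (h3 : ∀ u v w, u ∉ N → v ∉ N → w ∉ N → u + v + w = 0 →
      ∃ lam nu, IsLineSection a b lam nu (X u) (Y u) (X v) (Y v) (X w) (Y w)) :
    ∃ φ : A →+ (curve a b).Point, (∀ u, φ u = 0 ↔ u ∈ N) ∧
      ∀ u, u ∉ N → xCoord (φ u) = X u ∧ yCoord (φ u) = Y u := by
  let f : A → (curve a b).Point := fun u =>
    if h : u ∈ N then 0 else .some (X u) (Y u) (hns u h)
  have f0 : ∀ u, u ∈ N → f u = 0 := fun u h => dif_pos h
  have f1 : ∀ u (h : u ∉ N), f u = .some (X u) (Y u) (hns u h) := fun u h => dif_neg h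
  have f2 : ∀ u, f u = 0 ↔ u ∈ N := by
    intro u
    refine ⟨fun h => ?_, f0 u⟩
    by_contra hc
    rw [f1 u hc] at h
    exact WeierstrassCurve.Affine.Point.some_ne_zero _ h
  have fx : ∀ u, u ∉ N → xCoord (f u) = X u ∧ yCoord (f u) = Y u := by
    intro u hu
    rw [f1 u hu]
    exact ⟨rfl, rfl⟩
  have hN : ∀ u, -u ∈ N ↔ u ∈ N := fun u => neg_mem_iff
  have fadd : ∀ u v, f (u + v) = f u + f v := by
    apply map_add_of_triples
    · intro u
      by_cases hu : u ∈ N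
      · rw [f0 u hu, f0 (-u) (neg_mem hu), neg_zero]
      · have hu' : -u ∉ N := fun h => hu ((hN u).mp h)
        have hfu : f u ≠ 0 := fun h => hu ((f2 u).mp h)
        have hfu' : f (-u) ≠ 0 := fun h => hu' ((f2 _).mp h)
        apply point_ext hfu' (neg_ne_zero.mpr hfu)
        · rw [xCoord_neg, (fx u hu).1, (fx _ hu').1, (hneg u hu).1]
        · rw [yCoord_neg, (fx u hu).2, (fx _ hu').2, (hneg u hu).2]
    · intro u v hu
      rw [f2] at hu
      by_cases hv : v ∈ N
      · rw [f0 v hv, f0 _ (add_mem hu hv)]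
      · have huv : u + v ∉ N := fun h => hv ((add_mem_cancel_left hu).mp h)
        apply point_ext (fun h => huv ((f2 _).mp h)) (fun h => hv ((f2 _).mp h))
        · rw [(fx v hv).1, (fx _ huv).1, (hper u v hu hv).1]
        · rw [(fx v hv).2, (fx _ huv).2, (hper u v hu hv).2]
    · intro u v w h hu hv hw
      have hu' : u ∉ N := fun h => hu ((f2 _).mpr h)
      have hv' : v ∉ N := fun h => hv ((f2 _).mpr h)
      have hw' : w ∉ N := fun h => hw ((f2 _).mpr h)
      obtain ⟨lam, nu, hs⟩ := h3 u v w hu' hv' hw' h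
      refine IsLineSection.points_add_eq_zero (lam := lam) (nu := nu) hu hv hw ?_
      rwa [(fx u hu').1, (fx u hu').2, (fx v hv').1, (fx v hv').2, (fx w hw').1, (fx w hw').2]
  exact ⟨⟨⟨f, f0 0 N.zero_mem⟩, fadd⟩, f2, fx⟩

theorem IsLineSection.scale {R : Type*} [CommRing R] {a b lam nu x₁ y₁ x₂ y₂ x₃ y₃ : R} (u : R)
    (h : IsLineSection a b lam nu x₁ y₁ x₂ y₂ x₃ y₃) :
    IsLineSection (a * u ^ 4) (b * u ^ 6) (lam * u) (nu * u ^ 3) (x₁ * u ^ 2) (y₁ * u ^ 3)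
      (x₂ * u ^ 2) (y₂ * u ^ 3) (x₃ * u ^ 2) (y₃ * u ^ 3) := by
  obtain ⟨⟨h1, h2, h3⟩, h4, h5, h6⟩ := h
  refine ⟨⟨?_, ?_, ?_⟩, ?_, ?_, ?_⟩
  · linear_combination u ^ 3 * h1
  · linear_combination u ^ 3 * h2
  · linear_combination u ^ 3 * h3
  · linear_combination u ^ 2 * h4
  · linear_combination u ^ 4 * h5
  · linear_combination u ^ 6 * h6

/-- Extension of scalars followed by the change of variables `(x, y) ↦ (u ^ 2 x, u ^ 3 y)`. -/
theorem exists_scaleHom {F' : Type*} [Field F'] (f : F →+* F') {u : F'} (hu : u ≠ 0) :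
    ∃ φ : (curve a b).Point →+ (curve (f a * u ^ 4) (f b * u ^ 6)).Point,
      (∀ P, φ P = 0 ↔ P = 0) ∧
      ∀ P, P ≠ 0 → xCoord (φ P) = f (xCoord P) * u ^ 2 ∧ yCoord (φ P) = f (yCoord P) * u ^ 3 := by
  apply exists_pointHom (⊥ : AddSubgroup (curve a b).Point) (fun P => f (xCoord P) * u ^ 2)
    (fun P => f (yCoord P) * u ^ 3)
  · intro P hP
    obtain ⟨h1, h2⟩ := curve_nonsingular_iff.mp (point_nonsingular (P := P) (by simpa using hP))
    rw [curve_nonsingular_iff]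
    constructor
    · have := congrArg f h1
      simp only [map_add, map_mul, map_pow] at this
      linear_combination u ^ 6 * this
    · refine h2.imp (fun h => ?_) (fun h => ?_)
      · have h3 := mul_ne_zero ((map_ne_zero f).mpr h) (pow_ne_zero 4 hu)
        simp only [map_add, map_mul, map_pow, map_ofNat f 3] at h3
        convert h3 using 1
        ring
      · have h3 := mul_ne_zero ((map_ne_zero f).mpr h) (pow_ne_zero 3 hu)
        simp only [map_mul, map_ofNat f 2] at h3
        rwa [← mul_assoc]
  · intro P _
    refine ⟨?_, ?_⟩
    · simp only [xCoord_neg]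
    · simp only [yCoord_neg, map_neg, neg_mul]
  · intro P Q hP _
    rw [AddSubgroup.mem_bot] at hP
    simp [hP]
  · intro P Q R hP hQ hR h
    rw [AddSubgroup.mem_bot] at hP hQ hR
    exact ⟨_, _, ((isLineSection_of_points hP hQ hR h).map f).scale u⟩

/-- Weighted integrality of the coordinates of torsion points. -/
theorem scaled_torsion_integral {F' : Type*} [Field F'] (f : F →+* F') {u : F'} (hu : u ≠ 0)
    (A : Subring F') (ha : f a * u ^ 4 ∈ A) (hb : f b * u ^ 6 ∈ A) {l : ℕ}
    (hl : (l : F')⁻¹ ∈ A) (hl0 : (l : F') ≠ 0) {P : (curve a b).Point} (hP : l • P = 0)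
    (hP0 : P ≠ 0) :
    IsIntegral A (f (xCoord P) * u ^ 2) ∧ IsIntegral A (f (yCoord P) * u ^ 3) := by
  obtain ⟨φ, -, hφ⟩ := exists_scaleHom (a := a) (b := b) f hu
  have h1 : l • φ P = 0 := by rw [← map_nsmul, hP, map_zero]
  have hx := torsion_xCoord_integral _ ha hb hl hl0 h1
  have hy := torsion_yCoord_integral _ ha hb hl hl0 h1
  rw [(hφ P hP0).1] at hx
  rw [(hφ P hP0).2] at hy
  exact ⟨hx, hy⟩

end PointHom

/-! ### The weight parts of `R_l` -/

section Weights

variable {k : Type*} [Field k] {l : ℕ}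

theorem weightPart_mul {i j : ℕ} {x y : GenField k} (hx : x ∈ weightPart k l i)
    (hy : y ∈ weightPart k l j) : x * y ∈ weightPart k l (i + j) := by
  obtain ⟨p, hp, rfl⟩ := hx
  obtain ⟨q, hq, rfl⟩ := hy
  exact ⟨p * q, MvPolynomial.IsWeightedHomogeneous.mul hp hq,
    map_mul (MvPolynomial.aeval GenVar.val) p q⟩

theorem weightPart_algebraMap (c : k) : algebraMap k (GenField k) c ∈ weightPart k l 0 :=
  ⟨MvPolynomial.C c, MvPolynomial.isWeightedHomogeneous_C _ c, MvPolynomial.aeval_C _ c⟩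

theorem weightPart_one : (1 : GenField k) ∈ weightPart k l 0 := by
  simpa using weightPart_algebraMap (l := l) (1 : k)

theorem weightPart_val (v : GenVar k l) : v.val ∈ weightPart k l v.weight :=
  ⟨MvPolynomial.X v, MvPolynomial.isWeightedHomogeneous_X k _ v, MvPolynomial.aeval_X _ v⟩

theorem genA_mem_weightPart : genA k ∈ weightPart k l 4 := weightPart_val (GenVar.coord CoordVar.a)

theorem genB_mem_weightPart : genB k ∈ weightPart k l 6 := weightPart_val (GenVar.coord CoordVar.b)

theorem xCoord_mem_weightPart {P : GenPoint k} (hP : l • P = 0) :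
    xCoord P ∈ weightPart k l 2 := by
  by_cases h0 : P = 0
  · subst h0; exact zero_mem _
  · exact weightPart_val (GenVar.coord (CoordVar.x ⟨P, hP, h0⟩))

theorem yCoord_mem_weightPart {P : GenPoint k} (hP : l • P = 0) :
    yCoord P ∈ weightPart k l 3 := by
  by_cases h0 : P = 0
  · subst h0; exact zero_mem _
  · exact weightPart_val (GenVar.coord (CoordVar.y ⟨P, hP, h0⟩))

theorem slope_mem_weightPart {P Q : GenPoint k} (hP : l • P = 0) (hQ : l • Q = 0) (hP0 : P ≠ 0)
    (hQ0 : Q ≠ 0) (hPQ : P + Q ≠ 0) :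
    (curve (genA k) (genB k)).slope (xCoord P) (xCoord Q) (yCoord P) (yCoord Q) ∈
      weightPart k l 1 :=
  weightPart_val (GenVar.slope ⟨P, hP, hP0⟩ ⟨Q, hQ, hQ0⟩
    ⟨-(P + Q), by rw [neg_nsmul, nsmul_add, hP, hQ, add_zero, neg_zero], neg_ne_zero.mpr hPQ⟩
    (add_neg_cancel (P + Q)))

theorem weightPart_subset_ringR {j : ℕ} {x : GenField k} (hx : x ∈ weightPart k l j) :
    x ∈ ringR k l := by
  obtain ⟨p, -, rfl⟩ := hx
  exact ⟨p, rfl⟩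

/-- A multiplicative family of submodules containing the generators contains the weight parts. -/
theorem weightPart_le (S : ℕ → Submodule k (GenField k)) (h1 : 1 ∈ S 0)
    (hmul : ∀ i j x y, x ∈ S i → y ∈ S j → x * y ∈ S (i + j))
    (hval : ∀ v : GenVar k l, v.val ∈ S v.weight) (j : ℕ) : weightPart k l j ≤ S j := by
  have hpow : ∀ i x, x ∈ S i → ∀ n : ℕ, x ^ n ∈ S (n * i) := by
    intro i x hx n
    induction n with
    | zero => simpa using h1
    | succ n ih => rw [pow_succ, add_mul, one_mul]; exact hmul _ _ _ _ ih hx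
  have hmon : ∀ d : GenVar k l →₀ ℕ,
      (d.prod fun v n => v.val ^ n) ∈ S (Finsupp.weight GenVar.weight d) := by
    intro d
    induction d using Finsupp.induction with
    | zero => simpa using h1
    | single_add v n f hv hn ih =>
      rw [Finsupp.prod_add_index' (by simp) (by intros; rw [pow_add]), map_add,
        Finsupp.prod_single_index (by simp), Finsupp.weight_single]
      exact hmul _ _ _ _ (hpow _ _ (hval v) n) ih
  rintro _ ⟨p, hp, rfl⟩
  change MvPolynomial.aeval GenVar.val p ∈ S j
  rw [MvPolynomial.aeval_def, MvPolynomial.eval₂_eq]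
  refine Submodule.sum_mem _ fun d hd => ?_
  rw [← Algebra.smul_def]
  refine Submodule.smul_mem _ _ ?_
  have : Finsupp.weight GenVar.weight d = j := hp (MvPolynomial.mem_support_iff.mp hd)
  rw [← this]
  exact hmon d

end Weights

/-! ### Elements of `R_l` are modular forms -/

section Modular

variable {k : Type*} [Field k] {l : ℕ}

theorem levelOne_mul {i j : ℕ} {x y : GenField k} (hx : x ∈ levelOne k i)
    (hy : y ∈ levelOne k j) : x * y ∈ levelOne k (i + j) := by
  obtain ⟨p, hp, rfl⟩ := hx
  obtain ⟨q, hq, rfl⟩ := hy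
  exact ⟨p * q, MvPolynomial.IsWeightedHomogeneous.mul hp hq,
    map_mul (MvPolynomial.aeval ![genA k, genB k]) p q⟩

theorem levelOne_algebraMap (c : k) : algebraMap k (GenField k) c ∈ levelOne k 0 :=
  ⟨MvPolynomial.C c, MvPolynomial.isWeightedHomogeneous_C _ c, MvPolynomial.aeval_C _ c⟩

theorem genA_mem_levelOne : genA k ∈ levelOne k 4 :=
  ⟨MvPolynomial.X 0, MvPolynomial.isWeightedHomogeneous_X k _ 0, by simp⟩

theorem genB_mem_levelOne : genB k ∈ levelOne k 6 :=
  ⟨MvPolynomial.X 1, MvPolynomial.isWeightedHomogeneous_X k _ 1, by simp⟩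

theorem weightPart_le_torsionField {j : ℕ} {x : GenField k} (hx : x ∈ weightPart k l j) :
    x ∈ torsionField k l := by
  refine weightPart_le (l := l) (fun _ => ((torsionField k l).toSubalgebra.restrictScalars k).toSubmodule)
    (one_mem (torsionField k l)) (fun _ _ _ _ hx hy => (torsionField k l).mul_mem hx hy) ?_ j hx
  have hbase : ∀ c : BaseField k, algebraMap (BaseField k) (GenField k) c ∈ torsionField k l :=
    fun c => (torsionField k l).algebraMap_mem c
  have ha : genA k ∈ torsionField k l := hbase _
  have hb : genB k ∈ torsionField k l := hbase _
  have hxy : ∀ P : Torsion k l, xCoord P.1 ∈ torsionField k l ∧ yCoord P.1 ∈ torsionField k l :=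
    fun P => ⟨IntermediateField.subset_adjoin _ _ ⟨P, Or.inl rfl⟩,
      IntermediateField.subset_adjoin _ _ ⟨P, Or.inr rfl⟩⟩
  intro v
  change v.val ∈ torsionField k l
  rcases v with (_ | _ | P | P) | ⟨P, Q, R, h⟩
  · exact ha
  · exact hb
  · exact (hxy P).1
  · exact (hxy P).2
  · change (curve (genA k) (genB k)).slope _ _ _ _ ∈ torsionField k l
    rw [WeierstrassCurve.Affine.slope]
    have h3 : (3 : GenField k) ∈ torsionField k l := by
      simp
    have h1 := hxy P
    have h2 := hxy Q
    split_ifs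
    · exact zero_mem _
    · refine div_mem ?_ ?_
      · simp only [mul_zero, zero_mul, add_zero, sub_zero]
        exact add_mem (mul_mem h3 (pow_mem h1.1 2)) ha
      · rw [curve_negY]
        exact sub_mem h1.2 (neg_mem h1.2)
    · exact div_mem (sub_mem h1.2 h2.2) (sub_mem h1.1 h2.1)

/-- Quotients of isobaric polynomials, of total weight `j`. -/
def isobaricQuotients (k : Type*) [Field k] (l j : ℕ) : Submodule k (GenField k) where
  carrier := {f | ∃ (d : ℕ) (g h : MvPolynomial (CoordVar k l) k),
    g.IsWeightedHomogeneous CoordVar.weight (d + j) ∧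
    h.IsWeightedHomogeneous CoordVar.weight d ∧
    MvPolynomial.aeval CoordVar.val h ≠ 0 ∧
    f = MvPolynomial.aeval CoordVar.val g / MvPolynomial.aeval CoordVar.val h}
  zero_mem' := ⟨0, 0, 1, MvPolynomial.isWeightedHomogeneous_zero _ _ _,
    MvPolynomial.isWeightedHomogeneous_one _ _, by simp, by simp⟩
  add_mem' := by
    rintro _ _ ⟨d, g, h, hg, hh, h0, rfl⟩ ⟨d', g', h', hg', hh', h0', rfl⟩
    refine ⟨d + d', g * h' + g' * h, h * h', ?_, hh.mul hh', ?_, ?_⟩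
    · refine MvPolynomial.IsWeightedHomogeneous.add ?_ ?_
      · convert hg.mul hh' using 1; ring
      · convert hg'.mul hh using 1; ring
    · rw [map_mul]; exact mul_ne_zero h0 h0'
    · rw [map_add, map_mul, map_mul, map_mul]; field_simp
  smul_mem' := by
    rintro c _ ⟨d, g, h, hg, hh, h0, rfl⟩
    refine ⟨d, MvPolynomial.C c * g, h, ?_, hh, h0, ?_⟩
    · simpa using (MvPolynomial.isWeightedHomogeneous_C CoordVar.weight c).mul hg
    · rw [map_mul, MvPolynomial.aeval_C, Algebra.smul_def, mul_div_assoc]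

theorem isobaricQuotients_div {i j : ℕ} {g h : MvPolynomial (CoordVar k l) k}
    (hg : g.IsWeightedHomogeneous CoordVar.weight (i + j))
    (hh : h.IsWeightedHomogeneous CoordVar.weight i) (h0 : MvPolynomial.aeval CoordVar.val h ≠ 0) :
    MvPolynomial.aeval CoordVar.val g / MvPolynomial.aeval CoordVar.val h ∈
      isobaricQuotients k l j := ⟨i, g, h, hg, hh, h0, rfl⟩

/-- Only the slopes are not already polynomials in the coordinates: they are `(3x^2 + a)/(2y)`, with
weights 4 and 3, or a difference quotient of `y` by `x`, with weights 3 and 2. -/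
theorem weightPart_le_isobaricQuotients (j : ℕ) : weightPart k l j ≤ isobaricQuotients k l j := by
  have hX := fun v : CoordVar k l => MvPolynomial.isWeightedHomogeneous_X k CoordVar.weight v
  have hXx : ∀ P : Torsion k l, (MvPolynomial.X (CoordVar.x P) :
      MvPolynomial (CoordVar k l) k).IsWeightedHomogeneous CoordVar.weight 2 := fun P => hX _
  have hXy : ∀ P : Torsion k l, (MvPolynomial.X (CoordVar.y P) :
      MvPolynomial (CoordVar k l) k).IsWeightedHomogeneous CoordVar.weight 3 := fun P => hX _
  have hXa : (MvPolynomial.X CoordVar.a :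
      MvPolynomial (CoordVar k l) k).IsWeightedHomogeneous CoordVar.weight 4 := hX _
  refine weightPart_le _ ?_ ?_ ?_ j
  · exact ⟨0, 1, 1, MvPolynomial.isWeightedHomogeneous_one _ _,
      MvPolynomial.isWeightedHomogeneous_one _ _, by simp, by simp⟩
  · rintro i j _ _ ⟨d, g, h, hg, hh, h0, rfl⟩ ⟨d', g', h', hg', hh', h0', rfl⟩
    refine ⟨d + d', g * g', h * h', ?_, hh.mul hh', ?_, ?_⟩
    · convert hg.mul hg' using 1; ring
    · rw [map_mul]; exact mul_ne_zero h0 h0'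
    · rw [map_mul, map_mul, div_mul_div_comm]
  · rintro (v | ⟨P, Q, R, h⟩)
    · refine ⟨0, MvPolynomial.X v, 1, ?_, MvPolynomial.isWeightedHomogeneous_one _ _, by simp,
        by simp [GenVar.val]⟩
      convert hX v using 1
      exact zero_add _
    · obtain ⟨h1, h2⟩ := slope_formula P.2.2 Q.2.2 R.2.2 h
      rw [GenVar.val, show (GenVar.slope P Q R h).weight = 1 from rfl]
      by_cases hx : xCoord P.1 = xCoord Q.1
      · obtain ⟨hy, h1⟩ := h1 hx
        rw [h1]
        have hg : MvPolynomial.IsWeightedHomogeneous CoordVar.weight (MvPolynomial.C (3 : k) *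
            MvPolynomial.X (CoordVar.x P) ^ 2 + MvPolynomial.X CoordVar.a) 4 := by
          refine MvPolynomial.IsWeightedHomogeneous.add ?_ hXa
          have := (MvPolynomial.isWeightedHomogeneous_C CoordVar.weight (3 : k)).mul ((hXx P).pow 2)
          rwa [zero_add] at this
        have hh : MvPolynomial.IsWeightedHomogeneous CoordVar.weight (MvPolynomial.C (2 : k) *
            MvPolynomial.X (CoordVar.y P)) 3 := by
          have := (MvPolynomial.isWeightedHomogeneous_C CoordVar.weight (2 : k)).mul (hXy P)
          rwa [zero_add] at this
        have hg' : MvPolynomial.aeval CoordVar.val (MvPolynomial.C (3 : k) *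
            MvPolynomial.X (CoordVar.x P) ^ 2 + MvPolynomial.X CoordVar.a) =
            3 * xCoord P.1 ^ 2 + genA k := by
          rw [map_add, map_mul, map_pow, MvPolynomial.aeval_X, MvPolynomial.aeval_X,
            MvPolynomial.aeval_C, map_ofNat]
          rfl
        have hh' : MvPolynomial.aeval CoordVar.val (MvPolynomial.C (2 : k) *
            MvPolynomial.X (CoordVar.y P)) = 2 * yCoord P.1 := by
          rw [map_mul, MvPolynomial.aeval_X, MvPolynomial.aeval_C, map_ofNat]
          rfl
        rw [← hg', ← hh']
        exact isobaricQuotients_div (i := 3) hg hh (by rwa [hh'])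
      · rw [h2 hx]
        have hsub : ∀ {n : ℕ} {p q : MvPolynomial (CoordVar k l) k},
            p.IsWeightedHomogeneous CoordVar.weight n → q.IsWeightedHomogeneous CoordVar.weight n →
            (p - q).IsWeightedHomogeneous CoordVar.weight n := fun hp hq =>
          (MvPolynomial.weightedHomogeneousSubmodule k CoordVar.weight _).sub_mem hp hq
        have hg' : MvPolynomial.aeval CoordVar.val (MvPolynomial.X (CoordVar.y P) -
            MvPolynomial.X (CoordVar.y Q) : MvPolynomial (CoordVar k l) k) =
            yCoord P.1 - yCoord Q.1 := by
          rw [map_sub, MvPolynomial.aeval_X, MvPolynomial.aeval_X]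
          rfl
        have hh' : MvPolynomial.aeval CoordVar.val (MvPolynomial.X (CoordVar.x P) -
            MvPolynomial.X (CoordVar.x Q) : MvPolynomial (CoordVar k l) k) =
            xCoord P.1 - xCoord Q.1 := by
          rw [map_sub, MvPolynomial.aeval_X, MvPolynomial.aeval_X]
          rfl
        rw [← hg', ← hh']
        exact isobaricQuotients_div (i := 2) (hsub (hXy P) (hXy Q))
          (hsub (hXx P) (hXx Q)) (by rw [hh']; exact sub_ne_zero.mpr hx)

/-- The function field of the Rees parameter. -/
abbrev ReesField (k : Type*) [Field k] := FractionRing (GenField k)[X]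

/-- The constants of `ReesField`. -/
def reesC (k : Type*) [Field k] : GenField k →+* ReesField k :=
  (algebraMap (GenField k)[X] (ReesField k)).comp C

/-- The variable of `ReesField`. -/
def reesT (k : Type*) [Field k] : ReesField k := algebraMap (GenField k)[X] (ReesField k) X

theorem reesC_mul_pow (f : GenField k) (j : ℕ) : reesC k f * reesT k ^ j =
    algebraMap (GenField k)[X] (ReesField k) (C f * X ^ j) := by
  rw [map_mul, map_pow]; rfl

theorem reesT_ne_zero : reesT k ≠ 0 := by
  rw [reesT, Ne, map_eq_zero_iff _ (IsFractionRing.injective _ _)]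
  exact X_ne_zero

/-- The Rees ring `k[a T ^ 4, b T ^ 6]` of the graded ring `k[a, b]`. -/
def reesRing (k : Type*) [Field k] : Subring (ReesField k) :=
  Subring.closure (Set.range (fun c : k => reesC k (algebraMap k (GenField k) c)) ∪
    {reesC k (genA k) * reesT k ^ 4, reesC k (genB k) * reesT k ^ 6})

/-- The exponent of `T` records the weight. This is what turns ordinary integrality over the Rees
ring into an equation with homogeneous coefficients over `k[a,b]`. -/
theorem mem_reesRing {z : ReesField k} (hz : z ∈ reesRing k) :
    ∃ q : (GenField k)[X], z = algebraMap _ _ q ∧ ∀ n, q.coeff n ∈ levelOne k n := by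
  have hmon : ∀ (f : GenField k) (j : ℕ), f ∈ levelOne k j →
      ∀ n, (C f * X ^ j).coeff n ∈ levelOne k n := by
    intro f j hf n
    rw [coeff_C_mul_X_pow]
    split_ifs with h
    · rwa [h]
    · exact zero_mem _
  induction hz using Subring.closure_induction with
  | mem z hz =>
    rcases hz with ⟨c, rfl⟩ | rfl | rfl
    · refine ⟨C (algebraMap k (GenField k) c) * X ^ 0, by simp [reesC], hmon _ _ (levelOne_algebraMap c)⟩
    · exact ⟨_, reesC_mul_pow _ _, hmon _ _ genA_mem_levelOne⟩
    · exact ⟨_, reesC_mul_pow _ _, hmon _ _ genB_mem_levelOne⟩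
  | zero => exact ⟨0, by simp, fun n => by simp⟩
  | one =>
    refine ⟨C 1 * X ^ 0, by simp, hmon _ _ ?_⟩
    simpa using levelOne_algebraMap (1 : k)
  | add x y _ _ hx hy =>
    obtain ⟨p, rfl, hp⟩ := hx
    obtain ⟨q, rfl, hq⟩ := hy
    exact ⟨p + q, (map_add _ _ _).symm, fun n => by rw [coeff_add]; exact add_mem (hp n) (hq n)⟩
  | neg x _ hx =>
    obtain ⟨p, rfl, hp⟩ := hx
    exact ⟨-p, (map_neg _ _).symm, fun n => by rw [coeff_neg]; exact neg_mem (hp n)⟩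
  | mul x y _ _ hx hy =>
    obtain ⟨p, rfl, hp⟩ := hx
    obtain ⟨q, rfl, hq⟩ := hy
    refine ⟨p * q, (map_mul _ _ _).symm, fun n => ?_⟩
    rw [coeff_mul]
    refine Submodule.sum_mem _ fun x hx => ?_
    rw [← Finset.HasAntidiagonal.mem_antidiagonal.mp hx]
    exact levelOne_mul (hp _) (hq _)

/-- In a monic equation of degree `n` for `f T^j`, the coefficient of `T^(nj)` is an equation for
`f` of the required graded form. -/
theorem exists_graded_equation {f : GenField k} {j : ℕ}
    (hf : IsIntegral (reesRing k) (reesC k f * reesT k ^ j)) :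
    ∃ (n : ℕ) (c : ℕ → GenField k), 1 ≤ n ∧ (∀ i, c i ∈ levelOne k (i * j)) ∧
      f ^ n + ∑ i ∈ Finset.Icc 1 n, c i * f ^ (n - i) = 0 := by
  obtain ⟨p, hp, hpf⟩ := hf
  -- A monic polynomial of degree 0 is 1 and has no root.
  have hn : 1 ≤ p.natDegree := by
    by_contra h
    have h0 := Polynomial.eq_C_of_natDegree_eq_zero (show p.natDegree = 0 by omega)
    have h1 : p = 1 := by
      rw [h0]
      have := hp.leadingCoeff
      rw [Polynomial.leadingCoeff, show p.natDegree = 0 by omega] at this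
      rw [this, C_1]
    rw [h1] at hpf
    simp at hpf
  choose q hq1 hq2 using fun i => mem_reesRing (p.coeff i).2
  set n := p.natDegree with hnd
  have key : ∑ i ∈ Finset.range (n + 1), q i * (C f * X ^ j) ^ i = 0 := by
    apply IsFractionRing.injective (GenField k)[X] (ReesField k)
    rw [map_zero, map_sum, ← hpf, eval₂_eq_sum_range]
    refine Finset.sum_congr rfl fun i _ => ?_
    rw [map_mul, ← hq1, map_pow, ← reesC_mul_pow]
    rfl
  have hqn : q n = 1 := by
    apply IsFractionRing.injective (GenField k)[X] (ReesField k)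
    rw [← hq1, hnd, Polynomial.coeff_natDegree, hp.leadingCoeff, map_one]
    rfl
  -- The power `(f T^j)^(n-i)` already uses up `(n-i)j` of the exponent `nj`, so its coefficient
  -- contributes through its part of weight `ij`.
  refine ⟨n, fun i => (q (n - i)).coeff (i * j), hn, fun i => hq2 _ _, ?_⟩
  have hc := congrArg (fun r => Polynomial.coeff r (n * j)) key
  simp only [finsetSum_coeff, coeff_zero] at hc
  have hterm : ∀ i ∈ Finset.range (n + 1), (q i * (C f * X ^ j) ^ i).coeff (n * j) =
      (q i).coeff ((n - i) * j) * f ^ i := by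
    intro i hi
    have hi' : i ≤ n := by simpa [Nat.lt_succ_iff] using hi
    rw [mul_pow, ← C_pow, ← pow_mul, ← mul_assoc, mul_right_comm, coeff_mul_C]
    congr 1
    have : n * j = (n - i) * j + j * i := by
      rw [mul_comm j i, ← add_mul, Nat.sub_add_cancel hi']
    rw [this, coeff_mul_X_pow]
  rw [Finset.sum_congr rfl hterm, Finset.sum_range_succ, hqn, ← Finset.sum_range_reflect] at hc
  simp only [Nat.sub_self, zero_mul, coeff_one_zero, one_mul] at hc
  rw [add_comm, ← hc]
  congr 1
  rw [Finset.range_eq_Ico, Finset.sum_Ico_eq_sum_range, ← Finset.Ico_add_one_right_eq_Icc,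
    Finset.sum_Ico_eq_sum_range]
  refine Finset.sum_congr (by simp) fun i hi => ?_
  have hi' : i < n := by simpa using hi
  rw [show n - 1 - (0 + i) = n - (1 + i) by omega, show n - (n - (1 + i)) = 1 + i by omega]

/-- Elements integral over `k[a, b]` in the graded sense, in weight `j`. -/
def gradedIntegral (k : Type*) [Field k] (j : ℕ) : Submodule k (GenField k) where
  carrier := {f | IsIntegral (reesRing k) (reesC k f * reesT k ^ j)}
  zero_mem' := by
    change IsIntegral _ _
    rw [map_zero, zero_mul]; exact isIntegral_zero
  add_mem' := by
    intro x y hx hy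
    change IsIntegral _ _
    rw [map_add, add_mul]; exact hx.add hy
  smul_mem' := by
    intro c x hx
    change IsIntegral _ _
    rw [Algebra.smul_def, map_mul, mul_assoc]
    exact (isIntegral_algebraMap (x := (⟨_, Subring.subset_closure (Or.inl ⟨c, rfl⟩)⟩ :
      reesRing k))).mul hx

/-- The map `(x, y) ↦ (x T^2, y T^3)` carries the torsion to that of the curve with coefficients `a
T^4`, `b T^6` in the Rees ring, where the ungraded integrality applies. -/
theorem torsion_mem_gradedIntegral (hl : (l : k) ≠ 0) {P : GenPoint k} (hP : l • P = 0)
    (hP0 : P ≠ 0) : xCoord P ∈ gradedIntegral k 2 ∧ yCoord P ∈ gradedIntegral k 3 := by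
  have hl1 : (l : ReesField k) = reesC k (algebraMap k (GenField k) l) := by simp
  have hl0 : (l : ReesField k) ≠ 0 := by
    rw [hl1, Ne, map_eq_zero, map_eq_zero]; exact hl
  have hl2 : (l : ReesField k)⁻¹ ∈ reesRing k := by
    rw [hl1, ← map_inv₀, ← map_inv₀]
    exact Subring.subset_closure (Or.inl ⟨_, rfl⟩)
  have ha : reesC k (genA k) * reesT k ^ 4 ∈ reesRing k :=
    Subring.subset_closure (Or.inr (Or.inl rfl))
  have hb : reesC k (genB k) * reesT k ^ 6 ∈ reesRing k :=
    Subring.subset_closure (Or.inr (Or.inr rfl))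
  exact scaled_torsion_integral (reesC k) reesT_ne_zero _ ha hb hl2 hl0 hP hP0

theorem weightPart_le_gradedIntegral (hl : (l : k) ≠ 0) (j : ℕ) :
    weightPart k l j ≤ gradedIntegral k j := by
  refine weightPart_le _ ?_ ?_ ?_ j
  · change IsIntegral _ _
    rw [map_one, one_mul, pow_zero]; exact isIntegral_one
  · intro i j x y hx hy
    change IsIntegral _ _
    rw [map_mul, pow_add, mul_mul_mul_comm]
    exact IsIntegral.mul hx hy
  · rintro ((_ | _ | P | P) | ⟨P, Q, R, h⟩)
    · exact isIntegral_algebraMap (x := (⟨_, Subring.subset_closure (Or.inr (Or.inl rfl))⟩ : reesRing k))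
    · exact isIntegral_algebraMap (x := (⟨_, Subring.subset_closure (Or.inr (Or.inr rfl))⟩ : reesRing k))
    · exact (torsion_mem_gradedIntegral hl P.2.1 P.2.2).1
    · exact (torsion_mem_gradedIntegral hl P.2.1 P.2.2).2
    · have hs := ((isLineSection_of_points P.2.2 Q.2.2 R.2.2 h).map (reesC k)).scale (reesT k)
      have hl' : ∀ S : Torsion k l, IsIntegral (reesRing k) (reesC k (xCoord S.1) * reesT k ^ 2) :=
        fun S => (torsion_mem_gradedIntegral hl S.2.1 S.2.2).1
      have := hs.slope_integral (reesRing k) (hl' P) (hl' Q) (hl' R)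
      change IsIntegral _ _
      rw [show (GenVar.slope P Q R h).weight = 1 from rfl, pow_one]
      exact this

/-- Every weight `j` element of `R_l` is a modular form of weight `j`. -/
theorem isModularForm_of_mem_weightPart (hl : (l : k) ≠ 0) {j : ℕ} {c : GenField k}
    (hc : c ∈ weightPart k l j) : IsModularForm k l j c :=
  ⟨weightPart_le_torsionField hc, weightPart_le_isobaricQuotients j hc,
    exists_graded_equation (weightPart_le_gradedIntegral hl j hc)⟩

end Modular

/-! ### Orders of ideals at an invertible ideal -/

section IdealOrder

variable {R : Type*} [CommRing R]

/-- `M ^ n` is the exact power of `M` that contains `I`. -/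
def IdealOrder (M I : Ideal R) (n : ℕ) : Prop := I ≤ M ^ n ∧ ¬ I ≤ M ^ (n + 1)

theorem idealOrder_zero {M I : Ideal R} (h : ¬ I ≤ M) : IdealOrder M I 0 :=
  ⟨by simp, by simpa using h⟩

theorem idealOrder_span {M : Ideal R} {g : R} {n : ℕ} :
    IdealOrder M (Ideal.span {g}) n ↔ g ∈ M ^ n ∧ g ∉ M ^ (n + 1) := by
  simp [IdealOrder]

variable [IsDomain R] {M M' : Ideal R} {x : R} (hx : x ≠ 0) (hM : M * M' = Ideal.span {x})

include hx hM in
-- The relation `M M' = (x)` makes `M` invertible without any assumption that the ring is Dedekind: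
-- if `I ≤ M^n`, then `I M'^n` lies in `(x^n)`, and division by `x^n` gives the cofactor `J`.
theorem idealOrder_iff {I : Ideal R} {n : ℕ} :
    IdealOrder M I n ↔ ∃ J, I = M ^ n * J ∧ ¬ J ≤ M := by
  have hn : M ^ n * M' ^ n = Ideal.span {x ^ n} := by
    rw [← mul_pow, hM, Ideal.span_singleton_pow]
  have hx' := pow_ne_zero n hx
  constructor
  · rintro ⟨h1, h2⟩
    have h3 : I * M' ^ n ≤ Ideal.span {x ^ n} := hn ▸ Ideal.mul_mono_left h1
    obtain ⟨J, hJ⟩ : ∃ J : Ideal R, I * M' ^ n = Ideal.span {x ^ n} * J := by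
      refine ⟨Submodule.comap (LinearMap.mulLeft R (x ^ n)) (I * M' ^ n), ?_⟩
      ext z
      rw [Ideal.mem_span_singleton_mul]
      constructor
      · intro hz
        obtain ⟨w, hw⟩ := Ideal.mem_span_singleton'.mp (h3 hz)
        exact ⟨w, by simpa [mul_comm, hw] using hz, by rw [mul_comm, hw]⟩
      · rintro ⟨w, hw, rfl⟩
        exact hw
    have hI : I = M ^ n * J := by
      apply (Ideal.span_singleton_mul_right_inj hx').mp
      rw [mul_left_comm, ← hJ, ← hn]
      ring
    refine ⟨J, hI, fun hJM => h2 ?_⟩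
    rw [hI, pow_succ]
    exact Ideal.mul_mono_right hJM
  · rintro ⟨J, rfl, hJ⟩
    refine ⟨Ideal.mul_le_left, fun h => hJ ?_⟩
    apply (Ideal.span_singleton_mul_right_mono hx').mp
    rw [← hn, mul_right_comm, mul_right_comm _ _ M, ← pow_succ]
    exact Ideal.mul_mono_left h

include hx hM in
-- Both ideals are powers of `M` times cofactors not contained in `M`; as `M` is prime, neither is
-- the product of the cofactors.
theorem IdealOrder.mul [M.IsPrime] {I J : Ideal R} {m n : ℕ} (hI : IdealOrder M I m)
    (hJ : IdealOrder M J n) : IdealOrder M (I * J) (m + n) := by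
  obtain ⟨I', rfl, hI'⟩ := (idealOrder_iff hx hM).mp hI
  obtain ⟨J', rfl, hJ'⟩ := (idealOrder_iff hx hM).mp hJ
  refine (idealOrder_iff hx hM).mpr ⟨I' * J', by ring, fun h => ?_⟩
  rcases (Ideal.IsPrime.mul_le ‹_›).mp h with h | h
  · exact hI' h
  · exact hJ' h

include hx hM in
theorem idealOrder_self (hM1 : M ≠ ⊤) : IdealOrder M M 1 :=
  (idealOrder_iff hx hM).mpr ⟨⊤, by simp [Ideal.mul_top], fun h => hM1 (top_le_iff.mp h)⟩

include hx hM in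
/-- An element of the fraction field of order zero at `M` has a denominator outside `M`. -/
theorem exists_denominator {K : Type*} [Field K] [Algebra R K] [IsFractionRing R K] {f : K}
    {g h : R} {n : ℕ} (hf : f * algebraMap R K h = algebraMap R K g)
    (hg : IdealOrder M (Ideal.span {g}) n) (hh : IdealOrder M (Ideal.span {h}) n) :
    ∃ c, c ∉ M ∧ ∃ r, f * algebraMap R K c = algebraMap R K r := by
  obtain ⟨J, hJ, hJM⟩ := (idealOrder_iff hx hM).mp hh
  obtain ⟨c, hc, hcM⟩ := Set.not_subset.mp hJM
  refine ⟨c, hcM, ?_⟩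
  have hn : M ^ n * M' ^ n = Ideal.span {x ^ n} := by
    rw [← mul_pow, hM, Ideal.span_singleton_pow]
  -- As `c` lies in the cofactor of `(h)`, each `m c` is a multiple of `h`; hence multiplication by
  -- `f c` maps `M^n` into itself.
  have h1 : ∀ m ∈ M ^ n, ∃ s ∈ M ^ n, f * algebraMap R K c * algebraMap R K m = algebraMap R K s := by
    intro m hm
    have : m * c ∈ Ideal.span {h} := hJ ▸ Ideal.mul_mem_mul hm hc
    obtain ⟨r, hr⟩ := Ideal.mem_span_singleton'.mp this
    refine ⟨r * g, Ideal.mul_mem_left _ _ (hg.1 (Ideal.mem_span_singleton_self g)), ?_⟩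
    rw [mul_assoc, ← map_mul, mul_comm c, ← hr, map_mul, map_mul, ← hf]
    ring
  -- Multiplying by `M'^n` makes the stable ideal the principal ideal `(x^n)`, and stability of a
  -- principal ideal means that `f c` lies in the ring.
  have h2 : ∀ z ∈ M ^ n * M' ^ n, ∃ s ∈ M ^ n * M' ^ n,
      f * algebraMap R K c * algebraMap R K z = algebraMap R K s := by
    intro z hz
    induction hz using Submodule.mul_induction_on' with
    | mem_mul_mem m hm m' hm' =>
      obtain ⟨s, hs, hs'⟩ := h1 m hm
      exact ⟨s * m', Ideal.mul_mem_mul hs hm', by rw [map_mul, map_mul, ← hs']; ring⟩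
    | add z hz w hw ihz ihw =>
      obtain ⟨s, hs, hs'⟩ := ihz
      obtain ⟨t, ht, ht'⟩ := ihw
      exact ⟨s + t, add_mem hs ht, by rw [map_add, map_add, ← hs', ← ht']; ring⟩
  rw [hn] at h2
  obtain ⟨s, hs, hs'⟩ := h2 _ (Ideal.mem_span_singleton_self _)
  obtain ⟨r, rfl⟩ := Ideal.mem_span_singleton'.mp hs
  refine ⟨r, ?_⟩
  have hx' : algebraMap R K (x ^ n) ≠ 0 := by
    rw [Ne, map_eq_zero_iff _ (IsFractionRing.injective R K)]
    exact pow_ne_zero n hx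
  apply mul_right_cancel₀ hx'
  rw [hs', map_mul]

end IdealOrder

/-! ### Divisors of functions; functions without affine zeros or poles -/

section Divisors

open WeierstrassCurve.Affine WeierstrassCurve.Affine.CoordinateRing

variable {F : Type*} [Field F] {a b : F}

/-- The maximal ideal of an affine point. -/
abbrev pointIdeal (a b x y : F) : Ideal (curve a b).CoordinateRing := XYIdeal (curve a b) x (C y)

theorem pointIdeal_mul {x y : F} (h : (curve a b).Nonsingular x y) :
    pointIdeal a b x y * pointIdeal a b x (-y) = Ideal.span {XClass (curve a b) x} := by
  have := XYIdeal_neg_mul h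
  rw [curve_negY] at this
  rw [mul_comm]
  exact this

theorem pointIdeal_isMaximal {x y : F} (h : (curve a b).Equation x y) :
    (pointIdeal a b x y).IsMaximal := by
  have e := quotientXYIdealEquiv (W' := curve a b) (x := x) (y := C y) (by
    rw [WeierstrassCurve.Affine.Equation, evalEval] at h; exact h)
  exact Ideal.Quotient.maximal_of_isField _ (e.toMulEquiv.isField (Field.toIsField F))

theorem pointIdeal_ne_top {x y : F} (h : (curve a b).Equation x y) : pointIdeal a b x y ≠ ⊤ :=
  (pointIdeal_isMaximal h).ne_top

theorem mk_C_C (c : F) : CoordinateRing.mk (curve a b) (C (C c)) =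
    algebraMap F (curve a b).CoordinateRing c := rfl

theorem sub_mem_pointIdeal {M : Ideal (curve a b).CoordinateRing} {u v : F} {p : F[X][X]}
    (h1 : CoordinateRing.mk (curve a b) (p - C (C u)) ∈ M)
    (h2 : CoordinateRing.mk (curve a b) (p - C (C v)) ∈ M) (hM : M ≠ ⊤) : u = v := by
  by_contra h
  have h3 := M.sub_mem h2 h1
  rw [← map_sub, sub_sub_sub_cancel_left, ← C_sub, ← C_sub, mk_C_C] at h3
  apply hM
  refine Ideal.eq_top_of_isUnit_mem _ h3 ?_
  exact (IsUnit.mk0 _ (sub_ne_zero.mpr h)).map _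

theorem XClass_mem_pointIdeal (x y : F) :
    CoordinateRing.mk (curve a b) (C X - C (C x)) ∈ pointIdeal a b x y := by
  rw [← C_sub]
  exact Ideal.subset_span (Or.inl rfl)

theorem YClass_mem_pointIdeal (x y : F) :
    CoordinateRing.mk (curve a b) (X - C (C y)) ∈ pointIdeal a b x y :=
  Ideal.subset_span (Or.inr rfl)

theorem eq_of_pointIdeal_le {x y x' y' : F} (h : (curve a b).Equation x y)
    (hle : pointIdeal a b x' y' ≤ pointIdeal a b x y) : x' = x ∧ y' = y :=
  ⟨sub_mem_pointIdeal (hle (XClass_mem_pointIdeal x' y')) (XClass_mem_pointIdeal x y)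
    (pointIdeal_ne_top h),
  sub_mem_pointIdeal (hle (YClass_mem_pointIdeal x' y')) (YClass_mem_pointIdeal x y)
    (pointIdeal_ne_top h)⟩

theorem pointIdeal_order {x y x' y' : F} (h : (curve a b).Nonsingular x y) :
    IdealOrder (pointIdeal a b x y) (pointIdeal a b x' y') (if x' = x ∧ y' = y then 1 else 0) := by
  split_ifs with hc
  · obtain ⟨rfl, rfl⟩ := hc
    exact idealOrder_self (XClass_ne_zero _) (pointIdeal_mul h) (pointIdeal_ne_top h.1)
  · exact idealOrder_zero fun hle => hc (eq_of_pointIdeal_le h.1 hle)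

theorem hasOrderAt_some_iff {f : (curve a b).FunctionField} {x y : F}
    (hn : (curve a b).Nonsingular x y) {n : ℤ} :
    HasOrderAt f (Point.some x y hn : (curve a b).Point) n ↔
      ∃ (g h : (curve a b).CoordinateRing) (i j : ℕ), f * algebraMap _ _ h = algebraMap _ _ g ∧
        IdealOrder (pointIdeal a b x y) (Ideal.span {g}) i ∧
        IdealOrder (pointIdeal a b x y) (Ideal.span {h}) j ∧ n = i - j := by
  simp only [idealOrder_span, HasOrderAt, and_assoc]

theorem idealOrder_ne_zero {R : Type*} [CommRing R] {M : Ideal R} {g : R} {n : ℕ}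
    (h : IdealOrder M (Ideal.span {g}) n) : g ≠ 0 := by
  rintro rfl
  exact h.2 (by simp)

theorem HasOrderAt.mul {f f' : (curve a b).FunctionField} {P : (curve a b).Point} {m n : ℤ}
    (h : HasOrderAt f P m) (h' : HasOrderAt f' P n) : HasOrderAt (f * f') P (m + n) := by
  rcases P with _ | ⟨x, y, hn⟩
  · obtain ⟨h0, h⟩ := h
    obtain ⟨h0', h'⟩ := h'
    refine ⟨mul_ne_zero h0 h0', ?_⟩
    rw [map_mul, HahnSeries.order_mul ((_root_.map_ne_zero _).mpr h0) ((_root_.map_ne_zero _).mpr h0'), h, h']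
  · rw [hasOrderAt_some_iff] at *
    obtain ⟨g, d, i, j, e, hg, hd, rfl⟩ := h
    obtain ⟨g', d', i', j', e', hg', hd', rfl⟩ := h'
    have := (pointIdeal_isMaximal hn.1).isPrime
    have hx := XClass_ne_zero (W' := curve a b) x
    refine ⟨g * g', d * d', i + i', j + j', ?_, ?_, ?_, by push_cast; ring⟩
    · rw [map_mul, map_mul, ← e, ← e']; ring
    · rw [← Ideal.span_singleton_mul_span_singleton]
      exact hg.mul hx (pointIdeal_mul hn) hg'
    · rw [← Ideal.span_singleton_mul_span_singleton]
      exact hd.mul hx (pointIdeal_mul hn) hd'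

theorem HasOrderAt.ne_zero {f : (curve a b).FunctionField} {P : (curve a b).Point} {n : ℤ}
    (h : HasOrderAt f P n) : f ≠ 0 := by
  rcases P with _ | ⟨x, y, hn⟩
  · exact h.1
  · rw [hasOrderAt_some_iff] at h
    obtain ⟨g, d, i, j, e, hg, hd, rfl⟩ := h
    rintro rfl
    rw [zero_mul, eq_comm, map_eq_zero_iff _ (IsFractionRing.injective _ _)] at e
    exact idealOrder_ne_zero hg e

theorem hasOrderAt_one (P : (curve a b).Point) : HasOrderAt 1 P 0 := by
  rcases P with _ | ⟨x, y, hn⟩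
  · exact ⟨one_ne_zero, by rw [map_one, HahnSeries.order_one]⟩
  · rw [hasOrderAt_some_iff]
    have h0 : IdealOrder (pointIdeal a b x y) (Ideal.span {1}) 0 := by
      apply idealOrder_zero
      rw [Ideal.span_singleton_one, top_le_iff]
      exact pointIdeal_ne_top hn.1
    exact ⟨1, 1, 0, 0, by simp, h0, h0, by simp⟩

theorem HasOrderAt.inv {f : (curve a b).FunctionField} {P : (curve a b).Point} {n : ℤ}
    (h : HasOrderAt f P n) : HasOrderAt f⁻¹ P (-n) := by
  have h0 := h.ne_zero
  rcases P with _ | ⟨x, y, hn⟩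
  · refine ⟨inv_ne_zero h0, ?_⟩
    have h1 := HahnSeries.order_mul ((_root_.map_ne_zero (expandAtInfty a b)).mpr h0)
      ((_root_.map_ne_zero (expandAtInfty a b)).mpr (inv_ne_zero h0))
    rw [← map_mul, mul_inv_cancel₀ h0, map_one, HahnSeries.order_one, h.2] at h1
    linarith
  · rw [hasOrderAt_some_iff] at *
    obtain ⟨g, d, i, j, e, hg, hd, rfl⟩ := h
    refine ⟨d, g, j, i, ?_, hd, hg, by ring⟩
    rw [← e, inv_mul_cancel_left₀ h0]

theorem HasDivisor.mul {f f' : (curve a b).FunctionField} {D D' : (curve a b).Point →₀ ℤ}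
    (h : HasDivisor f D) (h' : HasDivisor f' D') : HasDivisor (f * f') (D + D') :=
  fun P => (h P).mul (h' P)

theorem HasDivisor.inv {f : (curve a b).FunctionField} {D : (curve a b).Point →₀ ℤ}
    (h : HasDivisor f D) : HasDivisor f⁻¹ (-D) := fun P => (h P).inv

theorem hasDivisor_one : HasDivisor (1 : (curve a b).FunctionField) 0 := fun P => hasOrderAt_one P

theorem HasDivisor.pow {f : (curve a b).FunctionField} {D : (curve a b).Point →₀ ℤ}
    (h : HasDivisor f D) (n : ℕ) : HasDivisor (f ^ n) (n • D) := by
  induction n with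
  | zero => rw [pow_zero, zero_smul]; exact hasDivisor_one
  | succ n ih => rw [pow_succ, succ_nsmul]; exact ih.mul h

theorem HasDivisor.zpow {f : (curve a b).FunctionField} {D : (curve a b).Point →₀ ℤ}
    (h : HasDivisor f D) (n : ℤ) : HasDivisor (f ^ n) (n • D) := by
  rcases n with n | n
  · simpa using h.pow n
  · rw [zpow_negSucc, negSucc_zsmul]; exact (h.pow (n + 1)).inv

theorem mk_Y_sq : CoordinateRing.mk (curve a b) X ^ 2 = CoordinateRing.mk (curve a b) (C X) ^ 3
    + algebraMap F _ a * CoordinateRing.mk (curve a b) (C X) + algebraMap F _ b := by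
  have h : CoordinateRing.mk (curve a b) (X ^ 2 + C (C 0 * X + C 0) * X -
    C (X ^ 3 + C 0 * X ^ 2 + C a * X + C b)) = 0 := AdjoinRoot.mk_self
  simp only [C_0, C_add, C_mul, C_pow] at h
  simp only [map_add, map_sub, map_mul, map_pow, zero_mul, add_zero, mk_C_C] at h
  linear_combination h

/-- Nullstellensatz: the residue field at a maximal ideal is finite over the algebraically closed
field `F`, hence equal to it, and the images of `x` and `y` are the coordinates of a point. -/
theorem exists_le_pointIdeal [IsAlgClosed F] {I : Ideal (curve a b).CoordinateRing} (hI : I ≠ ⊤) :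
    ∃ x y, (curve a b).Equation x y ∧ I ≤ pointIdeal a b x y := by
  obtain ⟨m, hm, hIm⟩ := Ideal.exists_le_maximal I hI
  let _ : Field ((curve a b).CoordinateRing ⧸ m) := Ideal.Quotient.field m
  have hft : Algebra.FiniteType F (curve a b).CoordinateRing := by
    have h1 : Algebra.FiniteType F F[X][X] :=
      Algebra.FiniteType.trans (S := F[X]) inferInstance inferInstance
    exact Algebra.FiniteType.of_surjective (AdjoinRoot.mkₐ (curve a b).polynomial |>.restrictScalars F)
      AdjoinRoot.mk_surjective
  have hft' : Algebra.FiniteType F ((curve a b).CoordinateRing ⧸ m) :=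
    Algebra.FiniteType.of_surjective (Ideal.Quotient.mkₐ F m) (Ideal.Quotient.mkₐ_surjective F m)
  have hfin := finite_of_finite_type_of_isJacobsonRing F ((curve a b).CoordinateRing ⧸ m)
  have hbij := IsAlgClosed.algebraMap_bijective_of_isIntegral
    (k := F) (K := (curve a b).CoordinateRing ⧸ m)
  have hmk : ∀ c : F, Ideal.Quotient.mk m (algebraMap F _ c) =
    algebraMap F ((curve a b).CoordinateRing ⧸ m) c := fun c => rfl
  obtain ⟨x, hx⟩ := hbij.2 (Ideal.Quotient.mk m (CoordinateRing.mk (curve a b) (C X)))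
  obtain ⟨y, hy⟩ := hbij.2 (Ideal.Quotient.mk m (CoordinateRing.mk (curve a b) X))
  have he : (curve a b).Equation x y := by
    rw [curve_equation_iff]
    apply hbij.1
    have := congrArg (Ideal.Quotient.mk m) (mk_Y_sq (a := a) (b := b))
    simp only [map_add, map_mul, map_pow, hmk, ← hx, ← hy] at this
    simpa only [map_add, map_mul, map_pow] using this
  refine ⟨x, y, he, ?_⟩
  have hle : pointIdeal a b x y ≤ m := by
    rw [pointIdeal, XYIdeal, Ideal.span_le]
    rintro _ (rfl | rfl)
    · change XClass (curve a b) x ∈ m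
      rw [XClass, C_sub, map_sub, mk_C_C, ← Ideal.Quotient.eq_zero_iff_mem, map_sub, hmk, hx, sub_self]
    · change YClass (curve a b) (C y) ∈ m
      rw [YClass, map_sub, mk_C_C, ← Ideal.Quotient.eq_zero_iff_mem, map_sub, hmk, hy, sub_self]
  rw [(pointIdeal_isMaximal he).eq_of_le hm.ne_top hle]
  exact hIm

/-- The curve has no singular affine points. -/
def IsSmooth (a b : F) : Prop := ∀ x y, (curve a b).Equation x y → (curve a b).Nonsingular x y

/-- The denominators of `f` form an ideal. Order zero at an affine point yields a denominator
outside the maximal ideal of that point, so no maximal ideal contains all of them. -/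
theorem exists_coordinateRing [IsAlgClosed F] (hs : IsSmooth a b) {f : (curve a b).FunctionField}
    (hf : ∀ P : (curve a b).Point, P ≠ 0 → HasOrderAt f P 0) :
    ∃ r : (curve a b).CoordinateRing, f = algebraMap _ _ r := by
  let I : Ideal (curve a b).CoordinateRing :=
    { carrier := {c | ∃ r : (curve a b).CoordinateRing, f * algebraMap _ _ c = algebraMap _ (curve a b).FunctionField r}
      zero_mem' := ⟨0, by simp⟩
      add_mem' := by
        rintro c d ⟨r, hr⟩ ⟨s, hs⟩
        exact ⟨r + s, by rw [map_add, map_add, mul_add, hr, hs]⟩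
      smul_mem' := by
        rintro c d ⟨r, hr⟩
        exact ⟨c * r, by rw [smul_eq_mul, map_mul, map_mul, ← hr]; ring⟩ }
  have hI : I = ⊤ := by
    by_contra hI
    obtain ⟨x, y, he, hle⟩ := exists_le_pointIdeal hI
    have hn := hs x y he
    obtain ⟨g, h, i, j, e, hg, hh, hij⟩ := (hasOrderAt_some_iff hn).mp
      (hf (Point.some x y hn) (Point.some_ne_zero hn))
    obtain rfl : i = j := by omega
    obtain ⟨c, hc, hc'⟩ := exists_denominator (XClass_ne_zero x) (pointIdeal_mul hn) e hg hh
    exact hc (hle hc')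
  obtain ⟨r, hr⟩ := (hI ▸ Submodule.mem_top : (1 : (curve a b).CoordinateRing) ∈ I)
  exact ⟨r, by rw [← hr, map_one, mul_one]⟩

/-- Both `f` and its inverse are regular, so the norm of `f` to `F[X]` is a unit. The norm of `p + q
y` has degree `max (2 deg p) (2 deg q + 3)`; therefore `q = 0` and `p` is constant. Nothing is
needed at infinity. -/
theorem exists_const [IsAlgClosed F] (hs : IsSmooth a b) {f : (curve a b).FunctionField}
    (hf : ∀ P : (curve a b).Point, P ≠ 0 → HasOrderAt f P 0) (hf0 : f ≠ 0) :
    ∃ c : F, c ≠ 0 ∧ expandAtInfty a b f = HahnSeries.C c ∧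
      f = algebraMap _ _ (algebraMap F (curve a b).CoordinateRing c) := by
  obtain ⟨r, rfl⟩ := exists_coordinateRing hs hf
  obtain ⟨s, hs⟩ := exists_coordinateRing hs (fun P hP => by simpa using (hf P hP).inv)
  have hrs : r * s = 1 := by
    apply IsFractionRing.injective _ (curve a b).FunctionField
    rw [map_mul, ← hs, map_one, mul_inv_cancel₀ hf0]
  have hu : IsUnit (Algebra.norm F[X] r) := (IsUnit.of_mul_eq_one s hrs).map _
  have hdeg := degree_eq_zero_of_isUnit hu
  obtain ⟨p, q, rfl⟩ := CoordinateRing.exists_smul_basis_eq r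
  rw [degree_norm_smul_basis] at hdeg
  have hq : q = 0 := by
    by_contra hq
    have h1 := le_max_right (2 • p.degree) (2 • q.degree + 3)
    rw [hdeg, degree_eq_natDegree hq] at h1
    have h2 : ((2 * q.natDegree + 3 : ℕ) : WithBot ℕ) ≤ ((0 : ℕ) : WithBot ℕ) := by
      push_cast
      convert h1 using 2
      simp
    have h3 : 2 * q.natDegree + 3 ≤ 0 := WithBot.coe_le_coe.mp h2
    omega
  have hp : p.degree ≤ 0 := by
    by_cases hp : p = 0
    · simp [hp]
    have h1 := le_max_left (2 • p.degree) (2 • q.degree + 3)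
    rw [hdeg, degree_eq_natDegree hp] at h1
    have h2 : ((2 * p.natDegree : ℕ) : WithBot ℕ) ≤ ((0 : ℕ) : WithBot ℕ) := by
      push_cast
      convert h1 using 1
      simp
    have h3 : 2 * p.natDegree ≤ 0 := WithBot.coe_le_coe.mp h2
    rw [degree_eq_natDegree hp]
    exact_mod_cast (by omega : p.natDegree ≤ 0)
  obtain ⟨c, rfl⟩ : ∃ c, p = C c := ⟨_, eq_C_of_degree_le_zero hp⟩
  subst hq
  have hr : (C c • (1 : (curve a b).CoordinateRing) + (0 : F[X]) • CoordinateRing.mk (curve a b) X)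
      = algebraMap F (curve a b).CoordinateRing c := by
    rw [zero_smul, add_zero, CoordinateRing.smul, mul_one, mk_C_C]
  rw [hr] at hf0 ⊢
  refine ⟨c, ?_, ?_, rfl⟩
  · rintro rfl
    simp at hf0
  · rw [expandAtInfty, IsFractionRing.lift_algebraMap, expandCoord, ← mk_C_C]
    simp [CoordinateRing.mk, HahnSeries.algebraMap_apply']

end Divisors

/-! ### Balanced power series: inverses, roots, substitution -/

section Balanced

variable {k F : Type*} [Field k] [Field F] [Algebra k F] (R : ℕ → Submodule k F)

/-- The power series whose coefficient of degree `j` has weight `j`. -/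
def balancedSubring [SetLike.GradedMonoid R] : Subring (PowerSeries F) where
  carrier := {f | ∀ j, PowerSeries.coeff j f ∈ R j}
  mul_mem' {f g} hf hg j := by
    rw [PowerSeries.coeff_mul]
    refine Submodule.sum_mem _ fun p hp => ?_
    rw [← Finset.HasAntidiagonal.mem_antidiagonal.mp hp]
    exact SetLike.mul_mem_graded (hf _) (hg _)
  one_mem' j := by
    rw [PowerSeries.coeff_one]
    split_ifs with h
    · rw [h]; exact SetLike.one_mem_graded R
    · exact zero_mem _
  add_mem' hf hg j := by rw [map_add]; exact add_mem (hf j) (hg j)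
  zero_mem' j := by rw [map_zero]; exact zero_mem _
  neg_mem' hf j := by rw [map_neg]; exact neg_mem (hf j)

variable {R}

theorem natCast_mul_mem {j : ℕ} (n : ℕ) {c : F} (hc : c ∈ R j) : (n : F) * c ∈ R j := by
  rw [← nsmul_eq_mul]; exact nsmul_mem hc n

/-- Division by `n` is multiplication by a scalar of `k`; if `n = 0` in `k`, both are zero by
convention. -/
theorem div_natCast_mem {j : ℕ} (n : ℕ) {c : F} (hc : c ∈ R j) : c / n ∈ R j := by
  have : c / n = ((n : k)⁻¹) • c := by
    rw [Algebra.smul_def, map_inv₀, map_natCast, div_eq_inv_mul]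
  rw [this]; exact Submodule.smul_mem _ _ hc

variable [SetLike.GradedMonoid R]

theorem C_mul_X_pow_mem {n : ℕ} {c : F} (hc : c ∈ R n) :
    PowerSeries.C c * PowerSeries.X ^ n ∈ balancedSubring R := fun j => by
  rw [PowerSeries.coeff_C_mul, PowerSeries.coeff_X_pow]
  split_ifs with h
  · rw [h, mul_one]; exact hc
  · rw [mul_zero]; exact zero_mem _

theorem mk_mem_balancedSubring {c : ℕ → F} (hc : ∀ j, c j ∈ R j) :
    PowerSeries.mk c ∈ balancedSubring R := fun j => by rw [PowerSeries.coeff_mk]; exact hc j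

theorem inv_mem_balancedSubring {f : PowerSeries F} (hf : f ∈ balancedSubring R)
    (h1 : PowerSeries.constantCoeff f = 1) : f⁻¹ ∈ balancedSubring R := by
  intro j
  induction j using Nat.strong_induction_on with
  | _ j ih =>
    rw [PowerSeries.coeff_inv, h1]
    split_ifs with h
    · subst h; simpa using SetLike.one_mem_graded R
    · rw [inv_one, neg_one_mul]
      refine neg_mem (Submodule.sum_mem _ fun p hp => ?_)
      split_ifs with h2
      · rw [← Finset.HasAntidiagonal.mem_antidiagonal.mp hp]
        exact SetLike.mul_mem_graded (hf _) (ih _ h2)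
      · exact zero_mem _

theorem sSeries_mem_balancedSubring {a b : F} (ha : a ∈ R 4) (hb : b ∈ R 6) :
    sSeries a b ∈ balancedSubring R := by
  have : ∀ n, sIter a b n ∈ balancedSubring R := by
    intro n
    induction n with
    | zero => exact one_mem _
    | succ n ih =>
      exact add_mem (add_mem (one_mem _) (mul_mem (C_mul_X_pow_mem ha) (pow_mem ih 2)))
        (mul_mem (C_mul_X_pow_mem hb) (pow_mem ih 3))
  exact mk_mem_balancedSubring fun j => this j j

/-- Solving an equation `Φ g = f` in balanced power series by successive approximation. -/
theorem exists_mem_of_approx (Φ : PowerSeries F → PowerSeries F) (f u₀ : PowerSeries F) (n₀ : ℕ)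
    (hu₀ : u₀ ∈ balancedSubring R) (h0 : (PowerSeries.X : PowerSeries F) ^ n₀ ∣ Φ u₀ - f)
    (hcont : ∀ n u v, (PowerSeries.X : PowerSeries F) ^ n ∣ u - v →
      (PowerSeries.X : PowerSeries F) ^ n ∣ Φ u - Φ v)
    (hstep : ∀ n, n₀ ≤ n → ∀ u ∈ balancedSubring R, (PowerSeries.X : PowerSeries F) ^ n₀ ∣ u - u₀ →
      (PowerSeries.X : PowerSeries F) ^ n ∣ Φ u - f →
      ∃ c ∈ R n, (PowerSeries.X : PowerSeries F) ^ (n + 1) ∣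
        Φ (u + PowerSeries.C c * PowerSeries.X ^ n) - f) :
    ∃ g ∈ balancedSubring R, (PowerSeries.X : PowerSeries F) ^ n₀ ∣ g - u₀ ∧ Φ g = f := by
  -- `T n` consists of the balanced approximations solving the equation modulo `X^(n₀+n)`. Each
  -- successor agrees with its predecessor to that order, so the sequence converges coefficientwise.
  let T : ℕ → Type _ := fun n => {u : PowerSeries F // u ∈ balancedSubring R ∧
    (PowerSeries.X : PowerSeries F) ^ n₀ ∣ u - u₀ ∧
    (PowerSeries.X : PowerSeries F) ^ (n₀ + n) ∣ Φ u - f}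
  have hs : ∀ n (u : T n), ∃ v : T (n + 1), (PowerSeries.X : PowerSeries F) ^ (n₀ + n) ∣ v.1 - u.1 := by
    rintro n ⟨u, h1, h2, h3⟩
    obtain ⟨c, hc, hd⟩ := hstep (n₀ + n) (by omega) u h1 h2 h3
    refine ⟨⟨u + PowerSeries.C c * PowerSeries.X ^ (n₀ + n),
      add_mem h1 (C_mul_X_pow_mem hc), ?_, hd⟩, ?_⟩
    · rw [add_sub_right_comm]
      exact dvd_add h2 ((pow_dvd_pow _ (by omega)).mul_left _)
    · rw [add_sub_cancel_left]; exact Dvd.intro_left _ rfl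
  choose next hnext using hs
  let u : ∀ n, T n := fun n => Nat.rec ⟨u₀, hu₀, by simp, h0⟩ (fun n x => next n x) n
  have hu : ∀ n, (PowerSeries.X : PowerSeries F) ^ (n₀ + n) ∣ (u (n + 1)).1 - (u n).1 :=
    fun n => hnext n (u n)
  have hu' : ∀ n m, (PowerSeries.X : PowerSeries F) ^ (n₀ + n) ∣ (u (n + m)).1 - (u n).1 := by
    intro n m
    induction m with
    | zero => simp
    | succ m ih =>
      have := dvd_add ((pow_dvd_pow _ (by omega)).trans (hu (n + m))) ih
      rw [sub_add_sub_cancel] at this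
      exact this
  -- The coefficient of degree `j` no longer changes from index `j + 1` on.
  let g : PowerSeries F := PowerSeries.mk fun j => PowerSeries.coeff j (u (j + 1)).1
  have hg : ∀ n, (PowerSeries.X : PowerSeries F) ^ n ∣ g - (u n).1 := by
    intro n
    rw [PowerSeries.X_pow_dvd_iff]
    intro m hm
    obtain ⟨d, rfl⟩ := Nat.exists_eq_add_of_le (Nat.succ_le_of_lt hm)
    have := PowerSeries.X_pow_dvd_iff.mp (hu' (m + 1) d) m (by omega)
    rw [map_sub, sub_eq_zero] at this
    rw [map_sub, sub_eq_zero, PowerSeries.coeff_mk]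
    exact this.symm
  refine ⟨g, fun j => ?_, ?_, ?_⟩
  · rw [PowerSeries.coeff_mk]; exact (u (j + 1)).2.1 j
  · have := dvd_add (hg n₀) (u n₀).2.2.1
    simpa using this
  · rw [← sub_eq_zero]
    ext n
    have := dvd_add (hcont _ _ _ (hg (n + 1)))
      ((pow_dvd_pow _ (by omega)).trans (u (n + 1)).2.2.2)
    rw [sub_add_sub_cancel] at this
    rw [PowerSeries.X_pow_dvd_iff.mp this n (by omega), map_zero]

/-- If `u` has constant term 1, adding `c X^n` changes `u^l` by `l c X^n` modulo `X^(n+1)`. The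
correction is thus the first wrong coefficient, which has weight `n`, divided by `-l`. -/
theorem exists_root_mem_balancedSubring {f : PowerSeries F} (hf : f ∈ balancedSubring R)
    (h1 : PowerSeries.constantCoeff f = 1) {l : ℕ} (hl : (l : F) ≠ 0) :
    ∃ g ∈ balancedSubring R, PowerSeries.constantCoeff g = 1 ∧ g ^ l = f := by
  obtain ⟨g, hg, hg1, hgf⟩ := exists_mem_of_approx (R := R) (fun u => u ^ l) f 1 1 (one_mem _)
    (by rw [pow_one, PowerSeries.X_dvd_iff]; simp [h1])
    (fun n u v h => h.trans (sub_dvd_pow_sub_pow u v l)) (by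
      intro n hn u hu hu1 huf
      obtain ⟨w, hw⟩ := huf
      refine ⟨-(PowerSeries.coeff n (u ^ l - f)) / l,
        div_natCast_mem _ (neg_mem ((sub_mem (pow_mem hu l) hf) n)), ?_⟩
      have hc : PowerSeries.coeff n (u ^ l - f) = PowerSeries.constantCoeff w := by
        rw [hw]; simpa using PowerSeries.coeff_X_pow_mul w n 0
      rw [hc]
      set c := -(PowerSeries.constantCoeff w) / (l : F) with hcdef
      obtain ⟨e, he⟩ : ∃ e, u ^ l + (l : PowerSeries F) * u ^ (l - 1) * (PowerSeries.C c * PowerSeries.X ^ n) + e * (PowerSeries.C c * PowerSeries.X ^ n) ^ 2 = (u + PowerSeries.C c * PowerSeries.X ^ n) ^ l := by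
        obtain ⟨e, he⟩ := Polynomial.powAddExpansion u (PowerSeries.C c * PowerSeries.X ^ n) l
        exact ⟨e, he.symm⟩
      have h3 : (u + PowerSeries.C c * PowerSeries.X ^ n) ^ l - f = PowerSeries.X ^ n * (w + (l : PowerSeries F) * u ^ (l - 1) * PowerSeries.C c + e * PowerSeries.C c ^ 2 * PowerSeries.X ^ n) := by
        rw [← he]; linear_combination hw
      show _ ∣ (u + PowerSeries.C c * PowerSeries.X ^ n) ^ l - f
      rw [h3, pow_succ]
      apply mul_dvd_mul_left
      rw [PowerSeries.X_dvd_iff]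
      have h4 : PowerSeries.constantCoeff u = 1 := by
        rw [pow_one, PowerSeries.X_dvd_iff] at hu1
        simpa [sub_eq_zero] using hu1
      simp only [map_add, map_mul, map_pow, h4, map_natCast, PowerSeries.constantCoeff_C,
        PowerSeries.constantCoeff_X, zero_pow (by omega : n ≠ 0), hcdef]
      field_simp
      simp)
  refine ⟨g, hg, ?_, hgf⟩
  rw [pow_one, PowerSeries.X_dvd_iff] at hg1
  simpa [sub_eq_zero] using hg1

theorem coeff_X_mul_pow (v : PowerSeries F) (d n : ℕ) :
    PowerSeries.coeff n ((PowerSeries.X * v) ^ d) =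
      if d ≤ n then PowerSeries.coeff (n - d) (v ^ d) else 0 := by
  rw [mul_pow, PowerSeries.coeff_X_pow_mul']

theorem hasSubst_X_mul (v : PowerSeries F) : PowerSeries.HasSubst (PowerSeries.X * v) :=
  PowerSeries.HasSubst.of_constantCoeff_zero' (by simp)

/-- The coefficient of `X^n` in `(X v)^d` has weight `n - d`, and it is multiplied by the
coefficient of degree `d` of `u`, of weight `d`. -/
theorem subst_mem_balancedSubring {u v : PowerSeries F} (hu : u ∈ balancedSubring R)
    (hv : v ∈ balancedSubring R) :
    PowerSeries.subst (PowerSeries.X * v) u ∈ balancedSubring R := fun n => by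
  rw [PowerSeries.coeff_subst' (hasSubst_X_mul v)]
  refine finsum_induction (fun x => x ∈ R n) (zero_mem _) (fun _ _ => add_mem) fun d => ?_
  rw [coeff_X_mul_pow, smul_eq_mul]
  split_ifs with h
  · have := SetLike.mul_mem_graded (hu d) (pow_mem hv d (n - d))
    rwa [Nat.add_sub_cancel' h] at this
  · rw [mul_zero]; exact zero_mem _

theorem subst_X_pow_mul (v w : PowerSeries F) (n : ℕ) :
    PowerSeries.subst (PowerSeries.X * v) (PowerSeries.X ^ n * w) =
      PowerSeries.X ^ n * (v ^ n * PowerSeries.subst (PowerSeries.X * v) w) := by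
  have h := hasSubst_X_mul v
  rw [PowerSeries.subst_mul h, PowerSeries.subst_pow h, PowerSeries.subst_X h, mul_pow, mul_assoc]

theorem constantCoeff_subst_X_mul (u v : PowerSeries F) :
    PowerSeries.constantCoeff (PowerSeries.subst (PowerSeries.X * v) u) =
      PowerSeries.constantCoeff u := by
  have h := hasSubst_X_mul v
  have h1 : u = PowerSeries.C (PowerSeries.constantCoeff u) + PowerSeries.X ^ 1 *
      PowerSeries.mk fun p => PowerSeries.coeff (p + 1) u := by
    rw [pow_one, add_comm]; exact PowerSeries.eq_X_mul_shift_add_const u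
  conv_lhs => rw [h1]
  rw [PowerSeries.subst_add h, subst_X_pow_mul, map_add,
    show PowerSeries.subst (PowerSeries.X * v) (PowerSeries.C (PowerSeries.constantCoeff u)) =
      PowerSeries.C (PowerSeries.constantCoeff u) from PowerSeries.subst_C _]
  simp

/-- The lowest term of a nonzero series survives the substitution, because `v` has constant term 1.
-/
theorem subst_X_mul_injective {v : PowerSeries F} (hv : PowerSeries.constantCoeff v = 1) :
    Function.Injective (PowerSeries.subst (R := F) (PowerSeries.X * v) : PowerSeries F → PowerSeries F) := by
  have h := hasSubst_X_mul v
  intro p q hpq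
  rw [← sub_eq_zero]
  by_contra h0
  obtain ⟨w, hw⟩ := PowerSeries.X_pow_order_dvd (φ := p - q)
  have h1 : PowerSeries.subst (PowerSeries.X * v) (p - q) = (0 : PowerSeries F) := by
    rw [PowerSeries.subst_sub h]
    exact sub_eq_zero.mpr hpq
  rw [hw, subst_X_pow_mul] at h1
  have h2 := (mul_eq_zero.mp h1).resolve_left (pow_ne_zero _ PowerSeries.X_ne_zero)
  have h3 := congrArg PowerSeries.constantCoeff h2
  rw [map_mul, map_pow, hv, one_pow, one_mul, constantCoeff_subst_X_mul, map_zero] at h3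
  have h4 := PowerSeries.coeff_order h0
  apply h4
  have := PowerSeries.coeff_X_pow_mul w (p - q).order.toNat 0
  rw [zero_add, ← hw] at this
  rw [this]; simpa using h3

/-- The substitution sends `X^n` to `X^n` plus higher terms, so it is triangular with ones on the
diagonal and can be inverted one coefficient at a time, within the graded ring. -/
theorem exists_subst_eq {f v : PowerSeries F} (hf : f ∈ balancedSubring R)
    (hv : v ∈ balancedSubring R) (hv1 : PowerSeries.constantCoeff v = 1) :
    ∃ g ∈ balancedSubring R, PowerSeries.subst (PowerSeries.X * v) g = f := by
  have hs := hasSubst_X_mul v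
  obtain ⟨g, hg, -, hgf⟩ := exists_mem_of_approx (R := R)
    (fun u => PowerSeries.subst (PowerSeries.X * v) u) f 0 0 (zero_mem _) (by simp)
    (fun n u p h => by
      obtain ⟨w, hw⟩ := h
      refine ⟨v ^ n * PowerSeries.subst (PowerSeries.X * v) w, ?_⟩
      show PowerSeries.subst (PowerSeries.X * v) u - PowerSeries.subst (PowerSeries.X * v) p = _
      rw [← PowerSeries.subst_sub hs, hw, subst_X_pow_mul]) (by
      intro n _ u hu _ huf
      obtain ⟨w, hw⟩ := huf
      refine ⟨-PowerSeries.coeff n (PowerSeries.subst (PowerSeries.X * v) u - f),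
        neg_mem ((sub_mem (subst_mem_balancedSubring hu hv) hf) n), ?_⟩
      have hc : PowerSeries.coeff n (PowerSeries.subst (PowerSeries.X * v) u - f) =
          PowerSeries.constantCoeff w := by
        rw [hw]; simpa using PowerSeries.coeff_X_pow_mul w n 0
      rw [hc]
      have h3 : PowerSeries.subst (PowerSeries.X * v) (u + PowerSeries.C (-PowerSeries.constantCoeff w) *
          PowerSeries.X ^ n) - f = PowerSeries.X ^ n * (w + v ^ n * PowerSeries.C (-PowerSeries.constantCoeff w)) := by
        rw [PowerSeries.subst_add hs, mul_comm (PowerSeries.C _), subst_X_pow_mul,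
          show PowerSeries.subst (PowerSeries.X * v) (PowerSeries.C (-PowerSeries.constantCoeff w)) =
            PowerSeries.C (-PowerSeries.constantCoeff w) from PowerSeries.subst_C _]
        linear_combination hw
      show _ ∣ PowerSeries.subst (PowerSeries.X * v) (u + PowerSeries.C (-PowerSeries.constantCoeff w) *
          PowerSeries.X ^ n) - f
      rw [h3, pow_succ]
      apply mul_dvd_mul_left
      rw [PowerSeries.X_dvd_iff]
      simp [hv1])
  exact ⟨g, hg, hgf⟩

end Balanced

/-! ### Laurent series written as `t^m` times a power series -/

section LaurentForm

variable {F : Type*} [Field F]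

/-- The Laurent series `t ^ m u(t)`. -/
abbrev shiftSeries (m : ℤ) (u : PowerSeries F) : LaurentSeries F :=
  HahnSeries.single m 1 * HahnSeries.ofPowerSeries ℤ F u

theorem shiftSeries_mul (m n : ℤ) (u v : PowerSeries F) :
    shiftSeries m u * shiftSeries n v = shiftSeries (m + n) (u * v) := by
  have : (HahnSeries.single (m + n) (1 : F) : LaurentSeries F) =
      HahnSeries.single m 1 * HahnSeries.single n 1 := by
    rw [HahnSeries.single_mul_single, one_mul]
  rw [shiftSeries, shiftSeries, shiftSeries, this, map_mul]; ring

theorem shiftSeries_zero_one : shiftSeries 0 (1 : PowerSeries F) = 1 := by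
  simp [shiftSeries]

theorem coeff_shiftSeries (m : ℤ) (u : PowerSeries F) (j : ℕ) :
    (shiftSeries m u).coeff (m + j) = PowerSeries.coeff j u := by
  rw [shiftSeries, add_comm m, HahnSeries.coeff_single_mul_add, one_mul]
  exact HahnSeries.ofPowerSeries_apply_coeff u j

theorem coeff_shiftSeries_of_lt {m i : ℤ} (h : i < m) (u : PowerSeries F) :
    (shiftSeries m u).coeff i = 0 := by
  have : i = (i - m) + m := by ring
  rw [shiftSeries, this, HahnSeries.coeff_single_mul_add, one_mul]
  refine (PowerSeries.coeff_coe u _).trans (if_pos (by omega))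

theorem shiftSeries_ne_zero (m : ℤ) {u : PowerSeries F} (hu : PowerSeries.constantCoeff u ≠ 0) :
    shiftSeries m u ≠ 0 := by
  intro h
  have := coeff_shiftSeries m u 0
  rw [h] at this
  exact hu (by simpa using this.symm)

theorem order_shiftSeries (m : ℤ) {u : PowerSeries F} (hu : PowerSeries.constantCoeff u ≠ 0) :
    (shiftSeries m u).order = m := by
  apply le_antisymm
  · apply HahnSeries.order_le_of_coeff_ne_zero
    have := coeff_shiftSeries m u 0
    rw [Nat.cast_zero, add_zero] at this
    rw [this]; simpa using hu
  · by_contra h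
    have := coeff_shiftSeries_of_lt (not_le.mp h) u
    rw [← HahnSeries.leadingCoeff_eq, HahnSeries.leadingCoeff_eq_zero] at this
    exact shiftSeries_ne_zero m hu this

theorem leadingCoeff_shiftSeries (m : ℤ) {u : PowerSeries F}
    (hu : PowerSeries.constantCoeff u ≠ 0) :
    (shiftSeries m u).leadingCoeff = PowerSeries.constantCoeff u := by
  rw [HahnSeries.leadingCoeff_eq, order_shiftSeries m hu]
  have := coeff_shiftSeries m u 0
  rw [Nat.cast_zero, add_zero] at this
  rw [this]; simp

theorem shiftSeries_injective (m : ℤ) : Function.Injective (shiftSeries (F := F) m) := by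
  intro u v h
  ext j
  rw [← coeff_shiftSeries m, ← coeff_shiftSeries m, h]

theorem shiftSeries_inv (m : ℤ) {u : PowerSeries F} (hu : PowerSeries.constantCoeff u ≠ 0) :
    (shiftSeries m u)⁻¹ = shiftSeries (-m) u⁻¹ := by
  apply inv_eq_of_mul_eq_one_left
  rw [shiftSeries_mul, PowerSeries.inv_mul_cancel u hu, neg_add_cancel, shiftSeries_zero_one]

theorem eq_shiftSeries (G : LaurentSeries F) :
    G = shiftSeries G.order G.powerSeriesPart := G.single_order_mul_powerSeriesPart.symm

theorem constantCoeff_powerSeriesPart (G : LaurentSeries F) :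
    PowerSeries.constantCoeff G.powerSeriesPart = G.leadingCoeff := by
  rw [← PowerSeries.coeff_zero_eq_constantCoeff_apply, LaurentSeries.powerSeriesPart_coeff,
    HahnSeries.leadingCoeff_eq]
  simp

/-- The Euler operator `t d/dt`. -/
def eulerOp (u : PowerSeries F) : PowerSeries F :=
  PowerSeries.mk fun j => (j : F) * PowerSeries.coeff j u

theorem derivative_shiftSeries (m : ℤ) (u : PowerSeries F) :
    LaurentSeries.derivative F (shiftSeries m u) =
      shiftSeries (m - 1) (PowerSeries.C (m : F) * u + eulerOp u) := by
  ext n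
  rw [LaurentSeries.derivative_apply, LaurentSeries.hasseDeriv_coeff, Nat.cast_one,
    Ring.choose_one_right]
  rcases lt_or_ge n (m - 1) with h | h
  · rw [coeff_shiftSeries_of_lt h, coeff_shiftSeries_of_lt (by omega), smul_zero]
  · obtain ⟨j, hj⟩ := Int.eq_ofNat_of_zero_le (sub_nonneg.mpr h)
    have h1 : n = m - 1 + j := by omega
    have h2 : n + 1 = m + j := by omega
    rw [h2, coeff_shiftSeries, h1, coeff_shiftSeries, map_add, PowerSeries.coeff_C_mul, eulerOp,
      PowerSeries.coeff_mk, zsmul_eq_mul]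
    push_cast; ring

theorem derivative_div_shiftSeries (m : ℤ) {u : PowerSeries F}
    (hu : PowerSeries.constantCoeff u ≠ 0) :
    LaurentSeries.derivative F (shiftSeries m u) / shiftSeries m u =
      shiftSeries (-1) (PowerSeries.C (m : F) + eulerOp u * u⁻¹) := by
  rw [div_eq_mul_inv, derivative_shiftSeries, shiftSeries_inv m hu, shiftSeries_mul]
  congr 1
  · ring
  · rw [add_mul, mul_assoc, PowerSeries.mul_inv_cancel u hu, mul_one]

theorem xSeries_eq_shiftSeries (a b : F) : xSeries a b = shiftSeries (-2) (sSeries a b)⁻¹ := by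
  rw [xSeries]
  congr 1
  have := shiftSeries_inv 0 (u := sSeries a b) (by rw [constantCoeff_sSeries]; exact one_ne_zero)
  simpa [shiftSeries] using this

theorem ySeries_eq_shiftSeries (a b : F) : ySeries a b = -shiftSeries (-3) (sSeries a b)⁻¹ := by
  rw [ySeries]
  congr 2
  have := shiftSeries_inv 0 (u := sSeries a b) (by rw [constantCoeff_sSeries]; exact one_ne_zero)
  simpa [shiftSeries] using this

theorem shiftSeries_add_C (n : ℕ) (u : PowerSeries F) (c : F) :
    shiftSeries (-n) u + HahnSeries.C c = shiftSeries (-n) (u + PowerSeries.C c * PowerSeries.X ^ n) := by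
  rw [shiftSeries, shiftSeries, map_add, mul_add, map_mul, map_pow, HahnSeries.ofPowerSeries_C,
    HahnSeries.ofPowerSeries_X, mul_left_comm, single_neg_eq,
    inv_mul_cancel₀ (pow_ne_zero _ single_ne_zero'), mul_one]

theorem constantCoeff_inv_sSeries (a b : F) :
    PowerSeries.constantCoeff (sSeries a b)⁻¹ = 1 := by
  rw [PowerSeries.constantCoeff_inv, constantCoeff_sSeries, inv_one]

/-- With `w = 1/s` one has `x = t^(-2) w` and `y = -t^(-3) w`, so `dx/(2y dt)` is `(-2w + t
w')/(-2w) = 1 - (t w') s / 2`. -/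
theorem omegaSeries_eq (a b : F) (h2 : (2 : F) ≠ 0) : omegaSeries a b =
    shiftSeries 0 (1 - PowerSeries.C (2⁻¹ : F) * eulerOp (sSeries a b)⁻¹ * sSeries a b) := by
  have hs : PowerSeries.constantCoeff (sSeries a b)⁻¹ ≠ 0 := by
    rw [constantCoeff_inv_sSeries]; exact one_ne_zero
  have hs' : PowerSeries.constantCoeff (sSeries a b) ≠ 0 := by
    rw [constantCoeff_sSeries]; exact one_ne_zero
  have hss : (sSeries a b)⁻¹ * sSeries a b = 1 := PowerSeries.inv_mul_cancel _ hs'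
  have h2C : (PowerSeries.C (2⁻¹ : F)) * 2 = 1 := by
    rw [show (2 : PowerSeries F) = PowerSeries.C 2 from (map_ofNat _ 2).symm, ← map_mul,
      inv_mul_cancel₀ h2, map_one]
  have h20 : (2 : LaurentSeries F) ≠ 0 := by
    have : (2 : LaurentSeries F) = HahnSeries.C 2 := (map_ofNat _ 2).symm
    rw [this]; simpa using h2
  have h22 : (2 : LaurentSeries F) = shiftSeries 0 2 := by
    rw [shiftSeries, map_ofNat, HahnSeries.single_zero_one, one_mul]
  rw [omegaSeries, xSeries_eq_shiftSeries, ySeries_eq_shiftSeries, derivative_shiftSeries,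
    div_eq_iff (mul_ne_zero h20 (neg_ne_zero.mpr (shiftSeries_ne_zero _ hs)))]
  have : (2 : LaurentSeries F) * -shiftSeries (-3) (sSeries a b)⁻¹ = shiftSeries (-3) (-2 * (sSeries a b)⁻¹) := by
    rw [mul_neg, h22, shiftSeries_mul, zero_add, shiftSeries, shiftSeries, neg_mul, map_neg, mul_neg]
  rw [this, shiftSeries_mul, zero_add, show (-2 - 1 : ℤ) = -3 by norm_num,
    show (((-2 : ℤ)) : F) = -2 by norm_num, map_neg]
  refine congrArg (shiftSeries (F := F) (-3)) ?_
  generalize (sSeries a b)⁻¹ = w at *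
  generalize eulerOp w = e at *
  have h22' : (PowerSeries.C (2 : F)) = 2 := map_ofNat _ 2
  linear_combination (- w) * h22' - (PowerSeries.C (2⁻¹ : F)) * 2 * e * hss - e * h2C

end LaurentForm

/-! ### Balanced Laurent series and the uniformizer `z` -/

section BalancedForm

variable {k F : Type*} [Field k] [Field F] [Algebra k F] (R : ℕ → Submodule k F)
  [SetLike.GradedMonoid R]

/-- A balanced Laurent series `t ^ m (1 + ...)`, in terms of the ring of balanced power series. -/
def HasBalancedForm (m : ℤ) (G : LaurentSeries F) : Prop :=
  ∃ u ∈ balancedSubring R, PowerSeries.constantCoeff u = 1 ∧ G = shiftSeries m u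

variable {R}

theorem HasBalancedForm.order {m : ℤ} {G : LaurentSeries F} (h : HasBalancedForm R m G) :
    G.order = m := by
  obtain ⟨u, -, h1, rfl⟩ := h
  exact order_shiftSeries m (by rw [h1]; exact one_ne_zero)

theorem HasBalancedForm.leadingCoeff {m : ℤ} {G : LaurentSeries F} (h : HasBalancedForm R m G) :
    G.leadingCoeff = 1 := by
  obtain ⟨u, -, h1, rfl⟩ := h
  rw [leadingCoeff_shiftSeries m (by rw [h1]; exact one_ne_zero), h1]

theorem HasBalancedForm.ne_zero {m : ℤ} {G : LaurentSeries F} (h : HasBalancedForm R m G) :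
    G ≠ 0 := by
  rw [← HahnSeries.leadingCoeff_ne_zero, h.leadingCoeff]; exact one_ne_zero

theorem HasBalancedForm.one : HasBalancedForm R 0 (1 : LaurentSeries F) :=
  ⟨1, one_mem _, map_one _, shiftSeries_zero_one.symm⟩

theorem HasBalancedForm.mul {m n : ℤ} {G H : LaurentSeries F} (hG : HasBalancedForm R m G)
    (hH : HasBalancedForm R n H) : HasBalancedForm R (m + n) (G * H) := by
  obtain ⟨u, hu, h1, rfl⟩ := hG
  obtain ⟨v, hv, h2, rfl⟩ := hH
  exact ⟨u * v, mul_mem hu hv, by rw [map_mul, h1, h2, one_mul], shiftSeries_mul _ _ _ _⟩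

theorem HasBalancedForm.inv {m : ℤ} {G : LaurentSeries F} (hG : HasBalancedForm R m G) :
    HasBalancedForm R (-m) G⁻¹ := by
  obtain ⟨u, hu, h1, rfl⟩ := hG
  exact ⟨u⁻¹, inv_mem_balancedSubring hu h1, by rw [PowerSeries.constantCoeff_inv, h1, inv_one],
    shiftSeries_inv m (by rw [h1]; exact one_ne_zero)⟩

theorem HasBalancedForm.pow {m : ℤ} {G : LaurentSeries F} (hG : HasBalancedForm R m G) (n : ℕ) :
    HasBalancedForm R (n * m) (G ^ n) := by
  induction n with
  | zero => simpa using HasBalancedForm.one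
  | succ n ih =>
    rw [pow_succ]
    have := ih.mul hG
    rwa [show ((n + 1 : ℕ) : ℤ) * m = n * m + m by push_cast; ring]

theorem HasBalancedForm.zpow {m : ℤ} {G : LaurentSeries F} (hG : HasBalancedForm R m G) (n : ℤ) :
    HasBalancedForm R (n * m) (G ^ n) := by
  rcases Int.eq_nat_or_neg n with ⟨j, rfl | rfl⟩
  · simpa using hG.pow j
  · simpa [neg_mul] using (hG.pow j).inv

theorem HasBalancedForm.isBalanced {m : ℤ} {G : LaurentSeries F} (hG : HasBalancedForm R m G) :
    IsBalanced (fun j => (R j : Set F)) m G := by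
  obtain ⟨u, hu, h1, rfl⟩ := hG
  refine ⟨fun j => PowerSeries.coeff j u, by simpa using h1, fun j _ => hu j, ?_⟩
  exact congrArg (shiftSeries m) (PowerSeries.ext fun j => by rw [PowerSeries.coeff_mk])

theorem HasBalancedForm.coeff_mem {m : ℤ} {G : LaurentSeries F} (hG : HasBalancedForm R m G)
    (j : ℕ) : G.coeff (m + j) ∈ R j := by
  obtain ⟨u, hu, h1, rfl⟩ := hG
  rw [coeff_shiftSeries]; exact hu j

theorem eulerOp_mem {u : PowerSeries F} (hu : u ∈ balancedSubring R) :
    eulerOp u ∈ balancedSubring R :=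
  mk_mem_balancedSubring fun j => natCast_mul_mem j (hu j)

theorem HasBalancedForm.logDeriv {m : ℤ} {G : LaurentSeries F} (hG : HasBalancedForm R m G) :
    IsWeightedExpansion (fun j => (R j : Set F)) (-1) (m : F)
      (LaurentSeries.derivative F G / G) := by
  obtain ⟨u, hu, h1, rfl⟩ := hG
  have h0 : PowerSeries.constantCoeff u ≠ 0 := by rw [h1]; exact one_ne_zero
  have he : PowerSeries.constantCoeff (eulerOp u) = 0 := by
    rw [← PowerSeries.coeff_zero_eq_constantCoeff_apply, eulerOp, PowerSeries.coeff_mk]; simp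
  refine ⟨fun j => PowerSeries.coeff j (PowerSeries.C (m : F) + eulerOp u * u⁻¹), ?_, ?_, ?_⟩
  · simp [he]
  · intro j hj
    show PowerSeries.coeff j _ ∈ R j
    rw [map_add, PowerSeries.coeff_C, if_neg (by omega), zero_add]
    exact mul_mem (eulerOp_mem hu) (inv_mem_balancedSubring hu h1) j
  · rw [derivative_div_shiftSeries m h0]
    exact congrArg (shiftSeries (-1)) (PowerSeries.ext fun j => by rw [PowerSeries.coeff_mk])

theorem HasBalancedForm.exists_root {l : ℕ} (hl : (l : F) ≠ 0) {m : ℤ} {G : LaurentSeries F}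
    (hG : HasBalancedForm R (l * m) G) : ∃ G', HasBalancedForm R m G' ∧ G' ^ l = G := by
  obtain ⟨u, hu, h1, rfl⟩ := hG
  obtain ⟨g, hg, hg1, rfl⟩ := exists_root_mem_balancedSubring hu h1 hl
  refine ⟨shiftSeries m g, ⟨g, hg, hg1, rfl⟩, ?_⟩
  rw [shiftSeries, shiftSeries, mul_pow, map_pow, HahnSeries.single_pow, one_pow, nsmul_eq_mul]

/-- In `u^l - v^l = (∑ u^i v^(l-1-i)) (u - v)` the first factor has constant term `l`, which is
nonzero, when `u` and `v` have constant term 1. -/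
theorem root_unique {l : ℕ} (hl : (l : F) ≠ 0) {G G' : LaurentSeries F} (hG : G.leadingCoeff = 1)
    (hG' : G'.leadingCoeff = 1) (h : G ^ l = G' ^ l) : G = G' := by
  have hl0 : l ≠ 0 := by rintro rfl; simp at hl
  have h0 : G ≠ 0 := by rw [← HahnSeries.leadingCoeff_ne_zero, hG]; exact one_ne_zero
  have h0' : G' ≠ 0 := by rw [← HahnSeries.leadingCoeff_ne_zero, hG']; exact one_ne_zero
  have ho : G.order = G'.order := by
    have := congrArg HahnSeries.order h
    rw [HahnSeries.order_pow, HahnSeries.order_pow, nsmul_eq_mul, nsmul_eq_mul] at this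
    exact mul_left_cancel₀ (by exact_mod_cast hl0) this
  have hs := Commute.geom_sum₂_mul (Commute.all G.powerSeriesPart G'.powerSeriesPart) l
  have hp : G.powerSeriesPart ^ l = G'.powerSeriesPart ^ l := by
    apply shiftSeries_injective (l * G.order)
    have : ∀ (m : ℤ) (u : PowerSeries F), shiftSeries m u ^ l = shiftSeries (l * m) (u ^ l) := by
      intro m u
      rw [shiftSeries, shiftSeries, mul_pow, map_pow, HahnSeries.single_pow, one_pow, nsmul_eq_mul]
    rw [eq_shiftSeries G, eq_shiftSeries G', this, this, ← ho] at h
    exact h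
  rw [hp, sub_self, mul_eq_zero] at hs
  rcases hs with hs | hs
  · have := congrArg PowerSeries.constantCoeff hs
    rw [map_sum] at this
    simp only [map_mul, map_pow, constantCoeff_powerSeriesPart, hG, hG', one_pow, mul_one] at this
    simp at this
    exact absurd this hl
  · rw [eq_shiftSeries G, eq_shiftSeries G', ho, sub_eq_zero.mp hs]

/-- Dividing `G` by the `m`-th power of the new uniformizer `X v` leaves a power series with
constant term 1, for which the inverse substitution is available. -/
theorem HasBalancedForm.exists_laurentComp {v : PowerSeries F} (hv : v ∈ balancedSubring R)
    (hv1 : PowerSeries.constantCoeff v = 1) {m : ℤ} {G : LaurentSeries F}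
    (hG : HasBalancedForm R m G) :
    ∃ H, (∀ H', laurentComp H' (PowerSeries.X * v) = G ↔ H' = H) ∧ HasBalancedForm R m H := by
  have hz : HasBalancedForm R 1 (HahnSeries.ofPowerSeries ℤ F (PowerSeries.X * v)) :=
    ⟨v, hv, hv1, by rw [map_mul, HahnSeries.ofPowerSeries_X]⟩
  have hq : HasBalancedForm R 0 (G * HahnSeries.ofPowerSeries ℤ F (PowerSeries.X * v) ^ (-m)) := by
    simpa using hG.mul (hz.zpow (-m))
  have hz0 := hz.ne_zero
  obtain ⟨f, hf, hf1, hGf⟩ := hq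
  obtain ⟨g, hg, hgf⟩ := exists_subst_eq hf hv hv1
  have hg1 : PowerSeries.constantCoeff g = 1 := by
    rw [← constantCoeff_subst_X_mul g v, hgf, hf1]
  have hfs : HahnSeries.ofPowerSeries ℤ F f = shiftSeries 0 f := by simp [shiftSeries]
  refine ⟨shiftSeries m g, fun H' => ?_, ⟨g, hg, hg1, rfl⟩⟩
  have key : ∀ H' : LaurentSeries F, H'.order = m →
      (laurentComp H' (PowerSeries.X * v) = G ↔
        PowerSeries.subst (PowerSeries.X * v) H'.powerSeriesPart = f) := by
    intro H' ho
    rw [laurentComp, ho]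
    constructor
    · intro h
      apply HahnSeries.ofPowerSeries_injective (Γ := ℤ)
      rw [hfs, ← hGf, ← h, zpow_neg]
      field_simp
    · intro h
      rw [h, hfs, ← hGf, zpow_neg]
      field_simp
  constructor
  · intro h
    have hH0 : H' ≠ 0 := by
      rintro rfl
      apply hG.ne_zero
      rw [← h, laurentComp, LaurentSeries.powerSeriesPart_zero,
        show PowerSeries.subst (PowerSeries.X * v) (0 : PowerSeries F) = (0 : PowerSeries F) by
          rw [← PowerSeries.coe_substAlgHom (hasSubst_X_mul v), map_zero], map_zero, mul_zero]
    have hc : PowerSeries.constantCoeff H'.powerSeriesPart ≠ 0 := by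
      rw [constantCoeff_powerSeriesPart, HahnSeries.leadingCoeff_ne_zero]; exact hH0
    -- The uniformizer has order 1, so composing with it preserves the order; any solution therefore
    -- has the order of `G`, and `key` applies to it.
    have ho : H'.order = m := by
      have h1 := congrArg HahnSeries.order h
      have h2 : HahnSeries.ofPowerSeries ℤ F (PowerSeries.subst (PowerSeries.X * v) H'.powerSeriesPart)
          = shiftSeries 0 (PowerSeries.subst (PowerSeries.X * v) H'.powerSeriesPart) := by
        simp [shiftSeries]
      have hc' : PowerSeries.constantCoeff
          (PowerSeries.subst (PowerSeries.X * v) H'.powerSeriesPart) ≠ 0 := by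
        rwa [constantCoeff_subst_X_mul]
      rw [laurentComp, hG.order, h2, HahnSeries.order_mul (zpow_ne_zero _ hz0)
        (shiftSeries_ne_zero 0 hc'), order_shiftSeries 0 hc', (hz.zpow _).order] at h1
      linarith
    have := (key H' ho).mp h
    rw [← hgf] at this
    rw [eq_shiftSeries H', subst_X_mul_injective hv1 this, ho]
  · rintro rfl
    have ho := order_shiftSeries m (u := g) (by rw [hg1]; exact one_ne_zero)
    rw [key _ ho, ← hgf]
    congr 1
    apply shiftSeries_injective m
    conv_rhs => rw [eq_shiftSeries (shiftSeries m g), ho]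

/-- Here `ω = q dt` with `q` balanced of constant term 1; termwise integration shifts by one power
of `t` and divides the coefficient of degree `j` by `j + 1`. -/
theorem exists_zSeries_eq [CharZero F] {a b : F} (ha : a ∈ R 4) (hb : b ∈ R 6) :
    ∃ v ∈ balancedSubring R, PowerSeries.constantCoeff v = 1 ∧ zSeries a b = PowerSeries.X * v := by
  have hs := sSeries_mem_balancedSubring ha hb
  have hs1 := constantCoeff_sSeries a b
  set q : PowerSeries F := 1 - PowerSeries.C (2⁻¹ : F) * eulerOp (sSeries a b)⁻¹ * sSeries a b with hq
  have hqm : q ∈ balancedSubring R := by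
    refine sub_mem (one_mem _) (mul_mem (mul_mem ?_ ?_) hs)
    · have := C_mul_X_pow_mem (R := R) (n := 0) (c := (2⁻¹ : F)) (by
        have := div_natCast_mem 2 (SetLike.one_mem_graded R)
        rwa [one_div] at this)
      simpa using this
    · exact eulerOp_mem (inv_mem_balancedSubring hs hs1)
  have hqo := omegaSeries_eq a b two_ne_zero
  refine ⟨PowerSeries.mk fun j => PowerSeries.coeff j q / ((j + 1 : ℕ) : F),
    mk_mem_balancedSubring fun j => div_natCast_mem _ (hqm j), ?_, ?_⟩
  · rw [← PowerSeries.coeff_zero_eq_constantCoeff_apply, PowerSeries.coeff_mk]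
    have he : PowerSeries.constantCoeff (eulerOp (sSeries a b)⁻¹) = 0 := by
      rw [← PowerSeries.coeff_zero_eq_constantCoeff_apply, eulerOp, PowerSeries.coeff_mk]; simp
    simp [hq, he]
  · ext n
    rw [zSeries, PowerSeries.coeff_mk, hqo]
    rcases n with _ | j
    -- The constant term of `z` is a division by zero, hence 0.
    · simp
    · rw [PowerSeries.coeff_succ_X_mul, PowerSeries.coeff_mk, ← hq]
      have := coeff_shiftSeries 0 q j
      rw [zero_add] at this
      push_cast
      rw [add_sub_cancel_right, this]

end BalancedForm

/-! ### Miller functions and the series `f_D` -/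

section Miller

open WeierstrassCurve.Affine WeierstrassCurve.Affine.CoordinateRing

variable {F : Type*} [Field F] {a b : F}

/-- The maximal ideal of the affine point `P`. -/
abbrev idealAt (P : (curve a b).Point) : Ideal (curve a b).CoordinateRing :=
  pointIdeal a b (xCoord P) (yCoord P)

theorem idealOrder_idealAt {P Q : (curve a b).Point} (hP : P ≠ 0) (hQ : Q ≠ 0) :
    IdealOrder (idealAt Q) (idealAt P) (if P = Q then 1 else 0) := by
  have h := pointIdeal_order (x' := xCoord P) (y' := yCoord P) (point_nonsingular hQ)
  have he : (xCoord P = xCoord Q ∧ yCoord P = yCoord Q) ↔ P = Q :=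
    ⟨fun h => point_ext hP hQ h.1 h.2, fun h => by rw [h]; exact ⟨rfl, rfl⟩⟩
  simpa only [he] using h

theorem idealOrder_prod {s : Multiset (curve a b).Point} (hs : ∀ P ∈ s, P ≠ 0)
    {Q : (curve a b).Point} (hQ : Q ≠ 0) :
    IdealOrder (idealAt Q) (s.map idealAt).prod (s.count Q) := by
  have hn := point_nonsingular hQ
  have : (idealAt Q).IsPrime := (pointIdeal_isMaximal hn.1).isPrime
  induction s using Multiset.induction with
  | empty =>
    apply idealOrder_zero
    simpa [Ideal.one_eq_top] using pointIdeal_ne_top hn.1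
  | cons P s ih =>
    rw [Multiset.map_cons, Multiset.prod_cons, Multiset.count_cons, add_comm]
    have h1 := idealOrder_idealAt (hs P (Multiset.mem_cons_self _ _)) hQ
    have h2 := ih fun P hP => hs P (Multiset.mem_cons_of_mem hP)
    have := h1.mul (XClass_ne_zero _) (pointIdeal_mul hn) h2
    simpa only [eq_comm] using this

/-- A factorization of `(g)` into maximal ideals of points gives all the affine orders at once; only
the order at infinity has to be read off the expansion. -/
theorem hasDivisor_of_ideal {g : (curve a b).CoordinateRing} (hg : g ≠ 0)
    {s : Multiset (curve a b).Point} (hs : ∀ P ∈ s, P ≠ 0)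
    (h : Ideal.span {g} = (s.map idealAt).prod) {D : (curve a b).Point →₀ ℤ}
    (hD : ∀ Q, Q ≠ 0 → D Q = s.count Q) (h0 : (expandCoord a b g).order = D 0) :
    HasDivisor (algebraMap _ (curve a b).FunctionField g) D := by
  intro Q
  by_cases hQ : Q = 0
  · subst hQ
    refine ⟨by simpa using hg, ?_⟩
    rw [← h0, expandAtInfty, IsFractionRing.lift_algebraMap]
  · rw [hD Q hQ]
    have h1 := idealOrder_prod hs hQ
    rw [← h] at h1
    rw [point_eq_some hQ, hasOrderAt_some_iff, ← point_eq_some hQ]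
    have h2 : IdealOrder (pointIdeal a b (xCoord Q) (yCoord Q)) (Ideal.span {1}) 0 := by
      apply idealOrder_zero
      rw [Ideal.span_singleton_one, top_le_iff]
      exact pointIdeal_ne_top (point_nonsingular hQ).1
    exact ⟨g, 1, _, 0, by simp, h1, h2, by simp⟩

theorem span_XClass {P : (curve a b).Point} (hP : P ≠ 0) :
    Ideal.span {XClass (curve a b) (xCoord P)} = idealAt P * idealAt (-P) := by
  rw [idealAt, idealAt, xCoord_neg, yCoord_neg, pointIdeal_mul (point_nonsingular hP)]

/-- The class group identity behind the addition law reads `(x - x_{P+Q}) I_P I_Q = (line) I_{P+Q}`.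
As `R = -(P+Q)`, multiplying by `I_R` turns `I_{P+Q}` into the same principal ideal `(x - x_{P+Q})`,
which cancels. -/
theorem span_line {P Q R : (curve a b).Point} (hP : P ≠ 0) (hQ : Q ≠ 0) (hR : R ≠ 0)
    (h : P + Q + R = 0) : Ideal.span {YClass (curve a b) (linePolynomial (xCoord P) (yCoord P)
      ((curve a b).slope (xCoord P) (xCoord Q) (yCoord P) (yCoord Q)))} =
        idealAt P * (idealAt Q * idealAt R) := by
  have hPQ : P + Q ≠ 0 := by
    intro h0; rw [h0, zero_add] at h; exact hR h
  have hxy : ¬(xCoord P = xCoord Q ∧ yCoord P = (curve a b).negY (xCoord Q) (yCoord Q)) := by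
    rintro ⟨h1, h2⟩
    apply hPQ
    rw [curve_negY] at h2
    rw [← neg_neg Q, ← sub_eq_add_neg, sub_eq_zero]
    exact point_ext hP (neg_ne_zero.mpr hQ) (by rw [xCoord_neg, h1]) (by rw [yCoord_neg, h2])
  have key := XYIdeal_mul_XYIdeal (point_nonsingular hP).1 (point_nonsingular hQ).1 hxy
  have hS : P + Q = .some _ _ (nonsingular_add (point_nonsingular hP) (point_nonsingular hQ) hxy) := by
    conv_lhs => rw [point_eq_some hP, point_eq_some hQ]
    exact Point.add_some hxy
  have hx3 : (curve a b).addX (xCoord P) (xCoord Q)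
      ((curve a b).slope (xCoord P) (xCoord Q) (yCoord P) (yCoord Q)) = xCoord (P + Q) := by
    rw [hS, xCoord_some]
  have hy3 : (curve a b).addY (xCoord P) (xCoord Q) (yCoord P)
      ((curve a b).slope (xCoord P) (xCoord Q) (yCoord P) (yCoord Q)) = yCoord (P + Q) := by
    rw [hS, yCoord_some]
  rw [hx3, hy3] at key
  have hX := span_XClass hPQ
  have hRS : -(P + Q) = R := (eq_neg_of_add_eq_zero_right h).symm
  rw [hRS] at hX
  change Ideal.span _ * (idealAt P * idealAt Q) = Ideal.span _ * idealAt (P + Q) at key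
  have hX0 : Ideal.span {XClass (curve a b) (xCoord (P + Q))} ≠ ⊥ := by
    rw [Ne, Ideal.span_singleton_eq_bot]; exact XClass_ne_zero _
  have h3 := congrArg (· * idealAt R) key
  beta_reduce at h3
  rw [mul_assoc, mul_assoc (Ideal.span {YClass _ _}), ← hX, mul_comm (Ideal.span {YClass _ _})] at h3
  have h4 := (Ideal.span_singleton_mul_right_inj (XClass_ne_zero _)).mp h3
  rw [← h4, mul_assoc]

theorem expandCoord_XClass (x : F) :
    expandCoord a b (XClass (curve a b) x) =
      shiftSeries (-2) ((sSeries a b)⁻¹ + PowerSeries.C (-x) * PowerSeries.X ^ 2) := by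
  have h := shiftSeries_add_C 2 (sSeries a b)⁻¹ (-x)
  push_cast at h
  rw [← h, ← xSeries_eq_shiftSeries, map_neg, ← sub_eq_add_neg]
  simp [XClass, expandCoord, CoordinateRing.mk, HahnSeries.algebraMap_apply']

/-- The sign makes the leading coefficient 1, since `y` begins with `-t^(-3)`. The slope enters next
to `t` and the intercept next to `t^3`, matching their weights 1 and 3. -/
theorem expandCoord_line (x y lam : F) :
    expandCoord a b (-YClass (curve a b) (linePolynomial x y lam)) =
      shiftSeries (-3) ((sSeries a b)⁻¹ + PowerSeries.C lam * PowerSeries.X ^ 1 * (sSeries a b)⁻¹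
        + PowerSeries.C (y - lam * x) * PowerSeries.X ^ 3) := by
  have h := shiftSeries_add_C 3 ((sSeries a b)⁻¹ + PowerSeries.C lam * PowerSeries.X ^ 1 *
    (sSeries a b)⁻¹) (y - lam * x)
  have h2 : shiftSeries (-3) (PowerSeries.C lam * PowerSeries.X ^ 1 * (sSeries a b)⁻¹) =
      HahnSeries.C lam * shiftSeries (-2) (sSeries a b)⁻¹ := by
    have h3 : (HahnSeries.single (-2 : ℤ) (1 : F) : LaurentSeries F) =
      HahnSeries.single (-3 : ℤ) 1 * HahnSeries.single 1 1 := by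
      rw [HahnSeries.single_mul_single, one_mul]; norm_num
    rw [shiftSeries, shiftSeries, h3]
    simp only [map_mul, pow_one, HahnSeries.ofPowerSeries_C, HahnSeries.ofPowerSeries_X]
    ring
  push_cast at h
  have h4 : shiftSeries (-3) ((sSeries a b)⁻¹ + PowerSeries.C lam * PowerSeries.X ^ 1 *
    (sSeries a b)⁻¹) = -ySeries a b + HahnSeries.C lam * xSeries a b := by
    rw [ySeries_eq_shiftSeries, neg_neg, xSeries_eq_shiftSeries, ← h2, shiftSeries, shiftSeries,
      shiftSeries, map_add, mul_add]
  rw [← h, h4]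
  simp [YClass, linePolynomial, expandCoord, CoordinateRing.mk, HahnSeries.algebraMap_apply']
  have hsm : lam • (HahnSeries.single 0 x : LaurentSeries F) = HahnSeries.single 0 (lam * x) := by
    ext n; rw [HahnSeries.coeff_smul, HahnSeries.coeff_single, HahnSeries.coeff_single]; simp
  rw [smul_sub, hsm]
  ring

variable {k : Type*} [Field k] [Algebra k F] (R : ℕ → Submodule k F) [SetLike.GradedMonoid R]

/-- A function with divisor `D` and balanced expansion at infinity. -/
def BalancedFunction (f : (curve a b).FunctionField) (D : (curve a b).Point →₀ ℤ) : Prop :=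
  HasDivisor f D ∧ HasBalancedForm R (D 0) (expandAtInfty a b f)

variable {R}

theorem BalancedFunction.mul {f g : (curve a b).FunctionField} {D E : (curve a b).Point →₀ ℤ}
    (hf : BalancedFunction R f D) (hg : BalancedFunction R g E) :
    BalancedFunction R (f * g) (D + E) :=
  ⟨hf.1.mul hg.1, by rw [map_mul, Finsupp.add_apply]; exact hf.2.mul hg.2⟩

theorem BalancedFunction.congr {f : (curve a b).FunctionField} {D E : (curve a b).Point →₀ ℤ}
    (hf : BalancedFunction R f D) (h : D = E) : BalancedFunction R f E := h ▸ hf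

theorem BalancedFunction.one : BalancedFunction R (1 : (curve a b).FunctionField) 0 :=
  ⟨hasDivisor_one, by rw [map_one]; exact HasBalancedForm.one⟩

theorem BalancedFunction.inv {f : (curve a b).FunctionField} {D : (curve a b).Point →₀ ℤ}
    (hf : BalancedFunction R f D) : BalancedFunction R f⁻¹ (-D) :=
  ⟨hf.1.inv, by rw [map_inv₀, Finsupp.neg_apply]; exact hf.2.inv⟩

theorem BalancedFunction.zpow {f : (curve a b).FunctionField} {D : (curve a b).Point →₀ ℤ}
    (hf : BalancedFunction R f D) (n : ℤ) : BalancedFunction R (f ^ n) (n • D) :=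
  ⟨hf.1.zpow n, by rw [map_zpow₀, Finsupp.smul_apply, smul_eq_mul]; exact hf.2.zpow n⟩

theorem BalancedFunction.isPrincipal {f : (curve a b).FunctionField}
    {D : (curve a b).Point →₀ ℤ} (hf : BalancedFunction R f D) : IsPrincipalFunction D f :=
  ⟨hf.1, hf.2.leadingCoeff⟩

theorem exists_balanced_vertical (ha : a ∈ R 4) (hb : b ∈ R 6) {P : (curve a b).Point} (hP : P ≠ 0)
    (hx : xCoord P ∈ R 2) :
    ∃ f : (curve a b).FunctionField, BalancedFunction R f
      (Finsupp.single P 1 + Finsupp.single (-P) 1 - Finsupp.single 0 2) := by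
  have hP' : -P ≠ 0 := neg_ne_zero.mpr hP
  have hc : PowerSeries.constantCoeff
      ((sSeries a b)⁻¹ + PowerSeries.C (-xCoord P) * PowerSeries.X ^ 2) = 1 := by
    simp [constantCoeff_sSeries]
  refine ⟨algebraMap _ _ (XClass (curve a b) (xCoord P)),
    hasDivisor_of_ideal (XClass_ne_zero _) (s := {P, -P}) (by simp [hP]) ?_ ?_ ?_, ?_⟩
  · rw [span_XClass hP]; simp
  · intro Q hQ
    simp only [Finsupp.sub_apply, Finsupp.add_apply, Finsupp.single_apply, Ne.symm hQ, if_false]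
    rw [Multiset.insert_eq_cons, Multiset.count_cons, Multiset.count_singleton]
    push_cast
    simp only [eq_comm (a := Q)]
    ring
  · rw [expandCoord_XClass, order_shiftSeries _ (by rw [hc]; exact one_ne_zero)]
    simp [hP]
  · rw [expandAtInfty, IsFractionRing.lift_algebraMap]
    refine ⟨_, add_mem (inv_mem_balancedSubring (sSeries_mem_balancedSubring ha hb)
      (constantCoeff_sSeries a b)) (C_mul_X_pow_mem (neg_mem hx)), hc, ?_⟩
    rw [expandCoord_XClass]
    simp [hP]

theorem exists_balanced_line (ha : a ∈ R 4) (hb : b ∈ R 6) {P Q S : (curve a b).Point}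
    (hP : P ≠ 0) (hQ : Q ≠ 0) (hS : S ≠ 0) (h : P + Q + S = 0)
    (hx : xCoord P ∈ R 2) (hy : yCoord P ∈ R 3)
    (hlam : (curve a b).slope (xCoord P) (xCoord Q) (yCoord P) (yCoord Q) ∈ R 1) :
    ∃ f : (curve a b).FunctionField, BalancedFunction R f
      (Finsupp.single P 1 + Finsupp.single Q 1 + Finsupp.single S 1 - Finsupp.single 0 3) := by
  have hc : PowerSeries.constantCoeff
      ((sSeries a b)⁻¹ + PowerSeries.C ((curve a b).slope (xCoord P) (xCoord Q) (yCoord P) (yCoord Q))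
        * PowerSeries.X ^ 1 * (sSeries a b)⁻¹ + PowerSeries.C (yCoord P -
        (curve a b).slope (xCoord P) (xCoord Q) (yCoord P) (yCoord Q) * xCoord P)
        * PowerSeries.X ^ 3) = 1 := by
    simp [constantCoeff_sSeries]
  have hs := inv_mem_balancedSubring (sSeries_mem_balancedSubring ha hb) (constantCoeff_sSeries a b)
  refine ⟨algebraMap _ _ (-YClass (curve a b) (linePolynomial (xCoord P) (yCoord P)
      ((curve a b).slope (xCoord P) (xCoord Q) (yCoord P) (yCoord Q)))),
    hasDivisor_of_ideal (neg_ne_zero.mpr (YClass_ne_zero _)) (s := {P, Q, S}) (by simp [hP, hQ, hS])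
      ?_ ?_ ?_, ?_⟩
  · rw [Ideal.span_singleton_neg, span_line hP hQ hS h]; simp
  · intro T hT
    simp only [Finsupp.sub_apply, Finsupp.add_apply, Finsupp.single_apply, Ne.symm hT, if_false]
    rw [Multiset.insert_eq_cons, Multiset.insert_eq_cons, Multiset.count_cons, Multiset.count_cons,
      Multiset.count_singleton]
    push_cast
    simp only [eq_comm (a := T)]
    ring
  · rw [expandCoord_line, order_shiftSeries _ (by rw [hc]; exact one_ne_zero)]
    simp [hP, hQ, hS]
  · rw [expandAtInfty, IsFractionRing.lift_algebraMap]
    refine ⟨_, add_mem (add_mem hs (mul_mem (C_mul_X_pow_mem hlam) hs))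
      (C_mul_X_pow_mem (sub_mem hy (SetLike.mul_mem_graded hlam hx))), hc, ?_⟩
    rw [expandCoord_line]
    simp [hP, hQ, hS]

/-- The coordinates of the `l`-torsion points and the slopes of the lines through them lie in the
graded ring `R`. -/
structure TorsionGraded (R : ℕ → Submodule k F) (a b : F) (l : ℕ) : Prop where
  a_mem : a ∈ R 4
  b_mem : b ∈ R 6
  x_mem : ∀ P : (curve a b).Point, l • P = 0 → P ≠ 0 → xCoord P ∈ R 2
  y_mem : ∀ P : (curve a b).Point, l • P = 0 → P ≠ 0 → yCoord P ∈ R 3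
  slope_mem : ∀ P Q : (curve a b).Point, l • P = 0 → l • Q = 0 → P ≠ 0 → Q ≠ 0 → P + Q ≠ 0 →
    (curve a b).slope (xCoord P) (xCoord Q) (yCoord P) (yCoord Q) ∈ R 1

/-- Miller's function: the chord through `P` and `Q` over the vertical line through `P + Q`. If `P +
Q = O` the vertical line through `P` suffices, and if `P` or `Q` is `O` the constant 1 does. -/
theorem TorsionGraded.exists_balanced_add {l : ℕ} (hT : TorsionGraded R a b l)
    {P Q : (curve a b).Point} (hP : l • P = 0) (hQ : l • Q = 0) :
    ∃ f : (curve a b).FunctionField, BalancedFunction R f (Finsupp.single P 1 + Finsupp.single Q 1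
      - Finsupp.single (P + Q) 1 - Finsupp.single 0 1) := by
  have h2 : (Finsupp.single 0 2 : (curve a b).Point →₀ ℤ) = Finsupp.single 0 1 + Finsupp.single 0 1 := by
    rw [← Finsupp.single_add]; rfl
  have h3 : (Finsupp.single 0 3 : (curve a b).Point →₀ ℤ) =
      Finsupp.single 0 1 + Finsupp.single 0 1 + Finsupp.single 0 1 := by
    rw [← Finsupp.single_add, ← Finsupp.single_add]; rfl
  by_cases hP0 : P = 0
  · refine ⟨1, BalancedFunction.one.congr ?_⟩
    rw [hP0, zero_add Q]
    generalize Finsupp.single Q (1 : ℤ) = q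
    generalize Finsupp.single (0 : (curve a b).Point) (1 : ℤ) = z
    abel
  by_cases hQ0 : Q = 0
  · refine ⟨1, BalancedFunction.one.congr ?_⟩
    rw [hQ0, add_zero P]
    generalize Finsupp.single P (1 : ℤ) = p
    generalize Finsupp.single (0 : (curve a b).Point) (1 : ℤ) = z
    abel
  by_cases hPQ : P + Q = 0
  · obtain ⟨f, hf⟩ := exists_balanced_vertical hT.a_mem hT.b_mem hP0 (hT.x_mem P hP hP0)
    refine ⟨f, hf.congr ?_⟩
    rw [hPQ, eq_neg_of_add_eq_zero_right hPQ, h2]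
    generalize Finsupp.single P (1 : ℤ) = p
    generalize Finsupp.single (-P) (1 : ℤ) = q
    generalize Finsupp.single (0 : (curve a b).Point) (1 : ℤ) = z
    abel
  · have hl : l • (P + Q) = 0 := by rw [nsmul_add, hP, hQ, add_zero]
    obtain ⟨f, hf⟩ := exists_balanced_line hT.a_mem hT.b_mem hP0 hQ0 (neg_ne_zero.mpr hPQ)
      (add_neg_cancel _) (hT.x_mem P hP hP0) (hT.y_mem P hP hP0)
      (hT.slope_mem P Q hP hQ hP0 hQ0 hPQ)
    obtain ⟨g, hg⟩ := exists_balanced_vertical hT.a_mem hT.b_mem hPQ (hT.x_mem _ hl hPQ)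
    refine ⟨f * g⁻¹, (hf.mul hg.inv).congr ?_⟩
    rw [h2, h3]
    generalize Finsupp.single (P + Q) (1 : ℤ) = r
    generalize Finsupp.single (-(P + Q)) (1 : ℤ) = r'
    generalize Finsupp.single P (1 : ℤ) = p
    generalize Finsupp.single Q (1 : ℤ) = q
    generalize Finsupp.single (0 : (curve a b).Point) (1 : ℤ) = z
    abel

/-- For `n = l` the term at `n P` is `(O)`, so the divisor becomes `l(P) - l(O)`; the intermediate
divisors use only multiples of `P`, which are again torsion points. -/
theorem TorsionGraded.exists_balanced_nsmul {l : ℕ} (hT : TorsionGraded R a b l)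
    {P : (curve a b).Point} (hP : l • P = 0) (n : ℕ) :
    ∃ f : (curve a b).FunctionField, BalancedFunction R f ((n : ℤ) • Finsupp.single P 1
      - Finsupp.single (n • P) 1 - ((n : ℤ) - 1) • Finsupp.single 0 1) := by
  induction n with
  | zero =>
    refine ⟨_, BalancedFunction.one.congr (?_ : (0 : (curve a b).Point →₀ ℤ) = _)⟩
    simp
  | succ n ih =>
    obtain ⟨f, hf⟩ := ih
    obtain ⟨g, hg⟩ := hT.exists_balanced_add (P := n • P) (Q := P)
      (by rw [smul_comm, hP, smul_zero]) hP
    refine ⟨f * g, (hf.mul hg).congr ?_⟩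
    rw [succ_nsmul]
    push_cast
    generalize Finsupp.single (n • P) (1 : ℤ) = u
    generalize Finsupp.single (n • P + P) (1 : ℤ) = v
    generalize Finsupp.single P (1 : ℤ) = w
    generalize Finsupp.single (0 : (curve a b).Point) (1 : ℤ) = z
    module

theorem TorsionGraded.exists_balanced_divisor {l : ℕ} (hT : TorsionGraded R a b l)
    (D : (curve a b).Point →₀ ℤ) (hD : ∀ P ∈ D.support, l • P = 0) :
    ∃ f : (curve a b).FunctionField,
      BalancedFunction R f ((l : ℤ) • (D - Finsupp.single 0 (divDegree D))) := by
  have key : ∀ s : Finset (curve a b).Point, (∀ P ∈ s, l • P = 0) →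
      ∃ f : (curve a b).FunctionField, BalancedFunction R f
        ((l : ℤ) • (∑ P ∈ s, (Finsupp.single P (D P) - Finsupp.single 0 (D P)))) := by
    intro s
    induction s using Finset.induction with
    | empty => intro _; exact ⟨1, by simpa using BalancedFunction.one⟩
    | insert P s hPs ih =>
      intro hs
      obtain ⟨f, hf⟩ := ih fun P hP => hs P (Finset.mem_insert_of_mem hP)
      obtain ⟨g, hg⟩ := hT.exists_balanced_nsmul (hs P (Finset.mem_insert_self _ _)) l
      refine ⟨g ^ (D P) * f, ((hg.zpow (D P)).mul hf).congr ?_⟩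
      have h1 : ∀ Q : (curve a b).Point, Finsupp.single Q (D P) = D P • Finsupp.single Q (1 : ℤ) := by
        intro Q; rw [Finsupp.smul_single, smul_eq_mul, mul_one]
      rw [Finset.sum_insert hPs, hs P (Finset.mem_insert_self _ _), h1, h1]
      generalize Finsupp.single P (1 : ℤ) = w
      generalize Finsupp.single (0 : (curve a b).Point) (1 : ℤ) = z
      module
  obtain ⟨f, hf⟩ := key D.support hD
  refine ⟨f, hf.congr (congrArg _ ?_)⟩
  rw [Finset.sum_sub_distrib, ← Finsupp.single_finsetSum]
  congr 1
  exact Finsupp.sum_single D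

/-- The series is the `l`-th root of the expansion of the balanced function with divisor `D'`. Any
other normalized function with the same affine divisor has the same expansion, and the root with
leading coefficient 1 is unique. -/
theorem exists_normalizedSeries [IsAlgClosed F] (hs : IsSmooth a b) {l : ℕ} (hl : (l : F) ≠ 0)
    (hT : TorsionGraded R a b l) (D : (curve a b).Point →₀ ℤ)
    (hD : ∀ P ∈ D.support, l • P = 0) :
    ∃ G : LaurentSeries F, (∀ G', IsNormalizedSeries l D G' ↔ G' = G) ∧
      (∀ f, IsPrincipalFunction D f → expandAtInfty a b f = G) ∧
      HasBalancedForm R (D 0 - divDegree D) G := by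
  obtain ⟨f, hf⟩ := hT.exists_balanced_divisor D hD
  have hf2 := hf.2
  rw [Finsupp.smul_apply, Finsupp.sub_apply, Finsupp.single_eq_same, smul_eq_mul] at hf2
  obtain ⟨G, hG, hGl⟩ := hf2.exists_root hl
  -- Only affine orders are compared. For a principal `D` this lets `f^l` be matched with the
  -- function of `D'` without first knowing that `D` has degree zero.
  have key : ∀ g : (curve a b).FunctionField, (expandAtInfty a b g).leadingCoeff = 1 →
      (∀ P : (curve a b).Point, P ≠ 0 →
        HasOrderAt g P (((l : ℤ) • (D - Finsupp.single 0 (divDegree D)) : (curve a b).Point →₀ ℤ) P)) →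
      expandAtInfty a b g = expandAtInfty a b f := by
    intro g hg1 hgo
    have hf0 : f ≠ 0 := (hf.1 0).ne_zero
    have hg0 : g ≠ 0 := by
      rintro rfl; rw [map_zero, HahnSeries.leadingCoeff_zero] at hg1; exact zero_ne_one hg1
    obtain ⟨c, -, hc, -⟩ := exists_const hs (f := g * f⁻¹) (fun P hP => by
      have := (hgo P hP).mul (hf.1.inv P)
      rwa [Finsupp.neg_apply, add_neg_cancel] at this) (mul_ne_zero hg0 (inv_ne_zero hf0))
    have h1 : expandAtInfty a b g = HahnSeries.C c * expandAtInfty a b f := by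
      rw [← hc, ← map_mul, inv_mul_cancel_right₀ hf0]
    have h2 : (HahnSeries.C c : LaurentSeries F).leadingCoeff = c := by
      rw [HahnSeries.C_apply, HahnSeries.leadingCoeff_of_single]
    rw [h1, HahnSeries.leadingCoeff_mul, h2, hf.2.leadingCoeff, mul_one] at hg1
    rw [h1, hg1, map_one, one_mul]
  refine ⟨G, fun G' => ⟨?_, ?_⟩, fun g hg => ?_, hG⟩
  · rintro ⟨h1, g, hg, hGg⟩
    apply root_unique hl h1 hG.leadingCoeff
    rw [hGg, hGl, key g hg.2 fun P _ => hg.1 P]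
  · rintro rfl
    exact ⟨hG.leadingCoeff, f, hf.isPrincipal, hGl⟩
  · apply root_unique hl hg.2 hG.leadingCoeff
    rw [hGl, ← map_pow]
    apply key
    · rw [map_pow]
      have : ∀ n : ℕ, (expandAtInfty a b g ^ n).leadingCoeff = 1 := by
        intro n
        induction n with
        | zero => rw [pow_zero, HahnSeries.leadingCoeff_one]
        | succ n ih => rw [pow_succ, HahnSeries.leadingCoeff_mul, ih, hg.2, one_mul]
      exact this l
    · intro P hP
      have := hg.1.pow l P
      rw [Finsupp.smul_apply, Finsupp.sub_apply, Finsupp.single_apply, if_neg (Ne.symm hP), sub_zero]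
      simpa using this

end Miller

/-! ### The expansions on the generic curve -/

section GenericSeries

variable {k : Type*} [Field k] {l : ℕ}

instance weightPart_gradedMonoid : SetLike.GradedMonoid (weightPart k l) where
  one_mem := weightPart_one
  mul_mem _ _ _ _ hx hy := weightPart_mul hx hy

/-- A singular point would make `4a^3 + 27b^2` vanish; as `a`, `b` are independent, the
specialization `a = 0`, `b = 1` would give `27 = 0` in `k`. -/
theorem isSmooth_generic (h6 : (6 : k) ≠ 0) : IsSmooth (genA k) (genB k) := by
  have h2 : (2 : k) ≠ 0 := fun h => h6 (by linear_combination 3 * h)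
  have h3 : (3 : k) ≠ 0 := fun h => h6 (by linear_combination 2 * h)
  intro x y hxy
  rw [curve_equation_iff] at hxy
  rw [curve_nonsingular_iff]
  refine ⟨hxy, ?_⟩
  by_contra hcon
  push Not at hcon
  obtain ⟨hx, hy⟩ := hcon
  have h2' : (2 : GenField k) ≠ 0 := by
    have := (_root_.map_ne_zero (algebraMap k (GenField k))).mpr h2
    rwa [map_ofNat] at this
  have hy0 : y = 0 := (mul_eq_zero.mp hy).resolve_left h2'
  subst hy0
  have hd : 4 * genA k ^ 3 + 27 * genB k ^ 2 = 0 := by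
    have ha : genA k = -3 * x ^ 2 := by linear_combination hx
    have hb : genB k = 2 * x ^ 3 := by linear_combination -hxy - x * hx
    rw [ha, hb]; ring
  set p : MvPolynomial (Fin 2) k := 4 * MvPolynomial.X 0 ^ 3 + 27 * MvPolynomial.X 1 ^ 2 with hp
  have hp0 : p = 0 := by
    apply IsFractionRing.injective (MvPolynomial (Fin 2) k) (BaseField k)
    apply (algebraMap (BaseField k) (GenField k)).injective
    rw [map_zero, map_zero, ← hd, genA, genB, hp]
    simp only [map_add, map_mul, map_pow, map_ofNat]
  have h1 := congrArg (MvPolynomial.eval ![(0 : k), 1]) hp0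
  rw [hp] at h1
  simp only [map_add, map_mul, map_pow, map_ofNat, MvPolynomial.eval_X, map_zero] at h1
  apply h3
  have : (3 : k) ^ 3 = 0 := by
    simp at h1
    linear_combination h1
  exact pow_eq_zero_iff (by norm_num) |>.mp this

theorem torsionGraded_generic : TorsionGraded (weightPart k l) (genA k) (genB k) l where
  a_mem := genA_mem_weightPart
  b_mem := genB_mem_weightPart
  x_mem _ hP _ := xCoord_mem_weightPart hP
  y_mem _ hP _ := yCoord_mem_weightPart hP
  slope_mem _ _ hP hQ hP0 hQ0 hPQ := slope_mem_weightPart hP hQ hP0 hQ0 hPQ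

theorem exists_balanced_normalizedSeries (h6l : ((6 * l : ℕ) : k) ≠ 0) (D : GenPoint k →₀ ℤ)
    (hD : ∀ P ∈ D.support, l • P = 0) :
    ∃ G : LaurentSeries (GenField k),
      (∀ G', IsNormalizedSeries l D G' ↔ G' = G) ∧
      (∀ f, IsPrincipalFunction D f → expandAtInfty _ _ f = G) ∧
      IsBalanced (fun j => (weightPart k l j : Set (GenField k))) (D 0 - divDegree D) G ∧
      (∀ j : ℕ, 1 ≤ j →
        G.coeff (D 0 - divDegree D + j) ∈ ringR k l ∧
        IsModularForm k l j (G.coeff (D 0 - divDegree D + j))) ∧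
      IsWeightedExpansion (fun j => (weightPart k l j : Set (GenField k))) (-1)
        ((D 0 - divDegree D : ℤ) : GenField k)
        (LaurentSeries.derivative (GenField k) G / G) ∧
      (CharZero k → ∃ H : LaurentSeries (GenField k),
        (∀ H', laurentComp H' (zSeries (genA k) (genB k)) = G ↔ H' = H) ∧
        IsBalanced (fun j => (weightPart k l j : Set (GenField k))) (D 0 - divDegree D) H ∧
        IsWeightedExpansion (fun j => (weightPart k l j : Set (GenField k))) (-1)
          ((D 0 - divDegree D : ℤ) : GenField k)
          (LaurentSeries.derivative (GenField k) H / H)) := by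
  rw [Nat.cast_mul] at h6l
  have h6 : (6 : k) ≠ 0 := by exact_mod_cast left_ne_zero_of_mul h6l
  have hl : (l : k) ≠ 0 := right_ne_zero_of_mul h6l
  have hl' : (l : GenField k) ≠ 0 := by
    have := (_root_.map_ne_zero (algebraMap k (GenField k))).mpr hl
    rwa [map_natCast] at this
  obtain ⟨G, hG1, hG2, hG⟩ := exists_normalizedSeries (isSmooth_generic h6) hl'
    torsionGraded_generic D hD
  refine ⟨G, hG1, hG2, hG.isBalanced, fun j _ => ⟨weightPart_subset_ringR (hG.coeff_mem j),
    isModularForm_of_mem_weightPart hl (hG.coeff_mem j)⟩, hG.logDeriv, fun hk => ?_⟩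
  have : CharZero (GenField k) := charZero_of_injective_algebraMap (algebraMap k (GenField k)).injective
  obtain ⟨v, hv, hv1, hz⟩ := exists_zSeries_eq (R := weightPart k l) (a := genA k) (b := genB k)
    genA_mem_weightPart genB_mem_weightPart
  obtain ⟨H, hH1, hH⟩ := hG.exists_laurentComp hv hv1
  rw [← hz] at hH1
  exact ⟨H, hH1, hH.isBalanced, hH.logDeriv⟩

end GenericSeries

/-! ### The Weierstrass zeta function and its addition formula -/

section Lattice

open Filter Topology

variable (L : PeriodPair)

/-- A function that is periodic with respect to a lattice and has only removable singularities is
constant. -/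
theorem exists_eq_of_periodic_removable {f : ℂ → ℂ} (hper : ∀ z, ∀ w ∈ L.lattice, f (z + w) = f z)
    (hf : ∀ z, ∃ g, AnalyticAt ℂ g z ∧ f =ᶠ[𝓝[≠] z] g) :
    ∃ c, ∀ z g, AnalyticAt ℂ g z → f =ᶠ[𝓝[≠] z] g → g z = c := by
  choose g hg hfg using hf
  have uniq : ∀ z h, AnalyticAt ℂ h z → f =ᶠ[𝓝[≠] z] h → h z = g z z := by
    intro z h hh hfh
    have h1 : Tendsto h (𝓝[≠] z) (𝓝 (h z)) := hh.continuousAt.tendsto.mono_left nhdsWithin_le_nhds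
    have h2 : Tendsto (g z) (𝓝[≠] z) (𝓝 (g z z)) :=
      (hg z).continuousAt.tendsto.mono_left nhdsWithin_le_nhds
    exact tendsto_nhds_unique h1 (h2.congr' ((hfg z).symm.trans hfh))
  set K : ℂ → ℂ := fun z => g z z with hK
  -- The regularized values near `z` are those of the single extension chosen at `z`, so they form
  -- an entire function.
  have hKg : ∀ z, K =ᶠ[𝓝 z] g z := by
    intro z
    have h1 := (hg z).eventually_analyticAt
    have h2 : ∀ᶠ y in 𝓝 z, y ≠ z → ∀ᶠ x in 𝓝[≠] y, f x = g z x := by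
      have h3 := eventually_nhdsWithin_iff.mp (hfg z)
      obtain ⟨U, hU, hUo, hzU⟩ := eventually_nhds_iff.mp h3
      filter_upwards [hUo.mem_nhds hzU] with y hy hyz
      have : U ∩ {z}ᶜ ∈ 𝓝 y := inter_mem (hUo.mem_nhds hy) (isOpen_compl_singleton.mem_nhds hyz)
      exact nhdsWithin_le_nhds (mem_of_superset this fun x hx => hU x hx.1 hx.2)
    filter_upwards [h1, h2] with y hy1 hy2
    by_cases hyz : y = z
    · rw [hyz]
    · exact (uniq y (g z) hy1 (hy2 hyz)).symm
  have hdiff : Differentiable ℂ K := fun z =>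
    ((hg z).congr (hKg z).symm).differentiableAt
  have hKper : ∀ z, ∀ w ∈ L.lattice, K (z + w) = K z := by
    intro z w hw
    have := uniq (z + w) (fun x => g z (x - w)) ((hg z).comp_of_eq (by fun_prop) (by ring)) ?_
    · rw [hK]
      simp only [← this, add_sub_cancel_right]
    · have h4 : Tendsto (fun x => x - w) (𝓝[≠] (z + w)) (𝓝[≠] z) := by
        apply tendsto_nhdsWithin_of_tendsto_nhds_of_eventually_within
        · have : Tendsto (fun x => x - w) (𝓝 (z + w)) (𝓝 (z + w - w)) :=
            (continuous_id.sub continuous_const).tendsto _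
          rw [add_sub_cancel_right] at this
          exact this.mono_left nhdsWithin_le_nhds
        · filter_upwards [self_mem_nhdsWithin] with x hx h5
          exact hx (by rw [Set.mem_singleton_iff] at h5 ⊢; rw [← h5]; ring)
      filter_upwards [h4.eventually (hfg z)] with x hx
      rw [← hx, ← hper (x - w) w hw, sub_add_cancel]
  refine ⟨K 0, fun z h hh hfh => (uniq z h hh hfh).trans ?_⟩
  -- An entire periodic function is bounded, and Liouville's theorem applies.
  exact hdiff.apply_eq_apply_of_bounded (IsZLattice.isCompact_range_of_periodic L.lattice _
    hdiff.continuous hKper).isBounded z 0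

/-- The regular part at the origin of the Weierstrass zeta function. -/
def zetaReg (z : ℂ) : ℂ :=
  ∑' l : L.lattice, if l.1 = 0 then 0 else (1 / (z - l) + 1 / l + z / l ^ 2)

/-- The summand is `s^2/((s - l) l^2)`, of order `|l|^(-3)`, which is summable over a plane lattice.
-/
theorem zetaReg_bound (r : ℝ) (hr : 0 < r) (s : ℂ) (hs : ‖s‖ < r) (l : ℂ) (h : 2 * r ≤ ‖l‖) :
    ‖1 / (s - l) + 1 / l + s / l ^ 2‖ ≤ 2 * r ^ 2 * ‖l‖ ^ (-3 : ℝ) := by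
  have h1 : s ≠ l := by rintro rfl; linarith
  have h2 : 0 < ‖l‖ := by linarith
  have hl : l ≠ 0 := norm_pos_iff.mp h2
  have hsl : s - l ≠ 0 := sub_ne_zero.mpr h1
  have h3 : ‖l‖ / 2 ≤ ‖s - l‖ := by
    rw [norm_sub_rev]
    exact le_trans (by linarith) (norm_sub_norm_le l s)
  have h4 : 1 / (s - l) + 1 / l + s / l ^ 2 = s ^ 2 / ((s - l) * l ^ 2) := by
    field_simp
    ring
  rw [h4, norm_div, norm_mul, norm_pow, norm_pow]
  have h5 : ‖s‖ ^ 2 / (‖s - l‖ * ‖l‖ ^ 2) ≤ r ^ 2 / (‖l‖ / 2 * ‖l‖ ^ 2) := by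
    gcongr
  refine h5.trans (le_of_eq ?_)
  rw [Real.rpow_neg h2.le]
  norm_cast
  field_simp

theorem hasSumLocallyUniformly_zetaReg : HasSumLocallyUniformly
    (fun (l : L.lattice) (z : ℂ) => if l.1 = 0 then 0 else (1 / (z - l) + 1 / l + z / l ^ 2))
    (zetaReg L) := by
  refine L.hasSumLocallyUniformly_aux (u := fun r l => 2 * r ^ 2 * ‖l‖ ^ (-3 : ℝ)) _
    (fun _ _ => (ZLattice.summable_norm_rpow _ _ (by simp; norm_num)).mul_left _) fun r hr =>
    Filter.eventually_atTop.mpr ⟨2 * r, ?_⟩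
  rintro _ h s hs l rfl
  split_ifs
  · simp only [norm_zero]; positivity
  · exact zetaReg_bound r hr s hs l h

theorem hasSum_zetaReg (z : ℂ) : HasSum
    (fun l : L.lattice => if l.1 = 0 then 0 else (1 / (z - l) + 1 / l + z / l ^ 2))
    (zetaReg L z) := (hasSumLocallyUniformly_zetaReg L).hasSum

theorem differentiableAt_zetaReg_term (l : L.lattice) {z : ℂ} (hz : z ∈ (↑L.lattice \ {0} : Set ℂ)ᶜ) :
    HasDerivAt (fun z : ℂ => if l.1 = 0 then 0 else (1 / (z - l) + 1 / l + z / l ^ 2))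
      (-(if l.1 = 0 then 0 else (1 / (z - l) ^ 2 - 1 / l ^ 2))) z := by
  split_ifs with h
  · simpa using hasDerivAt_const z (0 : ℂ)
  · have hzl : z - l ≠ 0 := by
      intro e
      exact hz (by rw [sub_eq_zero.mp e]; exact ⟨l.2, h⟩)
    have h1 : HasDerivAt (fun z : ℂ => z - l) 1 z := (hasDerivAt_id z).sub_const _
    have h2 := (h1.inv hzl).add_const (1 / (l : ℂ))
    have h3 := h2.add ((hasDerivAt_id z).div_const ((l : ℂ) ^ 2))
    refine (h3.congr_deriv (by ring)).congr_of_eventuallyEq (.of_forall fun y => ?_)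
    simp [one_div]

theorem differentiableOn_zetaReg : DifferentiableOn ℂ (zetaReg L) (↑L.lattice \ {0} : Set ℂ)ᶜ :=
  (hasSumLocallyUniformly_zetaReg L).hasSumLocallyUniformlyOn.differentiableOn
    (.of_forall fun _ => .fun_sum fun l _ _ hz =>
      (differentiableAt_zetaReg_term L l hz).differentiableAt.differentiableWithinAt)
    L.isOpen_compl_lattice_sdiff

theorem deriv_zetaReg {z : ℂ} (hz : z ∈ (↑L.lattice \ {0} : Set ℂ)ᶜ) :
    deriv (zetaReg L) z = -L.weierstrassPExcept 0 z := by
  have h1 := ((hasSumLocallyUniformly_zetaReg L).tendstoLocallyUniformlyOn.deriv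
    (.of_forall fun _ => .fun_sum fun l _ _ hz =>
      (differentiableAt_zetaReg_term L l hz).differentiableAt.differentiableWithinAt)
    L.isOpen_compl_lattice_sdiff).tendsto_at hz
  refine tendsto_nhds_unique h1 ((L.hasSum_weierstrassPExcept 0 z).neg.congr fun s => ?_)
  simp only [Function.comp_apply]
  rw [deriv_fun_sum fun l _ => (differentiableAt_zetaReg_term L l hz).differentiableAt]
  exact (Finset.sum_congr rfl fun l _ => (differentiableAt_zetaReg_term L l hz).deriv).symm

theorem analyticAt_zetaReg {z : ℂ} (hz : z ∈ (↑L.lattice \ {0} : Set ℂ)ᶜ) :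
    AnalyticAt ℂ (zetaReg L) z :=
  (differentiableOn_zetaReg L).analyticAt (L.isOpen_compl_lattice_sdiff.mem_nhds hz)

theorem zetaReg_neg (z : ℂ) : zetaReg L (-z) = -zetaReg L z := by
  rw [zetaReg, zetaReg, ← tsum_neg, ← (Equiv.neg L.lattice).tsum_eq]
  congr 1
  ext l
  simp only [Equiv.neg_apply, NegMemClass.coe_neg, neg_eq_zero]
  split_ifs
  · simp
  · rw [show -z - -(l : ℂ) = -(z - l) by ring, even_two.neg_pow, div_neg, div_neg, neg_div]
    ring

theorem zetaReg_zero : zetaReg L 0 = 0 := by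
  have := zetaReg_neg L 0
  rw [neg_zero] at this
  linear_combination this / 2

/-- The Weierstrass zeta function. -/
def zetaFn (z : ℂ) : ℂ := 1 / z + zetaReg L z

theorem zetaFn_neg (z : ℂ) : zetaFn L (-z) = -zetaFn L z := by
  rw [zetaFn, zetaFn, zetaReg_neg, div_neg]; ring

theorem weierstrassP_eq (z : ℂ) : L.weierstrassP z = 1 / z ^ 2 + L.weierstrassPExcept 0 z := by
  have := L.weierstrassPExcept_add 0 z
  simp only [ZeroMemClass.coe_zero, sub_zero] at this
  rw [← this]; simp; ring

theorem hasDerivAt_zetaFn {z : ℂ} (hz : z ∉ L.lattice) :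
    HasDerivAt (zetaFn L) (-L.weierstrassP z) z := by
  have hz0 : z ≠ 0 := by rintro rfl; exact hz (zero_mem _)
  have hz' : z ∈ (↑L.lattice \ {0} : Set ℂ)ᶜ := fun h => hz h.1
  have h1 := (analyticAt_zetaReg L hz').differentiableAt.hasDerivAt
  rw [deriv_zetaReg L hz'] at h1
  have h2 := (hasDerivAt_inv hz0).add h1
  rw [weierstrassP_eq]
  refine (h2.congr_deriv (by rw [one_div]; ring)).congr_of_eventuallyEq (.of_forall fun y => ?_)
  simp [zetaFn]

theorem isConnected_compl_lattice : IsConnected ((L.lattice : Set ℂ)ᶜ) := by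
  have : Countable L.lattice := L.latticeEquivProd.toEquiv.countable_iff.mpr inferInstance
  exact Set.Countable.isConnected_compl_of_one_lt_rank (by simp) (Set.to_countable _)

theorem isOpen_compl_lattice : IsOpen ((L.lattice : Set ℂ)ᶜ) := L.isClosed_lattice.isOpen_compl

/-- The quasi-period of the zeta function. -/
theorem exists_zetaFn_add {w : ℂ} (hw : w ∈ L.lattice) :
    ∃ η, ∀ z, z ∉ L.lattice → zetaFn L (z + w) = zetaFn L z + η := by
  have hzw : ∀ z, z ∉ L.lattice → z + w ∉ L.lattice := fun z hz h =>
    hz (by simpa using sub_mem h hw)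
  have hd : ∀ z ∈ ((L.lattice : Set ℂ)ᶜ), HasDerivAt (fun z => zetaFn L (z + w) - zetaFn L z) 0 z := by
    intro z hz
    have h1 := (hasDerivAt_zetaFn L (hzw z hz)).comp_add_const z w
    have h2 := h1.sub (hasDerivAt_zetaFn L hz)
    have h3 : L.weierstrassP (z + w) = L.weierstrassP z := L.weierstrassP_add_coe z ⟨w, hw⟩
    rw [h3, sub_self] at h2
    exact h2
  obtain ⟨η, hη⟩ := (isOpen_compl_lattice L).exists_is_const_of_deriv_eq_zero
    (isConnected_compl_lattice L).isPreconnected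
    (fun z hz => (hd z hz).differentiableAt.differentiableWithinAt) (fun z hz => (hd z hz).deriv)
  exact ⟨η, fun z hz => by rw [← hη z hz]; ring⟩

/-- The slope function `ζ(u + v) - ζ(u) - ζ(v)`. -/
def zetaSlope (u v : ℂ) : ℂ := zetaFn L (u + v) - zetaFn L u - zetaFn L v

theorem zetaSlope_comm (u v : ℂ) : zetaSlope L u v = zetaSlope L v u := by
  rw [zetaSlope, zetaSlope, add_comm u v]; ring

theorem zetaSlope_neg_add (u v : ℂ) : zetaSlope L (-(u + v)) v = zetaSlope L u v := by
  rw [zetaSlope, zetaSlope, zetaFn_neg, show -(u + v) + v = -u by ring, zetaFn_neg]; ring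

theorem notMem_add_iff {w : ℂ} (hw : w ∈ L.lattice) (z : ℂ) :
    z + w ∈ L.lattice ↔ z ∈ L.lattice :=
  ⟨fun h => by simpa using sub_mem h hw, fun h => add_mem h hw⟩

/-- The quasi-period of `w` is added to both `ζ(u+v)` and `ζ(u)` and cancels. -/
theorem zetaSlope_add_left {u v w : ℂ} (hu : u ∉ L.lattice) (huv : u + v ∉ L.lattice)
    (hw : w ∈ L.lattice) : zetaSlope L (u + w) v = zetaSlope L u v := by
  obtain ⟨η, hη⟩ := exists_zetaFn_add L hw
  rw [zetaSlope, zetaSlope, hη u hu, show u + w + v = u + v + w by ring, hη _ huv]; ring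

theorem weierstrassP_add_mem {w : ℂ} (hw : w ∈ L.lattice) (z : ℂ) :
    L.weierstrassP (z + w) = L.weierstrassP z := L.weierstrassP_add_coe z ⟨w, hw⟩

theorem derivWeierstrassP_add_mem {w : ℂ} (hw : w ∈ L.lattice) (z : ℂ) :
    L.derivWeierstrassP (z + w) = L.derivWeierstrassP z := L.derivWeierstrassP_add_coe z ⟨w, hw⟩

theorem analyticAt_zetaFn {z : ℂ} (hz : z ∉ L.lattice) : AnalyticAt ℂ (zetaFn L) z := by
  have hd : DifferentiableOn ℂ (zetaFn L) ((L.lattice : Set ℂ)ᶜ) := fun z hz =>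
    (hasDerivAt_zetaFn L hz).differentiableAt.differentiableWithinAt
  exact hd.analyticAt ((isOpen_compl_lattice L).mem_nhds hz)

theorem analyticAt_weierstrassP {z : ℂ} (hz : z ∉ L.lattice) : AnalyticAt ℂ L.weierstrassP z :=
  L.analyticOnNhd_weierstrassP z hz

theorem hasDerivAt_weierstrassP {z : ℂ} (hz : z ∉ L.lattice) :
    HasDerivAt L.weierstrassP (L.derivWeierstrassP z) z := by
  rw [← L.deriv_weierstrassP]
  exact (analyticAt_weierstrassP L hz).differentiableAt.hasDerivAt

theorem eventually_notMem_lattice (z : ℂ) : ∀ᶠ x in 𝓝[≠] z, x ∉ L.lattice := by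
  have := L.compl_lattice_sdiff_singleton_mem_nhds z
  filter_upwards [nhdsWithin_le_nhds this, self_mem_nhdsWithin] with x hx hxz hxl
  exact hx ⟨hxl, hxz⟩

theorem analyticAt_zetaFn_add {z v : ℂ} (hz : z + v ∉ L.lattice) :
    AnalyticAt ℂ (fun z => zetaFn L (z + v)) z :=
  (analyticAt_zetaFn L hz).fun_comp (f := fun z => z + v) (by fun_prop)

theorem analyticAt_weierstrassP_add {z v : ℂ} (hz : z + v ∉ L.lattice) :
    AnalyticAt ℂ (fun z => L.weierstrassP (z + v)) z :=
  (analyticAt_weierstrassP L hz).fun_comp (f := fun z => z + v) (by fun_prop)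

/-- `(ζ(u + v) - ζ(u) - ζ(v)) ^ 2 = ℘(u) + ℘(v) + ℘(u + v)`. -/
theorem zetaSlope_sq {u v : ℂ} (hu : u ∉ L.lattice) (hv : v ∉ L.lattice) (huv : u + v ∉ L.lattice) :
    zetaSlope L u v ^ 2 = L.weierstrassP u + L.weierstrassP v + L.weierstrassP (u + v) := by
  let S : Set ℂ := {z | z ∉ L.lattice ∧ z + v ∉ L.lattice}
  let f : ℂ → ℂ := fun z => if z ∈ S then
    zetaSlope L z v ^ 2 - L.weierstrassP z - L.weierstrassP v - L.weierstrassP (z + v) else 0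
  have hSper : ∀ z, ∀ w ∈ L.lattice, (z + w ∈ S ↔ z ∈ S) := by
    intro z w hw
    simp only [S, Set.mem_ofPred_eq]
    rw [notMem_add_iff L hw, show z + w + v = z + v + w by ring, notMem_add_iff L hw]
  have hper : ∀ z, ∀ w ∈ L.lattice, f (z + w) = f z := by
    intro z w hw
    simp only [f, hSper z w hw]
    split_ifs with h
    · rw [zetaSlope_add_left L h.1 h.2 hw, weierstrassP_add_mem L hw,
        show z + w + v = z + v + w by ring, weierstrassP_add_mem L hw]
    · rfl
  -- The involution `z ↦ -(z+v)` exchanges the poles at `0` and `-v` modulo the lattice and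
  -- preserves the function, so only the pole at `0` needs an expansion.
  have hSsymm : ∀ z, (-(z + v) ∈ S ↔ z ∈ S) := by
    intro z
    simp only [S, Set.mem_ofPred_eq, show -(z + v) + v = -z by ring, neg_mem_iff]
    tauto
  have hfsymm : ∀ z, f (-(z + v)) = f z := by
    intro z
    simp only [f, hSsymm z]
    split_ifs
    · rw [zetaSlope_neg_add, show -(z + v) + v = -z by ring, L.weierstrassP_neg, L.weierstrassP_neg]
      ring
    · rfl
  have hS_nhds : ∀ z, ∀ᶠ x in 𝓝[≠] z, x ∈ S := by
    intro z
    have h2 : Tendsto (fun x => x + v) (𝓝[≠] z) (𝓝[≠] (z + v)) := by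
      apply tendsto_nhdsWithin_of_tendsto_nhds_of_eventually_within
      · exact ((continuous_id.add continuous_const).tendsto z).mono_left nhdsWithin_le_nhds
      · filter_upwards [self_mem_nhdsWithin] with x hx h5
        exact hx (by rw [Set.mem_singleton_iff] at h5 ⊢; exact add_right_cancel h5)
    filter_upwards [eventually_notMem_lattice L z, h2.eventually (eventually_notMem_lattice L (z + v))]
      with x h3 h4 using ⟨h3, h4⟩
  -- Near 0 the slope is `H(z) - 1/z` with `H(0) = 0` and `H'(0) = -℘(v)`. Its square contributes
  -- `1/z^2 - 2H(z)/z + H(z)^2`, so the pole cancels against `℘(z)`, and the value left at 0 is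
  -- `2℘(v) - ℘(v) - ℘(v) = 0`.
  have h0 : ∃ g, AnalyticAt ℂ g 0 ∧ f =ᶠ[𝓝[≠] 0] g ∧ g 0 = 0 := by
    let H : ℂ → ℂ := fun z => zetaFn L (z + v) - zetaFn L v - zetaReg L z
    have hv0 : (0 : ℂ) + v ∉ L.lattice := by rwa [zero_add]
    have h0m : (0 : ℂ) ∈ (↑L.lattice \ {0} : Set ℂ)ᶜ := fun h => h.2 rfl
    have hH : AnalyticAt ℂ H 0 :=
      ((analyticAt_zetaFn_add L hv0).sub analyticAt_const).sub (analyticAt_zetaReg L h0m)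
    have hH0 : H 0 = 0 := by simp [H, zetaReg_zero]
    have hH' : deriv H 0 = -L.weierstrassP v := by
      have h1 := ((hasDerivAt_zetaFn L hv0).comp_add_const 0 v).sub_const (zetaFn L v)
      have h2 := h1.sub (analyticAt_zetaReg L h0m).differentiableAt.hasDerivAt
      rw [deriv_zetaReg L h0m, L.weierstrassPExcept_zero, zero_add, neg_zero, sub_zero] at h2
      exact h2.deriv
    have hds : AnalyticAt ℂ (dslope H 0) 0 := by
      obtain ⟨U, hU, hUa⟩ := hH.eventually_analyticAt.exists_mem
      have := (Complex.differentiableOn_dslope hU).mpr fun z hz =>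
        (hUa z hz).differentiableAt.differentiableWithinAt
      exact this.analyticAt hU
    refine ⟨fun z => -2 * dslope H 0 z + H z ^ 2 - L.weierstrassPExcept 0 z - L.weierstrassP v
      - L.weierstrassP (z + v), ?_, ?_, ?_⟩
    · exact ((((analyticAt_const.mul hds).add (hH.pow 2)).sub
        (L.analyticAt_weierstrassPExcept 0)).sub analyticAt_const).sub
        (analyticAt_weierstrassP_add L hv0)
    · filter_upwards [hS_nhds 0, self_mem_nhdsWithin] with z hz hz0
      have hz0' : z ≠ 0 := hz0
      simp only [f, if_pos hz]
      rw [dslope_of_ne _ hz0', slope_def_field, hH0, weierstrassP_eq L z, zetaSlope]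
      have : zetaFn L (z + v) - zetaFn L z - zetaFn L v = H z - 1 / z := by
        simp only [H, zetaFn]; ring
      rw [this]
      field_simp
      ring
    · beta_reduce
      rw [dslope_same, hH', hH0, L.weierstrassPExcept_zero, zero_add]; ring
  obtain ⟨g, hg, hfg, hg0⟩ := h0
  have hlat : ∀ z ∈ L.lattice, ∃ g, AnalyticAt ℂ g z ∧ f =ᶠ[𝓝[≠] z] g := by
    intro z hz
    refine ⟨fun x => g (x - z), hg.comp_of_eq (by fun_prop) (by simp), ?_⟩
    have h4 : Tendsto (fun x => x - z) (𝓝[≠] z) (𝓝[≠] 0) := by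
      apply tendsto_nhdsWithin_of_tendsto_nhds_of_eventually_within
      · have : Tendsto (fun x => x - z) (𝓝 z) (𝓝 (z - z)) :=
          (continuous_id.sub continuous_const).tendsto _
        rw [sub_self] at this
        exact this.mono_left nhdsWithin_le_nhds
      · filter_upwards [self_mem_nhdsWithin] with x hx h5
        exact hx (sub_eq_zero.mp h5)
    filter_upwards [h4.eventually hfg] with x hx
    rw [← hx, ← hper (x - z) z hz, sub_add_cancel]
  have hnot : ∀ z ∈ S, AnalyticAt ℂ (fun z => zetaSlope L z v ^ 2 - L.weierstrassP z -
      L.weierstrassP v - L.weierstrassP (z + v)) z ∧ f =ᶠ[𝓝[≠] z] (fun z => zetaSlope L z v ^ 2 -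
      L.weierstrassP z - L.weierstrassP v - L.weierstrassP (z + v)) := by
    intro z hz
    refine ⟨?_, ?_⟩
    · exact ((((((analyticAt_zetaFn_add L hz.2).sub (analyticAt_zetaFn L hz.1)).sub
        analyticAt_const).pow 2).sub (analyticAt_weierstrassP L hz.1)).sub analyticAt_const).sub
        (analyticAt_weierstrassP_add L hz.2)
    · filter_upwards [hS_nhds z] with x hx
      simp only [f, if_pos hx]
  obtain ⟨c, hc⟩ := exists_eq_of_periodic_removable L hper (f := f) (by
    intro z
    by_cases hz : z ∈ L.lattice
    · exact hlat z hz
    by_cases hzv : z + v ∈ L.lattice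
    · obtain ⟨g', hg', hfg'⟩ := hlat (-(z + v)) (neg_mem hzv)
      refine ⟨fun x => g' (-(x + v)), hg'.comp_of_eq (by fun_prop) rfl, ?_⟩
      have h4 : Tendsto (fun x => -(x + v)) (𝓝[≠] z) (𝓝[≠] (-(z + v))) := by
        apply tendsto_nhdsWithin_of_tendsto_nhds_of_eventually_within
        · exact (((continuous_id.add continuous_const).neg).tendsto z).mono_left nhdsWithin_le_nhds
        · filter_upwards [self_mem_nhdsWithin] with x hx h5
          exact hx (by
            rw [Set.mem_singleton_iff] at h5 ⊢
            exact add_right_cancel (neg_injective h5))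
      filter_upwards [h4.eventually hfg'] with x hx
      rw [← hx, hfsymm]
    · exact ⟨_, hnot z ⟨hz, hzv⟩⟩)
  have hc0 : c = 0 := by rw [← hc 0 g hg hfg, hg0]
  have := hc u _ (hnot u ⟨hu, huv⟩).1 (hnot u ⟨hu, huv⟩).2
  rw [hc0] at this
  linear_combination this

/-- `(ζ(u + v) - ζ(u) - ζ(v)) (℘(u) - ℘(u + v)) = (℘'(u) + ℘'(u + v)) / 2`. -/
theorem zetaSlope_mul_left {u v : ℂ} (hu : u ∉ L.lattice) (hv : v ∉ L.lattice)
    (huv : u + v ∉ L.lattice) : 2 * zetaSlope L u v * (L.weierstrassP u - L.weierstrassP (u + v)) =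
      L.derivWeierstrassP u + L.derivWeierstrassP (u + v) := by
  -- The formula is the derivative with respect to `u` of the identity for the square.
  have h1 : HasDerivAt (fun z => zetaSlope L z v) (-L.weierstrassP (u + v) - -L.weierstrassP u) u :=
    (((hasDerivAt_zetaFn L huv).comp_add_const u v).sub (hasDerivAt_zetaFn L hu)).sub_const _
  have h2 := h1.pow 2
  have h3 : HasDerivAt (fun z => L.weierstrassP z + L.weierstrassP v + L.weierstrassP (z + v))
      (L.derivWeierstrassP u + L.derivWeierstrassP (u + v)) u :=
    ((hasDerivAt_weierstrassP L hu).add_const _).add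
      ((hasDerivAt_weierstrassP L huv).comp_add_const u v)
  have h4 : (fun z => zetaSlope L z v ^ 2) =ᶠ[𝓝 u]
      (fun z => L.weierstrassP z + L.weierstrassP v + L.weierstrassP (z + v)) := by
    have ho := isOpen_compl_lattice L
    filter_upwards [ho.mem_nhds hu, (ho.preimage (continuous_id.add continuous_const)).mem_nhds
      (show u ∈ (fun z : ℂ => z + v) ⁻¹' _ from huv)] with z hz1 hz2
    exact zetaSlope_sq L hz1 hv hz2
  have h5 := (h2.congr_of_eventuallyEq h4.symm).unique h3
  rw [← h5]
  push_cast
  ring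

theorem zetaSlope_mul_add {u v : ℂ} (hu : u ∉ L.lattice) (hv : v ∉ L.lattice)
    (huv : u + v ∉ L.lattice) : 2 * zetaSlope L u v * (L.weierstrassP v - L.weierstrassP (u + v)) =
      L.derivWeierstrassP v + L.derivWeierstrassP (u + v) := by
  have := zetaSlope_mul_left L hv hu (by rwa [add_comm])
  rwa [zetaSlope_comm, add_comm v u] at this

theorem zetaSlope_mul {u v : ℂ} (hu : u ∉ L.lattice) (hv : v ∉ L.lattice)
    (huv : u + v ∉ L.lattice) : 2 * zetaSlope L u v * (L.weierstrassP u - L.weierstrassP v) =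
      L.derivWeierstrassP u - L.derivWeierstrassP v := by
  linear_combination zetaSlope_mul_left L hu hv huv - zetaSlope_mul_add L hu hv huv

end Lattice

/-! ### Uniformization of the curve of a lattice -/

section LatticeCurve

open Filter Topology

variable (L : PeriodPair)

/-- The coefficient `a = -15 G₄` of the curve attached to a lattice. -/
def latA : ℂ := -15 * L.G 4

/-- The coefficient `b = -35 G₆` of the curve attached to a lattice. -/
def latB : ℂ := -35 * L.G 6

/-- The `y`-coordinate `℘' / 2`. -/
def latY (z : ℂ) : ℂ := L.derivWeierstrassP z / 2

theorem latY_sq {z : ℂ} (hz : z ∉ L.lattice) :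
    latY L z ^ 2 = L.weierstrassP z ^ 3 + latA L * L.weierstrassP z + latB L := by
  have := L.derivWeierstrassP_sq z hz
  rw [PeriodPair.g₂, PeriodPair.g₃] at this
  rw [latY, latA, latB]
  linear_combination this / 4

theorem latY_neg (z : ℂ) : latY L (-z) = -latY L z := by
  rw [latY, latY, L.derivWeierstrassP_neg]; ring

theorem latY_add_mem {w : ℂ} (hw : w ∈ L.lattice) (z : ℂ) : latY L (z + w) = latY L z := by
  rw [latY, latY, derivWeierstrassP_add_mem L hw]

theorem tendsto_sq_mul_weierstrassP :
    Tendsto (fun z => z ^ 2 * L.weierstrassP z) (𝓝[≠] 0) (𝓝 1) := by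
  have h1 : Tendsto (fun z => 1 + z ^ 2 * L.weierstrassPExcept 0 z) (𝓝 0) (𝓝 (1 + 0 ^ 2 * 0)) := by
    have := (L.analyticAt_weierstrassPExcept 0).continuousAt.tendsto
    rw [L.weierstrassPExcept_zero] at this
    exact tendsto_const_nhds.add (((continuous_pow 2).tendsto 0).mul this)
  have h2 := h1.mono_left (nhdsWithin_le_nhds (s := {0}ᶜ))
  rw [mul_zero, add_zero] at h2
  refine h2.congr' ?_
  filter_upwards [self_mem_nhdsWithin] with z hz
  have hz0 : z ≠ 0 := hz
  rw [weierstrassP_eq]; field_simp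

/-- By the identity theorem `℘` would be constant off the lattice, contradicting the limit 1 of `z^2
℘(z)` at 0. -/
theorem weierstrassP_not_eventually_const {z : ℂ} (hz : z ∉ L.lattice) (c : ℂ) :
    ¬ ∀ᶠ x in 𝓝 z, L.weierstrassP x = c := by
  intro h
  have h1 : Set.EqOn L.weierstrassP (fun _ => c) ((L.lattice : Set ℂ)ᶜ) :=
    L.analyticOnNhd_weierstrassP.eqOn_of_preconnected_of_eventuallyEq (fun _ _ => analyticAt_const)
      (isConnected_compl_lattice L).isPreconnected hz h
  have h2 : Tendsto (fun z : ℂ => z ^ 2 * c) (𝓝[≠] 0) (𝓝 (0 ^ 2 * c)) :=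
    (((continuous_pow 2).mul continuous_const).tendsto 0).mono_left nhdsWithin_le_nhds
  have h3 := h2.congr' (f₂ := fun z => z ^ 2 * L.weierstrassP z) (by
    filter_upwards [eventually_notMem_lattice L 0] with x hx
    rw [h1 hx])
  have := tendsto_nhds_unique h3 (tendsto_sq_mul_weierstrassP L)
  norm_num at this

theorem eventually_weierstrassP_ne {z : ℂ} (hz : z ∉ L.lattice) (c : ℂ) :
    ∀ᶠ x in 𝓝[≠] z, L.weierstrassP x ≠ c := by
  rcases ((analyticAt_weierstrassP L hz).sub
    (analyticAt_const (v := c))).eventually_eq_zero_or_eventually_ne_zero with h | h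
  · exact absurd (h.mono fun x hx => sub_eq_zero.mp hx) (weierstrassP_not_eventually_const L hz c)
  · exact h.mono fun x hx => sub_ne_zero.mp hx

/-- The points with parameters `u`, `v`, `w` with `u + v + w = 0` are collinear. -/
theorem lattice_isLineSection {u v w : ℂ} (hu : u ∉ L.lattice) (hv : v ∉ L.lattice)
    (hw : w ∉ L.lattice) (h : u + v + w = 0) :
    IsLineSection (latA L) (latB L) (zetaSlope L u v)
      (latY L u - zetaSlope L u v * L.weierstrassP u) (L.weierstrassP u) (latY L u)
      (L.weierstrassP v) (latY L v) (L.weierstrassP w) (latY L w) := by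
  have hw' : w = -(u + v) := by linear_combination h
  subst hw'
  have huv : u + v ∉ L.lattice := fun h => hw (neg_mem h)
  rw [L.weierstrassP_neg, latY_neg]
  have h1 := zetaSlope_sq L hu hv huv
  have h2 := zetaSlope_mul L hu hv huv
  have h3 := zetaSlope_mul_left L hu hv huv
  have hsq := latY_sq L hu
  -- When the abscissae differ, subtracting the two curve equations and cancelling `℘(v) - ℘(u)`
  -- gives the relation between slope and intercept.
  have he2 : ∀ v, v ∉ L.lattice → u + v ∉ L.lattice → L.weierstrassP v ≠ L.weierstrassP u →
      L.weierstrassP u * L.weierstrassP v + (L.weierstrassP u + L.weierstrassP v) *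
        (zetaSlope L u v ^ 2 - L.weierstrassP u - L.weierstrassP v) - latA L + 2 * zetaSlope L u v *
        (latY L u - zetaSlope L u v * L.weierstrassP u) = 0 := by
    intro v hv huv hne
    have h2 := zetaSlope_mul L hu hv huv
    have hsqv := latY_sq L hv
    apply mul_left_cancel₀ (sub_ne_zero.mpr hne)
    have h2' : latY L v = latY L u - zetaSlope L u v * (L.weierstrassP u - L.weierstrassP v) := by
      rw [latY, latY]; linear_combination h2 / 2
    rw [h2'] at hsqv
    linear_combination hsqv - hsq
  have he : L.weierstrassP u * L.weierstrassP v + (L.weierstrassP u + L.weierstrassP v) *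
        (zetaSlope L u v ^ 2 - L.weierstrassP u - L.weierstrassP v) - latA L + 2 * zetaSlope L u v *
        (latY L u - zetaSlope L u v * L.weierstrassP u) = 0 := by
    -- The case of equal abscissae, including tangents, follows by letting `v` vary, since `℘(x) ≠
    -- ℘(u)` for `x` near but different from `v`.
    have hs : ContinuousAt (fun v => zetaSlope L u v) v := by
      have h5 := (analyticAt_zetaFn_add L (z := v) (v := u) (by rwa [add_comm])).continuousAt
      simp only [zetaSlope, add_comm u]
      exact (h5.sub continuousAt_const).sub (analyticAt_zetaFn L hv).continuousAt
    have hP := (analyticAt_weierstrassP L hv).continuousAt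
    have hc : ContinuousAt (fun v => L.weierstrassP u * L.weierstrassP v +
        (L.weierstrassP u + L.weierstrassP v) *
        (zetaSlope L u v ^ 2 - L.weierstrassP u - L.weierstrassP v) - latA L + 2 * zetaSlope L u v *
        (latY L u - zetaSlope L u v * L.weierstrassP u)) v := by
      fun_prop
    refine tendsto_nhds_unique (hc.tendsto.mono_left (nhdsWithin_le_nhds (s := {v}ᶜ))) ?_
    refine tendsto_const_nhds.congr' ?_
    have ho := isOpen_compl_lattice L
    filter_upwards [eventually_weierstrassP_ne L hv (L.weierstrassP u), nhdsWithin_le_nhds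
      (ho.mem_nhds hv), nhdsWithin_le_nhds ((ho.preimage (continuous_const.add continuous_id)).mem_nhds
      (show v ∈ (fun z : ℂ => u + z) ⁻¹' _ from huv))] with x hx1 hx2 hx3
    exact (he2 x hx2 hx3 hx1).symm
  refine ⟨⟨by ring, ?_, ?_⟩, h1.symm, ?_, ?_⟩
  · rw [latY, latY]; linear_combination h2 / 2
  · rw [latY, latY]; linear_combination h3 / 2
  · linear_combination he - (L.weierstrassP u + L.weierstrassP v) * h1
  · linear_combination (-hsq + L.weierstrassP u * he - (L.weierstrassP u * L.weierstrassP v) * h1)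

/-- Differentiating the equation for `℘'^2` gives the claim times `℘'`; the factor is nonzero in a
punctured neighbourhood and both sides are continuous. -/
theorem deriv_derivWeierstrassP {z : ℂ} (hz : z ∉ L.lattice) :
    deriv L.derivWeierstrassP z = 6 * L.weierstrassP z ^ 2 + 2 * latA L := by
  have ho := isOpen_compl_lattice L
  have key : ∀ x, x ∉ L.lattice → L.derivWeierstrassP x *
      (deriv L.derivWeierstrassP x - (6 * L.weierstrassP x ^ 2 + 2 * latA L)) = 0 := by
    intro x hx
    have h1 := ((L.analyticOnNhd_derivWeierstrassP x hx).differentiableAt.hasDerivAt).pow 2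
    have hP := hasDerivAt_weierstrassP L hx
    have h2 := ((((hP.pow 3).add (hP.const_mul (latA L))).add_const (latB L)).const_mul 4)
    have h3 : (L.derivWeierstrassP ^ 2) =ᶠ[𝓝 x] fun y => 4 * ((L.weierstrassP ^ 3 + fun y => latA L *
        L.weierstrassP y) y + latB L) := by
      filter_upwards [ho.mem_nhds hx] with y hy
      have := latY_sq L hy
      rw [latY] at this
      simp only [Pi.pow_apply, Pi.add_apply]
      linear_combination 4 * this
    have h4 := (h1.congr_of_eventuallyEq h3.symm).unique h2
    push_cast at h4
    linear_combination h4 / 2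
  have hne : ∀ᶠ x in 𝓝[≠] z, L.derivWeierstrassP x ≠ 0 := by
    rcases (L.analyticOnNhd_derivWeierstrassP z hz).eventually_eq_zero_or_eventually_ne_zero with h | h
    · have h1 : Set.EqOn L.derivWeierstrassP (fun _ => 0) ((L.lattice : Set ℂ)ᶜ) :=
        L.analyticOnNhd_derivWeierstrassP.eqOn_of_preconnected_of_eventuallyEq
          (fun _ _ => analyticAt_const) (isConnected_compl_lattice L).isPreconnected hz h
      obtain ⟨c, hc⟩ := ho.exists_is_const_of_deriv_eq_zero
        (isConnected_compl_lattice L).isPreconnected L.differentiableOn_weierstrassP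
        (fun x hx => by rw [L.deriv_weierstrassP]; exact h1 hx)
      exact absurd (mem_of_superset (ho.mem_nhds hz) hc) (weierstrassP_not_eventually_const L hz c)
    · exact h
  have hP := (analyticAt_weierstrassP L hz).continuousAt
  have hP' := (L.analyticOnNhd_derivWeierstrassP z hz).deriv.continuousAt
  have hc : ContinuousAt (fun x => deriv L.derivWeierstrassP x -
      (6 * L.weierstrassP x ^ 2 + 2 * latA L)) z := by
    fun_prop
  rw [← sub_eq_zero]
  refine tendsto_nhds_unique (hc.tendsto.mono_left (nhdsWithin_le_nhds (s := {z}ᶜ))) ?_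
  refine tendsto_const_nhds.congr' ?_
  filter_upwards [hne, nhdsWithin_le_nhds (ho.mem_nhds hz)] with x hx1 hx2
  exact ((mul_eq_zero.mp (key x hx2)).resolve_left hx1).symm

/-- The recursion for the higher derivatives of `℘` coming from `℘'' = 6 ℘ ^ 2 + 2 a`. -/
theorem iteratedDeriv_weierstrassP_add_two {z : ℂ} (hz : z ∉ L.lattice) (n : ℕ) :
    iteratedDeriv (n + 2) L.weierstrassP z = 6 * (∑ i ∈ Finset.range (n + 1), (n.choose i : ℂ) *
      iteratedDeriv i L.weierstrassP z * iteratedDeriv (n - i) L.weierstrassP z) +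
      if n = 0 then 2 * latA L else 0 := by
  have hcd : ContDiffAt ℂ n L.weierstrassP z := (analyticAt_weierstrassP L hz).contDiffAt
  rw [iteratedDeriv_succ', iteratedDeriv_succ', L.deriv_weierstrassP]
  have h1 : deriv L.derivWeierstrassP =ᶠ[𝓝 z]
      (fun x => 6 * (L.weierstrassP * L.weierstrassP) x + 2 * latA L) := by
    filter_upwards [(isOpen_compl_lattice L).mem_nhds hz] with x hx
    rw [deriv_derivWeierstrassP L hx, Pi.mul_apply]; ring
  have h2 : ContDiffAt ℂ n (fun x => 6 * (L.weierstrassP * L.weierstrassP) x) z :=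
    contDiffAt_const.mul (hcd.mul hcd)
  rw [h1.iteratedDeriv_eq, ← iteratedDeriv_mul hcd hcd,
    iteratedDeriv_fun_add h2 contDiffAt_const, iteratedDeriv_const,
    iteratedDeriv_const_mul_field]

/-- The points of the parametrized curve are nonsingular. -/
theorem lattice_nonsingular {z : ℂ} (hz : z ∉ L.lattice) :
    (curve (latA L) (latB L)).Nonsingular (L.weierstrassP z) (latY L z) := by
  rw [curve_nonsingular_iff]
  refine ⟨latY_sq L hz, ?_⟩
  by_contra hcon
  push Not at hcon
  obtain ⟨h1, h2⟩ := hcon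
  have hY : L.derivWeierstrassP z = 0 := by rw [latY] at h2; linear_combination h2
  have hd1 : iteratedDeriv 1 L.weierstrassP z = 0 := by rw [iteratedDeriv_one, L.deriv_weierstrassP, hY]
  -- At a singular point `℘'` and `℘'' = 6℘^2 + 2a` both vanish, and the recursion then kills every
  -- higher derivative, so `℘` would be locally constant.
  have hd : ∀ n, 1 ≤ n → iteratedDeriv n L.weierstrassP z = 0 := by
    intro n
    induction n using Nat.strong_induction_on with
    | _ n ih =>
      intro hn
      rcases n with _ | _ | n
      · omega
      · exact hd1
      · rw [iteratedDeriv_weierstrassP_add_two L hz]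
        rcases Nat.eq_zero_or_pos n with rfl | hn'
        · simp; linear_combination 2 * h1
        · rw [if_neg (by omega), Finset.sum_eq_zero, mul_zero, add_zero]
          intro i hi
          rcases Nat.eq_zero_or_pos i with rfl | hi'
          · rw [Nat.sub_zero, ih n (by omega) hn', mul_zero]
          · have := Finset.mem_range.mp hi
            rw [ih i (by omega) hi', mul_zero, zero_mul]
  apply weierstrassP_not_eventually_const L hz (L.weierstrassP z)
  have hp := ((analyticAt_weierstrassP L hz).sub
    (analyticAt_const (v := L.weierstrassP z))).hasFPowerSeriesAt
  have h0 : ∀ n, iteratedDeriv n (L.weierstrassP - fun _ => L.weierstrassP z) z = 0 := by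
    intro n
    rw [iteratedDeriv_sub (analyticAt_weierstrassP L hz).contDiffAt contDiffAt_const,
      iteratedDeriv_const]
    rcases Nat.eq_zero_or_pos n with rfl | hn
    · simp
    · rw [if_neg (by omega), hd n hn, sub_zero]
  have h3 : (FormalMultilinearSeries.ofScalars ℂ (fun n =>
      iteratedDeriv n (L.weierstrassP - fun _ => L.weierstrassP z) z / (n.factorial : ℂ))) = 0 := by
    have : (fun n => iteratedDeriv n (L.weierstrassP - fun _ => L.weierstrassP z) z /
        (n.factorial : ℂ)) = 0 := by
      ext n; rw [h0, zero_div]; rfl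
    rw [this]; ext n; simp [FormalMultilinearSeries.ofScalars]
  rw [h3] at hp
  filter_upwards [hp.eventually_eq_zero] with x hx
  exact sub_eq_zero.mp hx

/-- A double point of a line section whose ordinate vanishes is singular. -/
theorem IsLineSection.ne_zero_of_eq {F : Type*} [Field F] {a b lam nu x y₁ y₂ x₃ y₃ : F}
    (h : IsLineSection a b lam nu x y₁ x y₂ x₃ y₃) (hn : (curve a b).Nonsingular x y₁) :
    2 * y₁ ≠ 0 := by
  intro hy
  obtain ⟨⟨h1, h2, h3⟩, e1, e2, e3⟩ := h
  rw [curve_nonsingular_iff] at hn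
  rcases hn.2 with h | h
  · apply h
    linear_combination lam * hy - e2 - 2 * lam * h1 + 2 * x * e1
  · exact h hy

/-- If `2u` is not a lattice point, the tangent at `u` is a line section with a double point, which
cannot have ordinate 0 on a nonsingular curve. -/
theorem latY_ne_zero {u : ℂ} (hu : u ∉ L.lattice) (h2 : u + u ∉ L.lattice) : latY L u ≠ 0 := by
  intro h
  have := (lattice_isLineSection L hu hu (fun h => h2 (by simpa using neg_mem h))
    (add_neg_cancel (u + u))).ne_zero_of_eq (lattice_nonsingular L hu)
  exact this (by rw [h, mul_zero])

/-- If neither `u + v` nor `u - v` is a lattice point, the chord identities for `(u, v)` and `(u,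
-v)` give `℘'(u) = ℘'(v)` and `℘'(u) = -℘'(v)`. Then `℘'(u) = 0`, which a line through two points
with the same abscissa excludes. -/
theorem mem_lattice_of_weierstrassP_eq {u v : ℂ} (hu : u ∉ L.lattice) (hv : v ∉ L.lattice)
    (h : L.weierstrassP u = L.weierstrassP v) : u + v ∈ L.lattice ∨ u - v ∈ L.lattice := by
  by_contra hcon
  push Not at hcon
  obtain ⟨h1, h2⟩ := hcon
  have e1 := zetaSlope_mul L hu hv h1
  have e2 := zetaSlope_mul L hu (fun h => hv (by simpa using neg_mem h)) (v := -v)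
    (by rwa [← sub_eq_add_neg])
  rw [L.weierstrassP_neg, L.derivWeierstrassP_neg] at e2
  rw [h, sub_self, mul_zero] at e1 e2
  have hs := lattice_isLineSection L hu hv (fun h => h1 (by simpa using neg_mem h))
    (add_neg_cancel (u + v))
  have hn := lattice_nonsingular L hu
  rw [← h] at hs
  exact hs.ne_zero_of_eq hn (by rw [latY]; linear_combination -(e1 + e2) / 2)

/-- If `c` were omitted, `1/(℘ - c)` would extend to an elliptic function without poles, hence
constant; it vanishes at 0 because of the double pole of `℘`, yet it is nowhere zero off the
lattice. -/
theorem weierstrassP_surjective (c : ℂ) : ∃ z, z ∉ L.lattice ∧ L.weierstrassP z = c := by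
  by_contra hcon
  push Not at hcon
  let f : ℂ → ℂ := fun z => if z ∈ L.lattice then 0 else (L.weierstrassP z - c)⁻¹
  have hper : ∀ z, ∀ w ∈ L.lattice, f (z + w) = f z := by
    intro z w hw
    simp only [f, notMem_add_iff L hw, weierstrassP_add_mem L hw]
  let g : ℂ → ℂ := fun z => z ^ 2 * (1 + z ^ 2 * (L.weierstrassPExcept 0 z - c))⁻¹
  have hg : AnalyticAt ℂ g 0 := by
    have h1 : AnalyticAt ℂ (fun z => 1 + z ^ 2 * (L.weierstrassPExcept 0 z - c)) 0 :=
      analyticAt_const.add (((analyticAt_id).pow 2).mul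
        ((L.analyticAt_weierstrassPExcept 0).sub analyticAt_const))
    exact (analyticAt_id.pow 2).mul (h1.inv (by simp))
  have hfg : f =ᶠ[𝓝[≠] 0] g := by
    filter_upwards [eventually_notMem_lattice L 0, self_mem_nhdsWithin] with z hz hz0
    have hz0' : z ≠ 0 := hz0
    simp only [f, g, if_neg hz]
    have h1 := sub_ne_zero.mpr (hcon z hz)
    have h2 : 1 + z ^ 2 * (L.weierstrassPExcept 0 z - c) = z ^ 2 * (L.weierstrassP z - c) := by
      rw [weierstrassP_eq]; field_simp; ring
    rw [h2]; field_simp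
  have hreg : ∀ z, z ∉ L.lattice → AnalyticAt ℂ (fun z => (L.weierstrassP z - c)⁻¹) z ∧
      f =ᶠ[𝓝[≠] z] fun z => (L.weierstrassP z - c)⁻¹ := by
    intro z hz
    refine ⟨((analyticAt_weierstrassP L hz).sub analyticAt_const).inv
      (sub_ne_zero.mpr (hcon z hz)), ?_⟩
    filter_upwards [eventually_notMem_lattice L z] with x hx
    simp only [f, if_neg hx]
  obtain ⟨d, hd⟩ := exists_eq_of_periodic_removable L hper (by
    intro z
    by_cases hz : z ∈ L.lattice
    · refine ⟨fun x => g (x - z), hg.comp_of_eq (by fun_prop) (by simp), ?_⟩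
      have h4 : Tendsto (fun x => x - z) (𝓝[≠] z) (𝓝[≠] 0) := by
        apply tendsto_nhdsWithin_of_tendsto_nhds_of_eventually_within
        · have : Tendsto (fun x => x - z) (𝓝 z) (𝓝 (z - z)) :=
            (continuous_id.sub continuous_const).tendsto _
          rw [sub_self] at this
          exact this.mono_left nhdsWithin_le_nhds
        · filter_upwards [self_mem_nhdsWithin] with x hx h5
          exact hx (sub_eq_zero.mp h5)
      filter_upwards [h4.eventually hfg] with x hx
      rw [← hx, ← hper (x - z) z hz, sub_add_cancel]
    · exact ⟨_, hreg z hz⟩)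
  have h0 := hd 0 g hg hfg
  have hw := L.ω₁_div_two_notMem_lattice
  have h1 := hd _ _ (hreg _ hw).1 (hreg _ hw).2
  rw [← h0] at h1
  simp only [g] at h1
  exact inv_ne_zero (sub_ne_zero.mpr (hcon _ hw)) (by rw [h1]; simp)

/-- By surjectivity of `℘` each affine point is `(℘(z), ±℘'(z)/2)`, and the points with the plus
sign are known to be nonsingular. -/
theorem lattice_isSmooth : IsSmooth (latA L) (latB L) := by
  intro x y hxy
  obtain ⟨z, hz, rfl⟩ := weierstrassP_surjective L x
  have hn := lattice_nonsingular L hz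
  rw [curve_equation_iff, ← latY_sq L hz, sq_eq_sq_iff_eq_or_eq_neg] at hxy
  rcases hxy with rfl | rfl
  · exact hn
  · rw [curve_nonsingular_iff] at hn ⊢
    exact ⟨by rw [neg_sq]; exact hn.1, hn.2.imp id fun h => by
      rw [mul_neg]; exact neg_ne_zero.mpr h⟩

/-- The uniformization `ℂ → E_L(ℂ)`. -/
theorem exists_uniformization : ∃ φ : ℂ →+ (curve (latA L) (latB L)).Point,
    (∀ u, φ u = 0 ↔ u ∈ L.lattice) ∧
    (∀ u, u ∉ L.lattice → xCoord (φ u) = L.weierstrassP u ∧ yCoord (φ u) = latY L u) ∧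
    Function.Surjective φ := by
  obtain ⟨φ, h1, h2⟩ := exists_pointHom L.lattice.toAddSubgroup L.weierstrassP (latY L)
    (fun u hu => lattice_nonsingular L hu) (fun u _ => ⟨L.weierstrassP_neg u, latY_neg L u⟩)
    (fun u v hu _ => ⟨by rw [add_comm]; exact weierstrassP_add_mem L hu v,
      by rw [add_comm]; exact latY_add_mem L hu v⟩)
    (fun u v w hu hv hw h => ⟨_, _, lattice_isLineSection L hu hv hw h⟩)
  refine ⟨φ, h1, h2, fun P => ?_⟩
  by_cases hP : P = 0
  · exact ⟨0, by rw [map_zero, hP]⟩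
  obtain ⟨z, hz, hzx⟩ := weierstrassP_surjective L (xCoord P)
  have hz0 : φ z ≠ 0 := fun h => hz ((h1 z).mp h)
  have hy := point_equation hP
  rw [← hzx, ← latY_sq L hz, sq_eq_sq_iff_eq_or_eq_neg] at hy
  rcases hy with hy | hy
  · exact ⟨z, point_ext hz0 hP (by rw [(h2 z hz).1, hzx]) (by rw [(h2 z hz).2, hy])⟩
  · refine ⟨-z, ?_⟩
    rw [map_neg]
    exact point_ext (neg_ne_zero.mpr hz0) hP (by rw [xCoord_neg, (h2 z hz).1, hzx])
      (by rw [yCoord_neg, (h2 z hz).2, hy])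

end LatticeCurve

/-! ### Holomorphic dependence on `τ` -/

section Periods

open Filter Topology
open scoped UpperHalfPlane

variable (L : PeriodPair)

theorem iteratedDeriv_weierstrassP {z : ℂ} (hz : z ∉ L.lattice) {n : ℕ} (hn : n ≠ 0) :
    iteratedDeriv n L.weierstrassP z = (n + 1).factorial * L.sumInvPow z (n + 2) := by
  have h := L.iteratedDeriv_weierstrassPExcept_self z (n := n)
  rwa [if_neg hn, L.weierstrassPExcept_of_notMem _ hz] at h

theorem mem_lattice_periods {τ : ℍ} {z : ℂ} :
    z ∈ (periods τ).lattice ↔ ∃ m n : ℤ, m * (τ : ℂ) + n = z := by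
  rw [PeriodPair.mem_lattice]
  constructor
  · rintro ⟨m, n, h⟩
    exact ⟨n, m, by rw [← h, periods]; ring⟩
  · rintro ⟨m, n, h⟩
    exact ⟨n, m, by rw [← h, periods]; ring⟩

/-- The enumeration of the period lattice by pairs of integers. -/
def periodEquiv (τ : ℍ) : ℤ × ℤ ≃ (periods τ).lattice :=
  (Equiv.prodComm ℤ ℤ).trans (periods τ).latticeEquivProd.symm.toEquiv

theorem periodEquiv_apply (τ : ℍ) (p : ℤ × ℤ) :
    (periodEquiv τ p : ℂ) = p.1 * (τ : ℂ) + p.2 := by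
  have := (periods τ).latticeEquiv_symm_apply (p.2, p.1)
  simp only [periodEquiv, Equiv.trans_apply, Equiv.prodComm_apply, Prod.swap]
  refine this.trans ?_
  rw [periods]; ring

theorem sumInvPow_periods (τ : ℍ) (z : ℂ) (k : ℕ) : (periods τ).sumInvPow z k =
    ∑' p : ℤ × ℤ, ((p.1 * (τ : ℂ) + p.2 - z) ^ k)⁻¹ := by
  rw [PeriodPair.sumInvPow, ← (periodEquiv τ).tsum_eq]
  simp_rw [periodEquiv_apply]

theorem int_linear_eq_zero {τ : ℍ} {m n : ℤ} : (m * (τ : ℂ) + n = 0) ↔ m = 0 ∧ n = 0 := by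
  refine ⟨fun h => ?_, by rintro ⟨rfl, rfl⟩; simp⟩
  have him := congrArg Complex.im h
  have hτ : (τ : ℂ).im ≠ 0 := τ.im_ne_zero
  simp at him
  have hm : m = 0 := him.resolve_right τ.im_pos.ne'
  subst hm
  refine ⟨rfl, ?_⟩
  simpa using h

theorem torsionArg_mem_lattice {l : ℕ} (hl : l ≠ 0) {r s : ℤ} {τ : ℍ} :
    torsionArg l r s τ ∈ (periods τ).lattice ↔ (l : ℤ) ∣ r ∧ (l : ℤ) ∣ s := by
  have hl' : (l : ℂ) ≠ 0 := Nat.cast_ne_zero.mpr hl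
  rw [mem_lattice_periods]
  constructor
  · rintro ⟨m, n, h⟩
    rw [torsionArg, eq_div_iff hl'] at h
    have := (int_linear_eq_zero (τ := τ) (m := m * l - r) (n := n * l - s)).mp
      (by push_cast; linear_combination h)
    exact ⟨⟨m, by linear_combination -this.1⟩, ⟨n, by linear_combination -this.2⟩⟩
  · rintro ⟨⟨m, rfl⟩, ⟨n, rfl⟩⟩
    refine ⟨m, n, ?_⟩
    rw [torsionArg, eq_div_iff hl']
    push_cast; ring

theorem torsionArg_add (l : ℕ) (r s r' s' : ℤ) (τ : ℍ) :
    torsionArg l (r + r') (s + s') τ = torsionArg l r s τ + torsionArg l r' s' τ := by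
  rw [torsionArg, torsionArg, torsionArg]; push_cast; ring

theorem torsionArg_neg (l : ℕ) (r s : ℤ) (τ : ℍ) :
    torsionArg l (-r) (-s) τ = -torsionArg l r s τ := by
  rw [torsionArg, torsionArg]; push_cast; ring

/-- The ring of holomorphic functions on the upper half-plane. -/
def holomorphicRing : Subalgebra ℂ (ℍ → ℂ) where
  carrier := {g | DifferentiableOn ℂ (g ∘ UpperHalfPlane.ofComplex) {w : ℂ | 0 < w.im}}
  mul_mem' := fun hf hg => hf.mul hg
  add_mem' := fun hf hg => hf.add hg
  algebraMap_mem' := fun c => differentiableOn_const c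

theorem mem_holomorphicRing {g : ℍ → ℂ} : g ∈ holomorphicRing ↔
    DifferentiableOn ℂ (g ∘ UpperHalfPlane.ofComplex) {w : ℂ | 0 < w.im} := Iff.rfl

theorem isOpen_halfPlane : IsOpen {w : ℂ | 0 < w.im} := isOpen_lt continuous_const Complex.continuous_im

theorem div_mem_holomorphicRing {f g : ℍ → ℂ} (hf : f ∈ holomorphicRing) (hg : g ∈ holomorphicRing)
    (h : ∀ τ, g τ ≠ 0) : f / g ∈ holomorphicRing :=
  DifferentiableOn.div hf hg fun _ _ => h _

/-- This separates a product of two lattice factors, so that each is bounded by a summand of an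
absolutely convergent Eisenstein series of weight `k + k'`. -/
theorem pow_mul_pow_le_add {x y : ℝ} (hx : 0 ≤ x) (hy : 0 ≤ y) (k k' : ℕ) :
    x ^ k * y ^ k' ≤ x ^ (k + k') + y ^ (k + k') := by
  rcases le_total x y with h | h
  · have : x ^ k * y ^ k' ≤ y ^ k * y ^ k' := by gcongr
    rw [pow_add y]
    exact this.trans (le_add_of_nonneg_left (by positivity))
  · have : x ^ k * y ^ k' ≤ x ^ k * x ^ k' := by gcongr
    rw [pow_add x]
    exact this.trans (le_add_of_nonneg_right (by positivity))

theorem differentiableAt_inv_linear_pow (m n : ℤ) (k : ℕ) {z : ℂ} (hz : 0 < z.im) :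
    DifferentiableAt ℂ (fun z : ℂ => ((m * z + n : ℂ) ^ k)⁻¹) z := by
  by_cases h0 : m = 0 ∧ n = 0
  · simp only [h0.1, h0.2, Int.cast_zero, zero_mul, add_zero]
    exact differentiableAt_const _
  · have : (m : ℂ) * z + n ≠ 0 := fun h => h0 ((int_linear_eq_zero (τ := ⟨z, hz⟩)).mp h)
    have hd : DifferentiableAt ℂ (fun z : ℂ => (m * z + n : ℂ) ^ k) z := by fun_prop
    exact hd.inv (pow_ne_zero _ this)

/-- Absolutely convergent lattice sums at torsion points are holomorphic in `τ`. -/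
theorem tsum_torsionArg_mem {l : ℕ} (hl : l ≠ 0) (r s : ℤ) {k k' : ℕ} (hk : 3 ≤ k + k') :
    (fun τ : ℍ => ∑' p : ℤ × ℤ, ((p.1 * (τ : ℂ) + p.2 - torsionArg l r s τ) ^ k)⁻¹ *
      ((p.1 * (τ : ℂ) + p.2) ^ k')⁻¹) ∈ holomorphicRing := by
  have hl' : (l : ℂ) ≠ 0 := Nat.cast_ne_zero.mpr hl
  rw [mem_holomorphicRing]
  intro w hw
  have hw0 : 0 < w.im := hw
  set B := w.im / 2 with hB
  have hB0 : 0 < B := by positivity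
  set A := |w.re| + 1 with hA
  let U : Set ℂ := {z | B < z.im ∧ |z.re| < A}
  have hU : IsOpen U := (isOpen_lt continuous_const Complex.continuous_im).inter
    (isOpen_lt (Complex.continuous_re.abs) continuous_const)
  have hwU : w ∈ U := ⟨by linarith, by linarith⟩
  -- After multiplication by `l` the factors are linear forms in `τ` with integer coefficients `(l m
  -- - r, l n - s)`, an injective subfamily of those in the Eisenstein bound on the vertical strip
  -- around `w`.
  let e : ℤ → ℤ → ℤ × ℤ → (Fin 2 → ℤ) := fun r s p => ![l * p.1 - r, l * p.2 - s]
  have he : ∀ r s, Function.Injective (e r s) := by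
    intro r s p q h
    have h0 := congrFun h 0
    have h1 := congrFun h 1
    have hlz : (l : ℤ) ≠ 0 := Int.natCast_ne_zero.mpr hl
    simp only [e, Matrix.cons_val_zero, Matrix.cons_val_one] at h0 h1
    exact Prod.ext (mul_left_cancel₀ hlz (by linarith)) (mul_left_cancel₀ hlz (by linarith))
  let F : ℤ × ℤ → ℂ → ℂ := fun p z => ((l : ℂ) ^ k * l ^ k') *
    (((((l * p.1 - r : ℤ) : ℂ) * z + ((l * p.2 - s : ℤ) : ℂ)) ^ k)⁻¹ *
    ((((l * p.1 - 0 : ℤ) : ℂ) * z + ((l * p.2 - 0 : ℤ) : ℂ)) ^ k')⁻¹)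
  set ρ := EisensteinSeries.r ⟨⟨A, B⟩, hB0⟩ with hρ
  let v : ℤ → ℤ → ℤ × ℤ → ℝ := fun r s p =>
    ρ ^ (-((k + k' : ℕ) : ℝ)) * ‖e r s p‖ ^ (-((k + k' : ℕ) : ℝ))
  have hv : ∀ r s, Summable (v r s) := fun r s =>
    ((EisensteinSeries.summable_one_div_norm_rpow (k := (k + k' : ℕ))
      (by exact_mod_cast hk)).comp_injective (he r s)).mul_left _
  have hbound : ∀ r s p, ∀ z ∈ U,
      ‖((l * p.1 - r : ℤ) : ℂ) * z + ((l * p.2 - s : ℤ) : ℂ)‖⁻¹ ^ (k + k') ≤ v r s p := by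
    intro r s p z hz
    have hz0 : 0 < z.im := hB0.trans hz.1
    have := EisensteinSeries.summand_bound_of_mem_verticalStrip (k := (k + k' : ℕ)) (z := ⟨z, hz0⟩)
      (by positivity) (e r s p) (A := A) hB0 ⟨hz.2.le, hz.1.le⟩
    rw [Real.rpow_neg (norm_nonneg _), Real.rpow_natCast, ← inv_pow] at this
    simpa only [e, Matrix.cons_val_zero, Matrix.cons_val_one] using this
  let u : ℤ × ℤ → ℝ := fun p => ((l : ℝ) ^ k * l ^ k') * (v r s p + v 0 0 p)
  have hu : Summable u := ((hv r s).add (hv 0 0)).mul_left _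
  have hFu : ∀ p, ∀ z ∈ U, ‖F p z‖ ≤ u p := by
    intro p z hz
    simp only [F, u, norm_mul, norm_pow, norm_inv, Complex.norm_natCast]
    refine mul_le_mul_of_nonneg_left ?_ (by positivity)
    rw [← inv_pow, ← inv_pow]
    exact (pow_mul_pow_le_add (by positivity) (by positivity) k k').trans
      (add_le_add (hbound r s p z hz) (hbound 0 0 p z hz))
  have hFd : ∀ p, DifferentiableOn ℂ (F p) U := fun p z hz =>
    (((differentiableAt_inv_linear_pow _ _ k (hB0.trans hz.1)).mul
      (differentiableAt_inv_linear_pow _ _ k' (hB0.trans hz.1))).const_mul _).differentiableWithinAt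
  have hd := Complex.differentiableOn_tsum_of_summable_norm hu hFd hU hFu
  refine DifferentiableAt.differentiableWithinAt ?_
  refine ((hd w hwU).differentiableAt (hU.mem_nhds hwU)).congr_of_eventuallyEq ?_
  filter_upwards [hU.mem_nhds hwU] with z hz
  have hz0 : 0 < z.im := hB0.trans hz.1
  rw [Function.comp_apply, UpperHalfPlane.ofComplex_apply_of_im_pos hz0]
  refine tsum_congr fun p => ?_
  simp only [F, torsionArg]
  rw [show (p.1 : ℂ) * ((⟨z, hz0⟩ : ℍ) : ℂ) + p.2 - (r * ((⟨z, hz0⟩ : ℍ) : ℂ) + s) / l =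
    (((l * p.1 - r : ℤ) : ℂ) * z + ((l * p.2 - s : ℤ) : ℂ)) / l by
      push_cast; field_simp; ring,
    show (p.1 : ℂ) * ((⟨z, hz0⟩ : ℍ) : ℂ) + p.2 =
    (((l * p.1 - 0 : ℤ) : ℂ) * z + ((l * p.2 - 0 : ℤ) : ℂ)) / l by
      push_cast; field_simp; ring, div_pow, inv_div, div_pow, inv_div, div_eq_mul_inv,
    div_eq_mul_inv]
  ring

theorem sumInvPow_torsionArg_mem {l : ℕ} (hl : l ≠ 0) (r s : ℤ) {k : ℕ} (hk : 3 ≤ k) :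
    (fun τ => (periods τ).sumInvPow (torsionArg l r s τ) k) ∈ holomorphicRing := by
  have := tsum_torsionArg_mem hl r s (k := k) (k' := 0) hk
  simpa only [sumInvPow_periods, pow_zero, inv_one, mul_one] using this

theorem latA_mem_holomorphicRing : (fun τ => latA (periods τ)) ∈ holomorphicRing := by
  have h := sumInvPow_torsionArg_mem one_ne_zero 0 0 (k := 4) (by norm_num)
  have h0 : ∀ τ, torsionArg 1 0 0 τ = 0 := fun τ => by simp [torsionArg]
  simp only [h0, PeriodPair.sumInvPow_zero] at h
  exact Subalgebra.mul_mem _ (Subalgebra.algebraMap_mem _ (-15 : ℂ)) h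

theorem latB_mem_holomorphicRing : (fun τ => latB (periods τ)) ∈ holomorphicRing := by
  have h := sumInvPow_torsionArg_mem one_ne_zero 0 0 (k := 6) (by norm_num)
  have h0 : ∀ τ, torsionArg 1 0 0 τ = 0 := fun τ => by simp [torsionArg]
  simp only [h0, PeriodPair.sumInvPow_zero] at h
  exact Subalgebra.mul_mem _ (Subalgebra.algebraMap_mem _ (-35 : ℂ)) h

variable {l : ℕ} (hl : l ≠ 0)
include hl

theorem iteratedDeriv_mem_holomorphicRing {r s : ℤ} (hrs : ¬((l : ℤ) ∣ r ∧ (l : ℤ) ∣ s)) {n : ℕ}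
    (hn : n ≠ 0) : (fun τ => iteratedDeriv n (periods τ).weierstrassP (torsionArg l r s τ)) ∈
      holomorphicRing := by
  have h := Subalgebra.mul_mem _ (Subalgebra.algebraMap_mem _ ((n + 1).factorial : ℂ))
    (sumInvPow_torsionArg_mem hl r s (k := n + 2) (by omega))
  convert h using 1
  ext τ
  exact iteratedDeriv_weierstrassP _ (fun h => hrs ((torsionArg_mem_lattice hl).mp h)) hn

theorem latY_mem_holomorphicRing {r s : ℤ} (hrs : ¬((l : ℤ) ∣ r ∧ (l : ℤ) ∣ s)) :
    (fun τ => latY (periods τ) (torsionArg l r s τ)) ∈ holomorphicRing := by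
  have h := Subalgebra.mul_mem _ (Subalgebra.algebraMap_mem _ (1 / 2 : ℂ))
    (iteratedDeriv_mem_holomorphicRing hl hrs one_ne_zero)
  convert h using 1
  ext τ
  simp only [iteratedDeriv_one, PeriodPair.deriv_weierstrassP, latY, Pi.mul_apply,
    Pi.algebraMap_apply]
  change _ = (1 / 2 : ℂ) * _
  ring

/-- The lattice sum in the style of the derivatives does not converge absolutely for `℘` itself.
Instead `℘` is recovered as a quotient of derivatives: `℘''' = 12 ℘ ℘'` in general, and `℘'''' = 12
℘ ℘''` at points of order 2, where `℘' = 0` but `℘'' ≠ 0` by nonsingularity. -/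
theorem weierstrassP_mem_holomorphicRing {r s : ℤ} (hrs : ¬((l : ℤ) ∣ r ∧ (l : ℤ) ∣ s)) :
    (fun τ => (periods τ).weierstrassP (torsionArg l r s τ)) ∈ holomorphicRing := by
  have hm : ∀ τ, torsionArg l r s τ ∉ (periods τ).lattice :=
    fun τ h => hrs ((torsionArg_mem_lattice hl).mp h)
  have hD := fun n (hn : n ≠ 0) => iteratedDeriv_mem_holomorphicRing hl hrs hn
  have h12 : (12 : ℂ) ≠ 0 := by norm_num
  by_cases h2 : (l : ℤ) ∣ r + r ∧ (l : ℤ) ∣ s + s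
  · have hY : ∀ τ, latY (periods τ) (torsionArg l r s τ) = 0 := by
      intro τ
      have h2' := (torsionArg_mem_lattice hl (τ := τ)).mpr h2
      rw [torsionArg_add] at h2'
      have := latY_add_mem (periods τ) h2' (-torsionArg l r s τ)
      rw [neg_add_cancel_left, latY_neg] at this
      linear_combination this / 2
    have e4 : ∀ τ, iteratedDeriv 4 (periods τ).weierstrassP (torsionArg l r s τ) =
        12 * (periods τ).weierstrassP (torsionArg l r s τ) *
          iteratedDeriv 2 (periods τ).weierstrassP (torsionArg l r s τ) := by
      intro τ
      rw [iteratedDeriv_weierstrassP_add_two (periods τ) (hm τ) 2]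
      have : iteratedDeriv 1 (periods τ).weierstrassP (torsionArg l r s τ) = 0 := by
        rw [iteratedDeriv_one, PeriodPair.deriv_weierstrassP]
        have := hY τ
        rw [latY] at this
        linear_combination 2 * this
      simp [Finset.sum_range_succ, this]
      ring
    have e2 : ∀ τ, iteratedDeriv 2 (periods τ).weierstrassP (torsionArg l r s τ) ≠ 0 := by
      intro τ h
      rw [iteratedDeriv_weierstrassP_add_two (periods τ) (hm τ) 0] at h
      rcases (curve_nonsingular_iff.mp (lattice_nonsingular (periods τ) (hm τ))).2 with h' | h'
      · apply h'
        simp at h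
        linear_combination h / 2
      · exact h' (by rw [hY, mul_zero])
    have := div_mem_holomorphicRing (hD 4 (by norm_num))
      (Subalgebra.mul_mem _ (Subalgebra.algebraMap_mem _ (12 : ℂ)) (hD 2 (by norm_num)))
      (fun τ => mul_ne_zero h12 (e2 τ))
    convert this using 1
    ext τ
    refine (eq_div_iff (mul_ne_zero h12 (e2 τ))).mpr ?_
    beta_reduce
    rw [e4]; ring
  · have hY : ∀ τ, iteratedDeriv 1 (periods τ).weierstrassP (torsionArg l r s τ) ≠ 0 := by
      intro τ h
      rw [iteratedDeriv_one, PeriodPair.deriv_weierstrassP] at h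
      refine latY_ne_zero (periods τ) (hm τ) (fun h => h2 ?_) (by rw [latY, h, zero_div])
      rwa [← torsionArg_add, torsionArg_mem_lattice hl] at h
    have e3 : ∀ τ, iteratedDeriv 3 (periods τ).weierstrassP (torsionArg l r s τ) =
        12 * (periods τ).weierstrassP (torsionArg l r s τ) *
          iteratedDeriv 1 (periods τ).weierstrassP (torsionArg l r s τ) := by
      intro τ
      rw [iteratedDeriv_weierstrassP_add_two (periods τ) (hm τ) 1]
      simp [Finset.sum_range_succ]
      ring
    have := div_mem_holomorphicRing (hD 3 (by norm_num))
      (Subalgebra.mul_mem _ (Subalgebra.algebraMap_mem _ (12 : ℂ)) (hD 1 (by norm_num)))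
      (fun τ => mul_ne_zero h12 (hY τ))
    convert this using 1
    ext τ
    refine (eq_div_iff (mul_ne_zero h12 (hY τ))).mpr ?_
    beta_reduce
    rw [e3]; ring

/-- The slope is a tangent or a chord quotient of functions already known to be holomorphic. Which
of the two applies depends only on the labels, so one formula holds for all `τ`. -/
theorem zetaSlope_mem_holomorphicRing {r s r' s' : ℤ} (hrs : ¬((l : ℤ) ∣ r ∧ (l : ℤ) ∣ s))
    (hrs' : ¬((l : ℤ) ∣ r' ∧ (l : ℤ) ∣ s')) (hsum : ¬((l : ℤ) ∣ r + r' ∧ (l : ℤ) ∣ s + s')) :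
    (fun τ => zetaSlope (periods τ) (torsionArg l r s τ) (torsionArg l r' s' τ)) ∈
      holomorphicRing := by
  have hm : ∀ τ, torsionArg l r s τ ∉ (periods τ).lattice :=
    fun τ h => hrs ((torsionArg_mem_lattice hl).mp h)
  have hm' : ∀ τ, torsionArg l r' s' τ ∉ (periods τ).lattice :=
    fun τ h => hrs' ((torsionArg_mem_lattice hl).mp h)
  have hms : ∀ τ, torsionArg l r s τ + torsionArg l r' s' τ ∉ (periods τ).lattice :=
    fun τ h => hsum ((torsionArg_mem_lattice hl).mp (by rwa [torsionArg_add]))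
  by_cases hd : (l : ℤ) ∣ r + -r' ∧ (l : ℤ) ∣ s + -s'
  · have hd' : ∀ τ, torsionArg l r s τ + -torsionArg l r' s' τ ∈ (periods τ).lattice := by
      intro τ; rw [← torsionArg_neg, ← torsionArg_add]; exact (torsionArg_mem_lattice hl).mpr hd
    have hY : ∀ τ, 2 * latY (periods τ) (torsionArg l r s τ) ≠ 0 := by
      intro τ
      refine mul_ne_zero two_ne_zero (latY_ne_zero _ (hm τ) fun h => hms τ ?_)
      simpa using sub_mem h (hd' τ)
    have hx := weierstrassP_mem_holomorphicRing hl hrs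
    have := div_mem_holomorphicRing (f := (fun τ => 3 * (periods τ).weierstrassP (torsionArg l r s τ) ^ 2 +
        latA (periods τ)))
      (Subalgebra.add_mem _ (Subalgebra.mul_mem _ (Subalgebra.algebraMap_mem _ (3 : ℂ))
        (Subalgebra.pow_mem _ hx 2)) latA_mem_holomorphicRing)
      (Subalgebra.mul_mem _ (Subalgebra.algebraMap_mem _ (2 : ℂ)) (latY_mem_holomorphicRing hl hrs)) hY
    convert this using 1
    ext τ
    refine (eq_div_iff (hY τ)).mpr ?_
    have hs : zetaSlope (periods τ) (torsionArg l r s τ) (torsionArg l r' s' τ) =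
        zetaSlope (periods τ) (torsionArg l r s τ) (torsionArg l r s τ) := by
      rw [zetaSlope_comm, zetaSlope_comm (periods τ) (torsionArg l r s τ),
        ← zetaSlope_add_left (periods τ) (hm' τ) (by rw [add_comm]; exact hms τ) (hd' τ)]
      congr 1; ring
    have h2 : torsionArg l r s τ + torsionArg l r s τ ∉ (periods τ).lattice := fun h =>
      hms τ (by simpa using sub_mem h (hd' τ))
    obtain ⟨⟨e1, -, -⟩, e2, e3, -⟩ := lattice_isLineSection (periods τ) (hm τ) (hm τ)
      (fun h => h2 (by simpa using neg_mem h)) (add_neg_cancel _)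
    rw [hs]
    generalize zetaSlope (periods τ) (torsionArg l r s τ) (torsionArg l r s τ) = z at *
    linear_combination e3 - 2 * (periods τ).weierstrassP (torsionArg l r s τ) * e2
  · have hx : ∀ τ, (periods τ).weierstrassP (torsionArg l r s τ) -
        (periods τ).weierstrassP (torsionArg l r' s' τ) ≠ 0 := by
      intro τ h
      rcases mem_lattice_of_weierstrassP_eq _ (hm τ) (hm' τ) (sub_eq_zero.mp h) with h | h
      · exact hms τ h
      · rw [sub_eq_add_neg, ← torsionArg_neg, ← torsionArg_add] at h
        exact hd ((torsionArg_mem_lattice hl).mp h)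
    have := div_mem_holomorphicRing
      (Subalgebra.sub_mem _ (latY_mem_holomorphicRing hl hrs) (latY_mem_holomorphicRing hl hrs'))
      (Subalgebra.sub_mem _ (weierstrassP_mem_holomorphicRing hl hrs)
        (weierstrassP_mem_holomorphicRing hl hrs')) hx
    convert this using 1
    ext τ
    refine (eq_div_iff (hx τ)).mpr ?_
    change _ = latY _ _ - latY _ _
    have := zetaSlope_mul (periods τ) (hm τ) (hm' τ) (hms τ)
    rw [latY, latY]
    linear_combination this / 2

end Periods

/-! ### Algebraic independence of `a(τ)` and `b(τ)` -/

section Independence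

open Filter Topology
open scoped UpperHalfPlane

theorem holomorphicRing_analytic (g : holomorphicRing) :
    AnalyticOnNhd ℂ (g.1 ∘ UpperHalfPlane.ofComplex) {w : ℂ | 0 < w.im} :=
  DifferentiableOn.analyticOnNhd g.2 isOpen_halfPlane

theorem eq_zero_of_comp_ofComplex {g : ℍ → ℂ}
    (h : ∀ w ∈ {w : ℂ | 0 < w.im}, (g ∘ UpperHalfPlane.ofComplex) w = 0) : g = 0 := by
  ext τ
  have := h τ τ.im_pos
  rwa [Function.comp_apply, UpperHalfPlane.ofComplex_apply] at this

instance isDomain_holomorphicRing : IsDomain holomorphicRing := by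
  have : NoZeroDivisors holomorphicRing := ⟨fun {f g} h => by
    have h' : ∀ w ∈ {w : ℂ | 0 < w.im}, (f.1 ∘ UpperHalfPlane.ofComplex) w •
        (g.1 ∘ UpperHalfPlane.ofComplex) w = 0 := fun w _ =>
      congrFun (congrArg Subtype.val h) (UpperHalfPlane.ofComplex w)
    rcases (holomorphicRing_analytic f).eq_zero_or_eq_zero_of_smul_eq_zero
      (holomorphicRing_analytic g) h' (convex_halfSpace_im_gt 0).isPreconnected with h | h
    · exact .inl (Subtype.ext (eq_zero_of_comp_ofComplex h))
    · exact .inr (Subtype.ext (eq_zero_of_comp_ofComplex h))⟩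
  exact NoZeroDivisors.to_isDomain _

/-- Evaluation of a holomorphic function at a point. -/
def evalAt (τ : ℍ) : holomorphicRing →ₐ[ℂ] ℂ :=
  (Pi.evalAlgHom ℂ (fun _ : ℍ => ℂ) τ).comp holomorphicRing.val

theorem holomorphicRing_ext {f g : holomorphicRing} (h : ∀ τ, evalAt τ f = evalAt τ g) : f = g :=
  Subtype.ext (funext h)

/-- `a(τ)` as a holomorphic function. -/
def holA : holomorphicRing := ⟨_, latA_mem_holomorphicRing⟩

/-- `b(τ)` as a holomorphic function. -/
def holB : holomorphicRing := ⟨_, latB_mem_holomorphicRing⟩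

theorem evalAt_holA (τ : ℍ) : evalAt τ holA = latA (periods τ) := rfl

theorem evalAt_holB (τ : ℍ) : evalAt τ holB = latB (periods τ) := rfl

theorem G_eq_of_smul {L L' : PeriodPair} {u : ℂ} (hu : u ≠ 0)
    (h : ∀ z, z ∈ L'.lattice ↔ u * z ∈ L.lattice) (k : ℕ) : L'.G k = u ^ k * L.G k := by
  let e : L'.lattice ≃ L.lattice := {
    toFun := fun z => ⟨u * z, (h z).mp z.2⟩
    invFun := fun z => ⟨u⁻¹ * z, (h _).mpr (by rw [mul_inv_cancel_left₀ hu]; exact z.2)⟩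
    left_inv := fun z => Subtype.ext (by simp [hu])
    right_inv := fun z => Subtype.ext (by simp [hu]) }
  rw [PeriodPair.G, PeriodPair.G, ← e.tsum_eq, ← tsum_mul_left]
  refine tsum_congr fun z => ?_
  simp only [e, Equiv.coe_fn_mk]
  rw [mul_pow, mul_inv, mul_inv_cancel_left₀ (pow_ne_zero _ hu)]

theorem im_neg_inv_pos (τ : ℍ) (n : ℤ) : 0 < (-((τ : ℂ) + n)⁻¹).im := by
  have h : 0 < ((τ : ℂ) + n).im := by simpa using τ.im_pos
  rw [Complex.neg_im, Complex.inv_im, neg_div, neg_neg]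
  refine div_pos h (Complex.normSq_pos.mpr fun h0 => ?_)
  rw [h0] at h
  exact lt_irrefl _ h

/-- The lattices of `τ` and `-1/(τ+n)` are homothetic by the factor `τ + n`. Both the fixed points
of these maps and the infinitude of the factors are exploited below. -/
theorem G_neg_inv (τ : ℍ) (n : ℤ) (k : ℕ) :
    (periods ⟨-((τ : ℂ) + n)⁻¹, im_neg_inv_pos τ n⟩).G k = ((τ : ℂ) + n) ^ k * (periods τ).G k := by
  have hu : (τ : ℂ) + n ≠ 0 := fun h => by
    have := congrArg Complex.im h
    simp at this
    exact τ.im_pos.ne' this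
  refine G_eq_of_smul hu (fun z => ?_) k
  rw [mem_lattice_periods, mem_lattice_periods]
  constructor
  · rintro ⟨p, q, rfl⟩
    refine ⟨q, q * n - p, ?_⟩
    push_cast
    simp only [mul_add, mul_neg]
    field_simp
    ring
  · rintro ⟨p, q, h⟩
    refine ⟨p * n - q, p, mul_left_cancel₀ hu ?_⟩
    rw [← h]
    push_cast
    simp only [mul_add, mul_neg]
    field_simp
    ring

/-- The primitive cube root of unity in the upper half-plane. -/
def rho : ℍ := ⟨⟨-1 / 2, √3 / 2⟩, by simp⟩

theorem rho_sq : (rho : ℂ) ^ 2 + rho + 1 = 0 := by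
  have h3 : √3 * √3 = 3 := Real.mul_self_sqrt (by norm_num)
  apply Complex.ext
  · simp [rho, pow_two]; linarith
  · simp [rho, pow_two]; ring

theorem neg_inv_rho : -((rho : ℂ) + 1)⁻¹ = rho := by
  have h := rho_sq
  have h1 : (rho : ℂ) + 1 ≠ 0 := fun h1 => by
    have : (rho : ℂ) ^ 2 = 0 := by linear_combination h - h1
    rw [pow_eq_zero_iff two_ne_zero] at this
    exact UpperHalfPlane.ne_zero _ this
  field_simp
  linear_combination -h

/-- The point `ρ` is fixed by `τ ↦ -1/(τ+1)`, but the weight 4 factor `(ρ+1)^4 = -ρ - 1` is not 1.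
-/
theorem latA_rho : latA (periods rho) = 0 := by
  have h := G_neg_inv rho 1 4
  have e : (⟨-((rho : ℂ) + (1 : ℤ))⁻¹, im_neg_inv_pos rho 1⟩ : ℍ) = rho :=
    UpperHalfPlane.ext (by push_cast; exact neg_inv_rho)
  rw [e] at h
  have h1 : ((rho : ℂ) + (1 : ℤ)) ^ 4 = -(rho : ℂ) - 1 := by
    have := rho_sq
    push_cast
    linear_combination ((rho : ℂ) ^ 2 + 3 * rho + 2) * this
  rw [h1] at h
  have h2 : (2 + (rho : ℂ)) * (periods rho).G 4 = 0 := by linear_combination h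
  have h3 : 2 + (rho : ℂ) ≠ 0 := fun h3 => by
    have := congrArg Complex.im h3
    simp at this
    exact rho.im_pos.ne' this
  rw [latA, (mul_eq_zero.mp h2).resolve_left h3, mul_zero]

/-- The point `i` is fixed by `τ ↦ -1/τ`, and the weight 6 factor is `i^6 = -1`. -/
theorem latB_I : latB (periods UpperHalfPlane.I) = 0 := by
  have h := G_neg_inv UpperHalfPlane.I 0 6
  have e : (⟨-((UpperHalfPlane.I : ℂ) + (0 : ℤ))⁻¹, im_neg_inv_pos _ 0⟩ : ℍ) = UpperHalfPlane.I :=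
    UpperHalfPlane.ext (by simp)
  rw [e] at h
  have h1 : ((UpperHalfPlane.I : ℂ) + (0 : ℤ)) ^ 6 = -1 := by
    simp [show (6 : ℕ) = 2 * 3 from rfl]
  rw [h1] at h
  rw [latB]
  linear_combination -35 / 2 * h

theorem not_isSmooth_zero {F : Type*} [Field F] : ¬ IsSmooth (0 : F) 0 := by
  intro h
  have := h 0 0 (curve_equation_iff.mpr (by simp))
  rw [curve_nonsingular_iff] at this
  simp at this

theorem latB_rho : latB (periods rho) ≠ 0 := fun h => not_isSmooth_zero (F := ℂ) <| by
  have := lattice_isSmooth (periods rho)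
  rwa [h, latA_rho] at this

theorem holA_ne_zero : holA ≠ 0 := fun h => not_isSmooth_zero (F := ℂ) <| by
  have := lattice_isSmooth (periods UpperHalfPlane.I)
  have h0 : latA (periods UpperHalfPlane.I) = 0 := by
    rw [← evalAt_holA, h, map_zero]
  rwa [latB_I, h0] at this

theorem map_aeval_pair {A B : Type*} [CommRing A] [CommRing B] [Algebra ℂ A] [Algebra ℂ B]
    (f : A →ₐ[ℂ] B) (x y : A) (p : MvPolynomial (Fin 2) ℂ) :
    f (MvPolynomial.aeval ![x, y] p) = MvPolynomial.aeval ![f x, f y] p := by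
  rw [← AlgHom.comp_apply, MvPolynomial.comp_aeval]
  congr 2
  ext i
  fin_cases i <;> rfl

/-- For fixed `τ` the expression is a polynomial in `u`. By modularity the relation at `-1/(τ+n)`
says that `u = τ + n` is a root, for every integer `n`, so the polynomial is zero. -/
theorem aeval_twist {p : MvPolynomial (Fin 2) ℂ} (hp : MvPolynomial.aeval ![holA, holB] p = 0)
    (u : ℂ) : MvPolynomial.aeval ![u ^ 4 • holA, u ^ 6 • holB] p = 0 := by
  refine holomorphicRing_ext fun τ => ?_
  rw [map_aeval_pair, map_zero, map_smul, map_smul]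
  let q : ℂ[X] := MvPolynomial.aeval ![C (evalAt τ holA) * X ^ 4, C (evalAt τ holB) * X ^ 6] p
  have hq : ∀ v : ℂ, q.eval v =
      MvPolynomial.aeval ![v ^ 4 • evalAt τ holA, v ^ 6 • evalAt τ holB] p := by
    intro v
    have := map_aeval_pair (Polynomial.aeval v) (C (evalAt τ holA) * X ^ 4)
      (C (evalAt τ holB) * X ^ 6) p
    rw [Polynomial.coe_aeval_eq_eval] at this
    rw [smul_eq_mul, smul_eq_mul, mul_comm (v ^ 4), mul_comm (v ^ 6)]
    simpa [q] using this
  rw [← hq]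
  suffices h : q = 0 by rw [h, eval_zero]
  have hinj : Function.Injective fun n : ℤ => (τ : ℂ) + n := fun m n h => by simpa using h
  refine Polynomial.eq_zero_of_infinite_isRoot q ((Set.infinite_range_of_injective hinj).mono ?_)
  rintro _ ⟨n, rfl⟩
  rw [Set.mem_ofPred_eq, IsRoot.def, hq]
  have h := congrArg (evalAt ⟨-((τ : ℂ) + n)⁻¹, im_neg_inv_pos τ n⟩) hp
  rw [map_aeval_pair, map_zero] at h
  have ea : evalAt ⟨-((τ : ℂ) + n)⁻¹, im_neg_inv_pos τ n⟩ holA = ((τ : ℂ) + n) ^ 4 • evalAt τ holA := by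
    rw [evalAt_holA, evalAt_holA, latA, latA, G_neg_inv, smul_eq_mul]; ring
  have eb : evalAt ⟨-((τ : ℂ) + n)⁻¹, im_neg_inv_pos τ n⟩ holB = ((τ : ℂ) + n) ^ 6 • evalAt τ holB := by
    rw [evalAt_holB, evalAt_holB, latB, latB, G_neg_inv, smul_eq_mul]; ring
  rw [ea, eb] at h
  exact h

/-- Substitution of the rescaled functions `u ^ 4 a`, `u ^ 6 b`. -/
def twistHom (u : ℂ) : (MvPolynomial (Fin 1) ℂ)[X] →+* holomorphicRing :=
  Polynomial.eval₂RingHom (MvPolynomial.aeval fun _ => u ^ 6 • holB).toRingHom (u ^ 4 • holA)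

theorem twistHom_X (u : ℂ) : twistHom u X = u ^ 4 • holA := Polynomial.eval₂_X _ _

theorem twistHom_C (u : ℂ) (c : MvPolynomial (Fin 1) ℂ) :
    twistHom u (C c) = MvPolynomial.aeval (fun _ => u ^ 6 • holB) c := Polynomial.eval₂_C _ _

theorem twistHom_finSuccEquiv (u : ℂ) (p : MvPolynomial (Fin 2) ℂ) :
    twistHom u (MvPolynomial.finSuccEquiv ℂ 1 p) =
      MvPolynomial.aeval ![u ^ 4 • holA, u ^ 6 • holB] p := by
  have h : (twistHom u).comp (MvPolynomial.finSuccEquiv ℂ 1 : _ →+* _) =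
      (MvPolynomial.aeval ![u ^ 4 • holA, u ^ 6 • holB] : _ →ₐ[ℂ] holomorphicRing).toRingHom := by
    refine MvPolynomial.ringHom_ext (fun c => ?_) fun i => ?_
    · have : MvPolynomial.finSuccEquiv ℂ 1 (MvPolynomial.C c) = C (MvPolynomial.C c) :=
        (MvPolynomial.finSuccEquiv ℂ 1).commutes c
      change twistHom u (MvPolynomial.finSuccEquiv ℂ 1 (MvPolynomial.C c)) =
        MvPolynomial.aeval _ (MvPolynomial.C c)
      rw [this, twistHom_C, MvPolynomial.aeval_C, MvPolynomial.aeval_C]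
    · change twistHom u (MvPolynomial.finSuccEquiv ℂ 1 (MvPolynomial.X i)) =
        MvPolynomial.aeval _ (MvPolynomial.X i)
      rw [MvPolynomial.aeval_X]
      refine Fin.cases ?_ (fun j => ?_) i
      · rw [MvPolynomial.finSuccEquiv_X_zero, twistHom_X]; rfl
      · rw [MvPolynomial.finSuccEquiv_X_succ, twistHom_C, MvPolynomial.aeval_X,
          Subsingleton.elim j 0]; rfl
  exact congrArg (fun f : _ →+* holomorphicRing => f p) h

/-- At `ρ` only the part of degree zero in `a` survives, and `u^6 b(ρ)` takes every nonzero value,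
so that part vanishes. The function `a` is not zero and can then be divided out, which lowers the
degree. -/
theorem eq_zero_of_twistHom : ∀ (n : ℕ) (f : (MvPolynomial (Fin 1) ℂ)[X]), f.natDegree ≤ n →
    (∀ u : ℂ, u ≠ 0 → twistHom u f = 0) → f = 0 := by
  have key : ∀ f : (MvPolynomial (Fin 1) ℂ)[X], (∀ u : ℂ, u ≠ 0 → twistHom u f = 0) →
      f.coeff 0 = 0 := by
    intro f hf
    -- Since `u` must be nonzero, the value at the origin is not reached; the extra variable makes
    -- the product vanish there as well.
    have h : MvPolynomial.X 0 * f.coeff 0 = 0 := by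
      refine MvPolynomial.funext fun s => ?_
      rw [map_zero, map_mul, MvPolynomial.eval_X, mul_eq_zero]
      by_cases hs : s 0 = 0
      · exact .inl hs
      right
      obtain ⟨u, hu⟩ := IsAlgClosed.exists_pow_nat_eq (s 0 / latB (periods rho))
        (show 0 < 6 by norm_num)
      have hu0 : u ≠ 0 := by
        rintro rfl
        rw [zero_pow (by norm_num)] at hu
        exact div_ne_zero hs latB_rho hu.symm
      have h1 := congrArg (evalAt rho) (hf u hu0)
      rw [← divX_mul_X_add f, map_add, map_mul, map_add, map_mul, map_zero] at h1
      have h2 : evalAt rho (twistHom u X) = 0 := by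
        rw [twistHom_X, map_smul, evalAt_holA, latA_rho, smul_zero]
      rw [h2, mul_zero, zero_add, twistHom_C, ← AlgHom.comp_apply, MvPolynomial.comp_aeval] at h1
      rw [← h1, MvPolynomial.aeval_eq_eval]
      congr 2
      ext i
      rw [Subsingleton.elim i 0, map_smul, evalAt_holB, hu, smul_eq_mul,
        div_mul_cancel₀ _ latB_rho]
    exact (mul_eq_zero.mp h).resolve_left (MvPolynomial.X_ne_zero 0)
  intro n
  induction n with
  | zero =>
    intro f hf h
    rw [eq_C_of_natDegree_le_zero hf, key f h, C_0]
  | succ n ih =>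
    intro f hf h
    have hd : f = divX f * X := by
      conv_lhs => rw [← divX_mul_X_add f, key f h, C_0, add_zero]
    have : divX f = 0 := by
      refine ih _ (by rw [natDegree_divX_eq_natDegree_tsub_one]; omega) fun u hu => ?_
      have h1 := h u hu
      rw [hd, map_mul] at h1
      refine (mul_eq_zero.mp h1).resolve_right ?_
      rw [twistHom_X]
      exact smul_ne_zero (pow_ne_zero 4 hu) holA_ne_zero
    rw [hd, this, zero_mul]

/-- The functions `a(τ)` and `b(τ)` are algebraically independent. -/
theorem aeval_holA_holB_injective :
    Function.Injective (MvPolynomial.aeval (R := ℂ) ![holA, holB]) := by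
  rw [injective_iff_map_eq_zero]
  intro p hp
  refine (map_eq_zero_iff (MvPolynomial.finSuccEquiv ℂ 1)
    (MvPolynomial.finSuccEquiv ℂ 1).injective).mp (eq_zero_of_twistHom _ _ le_rfl fun u _ => ?_)
  rw [twistHom_finSuccEquiv, aeval_twist hp]

end Independence

/-! ### Embedding the generic field and labelling the torsion points -/

section Realization

open Filter Topology
open scoped UpperHalfPlane

theorem isIntegral_of_range {R K : Type*} [CommRing R] [CommRing K] [Algebra R K] {x : K}
    (hx : IsIntegral (algebraMap R K).range x) : IsIntegral R x := by
  let _ : Algebra R (algebraMap R K).range := (algebraMap R K).rangeRestrict.toAlgebra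
  have : IsScalarTower R (algebraMap R K).range K := IsScalarTower.of_algebraMap_eq' rfl
  have : Algebra.IsIntegral R (algebraMap R K).range := ⟨fun y => by
    obtain ⟨z, rfl⟩ := (algebraMap R K).rangeRestrict_surjective y
    exact isIntegral_algebraMap⟩
  exact isIntegral_trans x hx

/-- A ring homomorphism onto an algebraically closed field extends to integral closures. -/
theorem exists_integralClosure_hom {R K Ω : Type*} [CommRing R] [CommRing K] [Algebra R K]
    (hinj : Function.Injective (algebraMap R K)) [Field Ω] [IsAlgClosed Ω] (f : R →+* Ω)
    (hf : Function.Surjective f) :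
    ∃ g : integralClosure R K →+* Ω, ∀ r, g (algebraMap R _ r) = f r := by
  have hm : (RingHom.ker f).IsMaximal := RingHom.ker_isMaximal_of_surjective f hf
  have hker : RingHom.ker (algebraMap R (integralClosure R K)) ≤ RingHom.ker f := by
    intro r hr
    rw [RingHom.mem_ker] at hr
    have : algebraMap R K r = 0 := congrArg Subtype.val hr
    rw [(map_eq_zero_iff _ hinj).mp this]
    exact zero_mem _
  obtain ⟨Q, hQ, hQm⟩ := Ideal.exists_ideal_over_maximal_of_isIntegral
    (S := integralClosure R K) (RingHom.ker f) hker
  let θ : Ω →+* (integralClosure R K ⧸ Q) := (Ideal.quotientMap Q (algebraMap R _) hQm.ge).comp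
    (RingHom.quotientKerEquivOfSurjective hf).symm.toRingHom
  have hθ : ∀ r, θ (f r) = Ideal.Quotient.mk Q (algebraMap R _ r) := by
    intro r
    have : (RingHom.quotientKerEquivOfSurjective hf).symm (f r) = Ideal.Quotient.mk _ r :=
      (RingEquiv.symm_apply_eq _).mpr rfl
    simp only [θ, RingHom.comp_apply, RingEquiv.toRingHom_eq_coe, RingHom.coe_coe, this]
    rfl
  have hfield : IsDomain (integralClosure R K ⧸ Q) := inferInstance
  have hint : θ.IsIntegral := by
    intro y
    obtain ⟨b, rfl⟩ := Ideal.Quotient.mk_surjective y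
    obtain ⟨p, hp, hpb⟩ := (Algebra.IsIntegral.isIntegral (R := R) b)
    refine ⟨p.map f, hp.map f, ?_⟩
    rw [eval₂_map, show θ.comp f = (Ideal.Quotient.mk Q).comp (algebraMap R _) from
      RingHom.ext hθ, ← hom_eval₂, hpb, map_zero]
  have hb := IsAlgClosed.ringHom_bijective_of_isIntegral θ hint
  refine ⟨(RingEquiv.ofBijective θ hb).symm.toRingHom.comp (Ideal.Quotient.mk Q), fun r => ?_⟩
  rw [RingHom.comp_apply, ← hθ]
  exact (RingEquiv.ofBijective θ hb).symm_apply_apply (f r)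

theorem exists_genField_hom {k Ω : Type*} [Field k] [Field Ω] [IsAlgClosed Ω]
    (f : MvPolynomial (Fin 2) k →+* Ω) (hf : Function.Injective f) :
    ∃ σ : GenField k →+* Ω, ∀ p, σ (algebraMap (BaseField k) (GenField k)
      (algebraMap (MvPolynomial (Fin 2) k) (BaseField k) p)) = f p := by
  let g : BaseField k →+* Ω := IsFractionRing.lift hf
  let _ : Algebra (BaseField k) Ω := g.toAlgebra
  refine ⟨(IsAlgClosed.lift (R := BaseField k) (S := GenField k) (M := Ω)).toRingHom, fun p => ?_⟩
  refine (AlgHom.commutes _ _).trans ?_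
  exact IsFractionRing.lift_algebraMap hf p

theorem mem_range_of_isIntegral {F Ω : Type*} [Field F] [IsAlgClosed F] [Field Ω] (σ : F →+* Ω)
    {x : Ω} (hx : IsIntegral σ.range x) : ∃ y, σ y = x := by
  let _ : Algebra F Ω := σ.toAlgebra
  have hx' : IsIntegral F x := isIntegral_of_range hx
  exact minpoly.mem_range_of_degree_eq_one F x
    (IsAlgClosed.degree_eq_one_of_irreducible F (minpoly.irreducible hx'))

/-- The pairs of integers both divisible by `l`. -/
def labelKernel (l : ℕ) : AddSubgroup (ℤ × ℤ) where
  carrier := {p | (l : ℤ) ∣ p.1 ∧ (l : ℤ) ∣ p.2}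
  zero_mem' := ⟨dvd_zero _, dvd_zero _⟩
  add_mem' := fun h h' => ⟨dvd_add h.1 h'.1, dvd_add h.2 h'.2⟩
  neg_mem' := fun h => ⟨(dvd_neg).mpr h.1, (dvd_neg).mpr h.2⟩

theorem nsmul_mem_labelKernel (l : ℕ) (p : ℤ × ℤ) : l • p ∈ labelKernel l :=
  ⟨⟨p.1, by simp⟩, ⟨p.2, by simp⟩⟩

/-- The argument `(r τ + s) / l` attached to the label `(r, s)`. -/
def torsionPt (l : ℕ) (τ : ℍ) : ℤ × ℤ →+ ℂ where
  toFun p := torsionArg l p.1 p.2 τ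
  map_zero' := by simp [torsionArg]
  map_add' p q := torsionArg_add l p.1 p.2 q.1 q.2 τ

theorem torsionPt_apply (l : ℕ) (τ : ℍ) (p : ℤ × ℤ) :
    torsionPt l τ p = torsionArg l p.1 p.2 τ := rfl

theorem torsionPt_mem_lattice {l : ℕ} [NeZero l] {τ : ℍ} {p : ℤ × ℤ} :
    torsionPt l τ p ∈ (periods τ).lattice ↔ p ∈ labelKernel l :=
  torsionArg_mem_lattice (NeZero.ne l)

variable (l : ℕ) [NeZero l]

/-- The function `℘((r τ + s) / l)`. -/
def holX (p : ℤ × ℤ) : holomorphicRing :=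
  if h : p ∈ labelKernel l then 0 else ⟨_, weierstrassP_mem_holomorphicRing (NeZero.ne l) h⟩

/-- The function `℘'((r τ + s) / l) / 2`. -/
def holY (p : ℤ × ℤ) : holomorphicRing :=
  if h : p ∈ labelKernel l then 0 else ⟨_, latY_mem_holomorphicRing (NeZero.ne l) h⟩

/-- The slope of the line through two torsion points, as a function of `τ`. -/
def holSlope (p q : ℤ × ℤ) : holomorphicRing :=
  if h : p ∉ labelKernel l ∧ q ∉ labelKernel l ∧ p + q ∉ labelKernel l then
    ⟨_, zetaSlope_mem_holomorphicRing (NeZero.ne l) h.1 h.2.1 h.2.2⟩ else 0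

variable {l}

theorem evalAt_holX {p : ℤ × ℤ} (h : p ∉ labelKernel l) (τ : ℍ) :
    evalAt τ (holX l p) = (periods τ).weierstrassP (torsionPt l τ p) := by
  rw [holX, dif_neg h]; rfl

theorem evalAt_holY {p : ℤ × ℤ} (h : p ∉ labelKernel l) (τ : ℍ) :
    evalAt τ (holY l p) = latY (periods τ) (torsionPt l τ p) := by
  rw [holY, dif_neg h]; rfl

theorem evalAt_holSlope {p q : ℤ × ℤ} (hp : p ∉ labelKernel l) (hq : q ∉ labelKernel l)
    (hpq : p + q ∉ labelKernel l) (τ : ℍ) : evalAt τ (holSlope l p q) =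
      zetaSlope (periods τ) (torsionPt l τ p) (torsionPt l τ q) := by
  rw [holSlope, dif_pos ⟨hp, hq, hpq⟩]; rfl

theorem isLineSection_of_evalAt {a b lam nu x₁ y₁ x₂ y₂ x₃ y₃ : holomorphicRing}
    (h : ∀ τ, IsLineSection (evalAt τ a) (evalAt τ b) (evalAt τ lam) (evalAt τ nu) (evalAt τ x₁)
      (evalAt τ y₁) (evalAt τ x₂) (evalAt τ y₂) (evalAt τ x₃) (evalAt τ y₃)) :
    IsLineSection a b lam nu x₁ y₁ x₂ y₂ x₃ y₃ := by
  refine ⟨⟨?_, ?_, ?_⟩, ?_, ?_, ?_⟩ <;> refine holomorphicRing_ext fun τ => ?_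
  · simpa using (h τ).1.1
  · simpa using (h τ).1.2.1
  · simpa using (h τ).1.2.2
  · simpa using (h τ).2.1
  · simpa [map_ofNat] using (h τ).2.2.1
  · simpa using (h τ).2.2.2

theorem hol_isLineSection {p q w : ℤ × ℤ} (hp : p ∉ labelKernel l) (hq : q ∉ labelKernel l)
    (hw : w ∉ labelKernel l) (h : p + q + w = 0) :
    IsLineSection holA holB (holSlope l p q) (holY l p - holSlope l p q * holX l p) (holX l p)
      (holY l p) (holX l q) (holY l q) (holX l w) (holY l w) := by
  refine isLineSection_of_evalAt fun τ => ?_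
  have hpq : p + q ∉ labelKernel l := by
    rwa [eq_neg_of_add_eq_zero_left h, neg_mem_iff]
  rw [map_sub, map_mul, evalAt_holSlope hp hq hpq, evalAt_holX hp, evalAt_holX hq, evalAt_holX hw,
    evalAt_holY hp, evalAt_holY hq, evalAt_holY hw, evalAt_holA, evalAt_holB]
  refine lattice_isLineSection (periods τ) ?_ ?_ ?_ ?_
  · rwa [torsionPt_mem_lattice]
  · rwa [torsionPt_mem_lattice]
  · rwa [torsionPt_mem_lattice]
  · rw [← map_add, ← map_add, h, map_zero]

theorem hol_nonsingular {Ω : Type*} [Field Ω] {ι : holomorphicRing →+* Ω}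
    (hι : Function.Injective ι) {p : ℤ × ℤ} (hp : p ∉ labelKernel l) :
    (curve (ι holA) (ι holB)).Nonsingular (ι (holX l p)) (ι (holY l p)) := by
  have hns := fun τ => curve_nonsingular_iff.mp (lattice_nonsingular (periods τ)
    (z := torsionPt l τ p) (by rwa [torsionPt_mem_lattice]))
  simp only [← evalAt_holX hp, ← evalAt_holY hp, ← evalAt_holA, ← evalAt_holB] at hns
  rw [curve_nonsingular_iff]
  constructor
  · have : holY l p ^ 2 = holX l p ^ 3 + holA * holX l p + holB :=
      holomorphicRing_ext fun τ => by simpa using (hns τ).1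
    rw [← map_pow, this]; simp
  · have h2 : ι 2 = 2 := map_ofNat ι 2
    have h3 : ι 3 = 3 := map_ofNat ι 3
    rw [← h2, ← h3, ← map_pow, ← map_mul, ← map_add, ← map_mul, map_ne_zero_iff _ hι,
      map_ne_zero_iff _ hι]
    rcases (hns UpperHalfPlane.I).2 with h | h
    · left
      intro h0
      apply h
      simpa [map_ofNat] using congrArg (evalAt UpperHalfPlane.I) h0
    · right
      intro h0
      apply h
      simpa [map_ofNat] using congrArg (evalAt UpperHalfPlane.I) h0

theorem hol_neg {p : ℤ × ℤ} (hp : p ∉ labelKernel l) :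
    holX l (-p) = holX l p ∧ holY l (-p) = -holY l p := by
  have hp' : -p ∉ labelKernel l := by rwa [neg_mem_iff]
  constructor <;> refine holomorphicRing_ext fun τ => ?_
  · rw [evalAt_holX hp, evalAt_holX hp', map_neg, PeriodPair.weierstrassP_neg]
  · rw [map_neg (evalAt τ), evalAt_holY hp, evalAt_holY hp', map_neg, latY_neg]

theorem hol_add_mem {p q : ℤ × ℤ} (hp : p ∈ labelKernel l) (hq : q ∉ labelKernel l) :
    holX l (p + q) = holX l q ∧ holY l (p + q) = holY l q := by
  have hpq : p + q ∉ labelKernel l := by rwa [(labelKernel l).add_mem_cancel_left hp]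
  have hm := fun τ => (torsionPt_mem_lattice (τ := τ)).mpr hp
  constructor <;> refine holomorphicRing_ext fun τ => ?_
  · rw [evalAt_holX hq, evalAt_holX hpq, map_add, add_comm, weierstrassP_add_mem _ (hm τ)]
  · rw [evalAt_holY hq, evalAt_holY hpq, map_add, add_comm, latY_add_mem _ (hm τ)]

/-- The torsion points of the generic curve, labelled by pairs of integers. -/
theorem exists_labelling {Ω : Type*} [Field Ω] [CharZero Ω] {ι : holomorphicRing →+* Ω}
    (hι : Function.Injective ι) {σ : GenField ℂ →+* Ω} (ha : σ (genA ℂ) = ι holA)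
    (hb : σ (genB ℂ) = ι holB) :
    ∃ φ : ℤ × ℤ →+ GenPoint ℂ, (∀ p, φ p = 0 ↔ p ∈ labelKernel l) ∧
      ∀ p, p ∉ labelKernel l →
        σ (xCoord (φ p)) = ι (holX l p) ∧ σ (yCoord (φ p)) = ι (holY l p) := by
  -- The labelling is first built over the large field `Ω`, where the coordinates are given by
  -- functions of `τ`.
  obtain ⟨φ, hφ0, hφ⟩ := exists_pointHom (labelKernel l) (fun p => ι (holX l p))
    (fun p => ι (holY l p)) (a := ι holA) (b := ι holB) (fun p hp => hol_nonsingular hι hp)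
    (fun p hp => by simp only [(hol_neg hp).1, (hol_neg hp).2, map_neg, and_self])
    (fun p q hp hq => by simp only [(hol_add_mem hp hq).1, (hol_add_mem hp hq).2, and_self])
    (fun p q w hp hq hw h => ⟨_, _, (hol_isLineSection hp hq hw h).map ι⟩)
  have hl : (l : Ω) ≠ 0 := Nat.cast_ne_zero.mpr (NeZero.ne l)
  have hmem : ∀ c, σ c ∈ σ.range := fun c => ⟨c, rfl⟩
  have hA : ι holA ∈ σ.range := ha ▸ hmem _
  have hB : ι holB ∈ σ.range := hb ▸ hmem _
  have hlinv : (l : Ω)⁻¹ ∈ σ.range := by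
    have := hmem ((l : GenField ℂ)⁻¹)
    rwa [map_inv₀, map_natCast] at this
  have htors : ∀ p, l • φ p = 0 := fun p => by
    rw [← map_nsmul, hφ0]; exact nsmul_mem_labelKernel l p
  have hxi := fun p => torsion_xCoord_integral σ.range hA hB hlinv hl (htors p)
  have hyi := fun p => torsion_yCoord_integral σ.range hA hB hlinv hl (htors p)
  -- These coordinates are integral over the image of the algebraically closed generic field, so
  -- they already lie in it and the labelling descends.
  choose X hX using fun p => mem_range_of_isIntegral σ (hxi p)
  choose Y hY using fun p => mem_range_of_isIntegral σ (hyi p)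
  have hX' : ∀ p, p ∉ labelKernel l → σ (X p) = ι (holX l p) := fun p hp => by
    rw [hX, (hφ p hp).1]
  have hY' : ∀ p, p ∉ labelKernel l → σ (Y p) = ι (holY l p) := fun p hp => by
    rw [hY, (hφ p hp).2]
  obtain ⟨φ', hφ0', hφ'⟩ := exists_pointHom (labelKernel l) X Y (a := genA ℂ) (b := genB ℂ)
    (fun p hp => isSmooth_generic (by norm_num) _ _ (curve_equation_iff.mpr (σ.injective (by
      have := curve_equation_iff.mp (hol_nonsingular hι hp).1
      simpa [hX' p hp, hY' p hp, ha, hb] using this))))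
    (fun p hp => ⟨σ.injective (by
        rw [hX' _ (by rwa [neg_mem_iff]), hX' p hp, (hol_neg hp).1]), σ.injective (by
        rw [map_neg, hY' _ (by rwa [neg_mem_iff]), hY' p hp, (hol_neg hp).2, map_neg])⟩)
    (fun p q hp hq => by
      have hpq : p + q ∉ labelKernel l := by rwa [(labelKernel l).add_mem_cancel_left hp]
      exact ⟨σ.injective (by rw [hX' _ hpq, hX' q hq, (hol_add_mem hp hq).1]),
        σ.injective (by rw [hY' _ hpq, hY' q hq, (hol_add_mem hp hq).2])⟩)
    (fun p q w hp hq hw h => by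
      have hs := (hol_isLineSection hp hq hw h).map ι
      have hi : ∀ p, p ∉ labelKernel l → IsIntegral σ.range (ι (holX l p)) := fun p hp => by
        rw [← (hφ p hp).1]; exact hxi p
      -- The slope descends for the same reason, its square being a sum of abscissae.
      obtain ⟨lam, hlam⟩ := mem_range_of_isIntegral σ
        (hs.slope_integral σ.range (hi p hp) (hi q hq) (hi w hw))
      refine ⟨lam, Y p - lam * X p, IsLineSection.of_map σ.injective ?_⟩
      rw [map_sub, map_mul] at hs ⊢
      rwa [ha, hb, hX' p hp, hX' q hq, hX' w hw, hY' p hp, hY' q hq, hY' w hw, hlam])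
  exact ⟨φ', hφ0', fun p hp => ⟨by rw [(hφ' p hp).1, hX' p hp], by rw [(hφ' p hp).2, hY' p hp]⟩⟩

end Realization

/-! ### The labelled points exhaust the torsion -/

section Range

open Filter Topology
open scoped UpperHalfPlane

/-- Reduction of the torsion of the generic curve to a given curve over an algebraically closed
field is injective. -/
theorem exists_specialization {k : Type*} [Field k] [IsAlgClosed k] {a b : k}
    (hs : IsSmooth a b) {l : ℕ} (hl : (l : k) ≠ 0) :
    ∃ s : (nsmulAddMonoidHom (α := GenPoint k) l).ker →+ (curve a b).Point,
      Function.Injective s := by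
  let R := MvPolynomial (Fin 2) k
  let K := GenField k
  have hinj : Function.Injective (algebraMap R K) := by
    rw [IsScalarTower.algebraMap_eq R (BaseField k) K]
    exact (algebraMap (BaseField k) K).injective.comp (IsFractionRing.injective R (BaseField k))
  -- The substitution of the given coefficients extends to the integral closure of the polynomial
  -- ring, which contains the coordinates of torsion points and the slopes. Nonzero torsion points
  -- therefore specialize to affine points, whence the injectivity.
  obtain ⟨ev, hev⟩ := exists_integralClosure_hom (K := K) hinj
    (MvPolynomial.aeval ![a, b] : R →ₐ[k] k).toRingHom
    (fun c => ⟨MvPolynomial.C c, MvPolynomial.aeval_C _ c⟩)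
  have hA : algebraMap R K (MvPolynomial.X 0) = genA k := IsScalarTower.algebraMap_apply _ (BaseField k) _ _
  have hB : algebraMap R K (MvPolynomial.X 1) = genB k := IsScalarTower.algebraMap_apply _ (BaseField k) _ _
  let A : integralClosure R K := ⟨genA k, hA ▸ isIntegral_algebraMap⟩
  let B : integralClosure R K := ⟨genB k, hB ▸ isIntegral_algebraMap⟩
  have evA : ev A = a := (congrArg ev (Subtype.ext hA.symm)).trans
    ((hev (MvPolynomial.X 0)).trans (MvPolynomial.aeval_X _ 0))
  have evB : ev B = b := (congrArg ev (Subtype.ext hB.symm)).trans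
    ((hev (MvPolynomial.X 1)).trans (MvPolynomial.aeval_X _ 1))
  have hlK : (l : K) ≠ 0 := by
    rw [← map_natCast (algebraMap k K)]
    exact (_root_.map_ne_zero _).mpr hl
  have hgA : genA k ∈ (algebraMap R K).range := ⟨_, hA⟩
  have hgB : genB k ∈ (algebraMap R K).range := ⟨_, hB⟩
  have hlinv : (l : K)⁻¹ ∈ (algebraMap R K).range := by
    refine ⟨MvPolynomial.C (l : k)⁻¹, ?_⟩
    have : algebraMap R K (MvPolynomial.C (l : k)⁻¹) = algebraMap k K (l : k)⁻¹ :=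
      (IsScalarTower.algebraMap_apply k R K _).symm
    rw [this, map_inv₀, map_natCast]
  let T := (nsmulAddMonoidHom (α := GenPoint k) l).ker
  have hT : ∀ u : T, l • u.1 = 0 := fun u => u.2
  let X : T → integralClosure R K := fun u => ⟨xCoord u.1,
    isIntegral_of_range (torsion_xCoord_integral (algebraMap R K).range hgA hgB hlinv hlK (hT u))⟩
  let Y : T → integralClosure R K := fun u => ⟨yCoord u.1,
    isIntegral_of_range (torsion_yCoord_integral (algebraMap R K).range hgA hgB hlinv hlK (hT u))⟩
  have hne : ∀ u : T, u ∉ (⊥ : AddSubgroup T) → u.1 ≠ 0 := fun u hu h =>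
    hu (AddSubgroup.mem_bot.mpr (Subtype.ext h))
  obtain ⟨s, hs0, -⟩ := exists_pointHom (⊥ : AddSubgroup T) (fun u => ev (X u)) (fun u => ev (Y u))
    (a := a) (b := b) (fun u hu => hs _ _ (curve_equation_iff.mpr (by
      have : Y u ^ 2 = X u ^ 3 + A * X u + B :=
        Subtype.ext (point_equation (hne u hu))
      rw [← map_pow, this]
      simp [evA, evB])))
    (fun u hu => ⟨congrArg ev (Subtype.ext (xCoord_neg u.1)), by
      rw [← map_neg]; exact congrArg ev (Subtype.ext (yCoord_neg u.1))⟩)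
    (fun u v hu hv => by rw [AddSubgroup.mem_bot.mp hu, zero_add]; exact ⟨rfl, rfl⟩)
    (fun u v w hu hv hw h => by
      have hL := isLineSection_of_points (hne u hu) (hne v hv) (hne w hw) (congrArg Subtype.val h)
      have hi : ∀ u : T, IsIntegral (algebraMap R K).range (xCoord u.1) := fun u =>
        torsion_xCoord_integral (algebraMap R K).range hgA hgB hlinv hlK (hT u)
      have hlam := isIntegral_of_range (hL.slope_integral (algebraMap R K).range (hi u) (hi v) (hi w))
      generalize (curve (genA k) (genB k)).slope (xCoord u.1) (xCoord v.1) (yCoord u.1)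
        (yCoord v.1) = lam at hL hlam
      let Lam : integralClosure R K := ⟨lam, hlam⟩
      have hL' : IsLineSection A B Lam (Y u - Lam * X u) (X u) (Y u) (X v) (Y v) (X w) (Y w) := by
        refine IsLineSection.of_map (f := (integralClosure R K).val.toRingHom)
          Subtype.val_injective ?_
        exact hL
      have := hL'.map ev
      rw [evA, evB] at this
      exact ⟨_, _, this⟩)
  exact ⟨s, (injective_iff_map_eq_zero s).mpr fun u hu => AddSubgroup.mem_bot.mp ((hs0 u).mp hu)⟩

theorem sub_emod_mem_labelKernel (l : ℕ) (p : ℤ × ℤ) :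
    p - (p.1 % l, p.2 % l) ∈ labelKernel l :=
  ⟨Int.dvd_self_sub_emod, Int.dvd_self_sub_emod⟩

theorem finite_range_of_labelKernel_le {A : Type*} [AddCommGroup A] {l : ℕ} (hl : l ≠ 0)
    {f : ℤ × ℤ →+ A} (hf : labelKernel l ≤ f.ker) : Finite f.range := by
  have hfin : (f '' (Set.Icc 0 (l : ℤ) ×ˢ Set.Icc 0 (l : ℤ))).Finite :=
    ((Set.finite_Icc _ _).prod (Set.finite_Icc _ _)).image _
  refine hfin.subset ?_
  rintro _ ⟨p, rfl⟩
  have hl' : (0 : ℤ) < l := by exact_mod_cast Nat.pos_of_ne_zero hl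
  refine ⟨(p.1 % l, p.2 % l), ⟨⟨Int.emod_nonneg _ hl'.ne', (Int.emod_lt_of_pos _ hl').le⟩,
    ⟨Int.emod_nonneg _ hl'.ne', (Int.emod_lt_of_pos _ hl').le⟩⟩, ?_⟩
  have := hf (sub_emod_mem_labelKernel l p)
  rw [AddMonoidHom.mem_ker, map_sub, sub_eq_zero] at this
  exact this.symm

/-- Both ranges are quotients by the same kernel, so an inclusion between them, once finite, is an
equality. -/
theorem range_eq_of_ker_eq {G A : Type*} [AddCommGroup G] [AddCommGroup A] {f g : G →+ A}
    (hker : f.ker = g.ker) (hle : f.range ≤ g.range) [Finite g.range] : f.range = g.range := by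
  have hc : Nat.card g.range = Nat.card f.range := by
    rw [← Nat.card_congr (QuotientAddGroup.quotientKerEquivRange f).toEquiv,
      ← Nat.card_congr (QuotientAddGroup.quotientKerEquivRange g).toEquiv, hker]
  exact AddSubgroup.eq_of_le_of_card_ge hle hc.le

/-- A homomorphism with kernel `l ℤ²` hits all the `l`-torsion of the generic curve. -/
theorem labelling_range {l : ℕ} [NeZero l] {φ : ℤ × ℤ →+ GenPoint ℂ}
    (hφ : ∀ p, φ p = 0 ↔ p ∈ labelKernel l) (P : GenPoint ℂ) (hP : l • P = 0) : ∃ p, φ p = P := by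
  let L := periods UpperHalfPlane.I
  obtain ⟨s, hs⟩ := exists_specialization (k := ℂ) (lattice_isSmooth L)
    (Nat.cast_ne_zero.mpr (NeZero.ne l))
  obtain ⟨u, hu0, -, husurj⟩ := exists_uniformization L
  have hT : ∀ p, l • φ p = 0 := fun p => by
    rw [← map_nsmul, hφ]; exact nsmul_mem_labelKernel l p
  -- Two labellings of the torsion of the lattice curve at `τ = i` are compared: `f` specializes the
  -- generic one and `g` comes from the uniformization. Both have kernel `l ℤ^2` and `g` reaches all
  -- the `l`-torsion, so `f` does too; injectivity of `s` then recovers the generic point.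
  let f : ℤ × ℤ →+ (curve (latA L) (latB L)).Point :=
    s.comp (φ.codRestrict (nsmulAddMonoidHom (α := GenPoint ℂ) l).ker hT)
  let g : ℤ × ℤ →+ (curve (latA L) (latB L)).Point := u.comp (torsionPt l UpperHalfPlane.I)
  have hf : f.ker = labelKernel l := by
    ext p
    rw [AddMonoidHom.mem_ker, ← hφ]
    refine (map_eq_zero_iff s hs).trans ?_
    exact ⟨fun h => congrArg Subtype.val h, fun h => Subtype.ext h⟩
  have hg : g.ker = labelKernel l := by
    ext p
    rw [AddMonoidHom.mem_ker]
    exact (hu0 _).trans torsionPt_mem_lattice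
  have hgr : ∀ Q, l • Q = 0 → Q ∈ g.range := by
    intro Q hQ
    obtain ⟨z, rfl⟩ := husurj Q
    rw [← map_nsmul, hu0, mem_lattice_periods] at hQ
    obtain ⟨m, n, h⟩ := hQ
    refine ⟨(m, n), congrArg u ?_⟩
    rw [torsionPt_apply, torsionArg, h, nsmul_eq_mul,
      mul_div_cancel_left₀ _ (Nat.cast_ne_zero.mpr (NeZero.ne l))]
  have : Finite g.range := finite_range_of_labelKernel_le (NeZero.ne l) hg.ge
  have hle : f.range ≤ g.range := by
    rintro _ ⟨p, rfl⟩
    apply hgr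
    rw [← map_nsmul]
    exact (AddMonoidHom.mem_ker).mp (hf.ge (nsmul_mem_labelKernel l p))
  have heq := range_eq_of_ker_eq (hf.trans hg.symm) hle
  have hsP : s ⟨P, hP⟩ ∈ f.range := by
    rw [heq]
    apply hgr
    rw [← map_nsmul]
    exact (congrArg s (Subtype.ext hP)).trans (map_zero s)
  obtain ⟨p, hp⟩ := hsP
  exact ⟨p, congrArg Subtype.val (hs hp)⟩

end Range

/-! ### `R_l` as a ring of holomorphic functions -/

section Realization

open Filter Topology
open scoped UpperHalfPlane

variable {l : ℕ} [NeZero l]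

/-- The ring `R_l` as a ring of holomorphic functions. -/
theorem exists_realization : ∃ (φ : ℤ × ℤ →+ GenPoint ℂ) (Ψ : ringR ℂ l →ₐ[ℂ] holomorphicRing),
    Function.Injective Ψ ∧ (∀ p, φ p = 0 ↔ p ∈ labelKernel l) ∧
    (∀ P : GenPoint ℂ, l • P = 0 ↔ ∃ p, φ p = P) ∧
    Ψ (ringR.gen .a) = holA ∧ Ψ (ringR.gen .b) = holB ∧
    (∀ (P : Torsion ℂ l) p, φ p = P.1 → Ψ (ringR.gen (.x P)) = holX l p) ∧
    (∀ (P : Torsion ℂ l) p, φ p = P.1 → Ψ (ringR.gen (.y P)) = holY l p) ∧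
    (∀ (P Q R : Torsion ℂ l) (h : P.1 + Q.1 + R.1 = 0) p q (c : ringR ℂ l), φ p = P.1 → φ q = Q.1 →
      (c : GenField ℂ) = GenVar.val (.slope P Q R h) → Ψ c = holSlope l p q) := by
  let M := FractionRing holomorphicRing
  let Ω := AlgebraicClosure M
  let ι : holomorphicRing →+* Ω := (algebraMap M Ω).comp (algebraMap holomorphicRing M)
  have hι : Function.Injective ι :=
    (algebraMap M Ω).injective.comp (IsFractionRing.injective holomorphicRing M)
  have hchar : CharZero Ω := charZero_of_injective_ringHom
    (f := ι.comp (algebraMap ℂ holomorphicRing)) (RingHom.injective _)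
  obtain ⟨σ, hσ⟩ := exists_genField_hom (ι.comp (MvPolynomial.aeval (R := ℂ) ![holA, holB]).toRingHom)
    (hι.comp aeval_holA_holB_injective)
  have ha : σ (genA ℂ) = ι holA := (hσ _).trans (congrArg ι (by simp))
  have hb : σ (genB ℂ) = ι holB := (hσ _).trans (congrArg ι (by simp))
  have hc : ∀ c : ℂ, σ (algebraMap ℂ _ c) = ι (algebraMap ℂ _ c) := fun c => by
    have := hσ (MvPolynomial.C c)
    rw [← MvPolynomial.algebraMap_eq, ← IsScalarTower.algebraMap_apply,
      ← IsScalarTower.algebraMap_apply] at this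
    exact this.trans (congrArg ι (AlgHom.commutes _ c))
  obtain ⟨φ, hφ0, hφ⟩ := exists_labelling (l := l) hι ha hb
  have hrange : ∀ P : GenPoint ℂ, l • P = 0 ↔ ∃ p, φ p = P := by
    refine fun P => ⟨labelling_range hφ0 P, ?_⟩
    rintro ⟨p, rfl⟩
    rw [← map_nsmul, hφ0]
    exact nsmul_mem_labelKernel l p
  have hlab : ∀ (P : Torsion ℂ l) p, φ p = P.1 → p ∉ labelKernel l := fun P p hp h =>
    P.2.2 (by rw [← hp, (hφ0 p).mpr h])
  have hx : ∀ (P : Torsion ℂ l) p, φ p = P.1 → σ (xCoord P.1) = ι (holX l p) := fun P p hp => by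
    rw [← hp]; exact (hφ p (hlab P p hp)).1
  have hy : ∀ (P : Torsion ℂ l) p, φ p = P.1 → σ (yCoord P.1) = ι (holY l p) := fun P p hp => by
    rw [← hp]; exact (hφ p (hlab P p hp)).2
  have hsl : ∀ (P Q R : Torsion ℂ l) (h : P.1 + Q.1 + R.1 = 0) p q, φ p = P.1 → φ q = Q.1 →
      σ (GenVar.val (.slope P Q R h)) = ι (holSlope l p q) := by
    intro P Q R h p q hp hq
    have hr : φ (-(p + q)) = R.1 := by
      rw [map_neg, map_add, hp, hq]; exact (eq_neg_of_add_eq_zero_right h).symm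
    have hns := fun (P : Torsion ℂ l) p (hp : φ p = P.1) =>
      hol_nonsingular hι (hlab P p hp)
    have h1 := (hol_isLineSection (hlab P p hp) (hlab Q q hq) (hlab R _ hr) (by abel)).map ι
    have h2 := (isLineSection_of_points P.2.2 Q.2.2 R.2.2 h).map σ
    rw [ha, hb, hx P p hp, hx Q q hq, hx R _ hr, hy P p hp, hy Q q hq, hy R _ hr] at h2
    -- The image of the algebraic slope and the analytic slope belong to line sections through the
    -- same three points, so they are equal.
    have e1 := h1.slope_eq (P := .some _ _ (hns P p hp)) (Q := .some _ _ (hns Q q hq))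
      (R := .some _ _ (hns R _ hr)) (WeierstrassCurve.Affine.Point.some_ne_zero _)
      (WeierstrassCurve.Affine.Point.some_ne_zero _) (WeierstrassCurve.Affine.Point.some_ne_zero _)
    have e2 := h2.slope_eq (P := .some _ _ (hns P p hp)) (Q := .some _ _ (hns Q q hq))
      (R := .some _ _ (hns R _ hr)) (WeierstrassCurve.Affine.Point.some_ne_zero _)
      (WeierstrassCurve.Affine.Point.some_ne_zero _) (WeierstrassCurve.Affine.Point.some_ne_zero _)
    exact e2.symm.trans e1
  have hval : ∀ v : GenVar ℂ l, ∃ g, ι g = σ v.val := by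
    rintro ((_ | _ | P | P) | ⟨P, Q, R, h⟩)
    · exact ⟨_, ha.symm⟩
    · exact ⟨_, hb.symm⟩
    · obtain ⟨p, hp⟩ := (hrange P.1).mp P.2.1
      exact ⟨_, (hx P p hp).symm⟩
    · obtain ⟨p, hp⟩ := (hrange P.1).mp P.2.1
      exact ⟨_, (hy P p hp).symm⟩
    · obtain ⟨p, hp⟩ := (hrange P.1).mp P.2.1
      obtain ⟨q, hq⟩ := (hrange Q.1).mp Q.2.1
      exact ⟨_, (hsl P Q R h p q hp hq).symm⟩
  -- The embedding sends the generators, hence all of `R_l`, to genuine holomorphic functions,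
  -- although it is only defined with values in an algebraic closure of their fraction field.
  have hmem : ∀ c : ringR ℂ l, ∃ g, ι g = σ c := by
    rintro ⟨_, p, rfl⟩
    change ∃ g, ι g = σ (MvPolynomial.aeval GenVar.val p)
    induction p using MvPolynomial.induction_on with
    | C c => exact ⟨_, (hc c).symm.trans (by rw [MvPolynomial.aeval_C])⟩
    | add p q hp hq =>
      obtain ⟨g, hg⟩ := hp
      obtain ⟨g', hg'⟩ := hq
      exact ⟨g + g', by rw [map_add, hg, hg', map_add, map_add]⟩
    | mul_X p i hp =>
      obtain ⟨g, hg⟩ := hp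
      obtain ⟨g', hg'⟩ := hval i
      exact ⟨g * g', by rw [map_mul, hg, hg', map_mul, map_mul, MvPolynomial.aeval_X]⟩
  choose ψ hψ using hmem
  let Ψ : ringR ℂ l →ₐ[ℂ] holomorphicRing := {
    toFun := ψ
    map_one' := hι (by rw [hψ]; simp)
    map_mul' := fun c d => hι (by rw [map_mul, hψ, hψ, hψ]; simp)
    map_zero' := hι (by rw [hψ]; simp)
    map_add' := fun c d => hι (by rw [map_add, hψ, hψ, hψ]; simp)
    commutes' := fun c => hι (by rw [hψ]; exact hc c) }
  refine ⟨φ, Ψ, fun c d h => Subtype.ext (σ.injective ?_), hφ0, hrange, hι ?_, hι ?_, ?_, ?_, ?_⟩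
  · rw [← hψ, ← hψ]; exact congrArg ι h
  · exact (hψ _).trans ha
  · exact (hψ _).trans hb
  · exact fun P p hp => hι ((hψ _).trans (hx P p hp))
  · exact fun P p hp => hι ((hψ _).trans (hy P p hp))
  · exact fun P Q R h p q c hp hq hc => hι ((hψ c).trans (hc ▸ hsl P Q R h p q hp hq))

end Realization

/-! ### Regularization of Hecke's series -/

section Hecke

open Filter Topology ComplexConjugate
open scoped UpperHalfPlane

/-- The summand `z ^ (-j) |z| ^ (-2 s)` of Hecke's series. -/
def heckeTerm (j : ℕ) (s z : ℂ) : ℂ :=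
  if z = 0 then 0 else 1 / (z ^ j * ((‖z‖ : ℝ) : ℂ) ^ (2 * s))

theorem heckeTerm_zero (j : ℕ) (s : ℂ) : heckeTerm j s 0 = 0 := if_pos rfl

theorem heckeSeries_eq (j : ℕ) (τ : ℍ) (α s : ℂ) :
    heckeSeries j τ α s = ∑' ω : (periods τ).lattice, heckeTerm j s (α + ω) := by
  rw [heckeSeries, ← (periodEquiv τ).tsum_eq]
  simp_rw [periodEquiv_apply]
  rfl

theorem norm_heckeTerm {j : ℕ} {s z : ℂ} (hz : z ≠ 0) :
    ‖heckeTerm j s z‖ = ‖z‖ ^ (-(j : ℝ) - 2 * s.re) := by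
  have hz' : 0 < ‖z‖ := norm_pos_iff.mpr hz
  rw [heckeTerm, if_neg hz, norm_div, norm_one, norm_mul, norm_pow,
    Complex.norm_cpow_eq_rpow_re_of_pos hz', sub_eq_add_neg, Real.rpow_add hz', Real.rpow_neg hz'.le,
    Real.rpow_natCast, Real.rpow_neg hz'.le, one_div, mul_inv]
  simp

theorem norm_heckeTerm_le (j : ℕ) (s z : ℂ) :
    ‖heckeTerm j s z‖ ≤ ‖z‖ ^ (-(j : ℝ) - 2 * s.re) := by
  by_cases hz : z = 0
  · rw [hz, heckeTerm_zero, norm_zero]; positivity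
  · exact (norm_heckeTerm hz).le

theorem heckeTerm_at_zero (j : ℕ) (hj : j ≠ 0) (z : ℂ) : heckeTerm j 0 z = (z ^ j)⁻¹ := by
  rw [heckeTerm]
  split_ifs with h
  · simp [h, hj]
  · simp

theorem heckeTerm_neg (j : ℕ) (s z : ℂ) : heckeTerm j s (-z) = (-1) ^ j * heckeTerm j s z := by
  rw [heckeTerm, heckeTerm]
  by_cases hz : z = 0
  · simp [hz]
  · rw [if_neg (neg_ne_zero.mpr hz), if_neg hz, norm_neg, neg_pow, mul_assoc, one_div, mul_inv,
      ← inv_pow, one_div]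
    norm_num

theorem differentiable_heckeTerm (j : ℕ) (z : ℂ) : Differentiable ℂ fun s => heckeTerm j s z := by
  intro s
  simp only [heckeTerm]
  by_cases hz : z = 0
  · simp only [hz, if_true]; exact differentiableAt_const _
  · simp only [if_neg hz]
    have h0 : ((‖z‖ : ℝ) : ℂ) ≠ 0 := Complex.ofReal_ne_zero.mpr (norm_ne_zero_iff.mpr hz)
    have h1 : ((‖z‖ : ℝ) : ℂ) ^ (2 * s) ≠ 0 := by simp [Complex.cpow_eq_zero_iff, h0]
    have h2 : DifferentiableAt ℂ (fun s : ℂ => ((‖z‖ : ℝ) : ℂ) ^ (2 * s)) s :=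
      DifferentiableAt.const_cpow (by fun_prop) (.inl h0)
    exact (differentiableAt_const _).div ((differentiableAt_const _).mul h2)
      (mul_ne_zero (pow_ne_zero _ hz) h1)

theorem heckeTerm_mul {j : ℕ} {s z w : ℂ} :
    heckeTerm j s (z * w) = heckeTerm j s z * heckeTerm j s w := by
  by_cases hz : z = 0
  · simp [hz, heckeTerm_zero]
  by_cases hw : w = 0
  · simp [hw, heckeTerm_zero]
  rw [heckeTerm, heckeTerm, heckeTerm, if_neg hz, if_neg hw, if_neg (mul_ne_zero hz hw), norm_mul,
    Complex.ofReal_mul, Complex.mul_cpow_ofReal_nonneg (norm_nonneg _) (norm_nonneg _), mul_pow]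
  field_simp

/-- With `w = log(1+u)` one has `2 log|1+u| = w + conj w`, so the term is the exponential of a
real-linear form in `w`, ready for a Taylor estimate. -/
theorem heckeTerm_one_add {j : ℕ} {s u : ℂ} (hu : ‖u‖ < 1) : heckeTerm j s (1 + u) =
    Complex.exp (-((j + s) * Complex.log (1 + u)) - s * conj (Complex.log (1 + u))) := by
  have h0 : 1 + u ≠ 0 := fun h => by
    rw [eq_neg_of_add_eq_zero_right h, norm_neg, norm_one] at hu
    exact lt_irrefl _ hu
  have h1 : ((‖1 + u‖ : ℝ) : ℂ) ≠ 0 := Complex.ofReal_ne_zero.mpr (norm_ne_zero_iff.mpr h0)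
  rw [heckeTerm, if_neg h0, Complex.cpow_def_of_ne_zero h1, ← Complex.ofReal_log (norm_nonneg _),
    ← Complex.log_re]
  have h2 : (((Complex.log (1 + u)).re : ℝ) : ℂ) * (2 * s) =
      s * Complex.log (1 + u) + s * conj (Complex.log (1 + u)) := by
    have := Complex.add_conj (Complex.log (1 + u))
    push_cast at this
    linear_combination -s * this
  have h3 : (1 + u) ^ j = Complex.exp (j * Complex.log (1 + u)) := by
    rw [Complex.exp_nat_mul, Complex.exp_log h0]
  rw [h2, h3, ← Complex.exp_add, one_div, ← Complex.exp_neg]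
  congr 1
  ring

/-- Second order Taylor estimate for `(1 + u) ^ (-j) |1 + u| ^ (-2 s)`. -/
theorem exists_heckeTerm_one_add_bound (j : ℕ) {R : ℝ} (hR : 0 < R) : ∃ C r : ℝ, 0 < C ∧ 0 < r ∧
    ∀ u s : ℂ, ‖u‖ ≤ r → ‖s‖ ≤ R →
      ‖heckeTerm j s (1 + u) - 1 + ((j + s) * u + s * conj u)‖ ≤ C * ‖u‖ ^ 2 := by
  set K : ℝ := j + 2 * R with hK
  have hK0 : 0 < K := by positivity
  -- Here `K` bounds the real-linear form `-(j+s)x - s conj x`. The radius keeps `|log(1+u)| ≤ 2|u|`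
  -- and the exponent of size at most `2K|u| ≤ 1`; the exponential then costs `(2K|u|)^2`, and
  -- replacing the logarithm by `u` costs `K|u|^2`.
  refine ⟨4 * K ^ 2 + K, min (1 / 2) (1 / (2 * K)), by positivity, by positivity,
    fun u s hu hs => ?_⟩
  have hu1 : ‖u‖ ≤ 1 / 2 := hu.trans (min_le_left _ _)
  have hu2 : ‖u‖ * (2 * K) ≤ 1 := by
    have := hu.trans (min_le_right _ _)
    rwa [le_div_iff₀ (by positivity)] at this
  rw [heckeTerm_one_add (by linarith)]
  have hw := Complex.norm_log_one_add_sub_self_le (z := u) (by linarith)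
  set w := Complex.log (1 + u) with hwdef
  have hw1 : ‖w - u‖ ≤ ‖u‖ ^ 2 := by
    refine hw.trans ?_
    have : (1 - ‖u‖)⁻¹ ≤ 2 := inv_le_of_inv_le₀ (by norm_num) (by linarith)
    nlinarith [sq_nonneg ‖u‖]
  have hw2 : ‖w‖ ≤ 2 * ‖u‖ := by
    have := norm_add_le (w - u) u
    rw [sub_add_cancel] at this
    nlinarith [norm_nonneg u]
  have lin : ∀ x : ℂ, ‖-((j + s) * x) - s * conj x‖ ≤ K * ‖x‖ := by
    intro x
    refine (norm_sub_le _ _).trans ?_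
    rw [norm_neg, norm_mul, norm_mul, RCLike.norm_conj]
    have : ‖(j : ℂ) + s‖ ≤ j + R := (norm_add_le _ _).trans (by simpa using hs)
    nlinarith [norm_nonneg x]
  set v := -((j + s) * w) - s * conj w with hv
  have hv1 : ‖v‖ ≤ 2 * K * ‖u‖ := (lin w).trans (by nlinarith)
  have hv2 := Complex.norm_exp_sub_one_sub_id_le (x := v) (by linarith)
  have e : Complex.exp v - 1 + ((j + s) * u + s * conj u) =
      (Complex.exp v - 1 - v) + (-((j + s) * (w - u)) - s * conj (w - u)) := by
    rw [hv, map_sub]; ring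
  rw [e]
  refine (norm_add_le _ _).trans ?_
  have h3 : ‖v‖ ^ 2 ≤ (2 * K * ‖u‖) ^ 2 := pow_le_pow_left₀ (norm_nonneg _) hv1 2
  have h4 := (lin (w - u)).trans (mul_le_mul_of_nonneg_left hw1 hK0.le)
  nlinarith

/-- The remainder of `heckeTerm j s (α + ω)` after the terms of first order in `α`. -/
def heckeRem (j : ℕ) (s α ω : ℂ) : ℂ := heckeTerm j s (α + ω) - heckeTerm j s ω +
  ((j + s) * (α / ω) + s * conj (α / ω)) * heckeTerm j s ω

theorem differentiable_heckeRem (j : ℕ) (α ω : ℂ) : Differentiable ℂ fun s => heckeRem j s α ω := by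
  have h1 := differentiable_heckeTerm j (α + ω)
  have h2 := differentiable_heckeTerm j ω
  unfold heckeRem
  fun_prop

/-- By homogeneity everything depends on `α/ω`, which is small for all but finitely many `ω`. -/
theorem heckeRem_eq {j : ℕ} {s α ω : ℂ} (hω : ω ≠ 0) : heckeRem j s α ω = heckeTerm j s ω *
    (heckeTerm j s (1 + α / ω) - 1 + ((j + s) * (α / ω) + s * conj (α / ω))) := by
  have : α + ω = ω * (1 + α / ω) := by field_simp; ring
  rw [heckeRem, this, heckeTerm_mul]
  ring

variable (L : PeriodPair)

theorem tendsto_norm_lattice : Tendsto (fun ω : L.lattice => ‖(ω : ℂ)‖) cofinite atTop := by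
  have h := ZLattice.summable_norm_rpow L.lattice (-3) (by simp; norm_num)
  have h0 := h.tendsto_cofinite_zero
  rw [tendsto_atTop]
  intro B
  have hB : (0 : ℝ) < (max B 1) ^ (-3 : ℝ) := by positivity
  have hne : ∀ᶠ ω : L.lattice in cofinite, ω ≠ 0 := by
    rw [eventually_cofinite]; simp
  filter_upwards [h0.eventually_lt_const hB, hne] with ω hω hne
  have hpos : 0 < ‖ω‖ := norm_pos_iff.mpr hne
  by_contra hlt
  push Not at hlt
  have := Real.rpow_le_rpow_of_nonpos hpos (hlt.le.trans (le_max_left B 1)) (by norm_num : (-3 : ℝ) ≤ 0)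
  exact absurd hω (not_lt.mpr this)

theorem summable_norm_lattice {x : ℂ} {r : ℝ} (hr : r < -2) :
    Summable fun ω : L.lattice => ‖x + ω‖ ^ r := by
  have := ZLattice.summable_norm_sub_rpow L.lattice r (by simpa using hr) (-x)
  simpa [sub_neg_eq_add, add_comm] using this

/-- For `j ≥ 1` and `Re s > -1/4` the term at a large `ω` is at most `|ω|^(-1/2)`, and the second
order remainder adds the factor `|α/ω|^2`; the exponent `-5/2` is summable. -/
theorem exists_heckeRem_bound {j : ℕ} (hj : 1 ≤ j) (α : ℂ) {R : ℝ} (hR : 0 < R) : ∃ C : ℝ, 0 < C ∧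
    ∀ᶠ ω : L.lattice in cofinite, ∀ s : ℂ, s ∈ {s : ℂ | -(1 / 4) < s.re ∧ ‖s‖ < R} →
      ‖heckeRem j s α ω‖ ≤ C * ‖(0 : ℂ) + ω‖ ^ (-(5 / 2) : ℝ) := by
  obtain ⟨C, r, hC, hr, hb⟩ := exists_heckeTerm_one_add_bound j hR
  refine ⟨C * ‖α‖ ^ 2 + 1, by positivity, ?_⟩
  filter_upwards [(tendsto_norm_lattice L).eventually_ge_atTop (max 1 (‖α‖ / r))] with ω hω s hs
  have h1 : 1 ≤ ‖(ω : ℂ)‖ := (le_max_left _ _).trans hω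
  have h2 : ‖α‖ / r ≤ ‖(ω : ℂ)‖ := (le_max_right _ _).trans hω
  have h0 : 0 < ‖(ω : ℂ)‖ := by linarith
  have hω0 : (ω : ℂ) ≠ 0 := norm_pos_iff.mp h0
  have hu : ‖α / ω‖ ≤ r := by
    rw [norm_div, div_le_iff₀ h0]
    rwa [div_le_iff₀ hr, mul_comm] at h2
  rw [heckeRem_eq hω0, norm_mul, norm_heckeTerm hω0, zero_add]
  have hb' := hb (α / ω) s hu hs.2.le
  rw [norm_div, div_pow] at hb'
  have hj' : (1 : ℝ) ≤ j := by exact_mod_cast hj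
  have hs1 : -(1 / 4 : ℝ) < s.re := hs.1
  have h3 : ‖(ω : ℂ)‖ ^ (-(j : ℝ) - 2 * s.re) ≤ ‖(ω : ℂ)‖ ^ (-(1 / 2) : ℝ) :=
    Real.rpow_le_rpow_of_exponent_le h1 (by linarith)
  have h4 : ‖(ω : ℂ)‖ ^ (-(5 / 2) : ℝ) = ‖(ω : ℂ)‖ ^ (-(1 / 2) : ℝ) / ‖(ω : ℂ)‖ ^ 2 := by
    rw [← Real.rpow_natCast, ← Real.rpow_sub h0]; norm_num
  calc _ ≤ ‖(ω : ℂ)‖ ^ (-(1 / 2) : ℝ) * (C * (‖α‖ ^ 2 / ‖(ω : ℂ)‖ ^ 2)) := by gcongr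
    _ = C * ‖α‖ ^ 2 * ‖(ω : ℂ)‖ ^ (-(5 / 2) : ℝ) := by rw [h4]; ring
    _ ≤ _ := mul_le_mul_of_nonneg_right (by linarith) (by positivity)

/-- The regularized lattice sum, which converges for `Re s > -1/4`. -/
def heckeReg (j : ℕ) (α s : ℂ) : ℂ := ∑' ω : L.lattice, heckeRem j s α ω

theorem analyticOnNhd_heckeReg {j : ℕ} (hj : 1 ≤ j) (α : ℂ) :
    AnalyticOnNhd ℂ (heckeReg L j α) {s : ℂ | -(1 / 4) < s.re} := by
  have hopen : IsOpen {s : ℂ | -(1 / 4) < s.re} := isOpen_lt continuous_const Complex.continuous_re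
  refine DifferentiableOn.analyticOnNhd (fun s hs => ?_) hopen
  obtain ⟨C, hC, hb⟩ := exists_heckeRem_bound L hj α (R := ‖s‖ + 1) (by positivity)
  set U : Set ℂ := {z : ℂ | -(1 / 4) < z.re ∧ ‖z‖ < ‖s‖ + 1} with hU
  have hUo : IsOpen U := hopen.inter (isOpen_lt continuous_norm continuous_const)
  have hsU : s ∈ U := ⟨hs, by linarith⟩
  have ht := tendstoUniformlyOn_tsum_of_cofinite_eventually
    ((summable_norm_lattice L (x := 0) (r := -(5 / 2)) (by norm_num)).mul_left C) hb
  have hd := ht.tendstoLocallyUniformlyOn.differentiableOn (.of_forall fun t =>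
    DifferentiableOn.fun_sum fun ω _ => (differentiable_heckeRem j α ω).differentiableOn) hUo
  exact ((hd s hsU).differentiableAt (hUo.mem_nhds hsU)).differentiableWithinAt

theorem summable_heckeTerm {j : ℕ} {α s : ℂ} (h : 2 < j + 2 * s.re) :
    Summable fun ω : L.lattice => heckeTerm j s (α + ω) :=
  .of_norm_bounded (summable_norm_lattice L (x := α) (r := -(j : ℝ) - 2 * s.re) (by linarith))
    fun _ => norm_heckeTerm_le _ _ _

/-- For `Re s > 1` the regularized sum is a combination of Hecke's series. -/
theorem heckeReg_eq {j : ℕ} (α : ℂ) {s : ℂ} (hs : 1 < s.re) : heckeReg L j α s =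
    ∑' ω : L.lattice, heckeTerm j s (α + ω) - ∑' ω : L.lattice, heckeTerm j s ω +
      (j + s) * α * ∑' ω : L.lattice, heckeTerm (j + 1) s ω +
      s * conj α * ∑' ω : L.lattice, heckeTerm j s ω / conj (ω : ℂ) := by
  have h2 : 2 < (j : ℝ) + 2 * s.re := by
    have : (0 : ℝ) ≤ j := by positivity
    linarith
  have hS1 := summable_heckeTerm L (j := j) (α := α) h2
  have hS0 : Summable fun ω : L.lattice => heckeTerm j s ω := by
    simpa using summable_heckeTerm L (j := j) (α := 0) h2
  have hS2 : Summable fun ω : L.lattice => heckeTerm (j + 1) s ω := by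
    simpa using summable_heckeTerm L (j := j + 1) (α := 0) (s := s) (by push_cast; linarith)
  have hS3 : Summable fun ω : L.lattice => heckeTerm j s ω / conj (ω : ℂ) := by
    refine .of_norm_bounded (summable_norm_lattice L (x := 0) (r := -(j + 1 : ℝ) - 2 * s.re)
      (by linarith)) fun ω => ?_
    by_cases hω : (ω : ℂ) = 0
    · rw [hω, heckeTerm_zero, zero_div, norm_zero]; positivity
    · have h0 : 0 < ‖(ω : ℂ)‖ := norm_pos_iff.mpr hω
      rw [norm_div, norm_heckeTerm hω, RCLike.norm_conj, zero_add,
        show -((j : ℝ) + 1) - 2 * s.re = -(j : ℝ) - 2 * s.re - 1 by ring, Real.rpow_sub_one h0.ne']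
  rw [← tsum_mul_left, ← tsum_mul_left, ← hS1.tsum_sub hS0,
    ← (hS1.sub hS0).tsum_add (hS2.mul_left _),
    ← ((hS1.sub hS0).add (hS2.mul_left _)).tsum_add (hS3.mul_left _)]
  refine tsum_congr fun ω => ?_
  rw [heckeRem]
  by_cases hω : (ω : ℂ) = 0
  · simp [hω, heckeTerm_zero]
  · have h1 : heckeTerm (j + 1) s ω = heckeTerm j s ω / ω := by
      rw [heckeTerm, heckeTerm, if_neg hω, if_neg hω, pow_succ]
      field_simp
    rw [h1, map_div₀]
    ring

end Hecke

/-! ### Analytic continuation to `s = 0` -/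

section Continuation

open Filter Topology ComplexConjugate
open scoped UpperHalfPlane

/-- The function `f`, considered on `Re s > 1`, has an analytic continuation to a half-plane
containing `0`, with the value `e` at `0`. -/
def HasContinuation (f : ℂ → ℂ) (e : ℂ) : Prop :=
  ∃ (ε : ℝ) (Φ : ℂ → ℂ), 0 < ε ∧ AnalyticOnNhd ℂ Φ {s | -ε < s.re} ∧
    (∀ s : ℂ, 1 < s.re → Φ s = f s) ∧ Φ 0 = e

theorem isPreconnected_rightHalfPlane (ε : ℝ) : IsPreconnected {s : ℂ | -ε < s.re} :=
  (convex_halfSpace_re_gt (-ε)).isPreconnected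

theorem HasContinuation.unique {f : ℂ → ℂ} {e e' : ℂ} (h : HasContinuation f e)
    (h' : HasContinuation f e') : e = e' := by
  obtain ⟨ε, Φ, hε, hΦ, hf, rfl⟩ := h
  obtain ⟨ε', Φ', hε', hΦ', hf', rfl⟩ := h'
  have hδ : 0 < min ε ε' := lt_min hε hε'
  have hs : ∀ s : ℂ, -(min ε ε') < s.re → -ε < s.re ∧ -ε' < s.re := fun s hs =>
    ⟨by linarith [min_le_left ε ε'], by linarith [min_le_right ε ε']⟩
  have hev : Φ =ᶠ[𝓝 2] Φ' := by
    have : ∀ᶠ s : ℂ in 𝓝 2, 1 < s.re :=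
      (isOpen_lt continuous_const Complex.continuous_re).mem_nhds (by simp)
    filter_upwards [this] with s hs
    rw [hf s hs, hf' s hs]
  exact (hΦ.mono fun s h => (hs s h).1).eqOn_of_preconnected_of_eventuallyEq
    (hΦ'.mono fun s h => (hs s h).2) (isPreconnected_rightHalfPlane _)
    (show (2 : ℂ) ∈ {s : ℂ | -(min ε ε') < s.re} by
      change -(min ε ε') < (2 : ℂ).re; simp; linarith [hε.le])
    hev (show (0 : ℂ) ∈ {s : ℂ | -(min ε ε') < s.re} by simpa using ⟨hε, hε'⟩)

theorem HasContinuation.congr {f g : ℂ → ℂ} {e : ℂ} (h : HasContinuation f e)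
    (hfg : ∀ s : ℂ, 1 < s.re → g s = f s) : HasContinuation g e := by
  obtain ⟨ε, Φ, hε, hΦ, hf, he⟩ := h
  exact ⟨ε, Φ, hε, hΦ, fun s hs => (hf s hs).trans (hfg s hs).symm, he⟩

theorem HasContinuation.add {f g : ℂ → ℂ} {e e' : ℂ} (h : HasContinuation f e)
    (h' : HasContinuation g e') : HasContinuation (fun s => f s + g s) (e + e') := by
  obtain ⟨ε, Φ, hε, hΦ, hf, rfl⟩ := h
  obtain ⟨ε', Φ', hε', hΦ', hf', rfl⟩ := h'
  refine ⟨min ε ε', fun s => Φ s + Φ' s, lt_min hε hε', ?_, fun s hs => by beta_reduce; rw [hf s hs, hf' s hs],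
    rfl⟩
  exact (hΦ.mono fun s (h : -(min ε ε') < s.re) => show -ε < s.re by
      linarith [min_le_left ε ε']).add
    (hΦ'.mono fun s (h : -(min ε ε') < s.re) => show -ε' < s.re by linarith [min_le_right ε ε'])

theorem HasContinuation.mul_left {f g : ℂ → ℂ} {e : ℂ} (h : HasContinuation f e)
    (hg : Differentiable ℂ g) : HasContinuation (fun s => g s * f s) (g 0 * e) := by
  obtain ⟨ε, Φ, hε, hΦ, hf, rfl⟩ := h
  exact ⟨ε, fun s => g s * Φ s, hε, fun s hs => (hg.analyticAt s).mul (hΦ s hs),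
    fun s hs => by beta_reduce; rw [hf s hs], rfl⟩

theorem HasContinuation.const_mul {f : ℂ → ℂ} {e : ℂ} (h : HasContinuation f e) (c : ℂ) :
    HasContinuation (fun s => c * f s) (c * e) := h.mul_left (g := fun _ => c) (differentiable_const c)

theorem HasContinuation.sub {f g : ℂ → ℂ} {e e' : ℂ} (h : HasContinuation f e)
    (h' : HasContinuation g e') : HasContinuation (fun s => f s - g s) (e - e') := by
  have := h.add (h'.const_mul (-1))
  rw [sub_eq_add_neg, ← neg_one_mul e']
  exact this.congr fun s _ => by ring

theorem hasContinuation_zero : HasContinuation (fun _ => 0) 0 :=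
  ⟨1, fun _ => 0, one_pos, fun _ _ => analyticAt_const, fun _ _ => rfl, rfl⟩

theorem hasContinuation_heckeReg (L : PeriodPair) {j : ℕ} (hj : 1 ≤ j) (α : ℂ) :
    HasContinuation (heckeReg L j α) (heckeReg L j α 0) :=
  ⟨1 / 4, _, by norm_num, analyticOnNhd_heckeReg L hj α, fun _ _ => rfl, rfl⟩

theorem IsEisensteinValue.hasContinuation {j : ℕ} {τ : ℍ} {α e : ℂ}
    (h : IsEisensteinValue j τ α e) : HasContinuation (heckeSeries j τ α) e := by
  obtain ⟨ε, Φ, hε, hΦ, hf, he⟩ := h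
  refine ⟨ε, Φ, hε, hΦ, fun s hs => hf s ?_ (by linarith), he⟩
  have : (0 : ℝ) ≤ j := by positivity
  linarith

variable (L : PeriodPair)

theorem tsum_lattice_add {j : ℕ} (α s : ℂ) {w : ℂ} (hw : w ∈ L.lattice) :
    ∑' ω : L.lattice, heckeTerm j s (α + w + ω) = ∑' ω : L.lattice, heckeTerm j s (α + ω) := by
  refine Eq.trans (tsum_congr fun ω => ?_)
    ((Equiv.addLeft (⟨w, hw⟩ : L.lattice)).tsum_eq fun ω => heckeTerm j s (α + ω))
  simp [add_assoc]

theorem tsum_lattice_neg {j : ℕ} (α s : ℂ) : ∑' ω : L.lattice, heckeTerm j s (-α + ω) =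
    (-1) ^ j * ∑' ω : L.lattice, heckeTerm j s (α + ω) := by
  rw [← (Equiv.neg L.lattice).tsum_eq, ← tsum_mul_left]
  refine tsum_congr fun ω => ?_
  rw [← heckeTerm_neg]
  simp [add_comm]

theorem tsum_eq_zero_of_odd {f : L.lattice → ℂ} (hf : ∀ ω, f (-ω) = -f ω) : ∑' ω, f ω = 0 := by
  have h : ∑' ω, f ω = -∑' ω, f ω := by
    rw [← tsum_neg]
    conv_lhs => rw [← (Equiv.neg L.lattice).tsum_eq]
    exact tsum_congr fun ω => hf ω
  linear_combination h / 2

theorem tsum_heckeTerm_odd {j : ℕ} (hj : Odd j) (s : ℂ) :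
    ∑' ω : L.lattice, heckeTerm j s ω = 0 :=
  tsum_eq_zero_of_odd L fun ω => by
    rw [Submodule.coe_neg, heckeTerm_neg, hj.neg_one_pow, neg_one_mul]

/-- At `s = 0` the terms are `1/(α+ω) - 1/ω + α/ω^2`, those of the zeta series with `ω` replaced by
`-ω`; the lattice point 0 supplies `1/α`, because `heckeTerm` vanishes at 0. -/
theorem heckeReg_one_zero {α : ℂ} : heckeReg L 1 α 0 = zetaFn L α := by
  have h1 := hasSum_zetaReg L α
  rw [← (Equiv.neg L.lattice).hasSum_iff] at h1
  have h2 := (hasSum_ite_eq (0 : L.lattice) (1 / α)).add h1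
  rw [heckeReg, zetaFn, ← h2.tsum_eq]
  refine tsum_congr fun ω => ?_
  simp only [heckeRem, heckeTerm_at_zero 1 one_ne_zero, Function.comp_apply, Equiv.neg_apply,
    Submodule.coe_neg, neg_eq_zero, ZeroMemClass.coe_eq_zero, pow_one]
  by_cases hω : ω = 0
  · simp [hω]
  · simp only [hω, if_false, sub_neg_eq_add]
    simp [div_eq_mul_inv, pow_two]
    ring

/-- At `s = 0` the terms are those of `℘` plus `2α/ω^3`, and the sum of the latter is zero by
oddness. -/
theorem heckeReg_two_zero (α : ℂ) : heckeReg L 2 α 0 = L.weierstrassP α := by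
  have h1 := L.hasSum_weierstrassP α
  rw [← (Equiv.neg L.lattice).hasSum_iff] at h1
  have h2 := (L.hasSum_sumInvPow 0 (r := 3) (by norm_num)).mul_left (2 * α)
  rw [L.sumInvPow_zero, L.G_eq_zero_of_odd 3 (by decide), mul_zero] at h2
  have h3 := h1.add h2
  rw [add_zero] at h3
  rw [heckeReg, ← h3.tsum_eq]
  refine tsum_congr fun ω => ?_
  simp only [heckeRem, heckeTerm_at_zero 2 two_ne_zero, Function.comp_apply, Equiv.neg_apply,
    Submodule.coe_neg, sub_neg_eq_add, sub_zero]
  by_cases hω : (ω : ℂ) = 0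
  · simp [hω]
  · simp [div_eq_mul_inv]
    field_simp

end Continuation

/-! ### Eisenstein values in terms of `ζ`, `℘` and lattice sums -/

section Values

open Filter Topology ComplexConjugate
open scoped UpperHalfPlane

variable {τ : ℍ} {α β e e' e'' : ℂ}

theorem heckeSeries_eq_zero (τ : ℍ) {j : ℕ} (hj : Odd j) (s : ℂ) : heckeSeries j τ 0 s = 0 := by
  rw [heckeSeries_eq]
  simpa using tsum_heckeTerm_odd (periods τ) hj s

theorem IsEisensteinValue.add_mem {j : ℕ} (h : IsEisensteinValue j τ α e) {w : ℂ}
    (hw : w ∈ (periods τ).lattice) : IsEisensteinValue j τ (α + w) e := by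
  obtain ⟨ε, Φ, hε, hΦ, hf, he⟩ := h
  refine ⟨ε, Φ, hε, hΦ, fun s hs hs' => (hf s hs hs').trans ?_, he⟩
  rw [heckeSeries_eq, heckeSeries_eq, tsum_lattice_add _ _ _ hw]

theorem IsEisensteinValue.unique {j : ℕ} (h : IsEisensteinValue j τ α e)
    (h' : IsEisensteinValue j τ α e') : e = e' := h.hasContinuation.unique h'.hasContinuation

theorem IsEisensteinValue.eq_zero_of_mem (h : IsEisensteinValue 1 τ α e)
    (hα : α ∈ (periods τ).lattice) : e = 0 := by
  have h0 := h.add_mem (neg_mem hα)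
  rw [add_neg_cancel] at h0
  exact h0.hasContinuation.unique
    (hasContinuation_zero.congr fun s _ => heckeSeries_eq_zero τ odd_one s)

theorem IsEisensteinValue.neg_eq (h : IsEisensteinValue 1 τ α e)
    (h' : IsEisensteinValue 1 τ (-α) e') : e' = -e := by
  have := h.hasContinuation.const_mul (-1)
  rw [neg_one_mul] at this
  refine h'.hasContinuation.unique (this.congr fun s _ => ?_)
  rw [heckeSeries_eq, heckeSeries_eq, tsum_lattice_neg, pow_one]

/-- For weight one, Eisenstein values are additive up to slopes of lines. -/
theorem IsEisensteinValue.add_sub_eq (h : IsEisensteinValue 1 τ α e)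
    (h' : IsEisensteinValue 1 τ β e') (h'' : IsEisensteinValue 1 τ (α + β) e'') :
    e + e' - e'' = -zetaSlope (periods τ) α β := by
  have h1 := ((hasContinuation_heckeReg (periods τ) le_rfl α).add
    (hasContinuation_heckeReg (periods τ) le_rfl β)).sub
    (hasContinuation_heckeReg (periods τ) le_rfl (α + β))
  rw [heckeReg_one_zero, heckeReg_one_zero, heckeReg_one_zero] at h1
  rw [zetaSlope, show -(zetaFn (periods τ) (α + β) - zetaFn (periods τ) α - zetaFn (periods τ) β) =
    zetaFn (periods τ) α + zetaFn (periods τ) β - zetaFn (periods τ) (α + β) by ring]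
  refine ((h.hasContinuation.add h'.hasContinuation).sub h''.hasContinuation).unique
    (h1.congr fun s hs => ?_)
  -- The correction terms in `heckeReg_eq` are additive in `α`, so they cancel in the combination
  -- for `α`, `β`, `α + β`; the sum independent of `α` is zero by oddness.
  rw [heckeReg_eq _ _ hs, heckeReg_eq _ _ hs, heckeReg_eq _ _ hs, tsum_heckeTerm_odd _ odd_one,
    heckeSeries_eq, heckeSeries_eq, heckeSeries_eq, map_add]
  ring

/-- For weight two, the Eisenstein values differ by values of `℘`. -/
theorem IsEisensteinValue.sub_eq (h : IsEisensteinValue 2 τ α e)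
    (h' : IsEisensteinValue 2 τ 0 e') : e - e' = (periods τ).weierstrassP α := by
  have h1 := hasContinuation_heckeReg (periods τ) one_le_two α
  rw [heckeReg_two_zero] at h1
  refine (h.hasContinuation.sub h'.hasContinuation).unique (h1.congr fun s hs => ?_)
  have hodd : ∑' ω : (periods τ).lattice, heckeTerm 2 s ω / conj (ω : ℂ) = 0 :=
    tsum_eq_zero_of_odd _ fun ω => by
      rw [Submodule.coe_neg, heckeTerm_neg, map_neg, div_neg]; norm_num
  rw [heckeReg_eq _ _ hs, hodd, tsum_heckeTerm_odd _ (show Odd (2 + 1) by decide), heckeSeries_eq,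
    heckeSeries_eq]
  simp only [zero_add, mul_zero, add_zero]

/-- For weight at least three, the Eisenstein values are absolutely convergent lattice sums. -/
theorem IsEisensteinValue.eq_sumInvPow {j : ℕ} (hj : 3 ≤ j) (h : IsEisensteinValue j τ α e) :
    e = (periods τ).sumInvPow (-α) j := by
  obtain ⟨ε, Φ, hε, hΦ, hf, he⟩ := h
  have hj' : (3 : ℝ) ≤ j := by exact_mod_cast hj
  rw [← he, hf 0 (by simp; linarith) (by simpa using hε), heckeSeries_eq, PeriodPair.sumInvPow]
  refine tsum_congr fun ω => ?_
  rw [heckeTerm_at_zero j (by omega), sub_neg_eq_add, add_comm]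

/-- The quasi-periods of the zeta function in terms of the nonholomorphic Eisenstein value of weight
two. -/
theorem IsEisensteinValue.exists_zetaFn_add (h : IsEisensteinValue 2 τ 0 e) : ∃ c : ℂ,
    ∀ w ∈ (periods τ).lattice, ∀ z,
      zetaFn (periods τ) (z + w) = zetaFn (periods τ) z + w * e + conj w * c := by
  set L := periods τ
  let Z : ℂ → ℂ := fun s => s * ∑' ω : L.lattice, heckeTerm 1 s ω / conj (ω : ℂ)
  -- The Hecke series at `z` and `z + w` coincide, so the difference of the regularized sums
  -- consists of correction terms: a multiple of the weight two series and `conj w` times the single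
  -- function `Z`.
  have key : ∀ w ∈ L.lattice, ∀ z, HasContinuation (fun s => conj w * Z s)
      (zetaFn L (z + w) - zetaFn L z - w * e) := by
    intro w hw z
    have h1 := (hasContinuation_heckeReg L le_rfl (z + w)).sub (hasContinuation_heckeReg L le_rfl z)
    have h2 := (h.hasContinuation.mul_left (g := fun s => (1 + s) * w) (by fun_prop))
    rw [heckeReg_one_zero, heckeReg_one_zero] at h1
    have h3 := h1.sub h2
    simp only [add_zero, one_mul] at h3
    refine h3.congr fun s hs => ?_
    rw [heckeReg_eq _ _ hs, heckeReg_eq _ _ hs, tsum_lattice_add L z s hw, heckeSeries_eq, map_add]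
    simp only [zero_add, Z, Nat.cast_one]
    ring
  have h1 : (1 : ℂ) ∈ L.lattice := mem_lattice_periods.mpr ⟨0, 1, by simp⟩
  -- The constant is read off at `w = 1`. The arguments 0 and 1 are lattice points, where `zetaFn`
  -- has its default value; `key` holds there as well.
  refine ⟨zetaFn L (0 + 1) - zetaFn L 0 - 1 * e, fun w hw z => ?_⟩
  have hc := (key 1 h1 0).const_mul (conj w)
  have := (key w hw z).unique (hc.congr fun s _ => by simp)
  linear_combination this

end Values

/-! ### The weight two Eisenstein value is not holomorphic -/

section WeightTwo

open Filter Topology ComplexConjugate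
open scoped UpperHalfPlane

/-- No linear function makes the zeta function periodic. -/
theorem zetaFn_not_linear_quasiperiodic (L : PeriodPair) (e : ℂ) :
    ¬ ∀ w ∈ L.lattice, ∀ z, zetaFn L (z + w) = zetaFn L z + w * e := by
  intro hq
  -- Under the assumption `F` is odd and periodic, so `F^2 - ℘`, whose singularities are removable,
  -- is constant. As `F` vanishes at half-periods, `℘` takes the same value at two inequivalent
  -- half-periods, which is impossible.
  let F : ℂ → ℂ := fun z => zetaFn L z - z * e
  have hF : ∀ w ∈ L.lattice, ∀ z, F (z + w) = F z := by
    intro w hw z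
    simp only [F, hq w hw z]
    ring
  have hFneg : ∀ z, F (-z) = -F z := by
    intro z
    simp only [F, zetaFn_neg]
    ring
  let f : ℂ → ℂ := fun z => if z ∈ L.lattice then 0 else F z ^ 2 - L.weierstrassP z
  have hper : ∀ z, ∀ w ∈ L.lattice, f (z + w) = f z := by
    intro z w hw
    simp only [f, notMem_add_iff L hw, hF w hw, weierstrassP_add_mem L hw]
  have h0 : ∃ g, AnalyticAt ℂ g 0 ∧ f =ᶠ[𝓝[≠] 0] g := by
    let H : ℂ → ℂ := fun z => zetaReg L z - z * e
    have h0m : (0 : ℂ) ∈ (↑L.lattice \ {0} : Set ℂ)ᶜ := fun h => h.2 rfl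
    have hH : AnalyticAt ℂ H 0 := (analyticAt_zetaReg L h0m).sub (by fun_prop)
    have hH0 : H 0 = 0 := by simp [H, zetaReg_zero]
    have hds : AnalyticAt ℂ (dslope H 0) 0 := by
      obtain ⟨U, hU, hUa⟩ := hH.eventually_analyticAt.exists_mem
      have := (Complex.differentiableOn_dslope hU).mpr fun z hz =>
        (hUa z hz).differentiableAt.differentiableWithinAt
      exact this.analyticAt hU
    refine ⟨fun z => 2 * dslope H 0 z + H z ^ 2 - L.weierstrassPExcept 0 z,
      ((analyticAt_const.mul hds).add (hH.pow 2)).sub (L.analyticAt_weierstrassPExcept 0), ?_⟩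
    filter_upwards [eventually_notMem_lattice L 0, self_mem_nhdsWithin] with z hz hz0
    have hz0' : z ≠ 0 := hz0
    simp only [f, if_neg hz]
    rw [dslope_of_ne _ hz0', slope_def_field, hH0, weierstrassP_eq L z]
    have : F z = H z + 1 / z := by
      simp only [F, H, zetaFn]; ring
    rw [this]
    field_simp
    ring
  obtain ⟨g, hg, hfg⟩ := h0
  have hnot : ∀ z ∉ L.lattice, AnalyticAt ℂ (fun z => F z ^ 2 - L.weierstrassP z) z ∧
      f =ᶠ[𝓝[≠] z] (fun z => F z ^ 2 - L.weierstrassP z) := by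
    intro z hz
    refine ⟨(((analyticAt_zetaFn L hz).sub (by fun_prop)).pow 2).sub
      (analyticAt_weierstrassP L hz), ?_⟩
    filter_upwards [eventually_notMem_lattice L z] with x hx
    simp only [f, if_neg hx]
  obtain ⟨c, hc⟩ := exists_eq_of_periodic_removable L hper (f := f) (by
    intro z
    by_cases hz : z ∈ L.lattice
    · refine ⟨fun x => g (x - z), hg.comp_of_eq (by fun_prop) (by simp), ?_⟩
      have h4 : Tendsto (fun x => x - z) (𝓝[≠] z) (𝓝[≠] 0) := by
        apply tendsto_nhdsWithin_of_tendsto_nhds_of_eventually_within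
        · have : Tendsto (fun x => x - z) (𝓝 z) (𝓝 (z - z)) :=
            (continuous_id.sub continuous_const).tendsto _
          rw [sub_self] at this
          exact this.mono_left nhdsWithin_le_nhds
        · filter_upwards [self_mem_nhdsWithin] with x hx h5
          exact hx (sub_eq_zero.mp h5)
      filter_upwards [h4.eventually hfg] with x hx
      rw [← hx, ← hper (x - z) z hz, sub_add_cancel]
    · exact ⟨_, hnot z hz⟩)
  have half : ∀ w, w ∈ L.lattice → w / 2 ∉ L.lattice → L.weierstrassP (w / 2) = -c := by
    intro w hw hw2
    have h1 : F (w / 2) = 0 := by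
      have := hF w hw (-(w / 2))
      rw [show -(w / 2) + w = w / 2 by ring, hFneg] at this
      linear_combination this / 2
    have := hc _ _ (hnot _ hw2).1 (hnot _ hw2).2
    beta_reduce at this
    rw [h1] at this
    linear_combination -this
  have h1 := half _ L.ω₁_mem_lattice L.ω₁_div_two_notMem_lattice
  have h2 := half _ L.ω₂_mem_lattice L.ω₂_div_two_notMem_lattice
  have hsum : L.ω₁ / 2 + L.ω₂ / 2 ∉ L.lattice := by
    have := (L.mul_ω₁_add_mul_ω₂_mem_lattice (α := 1 / 2) (β := 1 / 2)).not.mpr (by norm_num)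
    intro h
    apply this
    convert h using 1
    push_cast; ring
  rcases mem_lattice_of_weierstrassP_eq L L.ω₁_div_two_notMem_lattice L.ω₂_div_two_notMem_lattice
    (h1.trans h2.symm) with h | h
  · exact hsum h
  · apply hsum
    have := add_mem h L.ω₂_mem_lattice
    convert this using 1
    ring

/-- Combining fractions gives `ζ(α) = 1/α - α^2 ∑ 1/((ω - α) ω^2)`, a lattice sum with exponents 1
and 2 to which the holomorphy statement applies; the term at `ω = 0` is zero by convention. -/
theorem zetaFn_torsionArg_mem {l : ℕ} (hl : l ≠ 0) {r s : ℤ}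
    (hrs : ¬((l : ℤ) ∣ r ∧ (l : ℤ) ∣ s)) :
    (fun τ => zetaFn (periods τ) (torsionArg l r s τ)) ∈ holomorphicRing := by
  have hm : ∀ τ, torsionArg l r s τ ∉ (periods τ).lattice :=
    fun τ h => hrs ((torsionArg_mem_lattice hl).mp h)
  have hne : ∀ τ, torsionArg l r s τ ≠ 0 := fun τ h => hm τ (h ▸ zero_mem _)
  have harg : (fun τ => torsionArg l r s τ) ∈ holomorphicRing := by
    rw [mem_holomorphicRing]
    have : DifferentiableOn ℂ (fun w : ℂ => (r * w + s) / l) {w : ℂ | 0 < w.im} := by fun_prop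
    refine this.congr fun w hw => ?_
    rw [Function.comp_apply, UpperHalfPlane.ofComplex_apply_of_im_pos hw]
    rfl
  have h1 := div_mem_holomorphicRing (Subalgebra.one_mem _) harg hne
  have h2 := tsum_torsionArg_mem hl r s (k := 1) (k' := 2) le_rfl
  have h3 := Subalgebra.sub_mem _ h1 (Subalgebra.mul_mem _ (Subalgebra.pow_mem _ harg 2) h2)
  convert h3 using 1
  ext τ
  rw [zetaFn]
  change _ = 1 / torsionArg l r s τ - torsionArg l r s τ ^ 2 * _
  rw [sub_eq_add_neg]
  congr 1
  rw [zetaReg, ← (periodEquiv τ).tsum_eq, ← tsum_mul_left, ← tsum_neg]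
  refine tsum_congr fun p => ?_
  have hsub : torsionArg l r s τ - (periodEquiv τ p : ℂ) ≠ 0 := fun h =>
    hm τ (by rw [sub_eq_zero.mp h]; exact (periodEquiv τ p).2)
  rw [← periodEquiv_apply]
  split_ifs with h0
  · simp [h0]
  · have hsub' : (periodEquiv τ p : ℂ) - torsionArg l r s τ ≠ 0 := by
      rw [← neg_sub]; exact neg_ne_zero.mpr hsub
    field_simp
    ring

theorem not_differentiableAt_conj (z : ℂ) : ¬ DifferentiableAt ℂ (conj : ℂ → ℂ) z := by
  intro h
  have h1 := h.hasFDerivAt.restrictScalars ℝ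
  have h2 : HasFDerivAt (conj : ℂ → ℂ) (Complex.conjCLE : ℂ →L[ℝ] ℂ) z :=
    Complex.conjCLE.hasFDerivAt
  have h3 := h1.unique h2
  have e1 : fderiv ℂ (conj : ℂ → ℂ) z 1 = 1 := by
    simpa using congrArg (fun f : ℂ →L[ℝ] ℂ => f 1) h3
  have e2 : fderiv ℂ (conj : ℂ → ℂ) z Complex.I = -Complex.I := by
    simpa using congrArg (fun f : ℂ →L[ℝ] ℂ => f Complex.I) h3
  have e3 := (fderiv ℂ (conj : ℂ → ℂ) z).map_smul Complex.I 1
  rw [smul_eq_mul, mul_one, e1, e2, smul_eq_mul, mul_one] at e3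
  exact Complex.I_ne_zero (by linear_combination -e3 / 2)

/-- The Eisenstein series of weight two and level one is not holomorphic. -/
theorem eisensteinTwo_notMem {E : ℍ → ℂ} (hE : ∀ τ, IsEisensteinValue 2 τ 0 (E τ)) :
    E ∉ holomorphicRing := by
  intro hmem
  choose c hc using fun τ => (hE τ).exists_zetaFn_add
  have hc0 : ∀ τ, c τ ≠ 0 := fun τ h => zetaFn_not_linear_quasiperiodic (periods τ) (E τ)
    fun w hw z => by rw [hc τ w hw z, h, mul_zero, add_zero]
  have hid : (fun τ : ℍ => (τ : ℂ)) ∈ holomorphicRing := by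
    rw [mem_holomorphicRing]
    refine differentiableOn_id.congr fun w hw => ?_
    rw [Function.comp_apply, UpperHalfPlane.ofComplex_apply_of_im_pos hw]
    rfl
  -- In `ζ(z+w) = ζ(z) + w E + conj w c` the choice `z = -w/2` isolates the period. For `w = 1` and
  -- `w = τ` it makes `c` and `conj τ · c` holomorphic if `E` is; as `c` has no zeros, `conj τ`
  -- would be holomorphic.
  have h1 : ∀ τ, c τ = 2 * zetaFn (periods τ) (torsionArg 2 0 1 τ) - E τ := by
    intro τ
    have := hc τ 1 (mem_lattice_periods.mpr ⟨0, 1, by simp⟩) (-(1 / 2))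
    rw [zetaFn_neg, map_one] at this
    rw [torsionArg]
    push_cast
    rw [show ((0 : ℂ) * τ + 1) / 2 = 1 / 2 by ring]
    rw [show -(1 / 2 : ℂ) + 1 = 1 / 2 by ring] at this
    linear_combination -this
  have h2 : ∀ τ : ℍ, conj (τ : ℂ) * c τ = 2 * zetaFn (periods τ) (torsionArg 2 1 0 τ) - τ * E τ := by
    intro τ
    have := hc τ τ (mem_lattice_periods.mpr ⟨1, 0, by simp⟩) (-(τ / 2))
    rw [zetaFn_neg] at this
    rw [torsionArg]
    push_cast
    rw [show ((1 : ℂ) * τ + 0) / 2 = τ / 2 by ring]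
    rw [show -(τ / 2 : ℂ) + τ = τ / 2 by ring] at this
    linear_combination -this
  have hz1 := zetaFn_torsionArg_mem (l := 2) two_ne_zero (r := 0) (s := 1) (by norm_num)
  have hz2 := zetaFn_torsionArg_mem (l := 2) two_ne_zero (r := 1) (s := 0) (by norm_num)
  have h2c := Subalgebra.algebraMap_mem holomorphicRing (2 : ℂ)
  have hcm : c ∈ holomorphicRing := by
    have := Subalgebra.sub_mem _ (Subalgebra.mul_mem _ h2c hz1) hmem
    convert this using 1
    ext τ
    exact h1 τ
  have hcm' : (fun τ : ℍ => conj (τ : ℂ) * c τ) ∈ holomorphicRing := by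
    have := Subalgebra.sub_mem _ (Subalgebra.mul_mem _ h2c hz2) (Subalgebra.mul_mem _ hid hmem)
    convert this using 1
    ext τ
    exact h2 τ
  have hconj := div_mem_holomorphicRing hcm' hcm hc0
  have hI : (0 : ℝ) < (Complex.I).im := by simp
  refine not_differentiableAt_conj Complex.I
    (((mem_holomorphicRing.mp hconj Complex.I hI).differentiableAt
      (isOpen_halfPlane.mem_nhds hI)).congr_of_eventuallyEq ?_)
  filter_upwards [isOpen_halfPlane.mem_nhds hI] with w hw
  rw [Function.comp_apply, UpperHalfPlane.ofComplex_apply_of_im_pos hw]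
  exact (mul_div_cancel_right₀ _ (hc0 _)).symm

end WeightTwo

/-! ### Weights of the realized functions -/

section Weights

open Filter Topology
open scoped UpperHalfPlane

variable {l : ℕ}

/-- The holomorphic functions realized by elements of `R_l` of weight `j`. -/
def realizedPart (Ψ : ringR ℂ l →ₐ[ℂ] holomorphicRing) (j : ℕ) : Submodule ℂ holomorphicRing :=
  ((weightPart ℂ l j).comap (ringR ℂ l).val.toLinearMap).map Ψ.toLinearMap

variable {Ψ : ringR ℂ l →ₐ[ℂ] holomorphicRing}

theorem mul_mem_realizedPart {i j n : ℕ} {f g : holomorphicRing} (hf : f ∈ realizedPart Ψ i)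
    (hg : g ∈ realizedPart Ψ j) (h : i + j = n) : f * g ∈ realizedPart Ψ n := by
  subst h
  obtain ⟨c, hc, rfl⟩ := hf
  obtain ⟨d, hd, rfl⟩ := hg
  exact ⟨c * d, weightPart_mul hc hd, map_mul Ψ c d⟩

variable [NeZero l]

/-- The generators of `R_l` are realized by the expected functions. -/
structure RealizesGenerators (Ψ : ringR ℂ l →ₐ[ℂ] holomorphicRing) : Prop where
  a_mem : holA ∈ realizedPart Ψ 4
  x_mem : ∀ p, holX l p ∈ realizedPart Ψ 2
  y_mem : ∀ p, holY l p ∈ realizedPart Ψ 3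
  slope_mem : ∀ p q, holSlope l p q ∈ realizedPart Ψ 1

theorem exists_analyticRealization : ∃ (φ : ℤ × ℤ →+ GenPoint ℂ)
    (Ψ : ringR ℂ l →ₐ[ℂ] holomorphicRing),
    IsAnalyticRealization l φ (holomorphicRing.val.comp Ψ) ∧ RealizesGenerators Ψ := by
  obtain ⟨φ, Ψ, hinj, hker, hrange, ha, hb, hx, hy, hs⟩ := exists_realization (l := l)
  have htors : ∀ p, p ∉ labelKernel l → l • φ p = 0 ∧ φ p ≠ 0 := fun p hp =>
    ⟨(hrange _).mpr ⟨p, rfl⟩, fun h => hp ((hker p).mp h)⟩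
  have hlab : ∀ (P : Torsion ℂ l) p, φ p = P.1 → p ∉ labelKernel l := fun P p hp h =>
    P.2.2 (by rw [← hp, (hker p).mpr h])
  refine ⟨φ, Ψ, ⟨fun r s => hker (r, s), hrange, Subtype.val_injective.comp hinj,
    congrArg Subtype.val ha, congrArg Subtype.val hb, fun P r s hP => ?_, fun P r s hP => ?_⟩,
    ⟨⟨_, weightPart_val (.coord .a), ha⟩, fun p => ?_, fun p => ?_, fun p q => ?_⟩⟩
  · refine (congrArg Subtype.val (hx P (r, s) hP)).trans (funext fun τ => ?_)
    exact evalAt_holX (hlab P _ hP) τ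
  · refine (congrArg Subtype.val (hy P (r, s) hP)).trans (funext fun τ => ?_)
    exact evalAt_holY (hlab P _ hP) τ
  · by_cases hp : p ∈ labelKernel l
    · rw [holX, dif_pos hp]; exact zero_mem _
    · exact ⟨_, weightPart_val (.coord (.x ⟨φ p, htors p hp⟩)), hx ⟨φ p, htors p hp⟩ p rfl⟩
  · by_cases hp : p ∈ labelKernel l
    · rw [holY, dif_pos hp]; exact zero_mem _
    · exact ⟨_, weightPart_val (.coord (.y ⟨φ p, htors p hp⟩)), hy ⟨φ p, htors p hp⟩ p rfl⟩
  · by_cases h : p ∉ labelKernel l ∧ q ∉ labelKernel l ∧ p + q ∉ labelKernel l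
    · have hr : -(p + q) ∉ labelKernel l := by rw [neg_mem_iff]; exact h.2.2
      have h0 : φ p + φ q + φ (-(p + q)) = 0 := by
        rw [← map_add, ← map_add, add_neg_cancel, map_zero]
      let v : GenVar ℂ l :=
        .slope ⟨φ p, htors p h.1⟩ ⟨φ q, htors q h.2.1⟩ ⟨φ (-(p + q)), htors _ hr⟩ h0
      exact ⟨⟨v.val, weightPart_subset_ringR (weightPart_val v)⟩, weightPart_val v,
        hs ⟨φ p, htors p h.1⟩ ⟨φ q, htors q h.2.1⟩ ⟨φ (-(p + q)), htors _ hr⟩ h0 p q _ rfl rfl rfl⟩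
    · rw [holSlope, dif_neg h]; exact zero_mem _

variable (hΨ : RealizesGenerators Ψ)
include hΨ

/-- Since `℘'' = 6℘^2 + 2a`, Leibniz' rule writes the derivative of order `n + 2` as a combination
of products of two lower ones of total weight `n + 4`, plus `2a` when `n = 0`. -/
theorem RealizesGenerators.exists_iteratedDeriv {p : ℤ × ℤ} (hp : p ∉ labelKernel l) (n : ℕ) :
    ∃ f ∈ realizedPart Ψ (n + 2), ∀ τ, evalAt τ f =
      iteratedDeriv n (periods τ).weierstrassP (torsionPt l τ p) := by
  induction n using Nat.strong_induction_on with
  | _ n ih =>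
    rcases n with _ | _ | n
    · exact ⟨_, hΨ.x_mem p, fun τ => by rw [evalAt_holX hp, iteratedDeriv_zero]⟩
    · refine ⟨(2 : ℂ) • holY l p, Submodule.smul_mem _ _ (hΨ.y_mem p), fun τ => ?_⟩
      rw [map_smul, evalAt_holY hp, iteratedDeriv_one, PeriodPair.deriv_weierstrassP, latY, smul_eq_mul]
      ring
    · have hex : ∀ i, ∃ f : holomorphicRing, i ≤ n → f ∈ realizedPart Ψ (i + 2) ∧
          ∀ τ, evalAt τ f = iteratedDeriv i (periods τ).weierstrassP (torsionPt l τ p) := by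
        intro i
        by_cases hi : i ≤ n
        · obtain ⟨f, hf, hf'⟩ := ih i (by omega)
          exact ⟨f, fun _ => ⟨hf, hf'⟩⟩
        · exact ⟨0, fun h => absurd h hi⟩
      choose f hf using hex
      have hsum : (∑ i ∈ Finset.range (n + 1), (n.choose i : ℂ) • (f i * f (n - i))) ∈
          realizedPart Ψ (n + 1 + 1 + 2) := by
        refine Submodule.sum_mem _ fun i hi => Submodule.smul_mem _ _ ?_
        have := Finset.mem_range.mp hi
        exact mul_mem_realizedPart (hf i (by omega)).1 (hf (n - i) (by omega)).1 (by omega)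
      refine ⟨(6 : ℂ) • (∑ i ∈ Finset.range (n + 1), (n.choose i : ℂ) • (f i * f (n - i))) +
        if n = 0 then (2 : ℂ) • holA else 0, add_mem (Submodule.smul_mem _ _ hsum) ?_, fun τ => ?_⟩
      · split_ifs with h0
        · subst h0
          exact Submodule.smul_mem _ _ hΨ.a_mem
        · exact zero_mem _
      · rw [iteratedDeriv_weierstrassP_add_two _ (by rwa [torsionPt_mem_lattice]), map_add, map_smul,
          map_sum, smul_eq_mul]
        congr 1
        · congr 1
          refine Finset.sum_congr rfl fun i hi => ?_
          have := Finset.mem_range.mp hi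
          rw [map_smul, map_mul, (hf i (by omega)).2, (hf (n - i) (by omega)).2, smul_eq_mul, mul_assoc]
        · split_ifs
          · rw [map_smul, evalAt_holA, smul_eq_mul]
          · rw [map_zero]

/-- Up to the factor `(j-1)!` the sum is the derivative of order `j - 2` of `℘` at `-α`. -/
theorem RealizesGenerators.exists_sumInvPow {p : ℤ × ℤ} (hp : p ∉ labelKernel l) {j : ℕ}
    (hj : 3 ≤ j) : ∃ f ∈ realizedPart Ψ j, ∀ τ, evalAt τ f =
      (periods τ).sumInvPow (-torsionPt l τ p) j := by
  have hp' : -p ∉ labelKernel l := by rwa [neg_mem_iff]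
  obtain ⟨n, rfl⟩ := Nat.exists_eq_add_of_le' (show 2 ≤ j by omega)
  obtain ⟨f, hf, hf'⟩ := hΨ.exists_iteratedDeriv hp' n
  refine ⟨((n + 1).factorial : ℂ)⁻¹ • f, Submodule.smul_mem _ _ hf, fun τ => ?_⟩
  rw [map_smul, hf', iteratedDeriv_weierstrassP _ (by rwa [torsionPt_mem_lattice]) (by omega),
    smul_eq_mul, inv_mul_cancel_left₀ (Nat.cast_ne_zero.mpr (Nat.factorial_ne_zero _)), map_neg]

end Weights

/-! ### The distribution relation -/

section Distribution

open scoped UpperHalfPlane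

variable {l : ℕ} [NeZero l]

/-- The label attached to a pair of residues. -/
def finLabel (p : Fin l × Fin l) : ℤ × ℤ := (((p.1 : ℕ) : ℤ), ((p.2 : ℕ) : ℤ))

theorem finLabel_mem_labelKernel {p : Fin l × Fin l} (hp : finLabel p ∈ labelKernel l) :
    p = (0, 0) := by
  have h1 := Nat.eq_zero_of_dvd_of_lt (Int.natCast_dvd_natCast.mp hp.1) p.1.2
  have h2 := Nat.eq_zero_of_dvd_of_lt (Int.natCast_dvd_natCast.mp hp.2) p.2.2
  exact Prod.ext (Fin.ext (by simpa using h1)) (Fin.ext (by simpa using h2))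

/-- Division with remainder for pairs of integers. -/
def labelEquiv (l : ℕ) [NeZero l] : ℤ × ℤ ≃ (Fin l × Fin l) × (ℤ × ℤ) :=
  (((Int.divModEquiv l).prodCongr (Int.divModEquiv l)).trans (Equiv.prodProdProdComm _ _ _ _)).trans
    (Equiv.prodComm _ _)

theorem labelEquiv_symm_apply (p : Fin l × Fin l) (q : ℤ × ℤ) :
    (labelEquiv l).symm (p, q) = (q.1 * l + (p.1 : ℕ), q.2 * l + (p.2 : ℕ)) := by
  simp [labelEquiv, Int.divModEquiv]

/-- The distribution relation for lattice sums. -/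
theorem sum_sumInvPow (τ : ℍ) {j : ℕ} (hj : 3 ≤ j) :
    ∑ p : Fin l × Fin l, (periods τ).sumInvPow (-torsionPt l τ (finLabel p)) j =
      (l : ℂ) ^ j * (periods τ).G j := by
  have hl : (l : ℂ) ≠ 0 := Nat.cast_ne_zero.mpr (NeZero.ne l)
  have hs : Summable fun q : ℤ × ℤ => ((q.1 * (τ : ℂ) + q.2 - 0) ^ j)⁻¹ := by
    have := ((periods τ).hasSum_sumInvPow 0 (r := j) (by omega)).summable
    rw [← (periodEquiv τ).summable_iff] at this
    refine this.congr fun q => ?_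
    simp only [Function.comp_apply, periodEquiv_apply]
  rw [← PeriodPair.sumInvPow_zero, sumInvPow_periods, ← (labelEquiv l).symm.tsum_eq]
  have hs' := ((labelEquiv l).symm.summable_iff).mpr hs
  -- Pairs of integers are grouped by residues modulo `l`: a lattice point labelled `q l + p` is `l`
  -- times the one labelled `q`, translated by the torsion argument of `p`.
  refine Eq.symm ((congrArg _ hs'.tsum_prod).trans ?_)
  rw [tsum_fintype, Finset.mul_sum]
  refine Finset.sum_congr rfl fun p _ => ?_
  rw [sumInvPow_periods, ← tsum_mul_left]
  refine tsum_congr fun q => Eq.symm ?_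
  simp only [Function.comp_apply, labelEquiv_symm_apply, torsionPt_apply, finLabel, torsionArg]
  push_cast
  rw [show (q.1 : ℂ) * τ + q.2 - -((((p.1 : ℕ) : ℂ) * τ + ((p.2 : ℕ) : ℂ)) / l) =
    ((q.1 * l + ((p.1 : ℕ) : ℂ)) * τ + (q.2 * l + ((p.2 : ℕ) : ℂ)) - 0) / l by
      field_simp; ring, div_pow, inv_div, div_eq_mul_inv]

end Distribution

/-! ### Holomorphic Eisenstein series lie in `R_l` -/

section Eisenstein

open Filter Topology
open scoped UpperHalfPlane

variable {l : ℕ} [NeZero l] {Ψ : ringR ℂ l →ₐ[ℂ] holomorphicRing} (hΨ : RealizesGenerators Ψ)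
include hΨ

/-- In the distribution relation the label 0 contributes `G_j` itself; moving it across leaves `(l^j
- 1) G_j` as a sum over nonzero torsion, and `l^j ≠ 1` because `l ≥ 2`. -/
theorem RealizesGenerators.exists_G (hl : 2 ≤ l) {j : ℕ} (hj : 3 ≤ j) :
    ∃ f ∈ realizedPart Ψ j, ∀ τ, evalAt τ f = (periods τ).G j := by
  have hex : ∀ p : Fin l × Fin l, ∃ f ∈ realizedPart Ψ j, p ≠ (0, 0) → ∀ τ, evalAt τ f =
      (periods τ).sumInvPow (-torsionPt l τ (finLabel p)) j := by
    intro p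
    by_cases hp : p = (0, 0)
    · exact ⟨0, zero_mem _, fun h => absurd hp h⟩
    · obtain ⟨f, hf, hf'⟩ := hΨ.exists_sumInvPow (fun h => hp (finLabel_mem_labelKernel h)) hj
      exact ⟨f, hf, fun _ => hf'⟩
  choose f hf hf' using hex
  have hne : (l : ℂ) ^ j - 1 ≠ 0 := by
    have : 1 < l ^ j := Nat.one_lt_pow (by omega) (by omega)
    rw [sub_ne_zero]
    exact_mod_cast this.ne'
  refine ⟨((l : ℂ) ^ j - 1)⁻¹ • ∑ p ∈ (Finset.univ : Finset (Fin l × Fin l)).erase (0, 0), f p,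
    Submodule.smul_mem _ _ (Submodule.sum_mem _ fun p _ => hf p), fun τ => ?_⟩
  have h := sum_sumInvPow (l := l) τ hj
  rw [← Finset.add_sum_erase _ _ (Finset.mem_univ ((0, 0) : Fin l × Fin l))] at h
  have h0 : torsionPt l τ (finLabel ((0, 0) : Fin l × Fin l)) = 0 := by
    simp [torsionPt_apply, torsionArg, finLabel]
  rw [h0, neg_zero, PeriodPair.sumInvPow_zero] at h
  rw [map_smul, map_sum, smul_eq_mul, inv_mul_eq_iff_eq_mul₀ hne,
    Finset.sum_congr rfl fun p hp => hf' p (Finset.ne_of_mem_erase hp) τ]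
  linear_combination h

theorem RealizesGenerators.exists_eisenstein (hl : 2 ≤ l) {j : ℕ} (hj : 3 ≤ j) (p : Fin l × Fin l)
    {E : ℍ → ℂ} (hE : ∀ τ, IsEisensteinValue j τ (torsionPt l τ (finLabel p)) (E τ)) :
    ∃ f ∈ realizedPart Ψ j, ∀ τ, evalAt τ f = E τ := by
  by_cases hp : finLabel p ∈ labelKernel l
  · obtain ⟨f, hf, hf'⟩ := hΨ.exists_G hl hj
    refine ⟨f, hf, fun τ => ?_⟩
    rw [hf', (hE τ).eq_sumInvPow hj, finLabel_mem_labelKernel hp, ← PeriodPair.sumInvPow_zero]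
    simp [torsionPt_apply, torsionArg, finLabel]
  · obtain ⟨f, hf, hf'⟩ := hΨ.exists_sumInvPow hp hj
    exact ⟨f, hf, fun τ => by rw [hf', (hE τ).eq_sumInvPow hj]⟩

omit hΨ in
-- For degenerate labels `holSlope` is 0 by definition, and the left side vanishes by periodicity
-- and oddness of the weight one values. The formula thus holds for all labels, as the telescoping
-- sum requires.
theorem eisensteinOne_add_sub {τ : ℍ} {e : ℤ × ℤ → ℂ}
    (he : ∀ q, IsEisensteinValue 1 τ (torsionPt l τ q) (e q)) (p q : ℤ × ℤ) :
    e p + e q - e (p + q) = -evalAt τ (holSlope l p q) := by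
  have hmem : ∀ q, q ∈ labelKernel l → e q = 0 := fun q hq =>
    (he q).eq_zero_of_mem (torsionPt_mem_lattice.mpr hq)
  have hadd : ∀ p q, q ∈ labelKernel l → e (p + q) = e p := fun p q hq => by
    have := (he p).add_mem (torsionPt_mem_lattice.mpr hq)
    rw [← map_add] at this
    exact (he _).unique this
  by_cases h : p ∉ labelKernel l ∧ q ∉ labelKernel l ∧ p + q ∉ labelKernel l
  · have h3 := he (p + q)
    rw [map_add] at h3
    rw [evalAt_holSlope h.1 h.2.1 h.2.2]
    exact (he p).add_sub_eq (he q) h3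
  · rw [holSlope, dif_neg h, map_zero, neg_zero]
    by_cases hp : p ∈ labelKernel l
    · rw [hmem p hp, add_comm p, hadd q p hp]; ring
    by_cases hq : q ∈ labelKernel l
    · rw [hmem q hq, hadd p q hq]; ring
    have hpq : p + q ∈ labelKernel l := by
      by_contra hc
      exact h ⟨hp, hq, hc⟩
    have h1 := hadd (-p) (p + q) hpq
    rw [neg_add_cancel_left] at h1
    have h2 := he (-p)
    rw [map_neg] at h2
    rw [hmem _ hpq, h1, (he p).neg_eq h2]
    ring

/-- Summing `e(p) + e(np) - e((n+1)p)` over `n < l` telescopes to `l e(p)`, because `e` vanishes at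
the labels `0` and `l p`; each summand is minus a slope, of weight 1. -/
theorem RealizesGenerators.exists_eisensteinOne {E : Fin l × Fin l → ℍ → ℂ}
    (hE : ∀ p τ, IsEisensteinValue 1 τ (torsionPt l τ (finLabel p)) (E p τ)) (p : Fin l × Fin l) :
    ∃ f ∈ realizedPart Ψ 1, ∀ τ, evalAt τ f = E p τ := by
  have hl : (l : ℂ) ≠ 0 := Nat.cast_ne_zero.mpr (NeZero.ne l)
  refine ⟨(-(l : ℂ)⁻¹) • ∑ n ∈ Finset.range l, holSlope l (finLabel p) (n • finLabel p),
    Submodule.smul_mem _ _ (Submodule.sum_mem _ fun n _ => hΨ.slope_mem _ _), fun τ => ?_⟩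
  -- Values are given only for labels in the fundamental range; periodicity in `α` extends them to
  -- all labels, among them the multiples of `p`.
  have hex : ∀ q : ℤ × ℤ, ∃ e, IsEisensteinValue 1 τ (torsionPt l τ q) e := by
    intro q
    obtain ⟨⟨p, n⟩, rfl⟩ := (labelEquiv l).symm.surjective q
    refine ⟨E p τ, ?_⟩
    have hn : (l : ℤ) • n ∈ labelKernel l := ⟨⟨n.1, by simp⟩, ⟨n.2, by simp⟩⟩
    have := (hE p τ).add_mem (torsionPt_mem_lattice.mpr hn)
    rw [← map_add] at this
    convert this using 2
    rw [labelEquiv_symm_apply]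
    ext <;> simp [finLabel] <;> ring
  choose e he using hex
  have hep : e (finLabel p) = E p τ := (he _).unique (hE p τ)
  have hsum : ∑ n ∈ Finset.range l, (e (finLabel p) + e (n • finLabel p) -
      e ((n + 1) • finLabel p)) = l * e (finLabel p) := by
    have htel := Finset.sum_range_sub' (fun n => e (n • finLabel p)) l
    rw [zero_smul, (he 0).eq_zero_of_mem (torsionPt_mem_lattice.mpr (zero_mem _)),
      (he (l • finLabel p)).eq_zero_of_mem
        (torsionPt_mem_lattice.mpr (nsmul_mem_labelKernel l _)), sub_zero] at htel
    simp only [add_sub_assoc, Finset.sum_add_distrib]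
    rw [htel, Finset.sum_const, Finset.card_range, nsmul_eq_mul, add_zero]
  rw [map_smul, map_sum, smul_eq_mul, neg_mul, ← hep, neg_eq_iff_eq_neg, inv_mul_eq_iff_eq_mul₀ hl,
    mul_neg, ← hsum, ← Finset.sum_neg_distrib]
  refine Finset.sum_congr rfl fun n _ => ?_
  rw [add_smul, one_smul, add_comm (n • finLabel p), eisensteinOne_add_sub he, neg_neg]

omit hΨ in
theorem evalAt_holX_eq (p : ℤ × ℤ) (τ : ℍ) :
    evalAt τ (holX l p) = (periods τ).weierstrassP (torsionPt l τ p) := by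
  by_cases hp : p ∈ labelKernel l
  · rw [holX, dif_pos hp, map_zero]
    exact ((periods τ).weierstrassP_coe ⟨_, torsionPt_mem_lattice.mpr hp⟩).symm
  · exact evalAt_holX hp τ

/-- The holomorphic Eisenstein series on `Γ(l)` are realized by elements of `R_l`. -/
theorem RealizesGenerators.exists_of_isHolomorphicEisenstein (hl : 2 ≤ l) {j : ℕ} (hj : 1 ≤ j)
    {g : ℍ → ℂ} (hg : IsHolomorphicEisenstein l j g) :
    ∃ f ∈ realizedPart Ψ j, (f : ℍ → ℂ) = g := by
  obtain ⟨hhol, E, c, hE, hgE⟩ := hg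
  have hE' : ∀ p τ, IsEisensteinValue j τ (torsionPt l τ (finLabel p)) (E p τ) := hE
  have lin : (∀ p, ∃ f ∈ realizedPart Ψ j, ∀ τ, evalAt τ f = E p τ) →
      ∃ f ∈ realizedPart Ψ j, (f : ℍ → ℂ) = g := by
    intro h
    choose f hf hf' using h
    refine ⟨∑ p, c p • f p, Submodule.sum_mem _ fun p _ => Submodule.smul_mem _ _ (hf p), ?_⟩
    ext τ
    change evalAt τ (∑ p, c p • f p) = g τ
    rw [map_sum, hgE]
    exact Finset.sum_congr rfl fun p _ => by rw [map_smul, hf', smul_eq_mul]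
  obtain rfl | rfl | hj3 : j = 1 ∨ j = 2 ∨ 3 ≤ j := by omega
  · exact lin fun p => hΨ.exists_eisensteinOne hE' p
  · have h0 : ∀ τ, IsEisensteinValue 2 τ 0 (E (0, 0) τ) := fun τ => by
      have := hE' (0, 0) τ
      rwa [show torsionPt l τ (finLabel ((0, 0) : Fin l × Fin l)) = 0 by
        simp [torsionPt_apply, torsionArg, finLabel]] at this
    have hsum : ∀ τ, g τ = evalAt τ (∑ p, c p • holX l (finLabel p)) + (∑ p, c p) * E (0, 0) τ := by
      intro τ
      rw [hgE, map_sum, Finset.sum_mul, ← Finset.sum_add_distrib]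
      refine Finset.sum_congr rfl fun p _ => ?_
      rw [map_smul, evalAt_holX_eq, ← (hE' p τ).sub_eq (h0 τ), smul_eq_mul]
      ring
    have hmem : (∑ p, c p • holX l (finLabel p)) ∈ realizedPart Ψ 2 :=
      Submodule.sum_mem _ fun p _ => Submodule.smul_mem _ _ (hΨ.x_mem _)
    -- Up to a combination of values of `℘`, the function `g` is `∑ c` times the nonholomorphic
    -- value `E_2(τ,0)`, so holomorphy forces the sum of the coefficients to vanish.
    have hc : ∑ p, c p = 0 := by
      by_contra hc
      apply eisensteinTwo_notMem h0
      have := Subalgebra.smul_mem holomorphicRing (Subalgebra.sub_mem _ (mem_holomorphicRing.mpr hhol)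
        (∑ p, c p • holX l (finLabel p)).2) (∑ p, c p)⁻¹
      convert this using 1
      ext τ
      rw [Pi.smul_apply, Pi.sub_apply, hsum τ, smul_eq_mul, eq_inv_mul_iff_mul_eq₀ hc]
      exact (add_sub_cancel_left _ _).symm
    refine ⟨_, hmem, ?_⟩
    ext τ
    rw [hsum τ, hc, zero_mul, add_zero]
    rfl
  · exact lin fun p => hΨ.exists_eisenstein hl hj3 p (hE' p)

end Eisenstein

end ModuliEisenstein

end

/-! ### The theorem -/

open ModuliEisenstein in
theorem theorem3p9 (l : ℕ) (hl : 2 ≤ l) :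
    (∀ (k : Type*) [Field k], ((6 * l : ℕ) : k) ≠ 0 → (∃ ζ : k, IsPrimitiveRoot ζ l) →
      (∀ (j : ℕ) (c : GenField k), c ∈ weightPart k l j → c ∈ ringR k l ∧ IsModularForm k l j c) ∧
      ∀ D : GenPoint k →₀ ℤ, (∀ P ∈ D.support, l • P = 0) →
        ∃ G : LaurentSeries (GenField k),
          (∀ G', IsNormalizedSeries l D G' ↔ G' = G) ∧
          (∀ f, IsPrincipalFunction D f → expandAtInfty _ _ f = G) ∧
          IsBalanced (fun j => (weightPart k l j : Set (GenField k))) (D 0 - divDegree D) G ∧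
          (∀ j : ℕ, 1 ≤ j →
            G.coeff (D 0 - divDegree D + j) ∈ ringR k l ∧
            IsModularForm k l j (G.coeff (D 0 - divDegree D + j))) ∧
          IsWeightedExpansion (fun j => (weightPart k l j : Set (GenField k))) (-1)
            ((D 0 - divDegree D : ℤ) : GenField k)
            (LaurentSeries.derivative (GenField k) G / G) ∧
          (CharZero k → ∃ H : LaurentSeries (GenField k),
            (∀ H', laurentComp H' (zSeries (genA k) (genB k)) = G ↔ H' = H) ∧
            IsBalanced (fun j => (weightPart k l j : Set (GenField k))) (D 0 - divDegree D) H ∧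
            IsWeightedExpansion (fun j => (weightPart k l j : Set (GenField k))) (-1)
              ((D 0 - divDegree D : ℤ) : GenField k)
              (LaurentSeries.derivative (GenField k) H / H))) ∧
    ∃ (φ : ℤ × ℤ →+ GenPoint ℂ) (Ψ : ringR ℂ l →ₐ[ℂ] (UpperHalfPlane → ℂ)),
      IsAnalyticRealization l φ Ψ ∧
      ∀ (j : ℕ) (g : UpperHalfPlane → ℂ), 1 ≤ j → IsHolomorphicEisenstein l j g →
        ∃ c : ringR ℂ l, (c : GenField ℂ) ∈ weightPart ℂ l j ∧ Ψ c = g := by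
  refine ⟨fun k _ h6l _ => ⟨fun j c hc => ⟨weightPart_subset_ringR hc, ?_⟩,
    fun D hD => exists_balanced_normalizedSeries h6l D hD⟩, ?_⟩
  · refine isModularForm_of_mem_weightPart (fun h => h6l ?_) hc
    rw [Nat.cast_mul, h, mul_zero]
  · have : NeZero l := ⟨by omega⟩
    obtain ⟨φ, Ψ, hR, hΨ⟩ := exists_analyticRealization (l := l)
    refine ⟨φ, holomorphicRing.val.comp Ψ, hR, fun j g hj hg => ?_⟩
    obtain ⟨_, ⟨c, hc, rfl⟩, hf⟩ := hΨ.exists_of_isHolomorphicEisenstein hl hj hg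
    exact ⟨c, hc, hf⟩
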